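/- **Theorem 1.6 (Deterministic Set Intersection Hardness).** Write $[m]=\{1,\dots,m\}$. Algorithms are deterministic word RAM programs working on words of $O(\log n)$ bits, where $n$ is the parameter named below, with one time step per elementary word operation. *3SUM* over $[U]$ is the problem of deciding, for a given set $A\subseteq[U]$ of $n$ numbers, whether there are $a,b,c\in A$ with $a+b=c$. The *deterministic 3SUM hypothesis* states that for every $\epsilon>0$ there is a constant $c$ such that no deterministic algorithm solves 3SUM over $[n^c]$ in time $O(n^{2-\epsilon})$. *Offline Set Intersection* is the following problem: given sets $S_1,\dots,S_N\subseteq[U]$, each of size at most $s$, and a set $Q\subseteq[N]^2$ of $q$ queries, list for each query $(i,j)\in Q$ all elements of $S_i\cap S_j$. Let $0\le\alpha<1$ and $0\le\beta\le 1-\alpha$, and assume the deterministic 3SUM hypothesis. Then for every constant $C>0$ and every $\epsilon>0$ there is no deterministic algorithm that, given any $n\ge 1$ and any instance of offline Set Intersection with $$U\le C\,n^{1+\beta-\alpha},\quad N\le C\,n^{\frac12+\frac\alpha2+\frac\beta2},\quad s\le C\,n^{1-\alpha},\quad q\le C\,n^{1+\alpha},\quad \sum_{(i,j)\in Q}|S_i\cap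 S_j|\le C\,n^{2-\beta},$$ solves this instance in time $O(n^{2-\epsilon})$. -/

import Mathlib

/-! ### Word RAM with step counts

A program is a fixed finite text over finitely many scalar registers and finitely many
random-access arrays. All numbers that a run computes must fit into `w` bits; every elementary
operation on words (arithmetic, bitwise operation, comparison, memory access) costs one step.
Structured control flow (sequence, conditional, loop) changes running times only by constant
factors compared to jumps, and so does the use of a constant number of arrays instead of one. -/

namespace RAM

/-- Binary word operations. -/
inductive Op where
  | add | sub | mul | div | mod | and | or | xor | shl | shr

/-- The value of a word operation. Subtraction is truncated at `0`, division is integer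
division (with value `0` for the divisor `0`). -/
def Op.eval : Op → ℕ → ℕ → ℕ
  | .add, a, b => a + b
  | .sub, a, b => a - b
  | .mul, a, b => a * b
  | .div, a, b => a / b
  | .mod, a, b => a % b
  | .and, a, b => a &&& b
  | .or, a, b => a ||| b
  | .xor, a, b => a ^^^ b
  | .shl, a, b => a <<< b
  | .shr, a, b => a >>> b

/-- Deterministic programs. Registers and arrays are named by (constant) natural numbers. -/
inductive Program where
  /-- do nothing -/
  | skip
  /-- `reg r := v` for a constant `v` -/
  | const (r v : ℕ)
  /-- `reg r := reg a ∘ reg b` for a word operation `∘` -/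
  | op (o : Op) (r a b : ℕ)
  /-- `reg r := arr x [reg a]` -/
  | load (r x a : ℕ)
  /-- `arr x [reg a] := reg b` -/
  | store (x a b : ℕ)
  /-- first `p`, then `q` -/
  | seq (p q : Program)
  /-- if `reg a < reg b` then `p` else `q` -/
  | cond (a b : ℕ) (p q : Program)
  /-- while `reg a < reg b` do `p` -/
  | loop (a b : ℕ) (p : Program)

/-- A memory configuration: the contents of the registers and of the arrays. -/
@[ext]
structure State where
  reg : ℕ → ℕ
  arr : ℕ → ℕ → ℕ

/-- Write `v` into register `r`. -/
def State.setReg (σ : State) (r v : ℕ) : State :=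
  { σ with reg := Function.update σ.reg r v }

/-- Write `v` into cell `i` of array `x`. -/
def State.setArr (σ : State) (x i v : ℕ) : State :=
  { σ with arr := Function.update σ.arr x (Function.update (σ.arr x) i v) }

/-- The start configuration on given input arrays: the arrays `0, 1, 2, …` hold the lists in `l`,
and every other cell and every register is `0`. -/
def State.ofArrays (l : List (List ℕ)) : State where
  reg := fun _ => 0
  arr := fun x i => (l.getD x []).getD i 0

/-- `Exec w p σ t σ'`: on a machine with words of `w` bits the program `p`, started in `σ`, halts
after exactly `t` steps in `σ'`. Words are the numbers below `2 ^ w`; a run that would put a larger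
number into a register does not count as a run. -/
inductive Exec (w : ℕ) : Program → State → ℕ → State → Prop where
  | skip (σ : State) : Exec w .skip σ 1 σ
  | const (σ : State) (r v : ℕ) (h : v < 2 ^ w) :
      Exec w (.const r v) σ 1 (σ.setReg r v)
  | op (σ : State) (o : Op) (r a b : ℕ) (h : o.eval (σ.reg a) (σ.reg b) < 2 ^ w) :
      Exec w (.op o r a b) σ 1 (σ.setReg r (o.eval (σ.reg a) (σ.reg b)))
  | load (σ : State) (r x a : ℕ) (h : σ.arr x (σ.reg a) < 2 ^ w) :
      Exec w (.load r x a) σ 1 (σ.setReg r (σ.arr x (σ.reg a)))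
  | store (σ : State) (x a b : ℕ) :
      Exec w (.store x a b) σ 1 (σ.setArr x (σ.reg a) (σ.reg b))
  | seq {p q : Program} {σ σ' σ'' : State} {t t' : ℕ}
      (hp : Exec w p σ t σ') (hq : Exec w q σ' t' σ'') :
      Exec w (.seq p q) σ (t + t') σ''
  | cond_true {a b : ℕ} {p q : Program} {σ σ' : State} {t : ℕ}
      (h : σ.reg a < σ.reg b) (hp : Exec w p σ t σ') :
      Exec w (.cond a b p q) σ (t + 1) σ'
  | cond_false {a b : ℕ} {p q : Program} {σ σ' : State} {t : ℕ}
      (h : ¬ σ.reg a < σ.reg b) (hq : Exec w q σ t σ') :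
      Exec w (.cond a b p q) σ (t + 1) σ'
  | loop_done {a b : ℕ} {p : Program} {σ : State}
      (h : ¬ σ.reg a < σ.reg b) :
      Exec w (.loop a b p) σ 1 σ
  | loop_step {a b : ℕ} {p : Program} {σ σ' σ'' : State} {t t' : ℕ}
      (h : σ.reg a < σ.reg b) (hp : Exec w p σ t σ')
      (hl : Exec w (.loop a b p) σ' t' σ'') :
      Exec w (.loop a b p) σ (t + t' + 1) σ''

/-- Words of `κ` times the bit length of `n`, that is, of `O(log n)` bits. -/
def wordLength (κ n : ℕ) : ℕ := κ * (Nat.log 2 n + 1)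

end RAM

/-! ### 3SUM -/

namespace ThreeSum

/-- There are `a, b, c ∈ A` (not necessarily distinct) with `a + b = c`. -/
def IsYes (A : List ℕ) : Prop := ∃ a ∈ A, ∃ b ∈ A, ∃ c ∈ A, a + b = c

/-- Start configuration: array `0` holds `n = |A|`, array `1` lists the elements of `A`. -/
def start (A : List ℕ) : RAM.State := RAM.State.ofArrays [[A.length], A]

/-- Some deterministic algorithm, on words of `O(log n)` bits, decides 3SUM for all sets `A` of
`n ≥ 1` numbers from `[n ^ c] = {1, …, n ^ c}` in time `O(n ^ (2 - ε))`. The set is given as a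
list of its elements without repetitions, in any order; the answer (`1` for yes, `0` for no) is
left in register `0`. -/
def HasAlgorithm (c : ℕ) (ε : ℝ) : Prop :=
  ∃ (P : RAM.Program) (κ : ℕ) (T : ℝ), ∀ A : List ℕ,
    1 ≤ A.length → A.Nodup → (∀ a ∈ A, 1 ≤ a ∧ a ≤ A.length ^ c) →
    ∃ (t : ℕ) (σ : RAM.State),
      RAM.Exec (RAM.wordLength κ A.length) P (start A) t σ ∧
      (t : ℝ) ≤ T * (A.length : ℝ) ^ (2 - ε) ∧
      (IsYes A → σ.reg 0 = 1) ∧ (¬ IsYes A → σ.reg 0 = 0)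

/-- The deterministic 3SUM hypothesis: for every `ε > 0` there is a constant `c` such that no
deterministic algorithm solves 3SUM over `[n ^ c]` in time `O(n ^ (2 - ε))`. -/
def DeterministicHypothesis : Prop :=
  ∀ ε : ℝ, 0 < ε → ∃ c : ℕ, ¬ HasAlgorithm c ε

end ThreeSum

/-! ### Offline Set Intersection -/

/-- An instance of offline Set Intersection: sets `S 0, …, S (N - 1) ⊆ [U] = {1, …, U}` of size
at most `s`, and a set of queries, which are pairs of indices of sets. Sets are given as lists of
their elements without repetitions, in any order. -/
structure SetIntersection where
  U : ℕ
  N : ℕ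
  s : ℕ
  S : Fin N → List ℕ
  queries : List (Fin N × Fin N)
  nodup_S : ∀ i, (S i).Nodup
  mem_S : ∀ i, ∀ x ∈ S i, 1 ≤ x ∧ x ≤ U
  length_S : ∀ i, (S i).length ≤ s
  nodup_queries : queries.Nodup

namespace SetIntersection

/-- The number of queries. -/
def q (I : SetIntersection) : ℕ := I.queries.length

/-- The set that has to be reported for a query. -/
def answer (I : SetIntersection) (e : Fin I.N × Fin I.N) : Finset ℕ :=
  (I.S e.1).toFinset ∩ (I.S e.2).toFinset

/-- The total number of elements to be reported. -/
def outputSize (I : SetIntersection) : ℕ := (I.queries.map fun e => (I.answer e).card).sum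

/-- The lists of the elements of the sets, one after the other. -/
def setLists (I : SetIntersection) : List (List ℕ) := List.ofFn I.S

/-- Start configuration, for an instance belonging to the parameter `n`:
array `0` holds `n, U, N, s, q`;
arrays `1` and `2` hold for each set the position in array `3` at which its elements start, and
its size;
array `3` lists the elements of all sets, one set after the other;
arrays `4` and `5` hold the first and the second components of the queries. -/
def start (I : SetIntersection) (n : ℕ) : RAM.State :=
  RAM.State.ofArrays
    [[n, I.U, I.N, I.s, I.q],
      (List.range I.N).map fun i => (I.setLists.take i).flatten.length,
      I.setLists.map List.length,
      I.setLists.flatten,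
      I.queries.map fun e => (e.1 : ℕ),
      I.queries.map fun e => (e.2 : ℕ)]

/-- The final configuration `σ` reports for each query, in the order of the queries, the set
intersection, as a list of its elements without repetitions in any order: the sizes are in array
`6`, and the elements of all these lists, one list after the other, are in array `7`. -/
def Reports (I : SetIntersection) (σ : RAM.State) : Prop :=
  ∃ L : List (List ℕ),
    List.Forall₂ (fun e l => l.Nodup ∧ l.toFinset = I.answer e) I.queries L ∧
    (∀ (k : ℕ) (hk : k < L.length), σ.arr 6 k = L[k].length) ∧
    (∀ (k : ℕ) (hk : k < L.flatten.length), σ.arr 7 k = L.flatten[k])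

/-- The parameters of the instance obey, with the implied constant `C`,
`U = O(n ^ (1 + β - α))`, `N = O(n ^ (1 / 2 + α / 2 + β / 2))`, `s = O(n ^ (1 - α))`,
`q = O(n ^ (1 + α))`, and in total there are `O(n ^ (2 - β))` elements to be listed. -/
structure Admissible (I : SetIntersection) (α β C : ℝ) (n : ℕ) : Prop where
  U_le : (I.U : ℝ) ≤ C * (n : ℝ) ^ (1 + β - α)
  N_le : (I.N : ℝ) ≤ C * (n : ℝ) ^ (1 / 2 + α / 2 + β / 2)
  s_le : (I.s : ℝ) ≤ C * (n : ℝ) ^ (1 - α)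
  q_le : (I.q : ℝ) ≤ C * (n : ℝ) ^ (1 + α)
  outputSize_le : (I.outputSize : ℝ) ≤ C * (n : ℝ) ^ (2 - β)

/-- Some deterministic algorithm, on words of `O(log n)` bits, solves offline Set Intersection in
time `O(n ^ (2 - ε))` on all instances whose parameters obey the bounds in terms of `n ≥ 1` with
the implied constant `C`. -/
def HasAlgorithm (α β C ε : ℝ) : Prop :=
  ∃ (P : RAM.Program) (κ : ℕ) (T : ℝ), ∀ n : ℕ, 1 ≤ n → ∀ I : SetIntersection,
    I.Admissible α β C n →
    ∃ (t : ℕ) (σ : RAM.State),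
      RAM.Exec (RAM.wordLength κ n) P (I.start n) t σ ∧
      (t : ℝ) ≤ T * (n : ℝ) ^ (2 - ε) ∧
      I.Reports σ

end SetIntersection

/-! The proof is a deterministic reduction. From a Set Intersection algorithm that saves a factor
n^ε over quadratic time it builds, for every c, an algorithm for 3SUM over [n^c] whose time exponent
η < 2 does not depend on c. This contradicts the 3SUM hypothesis at 2 - η. All sizes are measured in
powers of D, the integral part of n^(1/K), for a large constant K.

Blocks. Sort the n numbers and cut them into R ≤ D^r blocks of g ~ n / D^r consecutive ones. For a
fixed target z the pairs of blocks that can contain x + y = z lie on a monotone staircase in the R ×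
R grid, so there are only 2 R n tasks (target, block, block) instead of R² n (`walkCode_runs`).

Moduli. The tasks are relaxed to congruences modulo 2h numbers d_t ≤ D. If no solution exists, then
every difference x + y - z that occurs is nonzero with at most B = O(log n) bits, so at most B
primes divide it. Averaging over the primes up to D shows that some choice of the next modulus
multiplies the number of false positives by at most B / π(D) (`Tasks.exists_update_le`). After 2h
greedy choices at most D^f of the N g² candidate pairs are left (`greedyCode_runs`,
`eventually_le_pow`). If more are left, a solution must exist, and the answer is yes.

Derandomization. The greedy choice needs exact counts of the pairs that satisfy all congruences.
Such a count is a sum of convolutions over a product of cyclic groups, one for each pair of blocks.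
It is evaluated by transforms over `ZMod (ℓ ^ e)` for a prime ℓ between 2D and 4D, where the powers
y^(ℓ^(e-1)) serve as roots of unity of order dividing ℓ - 1 (`sum_root_pow`, `sum_root_dualEntry`,
`Tasks.collisions_eq_sum`). Transforming one digit at a time takes about R² ℓ^(2h+1) steps. As ℓ^e
exceeds every possible count, the residue determines the count.

The instance. The congruences x + y ≡ z are split: half of the residues of z shift x, the other half
shift -y. Each block therefore needs only ℓ^h shifted copies on either side, which gives 2 R ℓ^h
sets in a universe of size ℓ^(2h), and each task becomes one query (`Tasks.code_pair_eq_iff`). Every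
reported element leads to a bucket of entries x, and each of these is tested exactly by looking up z
- x in a table. The total size of the buckets is at most the number of surviving pairs
(`Tasks.sum_bucket_le`).

Exponents. The instance is declared to have parameter D^m with m slightly larger than K. All
required bounds then hold with strict inequalities between exponents, which absorb constants and
logarithms, while (D^m)^(2-ε) stays polynomially below n² (`exists_exponents`,
`eventually_admissible`, `hasAlgorithm_of_exponents`).

The programs are verified in a small Hoare calculus with step counts (`Runs`), whose frame
conditions are decided by evaluation. -/

/-! ### Arithmetic expressions and their compilation -/

namespace RAM

/-- Arithmetic operations whose results are polynomially bounded. -/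
inductive ArithOp where
  | add | sub | mul | div | mod

/-- The machine operation. -/
def ArithOp.toOp : ArithOp → Op
  | .add => .add
  | .sub => .sub
  | .mul => .mul
  | .div => .div
  | .mod => .mod

/-- Arithmetic expressions over registers, literals and array cells. -/
inductive Expr where
  | reg (r : ℕ)
  | lit (v : ℕ)
  | bin (o : ArithOp) (a b : Expr)
  | ld (x : ℕ) (a : Expr)

namespace Expr

instance : Add Expr := ⟨.bin .add⟩
instance : Sub Expr := ⟨.bin .sub⟩
instance : Mul Expr := ⟨.bin .mul⟩
instance : Div Expr := ⟨.bin .div⟩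
instance : Mod Expr := ⟨.bin .mod⟩
instance (n : ℕ) : OfNat Expr n := ⟨.lit n⟩

/-- The value of an expression. -/
def eval (σ : State) : Expr → ℕ
  | reg r => σ.reg r
  | lit v => v
  | bin o a b => o.toOp.eval (a.eval σ) (b.eval σ)
  | ld x a => σ.arr x (a.eval σ)

@[simp] theorem eval_reg (σ : State) (r : ℕ) : (reg r).eval σ = σ.reg r := rfl
@[simp] theorem eval_lit (σ : State) (n : ℕ) : (lit n).eval σ = n := rfl
@[simp] theorem eval_ofNat (σ : State) (n : ℕ) :
    (no_index (OfNat.ofNat n : Expr)).eval σ = n := rfl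
@[simp] theorem eval_add (σ : State) (a b : Expr) : (a + b).eval σ = a.eval σ + b.eval σ := rfl
@[simp] theorem eval_sub (σ : State) (a b : Expr) : (a - b).eval σ = a.eval σ - b.eval σ := rfl
@[simp] theorem eval_mul (σ : State) (a b : Expr) : (a * b).eval σ = a.eval σ * b.eval σ := rfl
@[simp] theorem eval_div (σ : State) (a b : Expr) : (a / b).eval σ = a.eval σ / b.eval σ := rfl
@[simp] theorem eval_mod (σ : State) (a b : Expr) : (a % b).eval σ = a.eval σ % b.eval σ := rfl
@[simp] theorem eval_ld (σ : State) (x : ℕ) (a : Expr) :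
    (ld x a).eval σ = σ.arr x (a.eval σ) := rfl

/-- Code that evaluates an expression with the work registers `d, d + 1, …`, and the register
that holds the result. -/
def code : Expr → ℕ → Program × ℕ
  | reg r, _ => (.skip, r)
  | lit v, d => (.const d v, d)
  | bin o a b, d =>
    (.seq (a.code d).1 (.seq (b.code (d + 1)).1
      (.op o.toOp d (a.code d).2 (b.code (d + 1)).2)), d)
  | ld x a, d => (.seq (a.code d).1 (.load d x (a.code d).2), d)

/-- The running time of the code. -/
def cost : Expr → ℕ
  | reg _ => 1
  | lit _ => 1
  | bin _ a b => a.cost + (b.cost + 1)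
  | ld _ a => a.cost + 1

/-- The size of an expression. -/
def size : Expr → ℕ
  | reg _ => 1
  | lit _ => 1
  | bin _ a b => a.size + b.size
  | ld _ a => a.size + 1

/-- Only registers below `40` and literals at most `2` occur. -/
def leaves : Expr → Bool
  | reg r => Nat.ble (r + 1) 40
  | lit v => Nat.ble v 2
  | bin _ a b => a.leaves && b.leaves
  | ld _ a => a.leaves

/-- Well-formed expressions: small, and with small leaves. -/
def wf (e : Expr) : Bool := e.leaves && Nat.ble e.size 32

theorem size_pos (e : Expr) : 1 ≤ e.size := by
  induction e <;> simp only [size] <;> omega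

theorem cost_le (e : Expr) : e.cost + 1 ≤ 2 * e.size := by
  induction e <;> simp [size, cost] <;> omega

/-- All values that the code computes are below `B`. -/
def Fits (B : ℕ) (σ : State) : Expr → Prop
  | reg _ => True
  | lit v => v < B
  | bin o a b => a.Fits B σ ∧ b.Fits B σ ∧ (bin o a b).eval σ < B
  | ld x a => a.Fits B σ ∧ (ld x a).eval σ < B

theorem eval_congr {σ τ : State} {e : Expr} (he : e.leaves = true)
    (hr : ∀ r < 40, τ.reg r = σ.reg r) (ha : τ.arr = σ.arr) : e.eval τ = e.eval σ := by
  induction e with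
  | reg r => exact hr r (by simpa [leaves] using he)
  | lit v => rfl
  | bin o a b iha ihb =>
    simp only [leaves, Bool.and_eq_true] at he
    simp only [eval, iha he.1, ihb he.2]
  | ld x a iha => simp only [eval, iha he, ha]

theorem Fits.congr {B : ℕ} {σ τ : State} {e : Expr} (he : e.leaves = true)
    (hr : ∀ r < 40, τ.reg r = σ.reg r) (ha : τ.arr = σ.arr) (h : e.Fits B σ) : e.Fits B τ := by
  induction e with
  | reg r => trivial
  | lit v => exact h
  | bin o a b iha ihb =>
    have he' := he
    simp only [leaves, Bool.and_eq_true] at he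
    exact ⟨iha he.1 h.1, ihb he.2 h.2.1, by rw [eval_congr he' hr ha]; exact h.2.2⟩
  | ld x a iha => exact ⟨iha he h.1, by rw [eval_congr he hr ha]; exact h.2⟩

theorem code_snd {e : Expr} (he : e.leaves = true) (d : ℕ) :
    (e.code d).2 < 40 ∨ (e.code d).2 = d := by
  cases e with
  | reg r => left; exact Nat.le_of_ble_eq_true he
  | lit v => right; rfl
  | bin o a b => right; rfl
  | ld x a => right; rfl

/-- Evaluation works like a stack. The first result sits in a variable or in register `d`
(`code_snd`), and the second operand uses only work registers from `d + 1` on, so it cannot destroy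
the first result. -/
theorem exec_code {w : ℕ} (e : Expr) (he : e.leaves = true) (d : ℕ) (hd : 40 ≤ d) (σ : State)
    (hf : e.Fits (2 ^ w) σ) :
    ∃ τ, Exec w (e.code d).1 σ e.cost τ ∧ τ.reg (e.code d).2 = e.eval σ ∧ τ.arr = σ.arr ∧
      ∀ r < d, τ.reg r = σ.reg r := by
  induction e generalizing d σ with
  | reg r => exact ⟨σ, .skip σ, rfl, rfl, fun _ _ => rfl⟩
  | lit v =>
    exact ⟨_, .const σ d v hf, by simp [State.setReg, code, eval], rfl,
      fun r hr => by simp [State.setReg, hr.ne]⟩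
  | bin o a b iha ihb =>
    simp only [leaves, Bool.and_eq_true] at he
    obtain ⟨τ, h1, h2, h3, h4⟩ := iha he.1 d hd σ hf.1
    have hreg : ∀ r < 40, τ.reg r = σ.reg r := fun r hr => h4 r (by omega)
    obtain ⟨υ, g1, g2, g3, g4⟩ := ihb he.2 (d + 1) (by omega) τ (hf.2.1.congr he.2 hreg h3)
    have hra : υ.reg (a.code d).2 = a.eval σ := by
      rw [g4 _ (by rcases code_snd he.1 d with h | h <;> omega), h2]
    have hrb : υ.reg (b.code (d + 1)).2 = b.eval σ := by
      rw [g2, eval_congr he.2 hreg h3]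
    refine ⟨_, .seq h1 (.seq g1 (.op υ o.toOp d _ _ ?_)), ?_, ?_, ?_⟩
    · rw [hra, hrb]; exact hf.2.2
    · simp [State.setReg, code, eval, hra, hrb]
    · simp [State.setReg, g3, h3]
    · intro r hr
      simp only [State.setReg, Function.update_apply, hr.ne, if_false]
      rw [g4 r (by omega), h4 r hr]
  | ld x a iha =>
    obtain ⟨τ, h1, h2, h3, h4⟩ := iha he d hd σ hf.1
    refine ⟨_, .seq h1 (.load τ d x _ ?_), ?_, ?_, ?_⟩
    · rw [h2, h3]; exact hf.2
    · simp [State.setReg, code, eval, h2, h3]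
    · simp [State.setReg, h3]
    · intro r hr
      simp only [State.setReg, Function.update_apply, hr.ne, if_false]
      rw [h4 r hr]

end Expr

/-! ### Structured programs -/

/-- All registers and array cells are at most `X`. -/
def State.Bdd (X : ℕ) (σ : State) : Prop := (∀ r, σ.reg r ≤ X) ∧ ∀ x i, σ.arr x i ≤ X

/-- Word lengths `w` together with a bound `X` on the values of variables: every small expression
over variables that are bounded by `X` can be evaluated without overflow. -/
structure Machine where
  X : ℕ
  w : ℕ
  two_le : 2 ≤ X
  pow_lt : X ^ 32 < 2 ^ w

/-- Sizes add under every operation, so it suffices that a result is at most the product of the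
bounds of the operands. For a sum this uses that both bounds are at least 2. A left shift would
break the estimate, which is why `ArithOp` omits it. -/
theorem Expr.eval_le_pow {X : ℕ} (hX : 2 ≤ X) {σ : State} (hσ : σ.Bdd X) {e : Expr}
    (he : e.leaves = true) : e.eval σ ≤ X ^ e.size := by
  induction e with
  | reg r => simpa [eval, size] using hσ.1 r
  | lit v =>
    have : v ≤ 2 := by simpa [leaves] using he
    simp only [eval, size, pow_one]; omega
  | bin o a b iha ihb =>
    simp only [leaves, Bool.and_eq_true] at he
    have ha := iha he.1
    have hb := ihb he.2
    have h1 : X ≤ X ^ a.size := Nat.le_self_pow (by have := a.size_pos; omega) X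
    have h2 : X ≤ X ^ b.size := Nat.le_self_pow (by have := b.size_pos; omega) X
    have h3 : X ^ a.size ≤ X ^ a.size * X ^ b.size := Nat.le_mul_of_pos_right _ (by omega)
    simp only [size, pow_add]
    cases o with
    | add =>
      simp only [eval, ArithOp.toOp, Op.eval]
      have : X ^ a.size + X ^ b.size ≤ X ^ a.size * X ^ b.size :=
        Nat.add_le_mul (by omega) (by omega)
      omega
    | sub => simp only [eval, ArithOp.toOp, Op.eval]; omega
    | mul => simp only [eval, ArithOp.toOp, Op.eval]; exact Nat.mul_le_mul ha hb
    | div =>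
      simp only [eval, ArithOp.toOp, Op.eval]
      exact (Nat.div_le_self _ _).trans (ha.trans h3)
    | mod =>
      simp only [eval, ArithOp.toOp, Op.eval]
      exact (Nat.mod_le _ _).trans (ha.trans h3)
  | ld x a iha =>
    have h1 : X ≤ X ^ (a.size + 1) := Nat.le_self_pow (by omega) X
    exact (hσ.2 x _).trans h1

theorem Expr.fits {X w : ℕ} (hX : 2 ≤ X) (n : ℕ) (hw : X ^ n < 2 ^ w) {σ : State} (hσ : σ.Bdd X)
    {e : Expr} (he : e.leaves = true) (hs : e.size ≤ n) : e.Fits (2 ^ w) σ := by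
  have key : ∀ e : Expr, e.leaves = true → e.size ≤ n → e.eval σ < 2 ^ w := fun e he hs =>
    ((e.eval_le_pow hX hσ he).trans (Nat.pow_le_pow_right (by omega) hs)).trans_lt hw
  induction e with
  | reg r => trivial
  | lit v => exact key _ he hs
  | bin o a b iha ihb =>
    have he' := he
    simp only [leaves, Bool.and_eq_true] at he
    have := a.size_pos
    have := b.size_pos
    have hs' := hs
    simp only [size] at hs'
    exact ⟨iha he.1 (by omega), ihb he.2 (by omega), key _ he' hs⟩
  | ld x a iha =>
    have hs' := hs
    simp only [size] at hs'
    exact ⟨iha he (by omega), key _ he hs⟩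

/-- Forget the work registers. -/
def State.erase (σ : State) : State := { σ with reg := fun r => if r < 40 then σ.reg r else 0 }

@[simp] theorem State.erase_arr (σ : State) : σ.erase.arr = σ.arr := rfl

theorem State.erase_reg (σ : State) {r : ℕ} (h : r < 40) : σ.erase.reg r = σ.reg r := by
  simp [State.erase, h]

theorem State.erase_ext {σ τ : State} (hr : ∀ r < 40, σ.reg r = τ.reg r) (ha : σ.arr = τ.arr) :
    σ.erase = τ.erase := by
  ext r
  · simp only [State.erase]
    split_ifs with h
    · exact hr r h
    · rfl
  · simp [ha]

theorem State.erase_setReg (σ : State) {r : ℕ} (h : r < 40) (v : ℕ) :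
    (σ.setReg r v).erase = σ.erase.setReg r v := by
  ext s
  · simp only [State.erase, State.setReg, Function.update_apply]
    split_ifs <;> first | rfl | omega
  · rfl

theorem State.erase_setReg_work (σ : State) {r : ℕ} (h : 40 ≤ r) (v : ℕ) :
    (σ.setReg r v).erase = σ.erase := by
  apply State.erase_ext
  · intro s hs
    have : s ≠ r := by omega
    simp [State.setReg, this]
  · rfl

theorem State.erase_setArr (σ : State) (x i v : ℕ) :
    (σ.setArr x i v).erase = σ.erase.setArr x i v := rfl

@[simp] theorem State.setReg_reg (σ : State) (r v s : ℕ) :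
    (σ.setReg r v).reg s = if s = r then v else σ.reg s := by
  simp [State.setReg, Function.update_apply]

@[simp] theorem State.setReg_arr (σ : State) (r v : ℕ) : (σ.setReg r v).arr = σ.arr := rfl

@[simp] theorem State.setArr_reg (σ : State) (x i v : ℕ) : (σ.setArr x i v).reg = σ.reg := rfl

@[simp] theorem State.setArr_arr (σ : State) (x i v y : ℕ) :
    (σ.setArr x i v).arr y = if y = x then Function.update (σ.arr x) i v else σ.arr y := by
  by_cases h : y = x
  · subst h; simp [State.setArr]
  · simp [State.setArr, h]

theorem State.Bdd.setReg {X : ℕ} {σ : State} (h : σ.Bdd X) {r v : ℕ} (hv : v ≤ X) :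
    (σ.setReg r v).Bdd X := by
  refine ⟨fun s => ?_, h.2⟩
  rw [State.setReg_reg]
  split_ifs
  · exact hv
  · exact h.1 s

theorem State.Bdd.setArr {X : ℕ} {σ : State} (h : σ.Bdd X) {x i v : ℕ} (hv : v ≤ X) :
    (σ.setArr x i v).Bdd X := by
  refine ⟨h.1, fun y j => ?_⟩
  rw [State.setArr_arr]
  split_ifs
  · rw [Function.update_apply]
    split_ifs
    · exact hv
    · exact h.2 _ _
  · exact h.2 _ _

/-- May the program write to the register? -/
def Program.wr : Program → ℕ → Bool
  | .skip, _ => false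
  | .const r _, s => Nat.beq r s
  | .op _ r _ _, s => Nat.beq r s
  | .load r _ _, s => Nat.beq r s
  | .store _ _ _, _ => false
  | .seq p q, s => p.wr s || q.wr s
  | .cond _ _ p q, s => p.wr s || q.wr s
  | .loop _ _ p, s => p.wr s

/-- May the program write to the array? -/
def Program.wa : Program → ℕ → Bool
  | .skip, _ => false
  | .const _ _, _ => false
  | .op _ _ _ _, _ => false
  | .load _ _ _, _ => false
  | .store x _ _, y => Nat.beq x y
  | .seq p q, s => p.wa s || q.wa s
  | .cond _ _ p q, s => p.wa s || q.wa s
  | .loop _ _ p, s => p.wa s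

/-- `wr` is a syntactic over-approximation with values in `Bool`, so for concrete programs the
hypothesis is closed by `rfl`. -/
theorem Exec.reg_eq {w : ℕ} {p : Program} {σ τ : State} {t : ℕ} (h : Exec w p σ t τ) {s : ℕ}
    (hs : p.wr s = false) : τ.reg s = σ.reg s := by
  induction h with
  | skip | store | loop_done => rfl
  | const | op | load =>
    have : s ≠ _ := Ne.symm (Nat.ne_of_beq_eq_false hs)
    simp [this]
  | seq _ _ ih1 ih2 =>
    simp only [Program.wr, Bool.or_eq_false_iff] at hs
    rw [ih2 hs.2, ih1 hs.1]
  | cond_true _ _ ih =>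
    simp only [Program.wr, Bool.or_eq_false_iff] at hs
    exact ih hs.1
  | cond_false _ _ ih =>
    simp only [Program.wr, Bool.or_eq_false_iff] at hs
    exact ih hs.2
  | loop_step _ _ _ ih1 ih2 => rw [ih2 hs, ih1 hs]

theorem Exec.arr_eq {w : ℕ} {p : Program} {σ τ : State} {t : ℕ} (h : Exec w p σ t τ) {y : ℕ}
    (hs : p.wa y = false) : τ.arr y = σ.arr y := by
  induction h with
  | skip | const | op | load | loop_done => rfl
  | store =>
    have : y ≠ _ := Ne.symm (Nat.ne_of_beq_eq_false hs)
    simp [this]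
  | seq _ _ ih1 ih2 =>
    simp only [Program.wa, Bool.or_eq_false_iff] at hs
    rw [ih2 hs.2, ih1 hs.1]
  | cond_true _ _ ih =>
    simp only [Program.wa, Bool.or_eq_false_iff] at hs
    exact ih hs.1
  | cond_false _ _ ih =>
    simp only [Program.wa, Bool.or_eq_false_iff] at hs
    exact ih hs.2
  | loop_step _ _ _ ih1 ih2 => rw [ih2 hs, ih1 hs]

/-! ### A Hoare calculus with step counts -/

/-- The two states differ only where `p` may write. -/
structure Frame (p : Program) (σ τ : State) : Prop where
  reg : ∀ r, p.wr r = false → τ.reg r = σ.reg r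
  arr : ∀ x, p.wa x = false → τ.arr x = σ.arr x

/-- Started in a state that agrees with `σ` up to work registers and is bounded by `X`, the
program halts within `t` steps in a state that is bounded by `X` and satisfies `Q` up to work
registers. -/
def Runs (𝔐 : Machine) (p : Program) (σ : State) (t : ℕ) (Q : State → Prop) : Prop :=
  σ.Bdd 𝔐.X → ∀ σ₀ : State, σ₀.erase = σ → ∃ t' τ₀, Exec 𝔐.w p σ₀ t' τ₀ ∧ t' ≤ t ∧
    τ₀.erase.Bdd 𝔐.X ∧ Q τ₀.erase

/-- Assign the value of an expression to a register. -/
def assign (r : ℕ) (e : Expr) : Program :=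
  .seq (e.code 40).1 (.seq (.const 41 0) (.op .add r (e.code 40).2 41))

/-- Store the value of `e` in cell `i` of array `x`. -/
def write (x : ℕ) (i e : Expr) : Program :=
  .seq (i.code 40).1 (.seq (e.code 41).1 (.store x (i.code 40).2 (e.code 41).2))

/-- If `a < b` then `p` else `q`. -/
def ite (a b : Expr) (p q : Program) : Program :=
  .seq (a.code 40).1 (.seq (b.code 41).1 (.cond (a.code 40).2 (b.code 41).2 p q))

/-- For the values `0, 1, …, reg b - 1` of register `i` do `p`. -/
def forLoop (i b : ℕ) (p : Program) : Program :=
  .seq (.const i 0) (.loop i b (.seq p (.seq (.const 40 1) (.op .add i i 40))))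

infixr:60 " ;; " => Program.seq

variable {𝔐 : Machine} {p q : Program} {σ : State} {t t' : ℕ} {Q R : State → Prop}

/-- The bound on the initial state is a premise inside `Runs`, so it may be used while a triple is
being proved. -/
theorem Runs.of_bdd (h : σ.Bdd 𝔐.X → Runs 𝔐 p σ t Q) : Runs 𝔐 p σ t Q := fun hb => h hb hb

theorem Runs.mono (h : Runs 𝔐 p σ t Q) (ht : t ≤ t') : Runs 𝔐 p σ t' Q := by
  intro hb σ₀ h0
  obtain ⟨s, τ, h1, h2, h3⟩ := h hb σ₀ h0
  exact ⟨s, τ, h1, h2.trans ht, h3⟩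

/-- Boundedness and the frame condition come for free with every triple. Specifications therefore
mention only what a program changes. -/
theorem Runs.frame (h : Runs 𝔐 p σ t Q) :
    Runs 𝔐 p σ t (fun τ => τ.Bdd 𝔐.X ∧ Frame p σ τ ∧ Q τ) := by
  intro hb σ₀ h0
  obtain ⟨s, τ, h1, h2, h3, h4⟩ := h hb σ₀ h0
  refine ⟨s, τ, h1, h2, h3, h3, ⟨fun r hr => ?_, fun x hx => ?_⟩, h4⟩
  · subst h0
    simp only [State.erase, h1.reg_eq hr]
  · subst h0
    simp only [State.erase, h1.arr_eq hx]

theorem Runs.imp (h : Runs 𝔐 p σ t Q) (hQ : ∀ τ, τ.Bdd 𝔐.X → Frame p σ τ → Q τ → R τ) :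
    Runs 𝔐 p σ t R := by
  intro hb σ₀ h0
  obtain ⟨s, τ, h1, h2, h3, h4, h5, h6⟩ := h.frame hb σ₀ h0
  exact ⟨s, τ, h1, h2, h3, hQ _ h4 h5 h6⟩

theorem Runs.seq (h : Runs 𝔐 p σ t R)
    (h' : ∀ τ, τ.Bdd 𝔐.X → Frame p σ τ → R τ → Runs 𝔐 q τ t' Q) :
    Runs 𝔐 (p ;; q) σ (t + t') Q := by
  intro hb σ₀ h0
  obtain ⟨s, τ, h1, h2, h3, h4, h5, h6⟩ := h.frame hb σ₀ h0
  obtain ⟨s', υ, g1, g2, g3⟩ := h' _ h4 h5 h6 h3 τ rfl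
  exact ⟨s + s', υ, h1.seq g1, by omega, g3⟩

theorem Runs.skip (h : Q σ) : Runs 𝔐 .skip σ 1 Q := by
  rintro hb σ₀ rfl
  exact ⟨1, σ₀, .skip _, le_rfl, hb, h⟩

theorem erase_bdd_of {σ₀ : State} {e : Expr} (he : e.wf = true) (hb : σ₀.erase.Bdd 𝔐.X) :
    e.leaves = true ∧ e.size ≤ 32 ∧ e.cost ≤ 64 ∧ e.Fits (2 ^ 𝔐.w) σ₀ ∧
      e.eval σ₀ = e.eval σ₀.erase := by
  simp only [Expr.wf, Bool.and_eq_true, Nat.ble_eq] at he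
  have hreg : ∀ r < 40, σ₀.reg r = σ₀.erase.reg r := fun r hr => (σ₀.erase_reg hr).symm
  refine ⟨he.1, he.2, by have := e.cost_le; omega, ?_, Expr.eval_congr he.1 hreg rfl⟩
  exact (Expr.fits 𝔐.two_le 32 𝔐.pow_lt hb he.1 he.2).congr he.1 hreg rfl

theorem Machine.X_lt (𝔐 : Machine) : 𝔐.X < 2 ^ 𝔐.w :=
  (Nat.le_self_pow (by norm_num) 𝔐.X).trans_lt 𝔐.pow_lt

/-- The flat cost is generous: a well-formed expression has size at most 32 and so takes fewer than
64 steps. Intermediate values may reach X^32, but the assigned value has to be at most X again,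
which keeps states bounded through any number of assignments. -/
theorem Runs.assign {r : ℕ} {e : Expr} (hv : e.eval σ ≤ 𝔐.X)
    (h : Q (σ.setReg r (e.eval σ))) (he : e.wf = true := by rfl)
    (hr : Nat.ble (r + 1) 40 = true := by rfl) :
    Runs 𝔐 (assign r e) σ 100 Q := by
  rintro hb σ₀ rfl
  have hr' : r < 40 := by simpa using hr
  obtain ⟨h1, h2, h3, h4, h5⟩ := erase_bdd_of he hb
  obtain ⟨τ, g1, g2, g3, g4⟩ := e.exec_code h1 40 le_rfl σ₀ h4
  have hX := 𝔐.X_lt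
  -- Copying is done by adding register 41, set to zero. The result lies in register 40 or in a
  -- variable, so clearing 41 is harmless.
  have hq : (τ.setReg 41 0).reg (e.code 40).2 = e.eval σ₀.erase := by
    rw [State.setReg_reg, if_neg, g2, h5]
    rcases Expr.code_snd h1 40 with h | h <;> omega
  have key : ((τ.setReg 41 0).setReg r (Op.add.eval ((τ.setReg 41 0).reg (e.code 40).2)
      ((τ.setReg 41 0).reg 41))).erase = σ₀.erase.setReg r (e.eval σ₀.erase) := by
    rw [State.erase_setReg _ hr', State.erase_setReg_work _ (by omega), hq]
    simp only [Op.eval, State.setReg_reg, if_true, add_zero]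
    congr 1
    exact State.erase_ext (fun r hr => g4 r hr) g3
  refine ⟨_, _, g1.seq (.seq (.const _ _ _ (by positivity)) (.op _ _ _ _ _ ?_)), ?_, ?_, ?_⟩
  · rw [hq]; simp only [Op.eval, State.setReg_reg, if_true, add_zero]; omega
  · omega
  · rw [key]; exact hb.setReg hv
  · rw [key]; exact h

theorem Runs.write {x : ℕ} {i e : Expr} (hv : e.eval σ ≤ 𝔐.X)
    (h : Q (σ.setArr x (i.eval σ) (e.eval σ))) (hi : i.wf = true := by rfl)
    (he : e.wf = true := by rfl) :
    Runs 𝔐 (write x i e) σ 200 Q := by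
  rintro hb σ₀ rfl
  obtain ⟨h1, h2, h3, h4, h5⟩ := erase_bdd_of hi hb
  obtain ⟨k1, k2, k3, k4, k5⟩ := erase_bdd_of he hb
  obtain ⟨τ, g1, g2, g3, g4⟩ := i.exec_code h1 40 le_rfl σ₀ h4
  have hreg : ∀ r < 40, τ.reg r = σ₀.reg r := g4
  obtain ⟨υ, l1, l2, l3, l4⟩ := e.exec_code k1 41 (by omega) τ (k4.congr k1 hreg g3)
  have e1 : υ.reg (i.code 40).2 = i.eval σ₀.erase := by
    rw [l4 _ (by rcases Expr.code_snd h1 40 with h | h <;> omega), g2, h5]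
  have e2 : υ.reg (e.code 41).2 = e.eval σ₀.erase := by
    rw [l2, Expr.eval_congr k1 hreg g3, k5]
  have key : (υ.setArr x (υ.reg (i.code 40).2) (υ.reg (e.code 41).2)).erase =
      σ₀.erase.setArr x (i.eval σ₀.erase) (e.eval σ₀.erase) := by
    rw [State.erase_setArr, e1, e2]
    congr 1
    exact State.erase_ext (fun r hr => by rw [l4 r (by omega), hreg r hr]) (by rw [l3, g3])
  refine ⟨_, _, g1.seq (l1.seq (.store _ _ _ _)), by omega, ?_, ?_⟩
  · rw [key]; exact hb.setArr hv
  · rw [key]; exact h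

theorem Runs.ite {a b : Expr} (hp : a.eval σ < b.eval σ → Runs 𝔐 p σ t Q)
    (hq : ¬ a.eval σ < b.eval σ → Runs 𝔐 q σ t' Q) (ha : a.wf = true := by rfl)
    (hb : b.wf = true := by rfl) :
    Runs 𝔐 (ite a b p q) σ (max t t' + 200) Q := by
  rintro hbd σ₀ rfl
  obtain ⟨h1, h2, h3, h4, h5⟩ := erase_bdd_of ha hbd
  obtain ⟨k1, k2, k3, k4, k5⟩ := erase_bdd_of hb hbd
  obtain ⟨τ, g1, g2, g3, g4⟩ := a.exec_code h1 40 le_rfl σ₀ h4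
  have hreg : ∀ r < 40, τ.reg r = σ₀.reg r := g4
  obtain ⟨υ, l1, l2, l3, l4⟩ := b.exec_code k1 41 (by omega) τ (k4.congr k1 hreg g3)
  have e1 : υ.reg (a.code 40).2 = a.eval σ₀.erase := by
    rw [l4 _ (by rcases Expr.code_snd h1 40 with h | h <;> omega), g2, h5]
  have e2 : υ.reg (b.code 41).2 = b.eval σ₀.erase := by
    rw [l2, Expr.eval_congr k1 hreg g3, k5]
  have key : υ.erase = σ₀.erase :=
    State.erase_ext (fun r hr => by rw [l4 r (by omega), hreg r hr]) (by rw [l3, g3])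
  by_cases hlt : a.eval σ₀.erase < b.eval σ₀.erase
  · obtain ⟨s, ρ, r1, r2, r3⟩ := hp hlt hbd υ key
    exact ⟨_, ρ, g1.seq (l1.seq (.cond_true (by rw [e1, e2]; exact hlt) r1)), by omega, r3⟩
  · obtain ⟨s, ρ, r1, r2, r3⟩ := hq hlt hbd υ key
    exact ⟨_, ρ, g1.seq (l1.seq (.cond_false (by rw [e1, e2]; exact hlt) r1)), by omega, r3⟩

theorem Runs.const {r v : ℕ} (hv : v ≤ 𝔐.X) (h : Q (σ.setReg r v))
    (hr : Nat.ble (r + 1) 40 = true := by rfl) : Runs 𝔐 (.const r v) σ 1 Q := by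
  rintro hb σ₀ rfl
  have hr' : r < 40 := by simpa using hr
  have hX := 𝔐.X_lt
  refine ⟨1, _, .const _ _ _ (by omega), le_rfl, ?_, ?_⟩ <;> rw [State.erase_setReg _ hr']
  · exact hb.setReg hv
  · exact h

theorem Runs.assign_seq {r : ℕ} {e : Expr} (hv : e.eval σ ≤ 𝔐.X)
    (h : Runs 𝔐 p (σ.setReg r (e.eval σ)) t Q) (he : e.wf = true := by rfl)
    (hr : Nat.ble (r + 1) 40 = true := by rfl) :
    Runs 𝔐 (RAM.assign r e ;; p) σ (100 + t) Q :=
  (Runs.assign (Q := fun τ => τ = σ.setReg r (e.eval σ)) hv rfl he hr).seq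
    fun _ _ _ hτ => hτ ▸ h

theorem Runs.write_seq {x : ℕ} {i e : Expr} (hv : e.eval σ ≤ 𝔐.X)
    (h : Runs 𝔐 p (σ.setArr x (i.eval σ) (e.eval σ)) t Q) (hi : i.wf = true := by rfl)
    (he : e.wf = true := by rfl) :
    Runs 𝔐 (RAM.write x i e ;; p) σ (200 + t) Q :=
  (Runs.write (Q := fun τ => τ = σ.setArr x (i.eval σ) (e.eval σ)) hv rfl hi he).seq
    fun _ _ _ hτ => hτ ▸ h

theorem Runs.const_seq {r v : ℕ} (hv : v ≤ 𝔐.X) (h : Runs 𝔐 p (σ.setReg r v) t Q)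
    (hr : Nat.ble (r + 1) 40 = true := by rfl) : Runs 𝔐 (.const r v ;; p) σ (1 + t) Q :=
  (Runs.const (Q := fun τ => τ = σ.setReg r v) hv rfl hr).seq fun _ _ _ hτ => hτ ▸ h

/-- The rule for loops, with a time bound for each iteration. -/
theorem Runs.forLoop_sum {i b B : ℕ} (I : ℕ → State → Prop) (c : ℕ → ℕ) (hB : σ.reg b = B)
    (h0 : I 0 (σ.setReg i 0))
    (hs : ∀ k < B, ∀ τ, τ.Bdd 𝔐.X → Frame (forLoop i b p) σ τ → τ.reg i = k → I k τ →
      Runs 𝔐 p τ (c k) (fun τ' => I (k + 1) (τ'.setReg i (k + 1))))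
    (hQ : ∀ τ, τ.Bdd 𝔐.X → Frame (forLoop i b p) σ τ → τ.reg i = B → I B τ → Q τ)
    (hi : Nat.ble (i + 1) 40 = true := by rfl) (hb : Nat.ble (b + 1) 40 = true := by rfl)
    (hib : Nat.beq i b = false := by rfl) (hpi : p.wr i = false := by rfl)
    (hpb : p.wr b = false := by rfl) :
    Runs 𝔐 (forLoop i b p) σ (∑ k ∈ Finset.range B, (c k + 3) + 2) Q := by
  have hi' : i < 40 := by simpa using hi
  have hb' : b < 40 := by simpa using hb
  have hib' : i ≠ b := Nat.ne_of_beq_eq_false hib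
  intro hbd σ₀ hσ₀
  have hBX : B ≤ 𝔐.X := hB ▸ hbd.1 b
  have hX := 𝔐.X_lt
  have h40 : Nat.beq 40 b = false := by
    cases h : Nat.beq 40 b
    · rfl
    · have := Nat.eq_of_beq_eq_true h; omega
  have hwb : (RAM.forLoop i b p).wr b = false := by
    simp [RAM.forLoop, Program.wr, hpb, hib, h40]
  set body : Program := .seq p (.seq (.const 40 1) (.op .add i i 40)) with hbody
  -- Induction on the number `m` of remaining iterations, from an arbitrary value `k` of the
  -- counter.
  have key : ∀ m k, k + m = B → ∀ τ₀ : State, τ₀.erase.Bdd 𝔐.X →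
      Frame (forLoop i b p) σ τ₀.erase → τ₀.reg i = k → I k τ₀.erase →
      ∃ t' ρ, Exec 𝔐.w (.loop i b body) τ₀ t' ρ ∧ t' ≤ ∑ j ∈ Finset.Ico k B, (c j + 3) + 1 ∧
        ρ.erase.Bdd 𝔐.X ∧ Q ρ.erase := by
    intro m
    induction m with
    | zero =>
      intro k hk τ₀ h1 h2 h3 h4
      have hkB : k = B := by omega
      subst hkB
      refine ⟨1, τ₀, .loop_done ?_, by simp, h1, hQ _ h1 h2 (by rw [State.erase_reg _ hi', h3]) h4⟩
      have : τ₀.erase.reg b = σ.reg b := h2.reg b hwb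
      rw [State.erase_reg _ hb'] at this
      omega
    | succ m ih =>
      intro k hk τ₀ h1 h2 h3 h4
      have hτb : τ₀.reg b = B := by
        have : τ₀.erase.reg b = σ.reg b := h2.reg b hwb
        rw [State.erase_reg _ hb'] at this
        omega
      obtain ⟨s, ρ, r1, r2, r3, r4, r5, r6⟩ := (hs k (by omega) _ h1 h2
        (by rw [State.erase_reg _ hi', h3]) h4).frame h1 τ₀ rfl
      have hρi : ρ.reg i = k := by rw [r1.reg_eq hpi, h3]
      set ρ' := (ρ.setReg 40 1).setReg i (k + 1) with hρ'
      have hρe : ρ'.erase = ρ.erase.setReg i (k + 1) := by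
        rw [hρ', State.erase_setReg _ hi', State.erase_setReg_work _ le_rfl]
      -- The increment takes two steps and the loop test one, which is the `3` in the time bound.
      -- The final `2` pays for the initialization and the last test.
      have hstep : Exec 𝔐.w body τ₀ (s + (1 + 1)) ρ' := by
        refine r1.seq (.seq (.const _ _ _ (by have := 𝔐.two_le; omega)) ?_)
        have : Op.add.eval ((ρ.setReg 40 1).reg i) ((ρ.setReg 40 1).reg 40) = k + 1 := by
          simp [Op.eval, hρi, hi'.ne]
        rw [hρ', ← this]
        exact .op _ _ _ _ _ (by rw [this]; omega)
      have hfr : Frame (forLoop i b p) σ ρ'.erase := by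
        refine ⟨fun r hr => ?_, fun x hx => ?_⟩
        · have hr' := hr
          simp only [forLoop, Program.wr, Bool.or_eq_false_iff] at hr'
          have hri : r ≠ i := Ne.symm (Nat.ne_of_beq_eq_false hr'.1)
          rw [hρe, State.setReg_reg, if_neg hri, r5.reg r hr'.2.1, h2.reg r hr]
        · have hx' := hx
          simp only [forLoop, Program.wa, Bool.or_eq_false_iff] at hx'
          rw [hρe, State.setReg_arr, r5.arr x hx'.2.1, h2.arr x hx]
      obtain ⟨s', υ, u1, u2, u3⟩ := ih (k + 1) (by omega) ρ'
        (by rw [hρe]; exact r3.setReg (by omega)) hfr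
        (by simp [hρ']) (by rw [hρe]; exact r6)
      refine ⟨_, υ, .loop_step (by omega) hstep u1, ?_, u3⟩
      rw [Finset.sum_eq_sum_Ico_succ_bot (by omega)]
      omega
  have e0 : (σ₀.setReg i 0).erase = σ.setReg i 0 := by rw [State.erase_setReg _ hi', hσ₀]
  obtain ⟨s, ρ, r1, r2, r3⟩ := key B 0 (by omega) (σ₀.setReg i 0)
    (by rw [e0]; exact hbd.setReg (by omega))
    ⟨fun r hr => by
      simp only [forLoop, Program.wr, Bool.or_eq_false_iff] at hr
      have hri : r ≠ i := Ne.symm (Nat.ne_of_beq_eq_false hr.1)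
      rw [e0, State.setReg_reg, if_neg hri], fun x _ => by rw [e0]; rfl⟩
    (by simp) (by rw [e0]; exact h0)
  refine ⟨_, ρ, .seq (.const _ _ _ (by positivity)) r1, ?_, r3⟩
  rw [Finset.range_eq_Ico]
  omega

/-- The rule for loops, with a uniform time bound for the iterations. -/
theorem Runs.forLoop {i b B : ℕ} (I : ℕ → State → Prop) {c : ℕ} (hB : σ.reg b = B)
    (h0 : I 0 (σ.setReg i 0))
    (hs : ∀ k < B, ∀ τ, τ.Bdd 𝔐.X → Frame (forLoop i b p) σ τ → τ.reg i = k → I k τ →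
      Runs 𝔐 p τ c (fun τ' => I (k + 1) (τ'.setReg i (k + 1))))
    (hQ : ∀ τ, τ.Bdd 𝔐.X → Frame (forLoop i b p) σ τ → τ.reg i = B → I B τ → Q τ)
    (hi : Nat.ble (i + 1) 40 = true := by rfl) (hb : Nat.ble (b + 1) 40 = true := by rfl)
    (hib : Nat.beq i b = false := by rfl) (hpi : p.wr i = false := by rfl)
    (hpb : p.wr b = false := by rfl) :
    Runs 𝔐 (forLoop i b p) σ (B * (c + 3) + 2) Q := by
  have := Runs.forLoop_sum (𝔐 := 𝔐) I (fun _ => c) hB h0 hs hQ hi hb hib hpi hpb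
  simpa using this

end RAM

/-! ### Digits -/

namespace ThreeSum

open Finset

/-- The digit of `v` of index `t` in base `ℓ`. -/
def digit (ℓ t v : ℕ) : ℕ := v / ℓ ^ t % ℓ

theorem digit_lt {ℓ : ℕ} (hℓ : 0 < ℓ) (t v : ℕ) : digit ℓ t v < ℓ := Nat.mod_lt _ hℓ

theorem digit_eq_mod_div (ℓ s v : ℕ) : digit ℓ s v = v % ℓ ^ (s + 1) / ℓ ^ s := by
  rw [digit, pow_succ, Nat.mod_mul_right_div_self]

theorem digit_eq_of_mod_eq {ℓ s t v v' : ℕ} (h : v % ℓ ^ t = v' % ℓ ^ t) (hs : s < t) :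
    digit ℓ s v = digit ℓ s v' := by
  have hd : ℓ ^ (s + 1) ∣ ℓ ^ t := pow_dvd_pow _ hs
  rw [digit_eq_mod_div, digit_eq_mod_div, ← Nat.mod_mod_of_dvd v hd, ← Nat.mod_mod_of_dvd v' hd, h]

theorem digit_mod_pow {ℓ t h v : ℕ} (ht : t < h) : digit ℓ t (v % ℓ ^ h) = digit ℓ t v :=
  digit_eq_of_mod_eq (Nat.mod_mod _ _) ht

theorem digit_eq_zero_of_lt {ℓ t v : ℕ} (hv : v < ℓ ^ t) : digit ℓ t v = 0 := by
  rw [digit, Nat.div_eq_of_lt hv, Nat.zero_mod]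

theorem digit_mul_pow_of_lt {ℓ t h v : ℕ} (ht : t < h) : digit ℓ t (v * ℓ ^ h) = 0 := by
  rw [digit_eq_mod_div, Nat.mod_eq_zero_of_dvd ((pow_dvd_pow _ ht).mul_left _), Nat.zero_div]

theorem digit_div_mul_pow {ℓ t h v : ℕ} (hℓ : 0 < ℓ) (ht : h ≤ t) :
    digit ℓ t (v / ℓ ^ h * ℓ ^ h) = digit ℓ t v := by
  obtain ⟨s, rfl⟩ := Nat.exists_eq_add_of_le ht
  rw [digit, digit, pow_add, ← Nat.div_div_eq_div_mul, ← Nat.div_div_eq_div_mul,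
    Nat.mul_div_cancel _ (pow_pos hℓ h)]

/-- The number with the digits `f 0, …, f (k - 1)`. -/
def ofDigits (ℓ k : ℕ) (f : ℕ → ℕ) : ℕ := ∑ t ∈ range k, f t * ℓ ^ t

theorem ofDigits_lt {ℓ k : ℕ} {f : ℕ → ℕ} (hf : ∀ t < k, f t < ℓ) : ofDigits ℓ k f < ℓ ^ k := by
  induction k with
  | zero => simp [ofDigits]
  | succ k ih =>
    have := ih fun t ht => hf t (by omega)
    rw [ofDigits] at this ⊢
    rw [sum_range_succ, pow_succ]
    have h2 : (f k + 1) * ℓ ^ k ≤ ℓ * ℓ ^ k := Nat.mul_le_mul_right _ (hf k (by omega))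
    nlinarith

theorem digit_ofDigits {ℓ k : ℕ} {f : ℕ → ℕ} (hf : ∀ t < k, f t < ℓ) {t : ℕ} (ht : t < k) :
    digit ℓ t (ofDigits ℓ k f) = f t := by
  induction k with
  | zero => omega
  | succ k ih =>
    have hlt : ofDigits ℓ k f < ℓ ^ k := ofDigits_lt fun t ht => hf t (by omega)
    have hs : ofDigits ℓ (k + 1) f = ofDigits ℓ k f + f k * ℓ ^ k := by
      rw [ofDigits, sum_range_succ]; rfl
    rcases Nat.lt_succ_iff_lt_or_eq.mp ht with h | rfl
    · rw [← ih (fun t ht => hf t (by omega)) h, hs]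
      refine digit_eq_of_mod_eq (t := k) ?_ h
      rw [Nat.add_mul_mod_self_right]
    · have hℓ : 0 < ℓ := (Nat.zero_le _).trans_lt (hf t ht)
      rw [digit, hs, Nat.add_mul_div_right _ _ (pow_pos hℓ t), Nat.div_eq_of_lt hlt, zero_add,
        Nat.mod_eq_of_lt (hf t ht)]

theorem eq_of_digit_eq {ℓ k v v' : ℕ} (hℓ : 0 < ℓ) (hv : v < ℓ ^ k) (hv' : v' < ℓ ^ k)
    (h : ∀ t < k, digit ℓ t v = digit ℓ t v') : v = v' := by
  induction k generalizing v v' with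
  | zero => simp at hv hv'; omega
  | succ k ih =>
    have h1 : v % ℓ ^ k = v' % ℓ ^ k := by
      refine ih (Nat.mod_lt _ (pow_pos hℓ k)) (Nat.mod_lt _ (pow_pos hℓ k)) fun t ht => ?_
      rw [digit_mod_pow ht, digit_mod_pow ht, h t (by omega)]
    have h2 := h k (by omega)
    rw [digit_eq_mod_div, digit_eq_mod_div, Nat.mod_eq_of_lt hv, Nat.mod_eq_of_lt hv'] at h2
    rw [← Nat.div_add_mod v (ℓ ^ k), ← Nat.div_add_mod v' (ℓ ^ k), h1, h2]

theorem sum_range_mul {R : Type*} [AddCommMonoid R] (f : ℕ → R) (a b : ℕ) :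
    ∑ v ∈ range (a * b), f v = ∑ i ∈ range a, ∑ j ∈ range b, f (i * b + j) := by
  induction a with
  | zero => simp
  | succ a ih => rw [Nat.succ_mul, sum_range_add, ih, sum_range_succ]

/-- The numbers below ℓ^k are the k-tuples of digits, so this is distributivity. It splits a sum of
characters over ℓ^k points into k one-dimensional sums. -/
theorem sum_prod_digit {R : Type*} [CommSemiring R] (ℓ k : ℕ) (f : ℕ → ℕ → R) :
    ∑ v ∈ range (ℓ ^ k), ∏ t ∈ range k, f t (digit ℓ t v) =
      ∏ t ∈ range k, ∑ y ∈ range ℓ, f t y := by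
  induction k with
  | zero => simp
  | succ k ih =>
    rw [pow_succ', sum_range_mul, prod_range_succ, ← ih, mul_comm, sum_mul_sum]
    refine sum_congr rfl fun i hi => sum_congr rfl fun j hj => ?_
    simp only [mem_range] at hi hj
    rw [prod_range_succ, mul_comm]
    congr 1
    · congr 1
      have : 0 < ℓ ^ k := by omega
      rw [digit, mul_comm, Nat.mul_add_div this, Nat.div_eq_of_lt hj, add_zero,
        Nat.mod_eq_of_lt hi]
    · refine prod_congr rfl fun t ht => ?_
      simp only [mem_range] at ht
      congr 1
      refine digit_eq_of_mod_eq (t := k) ?_ ht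
      rw [mul_comm, Nat.mul_add_mod]

/-! ### Transforms along the digits -/

/-- The values after the transformation of the first `t` digits, for the sum of the indicators of
the keys. -/
def partialTransform {R : Type*} [CommSemiring R] (ℓ : ℕ) (E : ℕ → ℕ → ℕ → R) (N : ℕ)
    (key : ℕ → ℕ) (t idx : ℕ) : R :=
  ∑ m ∈ range N, if key m / ℓ ^ t = idx / ℓ ^ t then
    ∏ s ∈ range t, E s (digit ℓ s idx) (digit ℓ s (key m)) else 0

theorem partialTransform_zero {R : Type*} [CommSemiring R] (ℓ : ℕ) (E : ℕ → ℕ → ℕ → R) (N : ℕ)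
    (key : ℕ → ℕ) (idx : ℕ) :
    partialTransform ℓ E N key 0 idx = ((∑ m ∈ range N, if key m = idx then 1 else 0 : ℕ) : R) := by
  simp [partialTransform]

/-- Replace the digit of index `t`. -/
def setDigit (ℓ t idx x : ℕ) : ℕ := idx - digit ℓ t idx * ℓ ^ t + x * ℓ ^ t

theorem setDigit_div {ℓ : ℕ} (hℓ : 0 < ℓ) (t idx x : ℕ) :
    setDigit ℓ t idx x / ℓ ^ t = idx / ℓ ^ (t + 1) * ℓ + x := by
  have hP : 0 < ℓ ^ t := pow_pos hℓ t
  have h1 : idx - digit ℓ t idx * ℓ ^ t = idx / ℓ ^ (t + 1) * ℓ * ℓ ^ t + idx % ℓ ^ t := by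
    have e1 := Nat.div_add_mod idx (ℓ ^ t)
    have e2 := Nat.div_add_mod (idx / ℓ ^ t) ℓ
    rw [Nat.div_div_eq_div_mul, ← pow_succ] at e2
    rw [digit]
    generalize idx / ℓ ^ t % ℓ = y at *
    generalize idx / ℓ ^ (t + 1) = z at *
    generalize idx % ℓ ^ t = r at *
    rw [← e2] at e1
    have : idx = z * ℓ * ℓ ^ t + r + y * ℓ ^ t := by rw [← e1]; ring
    omega
  rw [setDigit, h1, add_right_comm, ← add_mul, mul_comm, Nat.mul_add_div hP,
    Nat.div_eq_of_lt (Nat.mod_lt _ hP), add_zero]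

theorem setDigit_mod {ℓ : ℕ} (t idx x : ℕ) :
    setDigit ℓ t idx x % ℓ ^ t = idx % ℓ ^ t := by
  rw [setDigit, Nat.add_mul_mod_self_right]
  have : digit ℓ t idx * ℓ ^ t ≤ idx :=
    (Nat.mul_le_mul_right _ (Nat.mod_le _ _)).trans (Nat.div_mul_le_self _ _)
  conv_rhs => rw [← Nat.sub_add_cancel this, Nat.add_mul_mod_self_right]

/-- One pass of the fast transform: ℓ multiplications per entry and digit. For a given key only the
summand in which `x` is the digit `t` of the key survives, because agreement of the quotients by ℓ^t
is agreement above digit `t` together with agreement at digit `t`. -/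
theorem partialTransform_succ {R : Type*} [CommSemiring R] {ℓ : ℕ} (hℓ : 0 < ℓ)
    (E : ℕ → ℕ → ℕ → R) (N : ℕ) (key : ℕ → ℕ) (t idx : ℕ) :
    partialTransform ℓ E N key (t + 1) idx = ∑ x ∈ range ℓ,
      E t (digit ℓ t idx) x * partialTransform ℓ E N key t (setDigit ℓ t idx x) := by
  simp only [partialTransform, mul_sum]
  rw [sum_comm]
  refine sum_congr rfl fun m _ => ?_
  have hkey : key m / ℓ ^ t = key m / ℓ ^ (t + 1) * ℓ + digit ℓ t (key m) := by
    rw [digit, pow_succ, ← Nat.div_div_eq_div_mul, Nat.div_add_mod']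
  have hdig : ∀ x, ∏ s ∈ range t, E s (digit ℓ s (setDigit ℓ t idx x)) (digit ℓ s (key m)) =
      ∏ s ∈ range t, E s (digit ℓ s idx) (digit ℓ s (key m)) := fun x =>
    prod_congr rfl fun s hs => by
      rw [digit_eq_of_mod_eq (setDigit_mod t idx x) (mem_range.mp hs)]
  simp only [setDigit_div hℓ, hdig, hkey]
  have hy := digit_lt hℓ t (key m)
  by_cases h : key m / ℓ ^ (t + 1) = idx / ℓ ^ (t + 1)
  · rw [if_pos h, sum_eq_single (digit ℓ t (key m))]
    · rw [if_pos (by rw [h]), prod_range_succ, mul_comm]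
    · intro x _ hx
      rw [if_neg, mul_zero]
      rw [h]
      omega
    · intro h
      exact absurd (mem_range.mpr hy) h
  · rw [if_neg h, sum_eq_zero]
    intro x hx
    rw [if_neg, mul_zero]
    intro h'
    apply h
    have := congrArg (fun i => i / ℓ) h'
    beta_reduce at this
    rwa [mul_comm, Nat.mul_add_div hℓ, Nat.div_eq_of_lt hy, mul_comm (idx / _), Nat.mul_add_div hℓ,
      Nat.div_eq_of_lt (mem_range.mp hx), add_zero, add_zero] at this

/-! ### Characters modulo prime powers -/

/-- The `(ℓ - 1)`-th root of unity modulo `ℓ ^ e` that is congruent to `y` modulo the prime `ℓ`. -/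
def root (ℓ e y : ℕ) : ZMod (ℓ ^ e) := (y : ZMod (ℓ ^ e)) ^ ℓ ^ (e - 1)

/-- Taking an ℓ-th power improves a congruence by one power of ℓ, and this is done e - 1 times. -/
theorem root_congr {ℓ e y y' : ℕ} (he : 1 ≤ e) (h : y % ℓ = y' % ℓ) : root ℓ e y = root ℓ e y' := by
  have h1 : ((ℓ : ℕ) : ℤ) ∣ (y : ℤ) - y' := by
    have : y' ≡ y [MOD ℓ] := h.symm
    exact (Nat.modEq_iff_dvd.mp this)
  have h2 := dvd_sub_pow_of_dvd_sub h1 (e - 1)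
  rw [Nat.sub_add_cancel he] at h2
  have h3 : (((ℓ ^ e : ℕ) : ℤ)) ∣ (y : ℤ) ^ ℓ ^ (e - 1) - (y' : ℤ) ^ ℓ ^ (e - 1) := by
    exact_mod_cast h2
  have h4 := (ZMod.intCast_zmod_eq_zero_iff_dvd _ (ℓ ^ e)).mpr h3
  push_cast at h4
  rw [root, root]
  exact sub_eq_zero.mp h4

theorem root_mul (ℓ e y y' : ℕ) : root ℓ e (y * y') = root ℓ e y * root ℓ e y' := by
  simp [root, mul_pow]

theorem root_pow_eq_one {ℓ e y j : ℕ} (hℓ : ℓ.Prime) (he : 1 ≤ e) (hy : ¬ ℓ ∣ y)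
    (hj : (ℓ - 1) ∣ j) : root ℓ e y ^ j = 1 := by
  obtain ⟨i, rfl⟩ := hj
  have hc : Nat.Coprime y (ℓ ^ e) := ((hℓ.coprime_iff_not_dvd.mpr hy).symm).pow_right e
  have h := ZMod.pow_totient (ZMod.unitOfCoprime y hc)
  have h' := congrArg (fun u : (ZMod (ℓ ^ e))ˣ => (u : ZMod (ℓ ^ e))) h
  simp only [Units.val_pow_eq_pow_val, ZMod.coe_unitOfCoprime, Units.val_one] at h'
  rw [Nat.totient_prime_pow hℓ (by omega)] at h'
  rw [root, ← pow_mul, ← mul_assoc, pow_mul, h', one_pow]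

/-- Orthogonality of characters. If ℓ - 1 does not divide j, multiplication by a generator of the
units modulo ℓ permutes the residues and multiplies the sum by the j-th power of its root. That
factor minus 1 has to be a unit, not merely nonzero, because `ZMod (ℓ ^ e)` has zero divisors when e
> 1. As j ≥ 1, the residue 0 contributes nothing. -/
theorem sum_root_pow {ℓ e j : ℕ} (hℓ : ℓ.Prime) (he : 1 ≤ e) (hj : 1 ≤ j) :
    ∑ y ∈ range ℓ, root ℓ e y ^ j = if (ℓ - 1) ∣ j then ((ℓ - 1 : ℕ) : ZMod (ℓ ^ e)) else 0 := by
  have : Fact ℓ.Prime := ⟨hℓ⟩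
  have hℓ0 := hℓ.pos
  have h0 : root ℓ e 0 = 0 := by
    rw [root, Nat.cast_zero, zero_pow (pow_pos hℓ0 _).ne']
  split_ifs with hd
  · obtain ⟨m, hm⟩ : ∃ m, ℓ = m + 1 := ⟨ℓ - 1, by omega⟩
    rw [show range ℓ = range (m + 1) by rw [hm], sum_range_succ', h0, zero_pow (by omega), add_zero]
    have : ∀ y ∈ range m, root ℓ e (y + 1) ^ j = 1 := by
      intro y hy
      refine root_pow_eq_one hℓ he (fun h => ?_) hd
      have := Nat.le_of_dvd (by omega) h
      simp only [mem_range] at hy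
      omega
    rw [sum_congr rfl this]
    simp [hm]
  · obtain ⟨g, hg⟩ := IsCyclic.exists_ofOrder_eq_natCard (α := (ZMod ℓ)ˣ)
    rw [Nat.card_eq_fintype_card, ZMod.card_units] at hg
    set g₀ := (g : ZMod ℓ).val with hg₀
    have hgc : ((g₀ : ℕ) : ZMod ℓ) = g := by rw [hg₀, ZMod.natCast_val, ZMod.cast_id]
    set S := ∑ y ∈ range ℓ, root ℓ e y ^ j with hS
    have hcop : Nat.Coprime ℓ g₀ := by
      refine hℓ.coprime_iff_not_dvd.mpr fun h => g.ne_zero ?_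
      rw [← hgc]
      exact (ZMod.natCast_eq_zero_iff _ _).mpr h
    have hperm : ∑ y ∈ range ℓ, root ℓ e (g₀ * y % ℓ) ^ j = S := by
      have hinj : Set.InjOn (fun y => g₀ * y % ℓ) (range ℓ : Set ℕ) := by
        intro a ha b hb hab
        simp only [coe_range, Set.mem_Iio] at ha hb
        have h1 : a ≡ b [MOD ℓ] := Nat.ModEq.cancel_left_of_coprime hcop hab
        rwa [Nat.ModEq, Nat.mod_eq_of_lt ha, Nat.mod_eq_of_lt hb] at h1
      have himg : (range ℓ).image (fun y => g₀ * y % ℓ) = range ℓ := by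
        refine eq_of_subset_of_card_le (fun y hy => ?_) ?_
        · obtain ⟨a, _, rfl⟩ := mem_image.mp hy
          exact mem_range.mpr (Nat.mod_lt _ hℓ0)
        · rw [card_image_of_injOn hinj]
      rw [hS]
      conv_rhs => rw [← himg]
      rw [sum_image hinj]
    have hmul : (root ℓ e g₀ ^ j - 1) * S = 0 := by
      rw [sub_mul, one_mul, sub_eq_zero]
      conv_rhs => rw [← hperm]
      rw [hS, mul_sum]
      refine sum_congr rfl fun y _ => ?_
      rw [root_congr (y := g₀ * y % ℓ) (y' := g₀ * y) he (Nat.mod_mod _ _), root_mul, mul_pow]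
    have : NeZero (ℓ ^ e) := ⟨(pow_pos hℓ0 e).ne'⟩
    -- Being a unit can be tested modulo ℓ, where the element is g^(ℓ^(e-1) j) - 1. The order ℓ - 1
    -- of g is coprime to ℓ, so this vanishes only if ℓ - 1 divides j.
    have hunit : IsUnit (root ℓ e g₀ ^ j - 1) := by
      set x := root ℓ e g₀ ^ j - 1 with hx
      have hxv : ((x.val : ℕ) : ZMod (ℓ ^ e)) = x := by rw [ZMod.natCast_val, ZMod.cast_id]
      rw [← hxv, ZMod.isUnit_iff_coprime]
      refine Nat.Coprime.pow_right _ ((hℓ.coprime_iff_not_dvd.mpr fun h => ?_).symm)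
      have hc : ZMod.castHom (dvd_pow_self ℓ (by omega : e ≠ 0)) (ZMod ℓ) x = 0 := by
        rw [← hxv, map_natCast]
        exact (ZMod.natCast_eq_zero_iff _ _).mpr h
      rw [hx, map_sub, map_one, map_pow, root, map_pow, map_natCast, hgc, sub_eq_zero, ← pow_mul,
        ← Units.val_pow_eq_pow_val, Units.val_eq_one, ← orderOf_dvd_iff_pow_eq_one,
        hg] at hc
      have hc2 : Nat.Coprime (ℓ - 1) (ℓ ^ (e - 1)) := by
        refine Nat.Coprime.pow_right _ ?_
        have := Nat.coprime_self_add_right (m := ℓ - 1) (n := 1)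
        rw [Nat.sub_add_cancel hℓ0] at this
        exact this.mpr (Nat.coprime_one_right _)
      exact hd (hc2.dvd_of_dvd_mul_left hc)
    exact (hunit.mul_right_eq_zero).mp hmul

/-- The matrix whose product with two powers detects addition modulo `d`. -/
def dualEntry (ℓ e d y c : ℕ) (inv : ZMod (ℓ ^ e)) : ZMod (ℓ ^ e) :=
  inv * (root ℓ e y ^ (ℓ - 1 - c) + root ℓ e y ^ (2 * (ℓ - 1) - c - d))

/-- Since a + b < 2d, the congruence modulo d means a + b = c or a + b = c + d, and each of the two
powers in `dualEntry` detects one case. The room 2d ≤ ℓ - 1 excludes any other multiple of ℓ - 1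
among the exponents, so one prime ℓ serves all moduli, whatever their relation to ℓ - 1. The added
multiples of ℓ - 1 keep the exponents positive. -/
theorem sum_root_dualEntry {ℓ e d a b c : ℕ} (hℓ : ℓ.Prime) (he : 1 ≤ e) (hd : 2 * d ≤ ℓ - 1)
    (ha : a < d) (hb : b < d) (hc : c < d) {inv : ZMod (ℓ ^ e)}
    (hinv : inv * ((ℓ - 1 : ℕ) : ZMod (ℓ ^ e)) = 1) :
    ∑ y ∈ range ℓ, root ℓ e y ^ a * root ℓ e y ^ b * dualEntry ℓ e d y c inv =
      if (a + b) % d = c then 1 else 0 := by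
  have h1 : ∀ y, root ℓ e y ^ a * root ℓ e y ^ b * dualEntry ℓ e d y c inv =
      inv * (root ℓ e y ^ (a + b + (ℓ - 1 - c)) +
        root ℓ e y ^ (a + b + (2 * (ℓ - 1) - c - d))) := fun y => by
    rw [dualEntry]; ring
  have key : ∀ i, i < 2 * (ℓ - 1) → i ≠ 0 → ((ℓ - 1) ∣ i ↔ i = ℓ - 1) := by
    intro i hi h0
    constructor
    · rintro ⟨m, rfl⟩
      have : m = 1 := by
        have hm : m < 2 := by
          by_contra h
          have : (ℓ - 1) * 2 ≤ (ℓ - 1) * m := Nat.mul_le_mul_left _ (by omega)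
          omega
        have : m ≠ 0 := by rintro rfl; simp at h0
        omega
      rw [this, mul_one]
    · rintro rfl; exact dvd_rfl
  have key2 : (ℓ - 1) ∣ a + b + (2 * (ℓ - 1) - c - d) ↔ a + b = c + d := by
    have e1 : a + b + (2 * (ℓ - 1) - c - d) + (c + d) = a + b + (ℓ - 1) * 2 := by omega
    constructor
    · rintro ⟨m, hm⟩
      have h3 : m < 3 := by
        by_contra h
        have : (ℓ - 1) * 3 ≤ (ℓ - 1) * m := Nat.mul_le_mul_left _ (by omega)
        omega
      interval_cases m <;> omega
    · intro h
      exact ⟨2, by omega⟩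
  have h2 := hℓ.two_le
  simp only [h1, ← mul_sum, sum_add_distrib]
  rw [sum_root_pow hℓ he (by omega), sum_root_pow hℓ he (by omega)]
  have k1 : (ℓ - 1) ∣ a + b + (ℓ - 1 - c) ↔ a + b = c := by
    rw [key _ (by omega) (by omega)]; omega
  simp only [k1, key2]
  by_cases hab : a + b < d
  · rw [Nat.mod_eq_of_lt hab]
    by_cases h : a + b = c
    · rw [if_pos h, if_neg (by omega), if_pos h, add_zero, hinv]
    · rw [if_neg h, if_neg (by omega), if_neg h, add_zero, mul_zero]
  · have hm : (a + b) % d = a + b - d := by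
      rw [Nat.mod_eq_sub_mod (by omega), Nat.mod_eq_of_lt (by omega)]
    rw [hm]
    by_cases h : a + b = c + d
    · rw [if_neg (by omega), if_pos h, if_pos (by omega), zero_add, hinv]
    · rw [if_neg (by omega), if_neg h, if_neg (by omega), add_zero, mul_zero]

/-- The geometric sum (ℓ^e - 1) / (ℓ - 1), multiplied by ℓ - 1, is -1 modulo ℓ^e. The inverse thus
takes a few word operations. -/
theorem inv_mul_eq_one {ℓ e : ℕ} (hℓ : 2 ≤ ℓ) :
    ((ℓ ^ e - (ℓ ^ e - 1) / (ℓ - 1) : ℕ) : ZMod (ℓ ^ e)) * ((ℓ - 1 : ℕ) : ZMod (ℓ ^ e)) = 1 := by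
  have hdvd : (ℓ - 1) ∣ ℓ ^ e - 1 := by
    simpa using Nat.sub_dvd_pow_sub_pow ℓ 1 e
  have h1 : 1 ≤ ℓ ^ e := Nat.one_le_pow _ _ (by omega)
  have h2 : (ℓ ^ e - 1) / (ℓ - 1) ≤ ℓ ^ e := (Nat.div_le_self _ _).trans (Nat.sub_le _ _)
  have h3 : (((ℓ ^ e - 1) / (ℓ - 1) : ℕ) : ZMod (ℓ ^ e)) * ((ℓ - 1 : ℕ) : ZMod (ℓ ^ e)) = -1 := by
    rw [← Nat.cast_mul, Nat.div_mul_cancel hdvd, Nat.cast_sub h1, ZMod.natCast_self]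
    simp
  rw [Nat.cast_sub h2, ZMod.natCast_self, sub_mul, h3]
  simp

end ThreeSum

namespace ThreeSum

open Finset

/-! ### Hashing -/

/-- The residues of `x` (for `b = 0`) or `-x` (for `b = 1`), shifted by the digits of `sh`, modulo
`d 0, …, d (k - 1)`, as a number with `k` digits. -/
def hash (ℓ k : ℕ) (d : ℕ → ℕ) (b sh x : ℕ) : ℕ :=
  ofDigits ℓ k fun t => (x * (b * (d t - 2) + 1) + digit ℓ t sh) % d t

theorem hash_lt {ℓ k : ℕ} {d : ℕ → ℕ} (hd : ∀ t < k, 1 ≤ d t ∧ d t ≤ ℓ) (b sh x : ℕ) :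
    hash ℓ k d b sh x < ℓ ^ k :=
  ofDigits_lt fun t ht => (Nat.mod_lt _ (hd t ht).1).trans_le (hd t ht).2

theorem digit_hash {ℓ k : ℕ} {d : ℕ → ℕ} (hd : ∀ t < k, 1 ≤ d t ∧ d t ≤ ℓ) (b sh x : ℕ) {t : ℕ}
    (ht : t < k) :
    digit ℓ t (hash ℓ k d b sh x) = (x * (b * (d t - 2) + 1) + digit ℓ t sh) % d t :=
  digit_ofDigits (fun t ht => (Nat.mod_lt _ (hd t ht).1).trans_le (hd t ht).2) ht

theorem digit_zero_right (ℓ t : ℕ) : digit ℓ t 0 = 0 := by simp [digit]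

theorem digit_hash_zero {ℓ k : ℕ} {d : ℕ → ℕ} (hd : ∀ t < k, 1 ≤ d t ∧ d t ≤ ℓ) (x : ℕ) {t : ℕ}
    (ht : t < k) : digit ℓ t (hash ℓ k d 0 0 x) = x % d t := by
  rw [digit_hash hd _ _ _ ht, digit_zero_right]
  simp

/-- A list of tasks: the task `m` is to look for `x` in the block `wi m` and `y` in the block `wj m`
of `L` with `L x + L y = L (wz m)`, where `L` has `n` entries and the blocks have length `g`. -/
structure Tasks where
  n : ℕ
  g : ℕ
  R : ℕ
  L : ℕ → ℕ
  N : ℕ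
  wz : ℕ → ℕ
  wi : ℕ → ℕ
  wj : ℕ → ℕ

namespace Tasks

/-- All indices are in their ranges. -/
structure Valid (W : Tasks) : Prop where
  g_pos : 0 < W.g
  le_mul : W.n ≤ W.R * W.g
  wz_lt : ∀ m < W.N, W.wz m < W.n
  wi_lt : ∀ m < W.N, W.wi m < W.R
  wj_lt : ∀ m < W.N, W.wj m < W.R

/-- Does the pair of indices solve the task modulo `d 0, …, d (k - 1)`? -/
def Hit (W : Tasks) (k : ℕ) (d : ℕ → ℕ) (m x y : ℕ) : Prop :=
  x / W.g = W.wi m ∧ y / W.g = W.wj m ∧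
    ∀ t < k, (W.L x + W.L y) % d t = W.L (W.wz m) % d t

open Classical in
/-- The total number of solutions of the tasks modulo `d 0, …, d (k - 1)`. -/
noncomputable def collisions (W : Tasks) (k : ℕ) (d : ℕ → ℕ) : ℕ :=
  ∑ m ∈ range W.N, ∑ x ∈ range W.n, ∑ y ∈ range W.n, if W.Hit k d m x y then 1 else 0

/-- The key of an entry of the list. -/
def keyA (W : Tasks) (ℓ k : ℕ) (d : ℕ → ℕ) (x : ℕ) : ℕ := x / W.g * ℓ ^ k + hash ℓ k d 0 0 (W.L x)

/-- The key of a task. -/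
def keyC (W : Tasks) (ℓ k : ℕ) (d : ℕ → ℕ) (m : ℕ) : ℕ :=
  (W.wi m * W.R + W.wj m) * ℓ ^ k + hash ℓ k d 0 0 (W.L (W.wz m))

/-- Expand the three transforms into sums over x, y and m and carry out the sum over v first. It
factors over the digits by `sum_prod_digit`, and `sum_root_dualEntry` turns each factor into the
indicator of one congruence. The block numbers sit above the k transformed digits, so the sums over
i and j merely pick the blocks of each task. -/
theorem collisions_eq_sum (W : Tasks) (hW : W.Valid) {ℓ e k : ℕ} {d : ℕ → ℕ} (hℓ : ℓ.Prime)
    (he : 1 ≤ e) (hd : ∀ t < k, 1 ≤ d t ∧ 2 * d t ≤ ℓ - 1) {inv : ZMod (ℓ ^ e)}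
    (hinv : inv * ((ℓ - 1 : ℕ) : ZMod (ℓ ^ e)) = 1) :
    ∑ i ∈ range W.R, ∑ j ∈ range W.R, ∑ v ∈ range (ℓ ^ k),
      partialTransform ℓ (fun _ y x => root ℓ e y ^ x) W.n (W.keyA ℓ k d) k (i * ℓ ^ k + v) *
      partialTransform ℓ (fun _ y x => root ℓ e y ^ x) W.n (W.keyA ℓ k d) k (j * ℓ ^ k + v) *
      partialTransform ℓ (fun t y c => dualEntry ℓ e (d t) y c inv) W.N (W.keyC ℓ k d) k
        ((i * W.R + j) * ℓ ^ k + v) = (W.collisions k d : ZMod (ℓ ^ e)) := by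
  have hℓ0 := hℓ.pos
  have hd' : ∀ t < k, 1 ≤ d t ∧ d t ≤ ℓ := fun t ht => by have := hd t ht; omega
  have hV : 0 < ℓ ^ k := pow_pos hℓ0 k
  have hdiv : ∀ i v, v < ℓ ^ k → (i * ℓ ^ k + v) / ℓ ^ k = i := fun i v hv => by
    rw [mul_comm, Nat.mul_add_div hV, Nat.div_eq_of_lt hv, add_zero]
  have hdig : ∀ i v t, t < k → digit ℓ t (i * ℓ ^ k + v) = digit ℓ t v := fun i v t ht =>
    digit_eq_of_mod_eq (t := k) (by rw [mul_comm, Nat.mul_add_mod]) ht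
  set a : ℕ → ℕ → ZMod (ℓ ^ e) := fun x v =>
    ∏ t ∈ range k, root ℓ e (digit ℓ t v) ^ (W.L x % d t) with ha
  set c : ℕ → ℕ → ZMod (ℓ ^ e) := fun m v =>
    ∏ t ∈ range k, dualEntry ℓ e (d t) (digit ℓ t v) (W.L (W.wz m) % d t) inv with hc
  have hA : ∀ i, ∀ v ∈ range (ℓ ^ k),
      partialTransform ℓ (fun _ y x => root ℓ e y ^ x) W.n (W.keyA ℓ k d) k (i * ℓ ^ k + v) =
      ∑ x ∈ range W.n, if x / W.g = i then a x v else 0 := by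
    intro i v hv
    rw [mem_range] at hv
    refine sum_congr rfl fun x _ => ?_
    rw [hdiv i v hv, keyA, hdiv _ _ (hash_lt hd' _ _ _)]
    refine if_congr Iff.rfl (prod_congr rfl fun t ht => ?_) rfl
    rw [mem_range] at ht
    rw [hdig _ _ _ ht, hdig _ _ _ ht, digit_hash_zero hd' _ ht]
  have hC : ∀ i j, j ∈ range W.R → ∀ v ∈ range (ℓ ^ k),
      partialTransform ℓ (fun t y c => dualEntry ℓ e (d t) y c inv) W.N (W.keyC ℓ k d) k
        ((i * W.R + j) * ℓ ^ k + v) =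
      ∑ m ∈ range W.N, if W.wi m = i then (if W.wj m = j then c m v else 0) else 0 := by
    intro i j hj v hv
    rw [mem_range] at hv hj
    refine sum_congr rfl fun m hm => ?_
    rw [mem_range] at hm
    rw [hdiv _ v hv, keyC, hdiv _ _ (hash_lt hd' _ _ _), ← ite_and]
    refine if_congr ?_ (prod_congr rfl fun t ht => ?_) rfl
    · have h1 := hW.wj_lt m hm
      constructor
      · intro h
        have h2 : (W.wi m * W.R + W.wj m) / W.R = (i * W.R + j) / W.R := by rw [h]
        rw [mul_comm, Nat.mul_add_div (by omega), Nat.div_eq_of_lt h1, mul_comm i,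
          Nat.mul_add_div (by omega), Nat.div_eq_of_lt hj] at h2
        have h3 : W.wi m = i := by omega
        rw [h3] at h
        exact ⟨h3, by omega⟩
      · rintro ⟨rfl, rfl⟩; rfl
    · rw [mem_range] at ht
      rw [hdig _ _ _ ht, hdig _ _ _ ht, digit_hash_zero hd' _ ht]
  -- For a fixed triple the sum over v is exactly the indicator of all congruences.
  have hsum : ∀ m x y, ∑ v ∈ range (ℓ ^ k), a x v * a y v * c m v =
      if ∀ t < k, (W.L x + W.L y) % d t = W.L (W.wz m) % d t then 1 else 0 := by
    intro m x y
    simp only [ha, hc, ← prod_mul_distrib]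
    rw [sum_prod_digit ℓ k fun t z => root ℓ e z ^ (W.L x % d t) * root ℓ e z ^ (W.L y % d t) *
      dualEntry ℓ e (d t) z (W.L (W.wz m) % d t) inv]
    have : ∀ t ∈ range k, ∑ z ∈ range ℓ, root ℓ e z ^ (W.L x % d t) * root ℓ e z ^ (W.L y % d t) *
        dualEntry ℓ e (d t) z (W.L (W.wz m) % d t) inv =
        if (W.L x + W.L y) % d t = W.L (W.wz m) % d t then 1 else 0 := by
      intro t ht
      rw [mem_range] at ht
      have h1 := hd t ht
      rw [sum_root_dualEntry hℓ he h1.2 (Nat.mod_lt _ h1.1) (Nat.mod_lt _ h1.1)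
        (Nat.mod_lt _ h1.1) hinv, ← Nat.add_mod]
    rw [prod_congr rfl this, prod_ite_zero]
    simp
  calc _ = ∑ i ∈ range W.R, ∑ j ∈ range W.R, ∑ m ∈ range W.N,
        if W.wi m = i then (if W.wj m = j then
          ∑ x ∈ range W.n, ∑ y ∈ range W.n, ∑ v ∈ range (ℓ ^ k),
            if x / W.g = i then (if y / W.g = j then a x v * a y v * c m v else 0) else 0
          else 0) else 0 := by
        refine sum_congr rfl fun i _ => sum_congr rfl fun j hj => ?_
        have : ∀ v ∈ range (ℓ ^ k), _ = _ := fun v hv =>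
          congrArg₂ (· * ·) (congrArg₂ (· * ·) (hA i v hv) (hA j v hv)) (hC i j hj v hv)
        refine (sum_congr rfl this).trans ?_
        have expand : ∀ (p q r : ℕ → ZMod (ℓ ^ e)), (∑ x ∈ range W.n, p x) * (∑ y ∈ range W.n, q y) *
            (∑ m ∈ range W.N, r m) =
            ∑ m ∈ range W.N, ∑ x ∈ range W.n, ∑ y ∈ range W.n, p x * q y * r m := by
          intro p q r
          rw [mul_sum]
          refine sum_congr rfl fun m _ => ?_
          rw [sum_mul_sum, sum_mul]
          exact sum_congr rfl fun x _ => sum_mul _ _ _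
        simp only [expand]
        rw [sum_comm]
        refine sum_congr rfl fun m _ => ?_
        by_cases h1 : W.wi m = i
        · by_cases h2 : W.wj m = j
          · simp only [h1, h2, if_true]
            rw [sum_comm]
            refine sum_congr rfl fun x _ => ?_
            rw [sum_comm]
            refine sum_congr rfl fun y _ => sum_congr rfl fun v _ => ?_
            split_ifs <;> simp
          · simp [h2]
        · simp [h1]
    _ = ∑ m ∈ range W.N, ∑ x ∈ range W.n, ∑ y ∈ range W.n, ∑ v ∈ range (ℓ ^ k),
            if x / W.g = W.wi m then (if y / W.g = W.wj m then a x v * a y v * c m v else 0)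
            else 0 := by
        simp only [sum_comm (s := range W.R) (t := range W.N)]
        refine sum_congr rfl fun m hm => ?_
        rw [mem_range] at hm
        rw [sum_eq_single (W.wi m)]
        · rw [sum_eq_single (W.wj m)]
          · simp
          · intro j _ hj
            simp [Ne.symm hj]
          · intro h
            exact absurd (mem_range.mpr (hW.wj_lt m hm)) h
        · intro i _ hi
          simp [Ne.symm hi]
        · intro h
          exact absurd (mem_range.mpr (hW.wi_lt m hm)) h
    _ = _ := by
        rw [collisions]
        push_cast
        refine sum_congr rfl fun m _ => sum_congr rfl fun x _ => sum_congr rfl fun y _ => ?_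
        by_cases h1 : x / W.g = W.wi m
        · by_cases h2 : y / W.g = W.wj m
          · simp only [h1, h2, if_true, hsum, Hit, true_and]
          · simp [h2, Hit]
        · simp [h1, Hit]

theorem card_block_le (g n i : ℕ) (hg : 0 < g) :
    #{x ∈ range n | x / g = i} ≤ g := by
  have : {x ∈ range n | x / g = i} ⊆ Ico (i * g) (i * g + g) := by
    intro x hx
    simp only [mem_filter, mem_range] at hx
    rw [mem_Ico, ← hx.2]
    exact ⟨Nat.div_mul_le_self _ _, Nat.lt_div_mul_add hg⟩
  simpa using card_le_card this

theorem collisions_le (W : Tasks) (hW : W.Valid) (k : ℕ) (d : ℕ → ℕ) :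
    W.collisions k d ≤ W.N * (W.g * W.g) := by
  classical
  rw [collisions]
  have : ∀ m ∈ range W.N, (∑ x ∈ range W.n, ∑ y ∈ range W.n,
      if W.Hit k d m x y then 1 else 0) ≤ W.g * W.g := by
    intro m _
    calc _ ≤ ∑ x ∈ range W.n, ∑ y ∈ range W.n,
          (if x / W.g = W.wi m then 1 else 0) * (if y / W.g = W.wj m then 1 else 0) := by
          refine sum_le_sum fun x _ => sum_le_sum fun y _ => ?_
          by_cases h : W.Hit k d m x y
          · simp [h, h.1, h.2.1]
          · simp [h]
      _ ≤ _ := by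
          rw [← sum_mul_sum]
          refine Nat.mul_le_mul ?_ ?_ <;> rw [← card_filter] <;>
            exact card_block_le _ _ _ hW.g_pos
  simpa using sum_le_sum this

/-- No task has a solution over the integers. -/
def NoSolution (W : Tasks) : Prop :=
  ∀ m < W.N, ∀ x < W.n, ∀ y < W.n, W.L x + W.L y ≠ W.L (W.wz m)

/-! ### Averaging over prime moduli -/

theorem card_prime_dvd_le {D B : ℕ} {z : ℤ} (hz : z ≠ 0) (hB : z.natAbs < 2 ^ B) :
    #((Icc 1 D).filter fun p : ℕ => p.Prime ∧ (p : ℤ) ∣ z) ≤ B := by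
  have h1 : ((Icc 1 D).filter fun p : ℕ => p.Prime ∧ (p : ℤ) ∣ z) ⊆ z.natAbs.primeFactors := by
    intro p hp
    simp only [mem_filter] at hp
    rw [Nat.mem_primeFactors]
    exact ⟨hp.2.1, Int.natCast_dvd.mp hp.2.2, by simpa using hz⟩
  refine (card_le_card h1).trans ?_
  have h2 : 2 ^ #z.natAbs.primeFactors ≤ z.natAbs := by
    calc 2 ^ #z.natAbs.primeFactors = ∏ _p ∈ z.natAbs.primeFactors, 2 := by simp
      _ ≤ ∏ p ∈ z.natAbs.primeFactors, p :=
          prod_le_prod' fun p hp => (Nat.prime_of_mem_primeFactors hp).two_le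
      _ ≤ z.natAbs := Nat.le_of_dvd (by omega) (Nat.prod_primeFactors_dvd _)
  exact ((Nat.pow_lt_pow_iff_right (by norm_num)).mp (h2.trans_lt hB)).le

/-- Some modulus `p ≤ D` reduces the number of solutions almost by the number of primes. -/
theorem exists_update_le (W : Tasks) (hn : W.NoSolution) {k D B t : ℕ} {d : ℕ → ℕ}
    (ht : t < k) (hdt : d t = 1) (hD : 2 ≤ D) (hz : ∀ m < W.N, W.wz m < W.n)
    (hB : ∀ x < W.n, 2 * W.L x < 2 ^ B) :
    ∃ p, 1 ≤ p ∧ p ≤ D ∧ Nat.primeCounting D * W.collisions k (Function.update d t p) ≤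
      B * W.collisions k d := by
  classical
  set P := {p ∈ Icc 1 D | p.Prime} with hP
  have hcard : #P = Nat.primeCounting D := by
    rw [Nat.primeCounting, Nat.primeCounting', Nat.count_eq_card_filter_range]
    congr 1
    ext p
    simp only [hP, mem_filter, mem_Icc, mem_range]
    constructor
    · rintro ⟨h1, h2⟩; exact ⟨by omega, h2⟩
    · rintro ⟨h1, h2⟩; exact ⟨⟨h2.one_le, by omega⟩, h2⟩
  have hne : P.Nonempty := ⟨2, by simp [hP, Nat.prime_two, hD]⟩
  have hsum : ∑ p ∈ P, W.collisions k (Function.update d t p) ≤ B * W.collisions k d := by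
    simp only [collisions]
    rw [sum_comm, mul_sum]
    refine sum_le_sum fun m hm => ?_
    rw [sum_comm, mul_sum]
    refine sum_le_sum fun x hx => ?_
    rw [sum_comm, mul_sum]
    refine sum_le_sum fun y hy => ?_
    rw [mem_range] at hm hx hy
    have himp : ∀ p, W.Hit k (Function.update d t p) m x y →
        W.Hit k d m x y ∧ (p : ℤ) ∣ (W.L x + W.L y : ℤ) - W.L (W.wz m) := by
      rintro p ⟨h1, h2, h3⟩
      refine ⟨⟨h1, h2, fun s hs => ?_⟩, ?_⟩
      -- The old modulus 1 imposes no condition, so putting `p` in its place can only remove hits.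
      · by_cases hst : s = t
        · subst hst; rw [hdt, Nat.mod_one, Nat.mod_one]
        · simpa [hst] using h3 s hs
      · have := h3 t ht
        rw [Function.update_self] at this
        have h4 : W.L (W.wz m) ≡ W.L x + W.L y [MOD p] := this.symm
        simpa using Nat.modEq_iff_dvd.mp h4
    by_cases h : W.Hit k d m x y
    -- A hit survives only for the primes that divide the nonzero integer L x + L y - L z, and this
    -- integer has at most B bits.
    · rw [if_pos h, mul_one, ← card_filter]
      refine le_trans (card_le_card ?_) (card_prime_dvd_le (D := D) (B := B)
        (z := (W.L x + W.L y : ℤ) - W.L (W.wz m)) ?_ ?_)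
      · intro p hp
        simp only [hP, mem_filter] at hp ⊢
        exact ⟨hp.1.1, hp.1.2, (himp p hp.2).2⟩
      · have := hn m hm x hx y hy
        omega
      · have h1 := hB x hx
        have h2 := hB y hy
        have h3 := hB _ (hz m hm)
        omega
    · rw [if_neg h, mul_zero, sum_eq_zero]
      intro p _
      rw [if_neg fun hp => h (himp p hp).1]
  -- The best prime is at most the average over the π(D) primes.
  obtain ⟨p, hp, hle⟩ := exists_min_image P (fun p => W.collisions k (Function.update d t p)) hne
  have hp' := hp
  simp only [hP, mem_filter, mem_Icc] at hp'
  refine ⟨p, hp'.1.1, hp'.1.2, ?_⟩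
  rw [← hcard, ← smul_eq_mul]
  exact (card_nsmul_le_sum P _ _ hle).trans hsum

end Tasks

end ThreeSum

namespace ThreeSum

open Finset RAM RAM.Expr

/-! ### Setting up the parameters -/

/-- Register `37` becomes the `c`-th power of register `36`. -/
def powCode (c : ℕ) : Program :=
  .const 39 c ;; assign 37 1 ;; forLoop 38 39 (assign 37 (reg 37 * reg 36))

theorem powCode_runs {𝔐 : Machine} {σ : State} {x c : ℕ} (hx : σ.reg 36 = x) (hc : c ≤ 𝔐.X)
    (hX : x ^ c ≤ 𝔐.X) (hx1 : 1 ≤ x) :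
    Runs 𝔐 (powCode c) σ (103 * c + 103) (fun τ => τ.reg 37 = x ^ c) := by
  refine (Runs.const_seq hc <| Runs.assign_seq ?_ <|
    Runs.forLoop (fun j τ => τ.reg 37 = x ^ j) (B := c) (c := 100) ?_ ?_ ?_ ?_).mono ?_
  · simp; have := 𝔐.two_le; omega
  · simp
  · simp
  · intro j hj τ hb hF hτ hI
    have h1 := hF.reg 36 rfl
    simp only [State.setReg_reg] at h1
    refine Runs.assign ?_ ?_
    · have : x ^ (j + 1) ≤ x ^ c := Nat.pow_le_pow_right hx1 hj
      simpa [hI, h1, hx, ← pow_succ] using this.trans hX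
    · simp [hI, h1, hx, pow_succ]
  · intro τ hb hF hτ hI
    exact hI
  · omega

/-- Register `2` becomes the integral part of the `K`-th root of register `1`. -/
def rootCode (K : ℕ) : Program :=
  assign 2 0 ;; forLoop 20 1 (assign 36 (reg 20 + 1) ;; powCode K ;;
    ite (reg 1) (reg 37) .skip (assign 2 (reg 20 + 1)))

/-- A linear scan is affordable, since linear time is negligible in the reduction. The condition `n
^ K ≤ 𝔐.X` is needed because the powers of all numbers up to n are computed. -/
theorem rootCode_runs {𝔐 : Machine} {σ : State} {n K : ℕ} (hn : σ.reg 1 = n) (hK : 1 ≤ K)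
    (hKX : K ≤ 𝔐.X) (hX : n ^ K ≤ 𝔐.X) (hn1 : 1 ≤ n) :
    Runs 𝔐 (rootCode K) σ (n * (103 * K + 510) + 102)
      (fun τ => (τ.reg 2) ^ K ≤ n ∧ n < (τ.reg 2 + 1) ^ K) := by
  have hnX : n ≤ 𝔐.X := (Nat.le_self_pow (by omega) n).trans hX
  refine (Runs.assign_seq ?_ <|
    Runs.forLoop (fun j τ => τ.reg 2 ≤ j ∧ (τ.reg 2) ^ K ≤ n ∧
      ∀ y, y ≤ j → y ^ K ≤ n → y ≤ τ.reg 2) (B := n) (c := 103 * K + 503) ?_ ?_ ?_ ?_).mono ?_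
  · simp
  · simp [hn]
  · simp [zero_pow (by omega : K ≠ 0)]
  · intro j hj τ hb hF hτ ⟨hI1, hI2, hI3⟩
    have h1 := hF.reg 1 rfl
    simp only [State.setReg_reg] at h1
    have h1' : τ.reg 1 = n := by simpa [hn] using h1
    refine ((Runs.assign_seq ?_ <| Runs.seq (powCode_runs (x := j + 1) (c := K) ?_ hKX ?_ ?_)
      fun υ hb' hF' hυ => Runs.ite (t := 1) (t' := 100) ?_ ?_)).mono ?_
    · simp [hτ]; omega
    · simp [hτ]
    · exact (Nat.pow_le_pow_left hj K).trans hX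
    · omega
    · intro hlt
      have e1 := hF'.reg 1 rfl
      have e2 := hF'.reg 2 rfl
      simp [h1'] at e1 e2 hlt
      refine Runs.skip ?_
      simp only [State.setReg_reg]
      simp [e2]
      refine ⟨by omega, hI2, fun y hy hyn => ?_⟩
      rcases Nat.lt_succ_iff_lt_or_eq.mp (Nat.lt_succ_of_le hy) with h | rfl
      · exact hI3 y (by omega) hyn
      · omega
    · intro hlt
      have e1 := hF'.reg 1 rfl
      have e3 := hF'.reg 20 rfl
      simp [h1', hτ] at e1 e3 hlt
      refine Runs.assign ?_ ?_
      · simp [e3]; omega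
      · simp [e3]
        exact ⟨by omega, fun y hy _ => hy⟩
    · have : max 1 100 = 100 := rfl
      omega
  · intro τ hb hF hτ ⟨hI1, hI2, hI3⟩
    refine ⟨hI2, ?_⟩
    by_contra h
    push Not at h
    by_cases hle : τ.reg 2 + 1 ≤ n
    · have := hI3 _ hle h; omega
    · have : τ.reg 2 + 1 ≤ (τ.reg 2 + 1) ^ K := Nat.le_self_pow (by omega) _
      omega
  · ring_nf; omega

/-- Register `3` becomes a prime number between `2 D` and `4 D`, where `D` is register `2`. -/
def primeCode : Program :=
  assign 20 (2 * reg 2) ;; assign 3 0 ;; forLoop 21 20 (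
    assign 22 (2 * reg 2 + 1 + reg 21) ;; assign 23 1 ;;
    forLoop 24 22 (ite 1 (reg 24) (ite (reg 22 % reg 24) 1 (assign 23 0) .skip) .skip) ;;
    ite 0 (reg 23) (assign 3 (reg 22)) .skip)

/-- Trial division; Bertrand's postulate guarantees a success, and the last prime found is kept. The
lower bound 2D leaves the room for carries that `sum_root_dualEntry` needs for moduli up to D. -/
theorem primeCode_runs {𝔐 : Machine} {σ : State} {D : ℕ} (hD : σ.reg 2 = D) (hD1 : 1 ≤ D)
    (hX : 4 * D ≤ 𝔐.X) :
    Runs 𝔐 primeCode σ (2 * D * (4 * D * 503 + 520) + 203)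
      (fun τ => (τ.reg 3).Prime ∧ 2 * D < τ.reg 3 ∧ τ.reg 3 ≤ 4 * D) := by
  have hX2 := 𝔐.two_le
  refine (Runs.assign_seq ?_ <| Runs.assign_seq ?_ <|
    Runs.forLoop (fun j τ => (τ.reg 3 = 0 ∨ (τ.reg 3).Prime ∧ 2 * D < τ.reg 3 ∧ τ.reg 3 ≤ 4 * D) ∧
      ((∃ p, p.Prime ∧ 2 * D < p ∧ p ≤ 2 * D + j) → τ.reg 3 ≠ 0)) (B := 2 * D)
      (c := 4 * D * 503 + 502) ?_ ?_ ?_ ?_).mono ?_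
  · simp [hD]; omega
  · simp
  · simp [hD]
  · simp
  · intro j hj τ hb hF hτ ⟨hI1, hI2⟩
    have h2 : τ.reg 2 = D := by simpa [hD] using hF.reg 2 rfl
    refine ((Runs.assign_seq ?_ <| Runs.assign_seq ?_ <| Runs.seq (R := fun υ =>
      υ.reg 23 = if (2 * D + 1 + j).Prime then 1 else 0)
      (Runs.forLoop (fun i υ => υ.reg 23 = if ∃ z, z < i ∧ 1 < z ∧ z ∣ 2 * D + 1 + j then 0 else 1)
        (B := 2 * D + 1 + j) (c := 500) ?_ ?_ ?_ ?_)
      fun υ hb' hF' hυ => Runs.ite (t := 100) (t' := 1) ?_ ?_)).mono ?_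
    · simp [hτ, h2]; omega
    · simp; omega
    · simp [hτ, h2]
    · simp
    · intro i hi υ hb' hF' hυ hI
      have e22 : υ.reg 22 = 2 * D + 1 + j := by
        have := hF'.reg 22 rfl
        simpa [hτ, h2] using this
      refine (Runs.ite (t := 300) (t' := 1) (fun hlt => Runs.ite (t := 100) (t' := 1)
        (fun hlt' => Runs.assign ?_ ?_) (fun hlt' => Runs.skip ?_)) (fun hlt => Runs.skip ?_)).mono ?_
      · simp
      · simp [hυ, e22] at hlt hlt'
        simp
        exact ⟨i, by omega, hlt, Nat.dvd_of_mod_eq_zero hlt'⟩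
      · simp [hυ, e22] at hlt hlt'
        simp [hI]
        refine if_congr ⟨fun ⟨z, h1, h2, h3⟩ => ⟨z, by omega, h2, h3⟩, fun ⟨z, h1, h2, h3⟩ =>
          ⟨z, ?_, h2, h3⟩⟩ rfl rfl
        rcases Nat.lt_succ_iff_lt_or_eq.mp (Nat.lt_succ_of_le h1) with h | rfl
        · exact h
        · exact absurd (Nat.mod_eq_zero_of_dvd h3) hlt'
      · simp [hυ] at hlt
        simp [hI]
        refine if_congr ⟨fun ⟨z, h1, h2, h3⟩ => ⟨z, by omega, h2, h3⟩, fun ⟨z, h1, h2, h3⟩ =>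
          ⟨z, by omega, h2, h3⟩⟩ rfl rfl
      · simp
    · intro υ hb' hF' hυ hI
      rw [hI]
      have h2 : 2 ≤ 2 * D + 1 + j := by omega
      by_cases hp : (2 * D + 1 + j).Prime
      · rw [if_pos hp, if_neg]
        rintro ⟨z, h1, h3, h4⟩
        rcases (Nat.dvd_prime hp).mp h4 with h | h <;> omega
      · rw [if_neg hp, if_pos]
        obtain ⟨z, h1, h3, h4⟩ := Nat.exists_dvd_of_not_prime2 h2 hp
        exact ⟨z, h4, h3, h1⟩
    · intro hlt
      have e22 : υ.reg 22 = 2 * D + 1 + j := by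
        have := hF'.reg 22 rfl
        simpa [hτ, h2] using this
      have hp : (2 * D + 1 + j).Prime := by
        by_contra h
        simp [hυ, h] at hlt
      refine Runs.assign ?_ ?_
      · simp [e22]; omega
      · simp [e22]
        exact ⟨hp, by omega, by omega⟩
    · intro hlt
      have hp : ¬ (2 * D + 1 + j).Prime := by
        intro h
        simp [hυ, h] at hlt
      have e3 : υ.reg 3 = τ.reg 3 := by
        have := hF'.reg 3 rfl
        simpa using this
      refine Runs.skip ?_
      simp only [State.setReg_reg]
      simp only [e3]
      refine ⟨by simpa using hI1, ?_⟩
      rintro ⟨p, hp1, hp2, hp3⟩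
      refine hI2 ⟨p, hp1, hp2, ?_⟩
      by_contra h
      have : p = 2 * D + 1 + j := by omega
      exact hp (this ▸ hp1)
    · have h4 : (2 * D + 1 + j) * 503 ≤ 4 * D * 503 := Nat.mul_le_mul_right _ (by omega)
      have : max 100 1 = 100 := rfl
      omega
  · intro τ hb hF hτ ⟨hI1, hI2⟩
    obtain ⟨p, hp1, hp2, hp3⟩ := Nat.exists_prime_lt_and_le_two_mul (2 * D) (by omega)
    rcases hI1 with h | h
    · exact absurd h (hI2 ⟨p, hp1, hp2, by omega⟩)
    · exact h
  · have : 2 * D * (4 * D * 503 + 502 + 3) = 2 * D * (4 * D * 503 + 505) := by ring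
    have h2 : 2 * D * (4 * D * 503 + 520) = 2 * D * (4 * D * 503 + 505) + 2 * D * 15 := by ring
    omega

/-- The values of the parameters of the reduction. -/
structure Params where
  n : ℕ
  D : ℕ
  ℓ : ℕ
  e : ℕ
  h : ℕ
  R : ℕ
  g : ℕ
  m : ℕ
  f : ℕ

/-- The parameters are stored in their registers. -/
structure Params.Holds (P : Params) (σ : State) : Prop where
  n : σ.reg 1 = P.n
  D : σ.reg 2 = P.D
  ℓ : σ.reg 3 = P.ℓ
  M : σ.reg 4 = P.ℓ ^ P.e
  R : σ.reg 5 = P.R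
  g : σ.reg 6 = P.g
  V : σ.reg 7 = P.ℓ ^ (2 * P.h)
  H : σ.reg 8 = P.ℓ ^ P.h
  k : σ.reg 10 = 2 * P.h
  f : σ.reg 11 = P.D ^ P.f
  inv : σ.reg 12 = P.ℓ ^ P.e - (P.ℓ ^ P.e - 1) / (P.ℓ - 1)
  m : σ.reg 15 = P.D ^ P.m

/-- The registers of the parameters. -/
def paramRegs : List ℕ := [1, 2, 3, 4, 5, 6, 7, 8, 10, 11, 12, 15]

theorem Params.Holds.of_frame {P : Params} {p : Program} {σ τ : State} (hP : P.Holds σ)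
    (hF : Frame p σ τ) (hp : paramRegs.all (fun r => !p.wr r) = true := by rfl) : P.Holds τ := by
  have key : ∀ r ∈ paramRegs, τ.reg r = σ.reg r := fun r hr => hF.reg r (by
    have := List.all_eq_true.mp hp r hr
    simpa using this)
  simp only [paramRegs, List.forall_mem_cons] at key
  obtain ⟨k1, k2, k3, k4, k5, k6, k7, k8, k9, k10, k11, k12, _⟩ := key
  exact ⟨k1.trans hP.n, k2.trans hP.D, k3.trans hP.ℓ, k4.trans hP.M, k5.trans hP.R, k6.trans hP.g,
    k7.trans hP.V, k8.trans hP.H, k9.trans hP.k, k10.trans hP.f, k11.trans hP.inv, k12.trans hP.m⟩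

theorem Params.Holds.setReg {P : Params} {σ : State} (hP : P.Holds σ) {r v : ℕ}
    (hr : paramRegs.all (fun s => !Nat.beq r s) = true := by rfl) : P.Holds (σ.setReg r v) := by
  refine hP.of_frame (p := .const r v) ⟨fun s hs => ?_, fun _ _ => rfl⟩ hr
  have : s ≠ r := Ne.symm (Nat.ne_of_beq_eq_false hs)
  simp [this]

theorem Params.Holds.setArr {P : Params} {σ : State} (hP : P.Holds σ) {x i v : ℕ} :
    P.Holds (σ.setArr x i v) :=
  ⟨hP.n, hP.D, hP.ℓ, hP.M, hP.R, hP.g, hP.V, hP.H, hP.k, hP.f, hP.inv, hP.m⟩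

/-- Compute the parameters from `n` in register `1`. -/
def paramCode (K r h e m f : ℕ) : Program :=
  rootCode K ;; primeCode ;; assign 36 (reg 3) ;; powCode e ;; assign 4 (reg 37) ;;
    powCode (2 * h) ;; assign 7 (reg 37) ;; powCode h ;; assign 8 (reg 37) ;;
    assign 36 (reg 2) ;; powCode f ;; assign 11 (reg 37) ;; powCode m ;; assign 15 (reg 37) ;;
    powCode r ;; assign 6 (reg 1 / reg 37 + 1) ;; assign 5 ((reg 1 - 1) / reg 6 + 1) ;;
    .const 10 (2 * h) ;; assign 12 (reg 4 - (reg 4 - 1) / (reg 3 - 1))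

theorem paramCode_runs {𝔐 : Machine} {σ : State} {n K r h e m f : ℕ} (hn : σ.reg 1 = n)
    (hK : 2 ≤ K) (hn1 : 1 ≤ n) (hc : K + r + 2 * h + e + m + f + 2 ≤ 𝔐.X)
    (hX : (4 * n) ^ (K + r + 2 * h + e + m + f + 2) ≤ 𝔐.X) :
    Runs 𝔐 (paramCode K r h e m f) σ
      (n * (103 * K + 5574) + 103 * (e + 3 * h + f + m + r) + 3000)
      (fun τ => ∃ D ℓ, D ^ K ≤ n ∧ n < (D + 1) ^ K ∧ ℓ.Prime ∧ 2 * D < ℓ ∧ ℓ ≤ 4 * D ∧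
        Params.Holds ⟨n, D, ℓ, e, h, (n - 1) / (n / D ^ r + 1) + 1, n / D ^ r + 1, m, f⟩ τ) := by
  have hpow : ∀ x i, 1 ≤ x → x ≤ 4 * n → i ≤ K + r + 2 * h + e + m + f + 2 → x ^ i ≤ 𝔐.X :=
    fun x i h1 h2 hi => (Nat.pow_le_pow_left h2 i).trans
      ((Nat.pow_le_pow_right (by omega) hi).trans hX)
  have hnX : 4 * n ≤ 𝔐.X := by simpa using hpow (4 * n) 1 (by omega) le_rfl (by omega)
  refine (Runs.seq (rootCode_runs hn (by omega) (by omega) (hpow n K hn1 (by omega) (by omega)) hn1)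
    fun τ₁ hb₁ hF₁ hQ₁ => ?_).mono (t := n * (103 * K + 510) + 102 + (n * 5064 + 203 +
      (103 * (e + 3 * h + f + m + r) + 2000))) (by
        have : n * (103 * K + 5574) = n * (103 * K + 510) + n * 5064 := by ring
        omega)
  obtain ⟨hD1, hD2⟩ := hQ₁
  set D := τ₁.reg 2 with hD
  have hDpos : 1 ≤ D := by
    by_contra h
    have h0 : D = 0 := by omega
    rw [h0, zero_add, one_pow] at hD2
    omega
  -- By K ≥ 2 the prime search, quadratic in D, is linear in n.
  have hD2n : D * D ≤ n := by
    rw [← pow_two]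
    exact (Nat.pow_le_pow_right hDpos hK).trans hD1
  have hDn : D ≤ n := (Nat.le_mul_of_pos_right D hDpos).trans hD2n
  have r1 : τ₁.reg 1 = n := (hF₁.reg 1 rfl).trans hn
  refine (Runs.seq (primeCode_runs rfl hDpos (by omega)) fun τ₂ hb₂ hF₂ hQ₂ => ?_).mono
    (Nat.add_le_add_right (Nat.add_le_add_right
      (by nlinarith : 2 * D * (4 * D * 503 + 520) ≤ n * 5064) _) _)
  obtain ⟨hp, hℓ1, hℓ2⟩ := hQ₂
  have r1' : τ₂.reg 1 = n := (hF₂.reg 1 rfl).trans r1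
  have r2' : τ₂.reg 2 = D := (hF₂.reg 2 rfl)
  set ℓ := τ₂.reg 3 with hℓ
  have hℓn : ℓ ≤ 4 * n := by omega
  refine (Runs.assign_seq (by simp; omega) <|
    Runs.seq (powCode_runs (x := ℓ) (c := e) (by simp; rfl) (by omega)
      (hpow ℓ e (by omega) hℓn (by omega)) (by omega)) fun τ₃ hb₃ hF₃ hQ₃ =>
    Runs.assign_seq (by simpa using hb₃.1 37) <|
    Runs.seq (powCode_runs (x := ℓ) (c := 2 * h)
      (by have := hF₃.reg 36 rfl; simp at this; simpa using this) (by omega)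
      (hpow ℓ (2 * h) (by omega) hℓn (by omega)) (by omega)) fun τ₄ hb₄ hF₄ hQ₄ =>
    Runs.assign_seq (by simpa using hb₄.1 37) <|
    Runs.seq (powCode_runs (x := ℓ) (c := h)
      (by have := hF₃.reg 36 rfl; have h2 := hF₄.reg 36 rfl; simp at this h2; simp [this, h2]; rfl)
      (by omega) (hpow ℓ h (by omega) hℓn (by omega)) (by omega)) fun τ₅ hb₅ hF₅ hQ₅ =>
    Runs.assign_seq (by simpa using hb₅.1 37) <|
    Runs.assign_seq (by simpa using hb₅.1 2) <|
    Runs.seq (powCode_runs (x := D) (c := f)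
      (by have h3 := hF₃.reg 2 rfl; have h4 := hF₄.reg 2 rfl; have h5 := hF₅.reg 2 rfl
          simp at h3 h4 h5; simp [h3, h4, h5, r2'])
      (by omega) (hpow D f (by omega) (by omega) (by omega)) (by omega)) fun τ₆ hb₆ hF₆ hQ₆ =>
    Runs.assign_seq (by simpa using hb₆.1 37) <|
    Runs.seq (powCode_runs (x := D) (c := m)
      (by have h3 := hF₃.reg 2 rfl; have h4 := hF₄.reg 2 rfl; have h5 := hF₅.reg 2 rfl
          have h6 := hF₆.reg 36 rfl
          simp at h3 h4 h5 h6; simp [h3, h4, h5, h6, r2'])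
      (by omega) (hpow D m (by omega) (by omega) (by omega)) (by omega)) fun τ₇ hb₇ hF₇ hQ₇ =>
    Runs.assign_seq (by simpa using hb₇.1 37) <|
    Runs.seq (powCode_runs (x := D) (c := r)
      (by have h3 := hF₃.reg 2 rfl; have h4 := hF₄.reg 2 rfl; have h5 := hF₅.reg 2 rfl
          have h6 := hF₆.reg 36 rfl; have h7 := hF₇.reg 36 rfl
          simp at h3 h4 h5 h6 h7; simp [h3, h4, h5, h6, h7, r2'])
      (by omega) (hpow D r (by omega) (by omega) (by omega)) (by omega)) fun τ₈ hb₈ hF₈ hQ₈ =>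
    ?_).mono (t := 1 * 100 + (103 * e + 103 + (100 + (103 * (2 * h) + 103 + (100 + (103 * h + 103 +
      (100 + (100 + (103 * f + 103 + (100 + (103 * m + 103 + (100 + (103 * r + 103 +
        401))))))))))))) (by omega)
  have e1 : τ₈.reg 1 = n := by
    have h3 := hF₃.reg 1 rfl; have h4 := hF₄.reg 1 rfl; have h5 := hF₅.reg 1 rfl
    have h6 := hF₆.reg 1 rfl; have h7 := hF₇.reg 1 rfl; have h8 := hF₈.reg 1 rfl
    simp at h3 h4 h5 h6 h7 h8
    rw [h8, h7, h6, h5, h4, h3, r1']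
  have e2 : τ₈.reg 2 = D := by
    have h3 := hF₃.reg 2 rfl; have h4 := hF₄.reg 2 rfl; have h5 := hF₅.reg 2 rfl
    have h6 := hF₆.reg 2 rfl; have h7 := hF₇.reg 2 rfl; have h8 := hF₈.reg 2 rfl
    simp at h3 h4 h5 h6 h7 h8
    rw [h8, h7, h6, h5, h4, h3, r2']
  have e3 : τ₈.reg 3 = ℓ := by
    have h3 := hF₃.reg 3 rfl; have h4 := hF₄.reg 3 rfl; have h5 := hF₅.reg 3 rfl
    have h6 := hF₆.reg 3 rfl; have h7 := hF₇.reg 3 rfl; have h8 := hF₈.reg 3 rfl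
    simp at h3 h4 h5 h6 h7 h8
    rw [h8, h7, h6, h5, h4, h3]
  have e4 : τ₈.reg 4 = ℓ ^ e := by
    have h4 := hF₄.reg 4 rfl; have h5 := hF₅.reg 4 rfl
    have h6 := hF₆.reg 4 rfl; have h7 := hF₇.reg 4 rfl; have h8 := hF₈.reg 4 rfl
    simp at h4 h5 h6 h7 h8
    rw [h8, h7, h6, h5, h4, hQ₃]
  have e7 : τ₈.reg 7 = ℓ ^ (2 * h) := by
    have h5 := hF₅.reg 7 rfl
    have h6 := hF₆.reg 7 rfl; have h7 := hF₇.reg 7 rfl; have h8 := hF₈.reg 7 rfl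
    simp at h5 h6 h7 h8
    rw [h8, h7, h6, h5, hQ₄]
  have e8 : τ₈.reg 8 = ℓ ^ h := by
    have h6 := hF₆.reg 8 rfl; have h7 := hF₇.reg 8 rfl; have h8 := hF₈.reg 8 rfl
    simp at h6 h7 h8
    rw [h8, h7, h6, hQ₅]
  have e11 : τ₈.reg 11 = D ^ f := by
    have h7 := hF₇.reg 11 rfl; have h8 := hF₈.reg 11 rfl
    simp at h7 h8
    rw [h8, h7, hQ₆]
  have e15 : τ₈.reg 15 = D ^ m := by
    have h8 := hF₈.reg 15 rfl
    simp at h8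
    rw [h8, hQ₇]
  have hg : n / D ^ r + 1 ≤ 𝔐.X := by have := Nat.div_le_self n (D ^ r); omega
  have hR : (n - 1) / (n / D ^ r + 1) + 1 ≤ 𝔐.X := by
    have := Nat.div_le_self (n - 1) (n / D ^ r + 1); omega
  have hM : ℓ ^ e ≤ 𝔐.X := hpow ℓ e (by omega) hℓn (by omega)
  refine (Runs.assign_seq ?_ <| Runs.assign_seq ?_ <| Runs.const_seq (by omega) <|
    Runs.assign ?_ ?_).mono (by omega)
  · simpa [e1, hQ₈] using hg
  · simpa [e1, hQ₈] using hR
  · exact le_trans (by simp [e4, e3]) hM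
  · exact ⟨D, ℓ, hD1, hD2, hp, hℓ1, hℓ2, by simp [e1], by simp [e2], by simp [e3], by simp [e4],
      by simp [e1, hQ₈], by simp [e1, hQ₈], by simp [e7], by simp [e8], by simp, by simp [e11],
      by simp [e4, e3], by simp [e15]⟩

end ThreeSum

namespace ThreeSum

open Finset RAM RAM.Expr

/-! ### Sorting -/

/-- The array starts with the list. -/
def ListAt (a : ℕ → ℕ) (L : List ℕ) : Prop := ∀ i (h : i < L.length), a i = L[i]

theorem ListAt.append {a : ℕ → ℕ} {L : List ℕ} (h : ListAt a L) (v : ℕ) :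
    ListAt (Function.update a L.length v) (L ++ [v]) := by
  intro i hi
  rw [List.length_append, List.length_singleton] at hi
  rw [Function.update_apply]
  split_ifs with hv
  · subst hv; simp
  · rw [List.getElem_append_left (by omega), h i (by omega)]

/-- Stability of radix sort: inside each half the bit `b` is constant and the old order by the lower
bits persists, and between the halves the bit decides. -/
theorem pairwise_mod_pow_succ {L : List ℕ} {b : ℕ}
    (h : L.Pairwise fun x y => x % 2 ^ b ≤ y % 2 ^ b) :
    (L.filter (fun x => x / 2 ^ b % 2 < 1) ++ L.filter (fun x => 0 < x / 2 ^ b % 2)).Pairwise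
      fun x y => x % 2 ^ (b + 1) ≤ y % 2 ^ (b + 1) := by
  have hs : ∀ x : ℕ, x % 2 ^ (b + 1) = x % 2 ^ b + 2 ^ b * (x / 2 ^ b % 2) := fun x => by
    rw [pow_succ, Nat.mod_mul]
  have hlt : ∀ x : ℕ, x % 2 ^ b < 2 ^ b := fun x => Nat.mod_lt _ (by positivity)
  rw [List.pairwise_append]
  refine ⟨?_, ?_, ?_⟩
  · refine (List.pairwise_filter.mpr (h.imp fun hxy hx hy => ?_))
    simp only [decide_eq_true_eq, Nat.lt_one_iff] at hx hy
    rw [hs, hs, hx, hy]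
    omega
  · refine (List.pairwise_filter.mpr (h.imp fun {x y} hxy hx hy => ?_))
    simp only [decide_eq_true_eq] at hx hy
    have h1 : x / 2 ^ b % 2 = 1 := by omega
    have h2 : y / 2 ^ b % 2 = 1 := by omega
    rw [hs, hs, h1, h2]
    omega
  · intro x hx y hy
    simp only [List.mem_filter, decide_eq_true_eq, Nat.lt_one_iff] at hx hy
    have h2 : y / 2 ^ b % 2 = 1 := by omega
    rw [hs, hs, hx.2, h2]
    have := hlt x
    omega

/-- One pass of radix sort: a stable partition of array `1` by the bit that register `21` holds. -/
def passCode : Program :=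
  assign 26 0 ;;
  forLoop 27 1 (assign 28 (ld 1 (reg 27)) ;; ite (reg 28 / reg 21 % 2) 1
    (write 2 (reg 26) (reg 28) ;; assign 26 (reg 26 + 1)) .skip) ;;
  forLoop 27 1 (assign 28 (ld 1 (reg 27)) ;; ite 0 (reg 28 / reg 21 % 2)
    (write 2 (reg 26) (reg 28) ;; assign 26 (reg 26 + 1)) .skip) ;;
  forLoop 27 1 (write 1 (reg 27) (ld 2 (reg 27)))

theorem passCode_runs {𝔐 : Machine} {σ : State} {L : List ℕ} {pw : ℕ} (hn : σ.reg 1 = L.length)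
    (hpw : σ.reg 21 = pw) (hL : ListAt (σ.arr 1) L) (hX : L.length ≤ 𝔐.X)
    (hlen : (L.filter (fun x => x / pw % 2 < 1) ++
      L.filter (fun x => 0 < x / pw % 2)).length = L.length) :
    Runs 𝔐 passCode σ (L.length * 1500 + 106) (fun τ => ListAt (τ.arr 1)
      (L.filter (fun x => x / pw % 2 < 1) ++ L.filter (fun x => 0 < x / pw % 2))) := by
  have htake : ∀ j (hj : j < L.length), L.take (j + 1) = L.take j ++ [L[j]] := fun j hj => by
    rw [List.take_succ_eq_append_getElem hj]
  have hlen' : (L.filter (fun x => x / pw % 2 < 1)).length +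
      (L.filter (fun x => 0 < x / pw % 2)).length = L.length := by simpa using hlen
  have hle1 : ∀ j, ((L.take j).filter (fun x => x / pw % 2 < 1)).length ≤ L.length := fun j =>
    (List.length_filter_le _ _).trans (by simp)
  have hle2 : ∀ j, ((L.take j).filter (fun x => 0 < x / pw % 2)).length ≤
      (L.filter (fun x => 0 < x / pw % 2)).length := fun j =>
    ((List.take_sublist j L).filter _).length_le
  refine (Runs.assign_seq (by simp) <| Runs.seq (Runs.forLoop (c := 600) (B := L.length)
    (fun j τ => τ.reg 26 = ((L.take j).filter (fun x => x / pw % 2 < 1)).length ∧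
      ListAt (τ.arr 2) ((L.take j).filter (fun x => x / pw % 2 < 1)))
    (by simp [hn]) ?_ ?_ (fun τ _ _ _ h => h)) fun τ₁ hb₁ hF₁ hQ₁ =>
    Runs.seq (Runs.forLoop (c := 600) (B := L.length)
    (fun j τ => τ.reg 26 = (L.filter (fun x => x / pw % 2 < 1) ++
        (L.take j).filter (fun x => 0 < x / pw % 2)).length ∧
      ListAt (τ.arr 2) (L.filter (fun x => x / pw % 2 < 1) ++
        (L.take j).filter (fun x => 0 < x / pw % 2)))
    ?_ ?_ ?_ (fun τ _ _ _ h => h)) fun τ₂ hb₂ hF₂ hQ₂ =>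
    Runs.forLoop (c := 200) (B := L.length) (fun j τ => ListAt (τ.arr 1)
      ((L.filter (fun x => x / pw % 2 < 1) ++ L.filter (fun x => 0 < x / pw % 2)).take j))
    ?_ ?_ ?_ ?_).mono ?_
  · simp
    intro i hi
    simp at hi
  · intro j hj τ hb hF hτ ⟨hI1, hI2⟩
    have e21 : τ.reg 21 = pw := by simpa [hpw] using hF.reg 21 rfl
    have e1 : τ.arr 1 j = L[j] := by
      rw [hF.arr 1 rfl]; exact hL j hj
    have hXj : L[j] ≤ 𝔐.X := e1 ▸ hb.2 1 j
    have hle := hle1 (j + 1)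
    rw [htake j hj, List.filter_append, List.length_append] at hle ⊢
    refine (Runs.assign_seq (by simpa [hτ, e1] using hXj) <|
      Runs.ite (t := 300) (t' := 1) (fun hlt => Runs.write_seq ?_ <| Runs.assign ?_ ?_)
        (fun hlt => Runs.skip ?_)).mono (by norm_num)
    · simpa [hτ, e1] using hXj
    · simp [hτ, e1, e21, hI1] at hlt hle ⊢
      simp [hlt] at hle
      omega
    · simp [hτ, e1, e21] at hlt
      simp [hτ, e1, hI1, hlt]
      simpa using hI2.append L[j]
    · simp [hτ, e1, e21] at hlt
      have hlt' : L[j] / pw % 2 = 1 := by omega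
      simp [hI1, hlt']
      simpa using hI2
  · have := hF₁.reg 1 rfl
    simpa [hn] using this
  · simpa [List.take_length] using hQ₁
  · intro j hj τ hb hF hτ ⟨hI1, hI2⟩
    have e21 : τ.reg 21 = pw := by
      have h1 := hF.reg 21 rfl
      have h2 := hF₁.reg 21 rfl
      simp at h1 h2
      rw [h1, h2, hpw]
    have e1 : τ.arr 1 j = L[j] := by
      rw [hF.arr 1 rfl, hF₁.arr 1 rfl]; exact hL j hj
    have hXj : L[j] ≤ 𝔐.X := e1 ▸ hb.2 1 j
    have hle := hle2 (j + 1)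
    rw [htake j hj, List.filter_append, List.length_append] at hle
    rw [htake j hj, List.filter_append, ← List.append_assoc]
    refine (Runs.assign_seq (by simpa [hτ, e1] using hXj) <|
      Runs.ite (t := 300) (t' := 1) (fun hlt => Runs.write_seq ?_ <| Runs.assign ?_ ?_)
        (fun hlt => Runs.skip ?_)).mono (by norm_num)
    · simpa [hτ, e1] using hXj
    · simp [hτ, e1, e21] at hlt
      simp [hlt] at hle hlen'
      simp [hI1]
      omega
    · simp [hτ, e1, e21] at hlt
      simp [hτ, e1, hI1, hlt]
      have := hI2.append L[j]
      exact ⟨by omega, by simpa using this⟩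
    · simp [hτ, e1, e21] at hlt
      simp [hI1, hlt]
      simpa using hI2
  · have h1 := hF₁.reg 1 rfl
    have h2 := hF₂.reg 1 rfl
    simp at h1
    rw [h2, h1, hn]
  · simp
    intro i hi
    simp at hi
  · intro j hj τ hb hF hτ hI
    rw [← hlen] at hj
    have e2 : τ.arr 2 j = (L.filter (fun x => x / pw % 2 < 1) ++
        L.filter (fun x => 0 < x / pw % 2))[j] := by
      rw [hF.arr 2 rfl]
      have := hQ₂.2
      rw [List.take_length] at this
      exact this j hj
    refine Runs.write (by simpa using hb.2 2 _) ?_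
    rw [List.take_succ_eq_append_getElem hj]
    simp only [State.setReg_arr, State.setArr_arr, if_true, eval_reg, eval_ld, hτ, e2]
    have := hI.append (L.filter (fun x => x / pw % 2 < 1) ++
        L.filter (fun x => 0 < x / pw % 2))[j]
    rwa [List.length_take, min_eq_left hj.le] at this
  · intro τ hb hF hτ hI
    rwa [List.take_of_length_le (by omega)] at hI
  · omega

/-- Sort array `1`, whose length is in register `1` and whose entries are at most the `c`-th power
of the length. -/
def sortCode (c : ℕ) : Program :=
  .const 20 c ;; assign 21 1 ;; assign 22 0 ;;
  forLoop 23 1 (ite (reg 1) (reg 21) .skip (assign 21 (reg 21 * 2) ;; assign 22 (reg 22 + 1))) ;;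
  assign 24 (reg 22 * reg 20) ;; assign 21 1 ;;
  forLoop 25 24 (passCode ;; assign 21 (reg 21 * 2))

/-- With n < 2^b the entries, at most n^c, have at most bc bits, so bc linear passes suffice. -/
theorem sortCode_runs {𝔐 : Machine} {σ : State} {A : List ℕ} {c : ℕ} (hn : σ.reg 1 = A.length)
    (hn1 : 1 ≤ A.length) (hL : ListAt (σ.arr 1) A) (hA : ∀ a ∈ A, a ≤ A.length ^ c)
    (hc : 1 ≤ c) (hcX : c ≤ 𝔐.X) (hX : (2 * A.length) ^ (c + 2) ≤ 𝔐.X) :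
    Runs 𝔐 (sortCode c) σ (A.length * 405 +
        (Nat.log 2 A.length + 1) * c * (A.length * 1500 + 209) + 507)
      (fun τ => ∃ L : List ℕ, L.Perm A ∧ L.Pairwise (· ≤ ·) ∧ ListAt (τ.arr 1) L) := by
  set n := A.length with hndef
  have hX2 := 𝔐.two_le
  have hpowX : ∀ i ≤ c + 2, (2 * n) ^ i ≤ 𝔐.X := fun i hi =>
    (Nat.pow_le_pow_right (by omega) hi).trans hX
  have h2n : 2 * n ≤ 𝔐.X := by simpa using hpowX 1 (by omega)
  refine (Runs.const_seq hcX <| Runs.assign_seq (by simp; omega) <| Runs.assign_seq (by simp) <|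
    Runs.seq (Runs.forLoop (c := 400) (B := n)
      (fun j τ => τ.reg 21 = 2 ^ τ.reg 22 ∧ (τ.reg 21 ≤ n → τ.reg 22 = j) ∧ τ.reg 21 ≤ 2 * n)
      (by simp [hn]) ?_ ?_ (fun τ _ _ _ h => h)) fun τ₁ hb₁ hF₁ hQ₁ => ?_).mono
      (t := 1 + (100 + (100 + (n * 403 + 2 +
        (200 + (Nat.log 2 n + 1) * c * (n * 1500 + 209) + 2))))) ?_
  · simp; omega
  · intro j hj τ hb hF hτ ⟨hI1, hI2, hI3⟩
    have e1 : τ.reg 1 = n := by simpa [hn] using hF.reg 1 rfl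
    refine (Runs.ite (t := 1) (t' := 200) (fun hlt => Runs.skip ?_)
      (fun hlt => Runs.assign_seq ?_ <| Runs.assign ?_ ?_)).mono (by norm_num)
    · simp [e1] at hlt
      simp
      exact ⟨hI1, fun h => by omega, hI3⟩
    · simp [e1] at hlt ⊢
      omega
    · simp [e1] at hlt ⊢
      have := hI2 hlt
      omega
    · simp [e1] at hlt
      simp [hI1, pow_succ]
      have := hI2 hlt
      rw [hI1] at hlt
      omega
  · obtain ⟨h1, h2, h3⟩ := hQ₁
    set b := τ₁.reg 22 with hb
    have e1 : τ₁.reg 1 = n := by have := hF₁.reg 1 rfl; simpa [hn] using this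
    have e20 : τ₁.reg 20 = c := by have := hF₁.reg 20 rfl; simpa using this
    -- If the doubling had never passed n, all n rounds would have doubled, against n < 2^n.
    have hbn : n < 2 ^ b := by
      by_contra h
      have h4 := h2 (by omega)
      have := Nat.lt_two_pow_self (n := n)
      rw [h4] at h
      exact h this
    rw [h1] at h3
    have hblog : b ≤ Nat.log 2 n + 1 := by
      have h4 : 2 ^ b ≤ 2 ^ (Nat.log 2 n + 2) := by
        refine h3.trans ?_
        have := Nat.lt_pow_succ_log_self (b := 2) (by norm_num) n
        rw [pow_succ _ (_ + 1)]
        omega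
      by_contra h
      have h5 : 2 * 2 ^ (b - 1) ≤ 2 * n := by
        rw [← pow_succ']
        rwa [Nat.sub_add_cancel (by omega)]
      have h6 := Nat.lt_pow_succ_log_self (b := 2) (by norm_num) n
      have h7 : 2 ^ (Nat.log 2 n + 1) ≤ 2 ^ (b - 1) :=
        Nat.pow_le_pow_right (by norm_num) (by omega)
      rw [Nat.succ_eq_add_one] at h6
      omega
    have hpw : ∀ j ≤ b * c, 2 ^ j ≤ 𝔐.X := fun j hj =>
      (Nat.pow_le_pow_right (by norm_num) hj).trans (by
        rw [pow_mul]
        exact (Nat.pow_le_pow_left h3 c).trans (hpowX c (by omega)))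
    have hpw' : 2 ^ (b * c) * 2 ≤ 𝔐.X := by
      refine le_trans ?_ (hpowX (c + 1) (by omega))
      rw [pow_succ, pow_mul]
      exact Nat.mul_le_mul (Nat.pow_le_pow_left h3 c) (by omega)
    have hbcX : b * c ≤ 𝔐.X := (Nat.lt_two_pow_self).le.trans (hpw _ le_rfl)
    refine (Runs.assign_seq (by simpa [e20] using hbcX) <| Runs.assign_seq (by simp; omega) <|
      Runs.forLoop (c := n * 1500 + 206) (B := b * c) (fun j τ => τ.reg 21 = 2 ^ j ∧
        ∃ L : List ℕ, L.Perm A ∧ L.Pairwise (fun x y => x % 2 ^ j ≤ y % 2 ^ j) ∧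
          ListAt (τ.arr 1) L) (by simp [e20, ← hb]) ?_ ?_ ?_).mono ?_
    · refine ⟨by simp, A, List.Perm.refl _, ?_, ?_⟩
      · simp only [pow_zero, Nat.mod_one, le_refl]
        exact List.pairwise_of_forall fun _ _ => trivial
      · have := hF₁.arr 1 rfl
        simp at this
        simpa [this] using hL
    · intro j hj τ hb hF hτ ⟨hI1, L, hI2, hI3, hI4⟩
      have e1' : τ.reg 1 = L.length := by
        have := hF.reg 1 rfl
        simpa [e1, hI2.length_eq] using this
      have hperm : (L.filter (fun x => x / 2 ^ j % 2 < 1) ++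
          L.filter (fun x => 0 < x / 2 ^ j % 2)).Perm L := by
        have h1 := List.filter_append_perm (fun x => decide (x / 2 ^ j % 2 < 1)) L
        have h2 : (fun x : ℕ => !decide (x / 2 ^ j % 2 < 1)) = fun x => decide (0 < x / 2 ^ j % 2) := by
          funext x
          by_cases h : x / 2 ^ j % 2 < 1
          · simp [h]; omega
          · simp [h]; omega
        rwa [h2] at h1
      have hlen : L.length = n := hI2.length_eq
      refine (Runs.seq (passCode_runs (L := L) (pw := 2 ^ j) e1' hI1 hI4
        (by rw [hI2.length_eq]; omega)
        hperm.length_eq) fun υ hb' hF' hυ => Runs.assign ?_ ?_).mono (by rw [hlen])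
      · have := hF'.reg 21 rfl
        simp [this, hI1]
        exact le_trans (Nat.mul_le_mul_right _ (Nat.pow_le_pow_right (by norm_num) hj.le)) hpw'
      · have := hF'.reg 21 rfl
        simp only [State.setReg_reg, State.setReg_arr]
        simp only [eval_mul, eval_reg, eval_ofNat, this, hI1]
        exact ⟨by simp [pow_succ], _, hperm.trans hI2, pairwise_mod_pow_succ hI3, hυ⟩
    · rintro τ hb hF hτ ⟨hI1, L, hI2, hI3, hI4⟩
      refine ⟨L, hI2, hI3.imp_of_mem fun {x y} hx hy hxy => ?_, hI4⟩
      have hlt : ∀ x ∈ L, x < 2 ^ (b * c) := fun x hx => by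
        have h4 := hA x (hI2.mem_iff.mp hx)
        exact h4.trans_lt (by rw [pow_mul]; exact Nat.pow_lt_pow_left hbn (by omega))
      rwa [Nat.mod_eq_of_lt (hlt x hx), Nat.mod_eq_of_lt (hlt y hy)] at hxy
    · have : b * c * (n * 1500 + 206 + 3) ≤ (Nat.log 2 n + 1) * c * (n * 1500 + 209) :=
        Nat.mul_le_mul (Nat.mul_le_mul_right _ hblog) le_rfl
      omega
  · omega

end ThreeSum

namespace ThreeSum

open Finset RAM RAM.Expr

/-! ### Listing the tasks -/

/-- The task to find the sum of the entries `x` and `y` is on the list for `z`. -/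
def Recorded (g N : ℕ) (a : ℕ → ℕ → ℕ) (z x y : ℕ) : Prop :=
  ∃ m < N, a 4 m = z ∧ a 5 m = x / g ∧ a 6 m = y / g

/-- The list of tasks is in range and its tasks are listed in order of `z`. -/
structure Listed (n R g : ℕ) (L : ℕ → ℕ) (N : ℕ) (a : ℕ → ℕ → ℕ) (z : ℕ) : Prop where
  range : ∀ m < N, a 4 m < n ∧ a 5 m < R ∧ a 6 m < R
  recorded : ∀ z' < z, ∀ x < n, ∀ y < n, L x + L y = L z' → Recorded g N a z' x y

/-- Put the pairs of blocks that may contain solutions for `z` on the list of tasks, for all `z`. -/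
def walkCode : Program :=
  write 1 (reg 5 * reg 6) (ld 1 (reg 1 - 1) + 1) ;; assign 9 0 ;; assign 20 (2 * reg 5) ;;
  forLoop 21 1 (assign 22 0 ;; assign 23 (reg 5) ;; forLoop 24 20 (ite 0 (reg 23)
    (write 4 (reg 9) (reg 21) ;; write 5 (reg 9) (reg 22) ;; write 6 (reg 9) (reg 23 - 1) ;;
      assign 9 (reg 9 + 1) ;;
      ite (ld 1 (reg 21)) (ld 1 ((reg 22 + 1) * reg 6) + ld 1 ((reg 23 - 1) * reg 6))
        (assign 23 (reg 23 - 1)) (assign 22 (reg 22 + 1)))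
    .skip))

/-- For each target two pointers run through the blocks in opposite directions. Every comparison of
the target with the first entries of two blocks discards the rest of a row or of a column, so at
most 2R pairs of blocks are listed per target. -/
theorem walkCode_runs {𝔐 : Machine} {σ : State} {P : Params} {L : ℕ → ℕ} (hP : P.Holds σ)
    (hL : σ.arr 1 = L) (hmono : ∀ i j, i < j → j < P.n → L i < L j) (hn : 1 ≤ P.n)
    (hg : 0 < P.g) (hR1 : (P.R - 1) * P.g < P.n) (hR : P.n ≤ P.R * P.g) (hR0 : 1 ≤ P.R)
    (hLX : L (P.n - 1) + 1 ≤ 𝔐.X) (hX : 2 * P.R * P.n ≤ 𝔐.X) :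
    Runs 𝔐 walkCode σ (P.n * P.R * 4000 + 1000) (fun τ =>
      τ.arr 1 = Function.update L (P.R * P.g) (L (P.n - 1) + 1) ∧ τ.reg 9 ≤ 2 * P.R * P.n ∧
      Listed P.n P.R P.g L (τ.reg 9) τ.arr P.n) := by
  set n := P.n with hnd
  set R := P.R with hRd
  set g := P.g with hgd
  set L' := Function.update L (R * g) (L (n - 1) + 1) with hL'
  have hX2 := 𝔐.two_le
  have hlt : ∀ i < n, L' i = L i := fun i hi => by
    rw [hL', Function.update_of_ne (by omega)]
  -- A sentinel above all entries acts as the first entry of a block number R. Its index R g is at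
  -- least n, so no entry is overwritten.
  have hsent : ∀ i < n, L i < L' (R * g) := fun i hi => by
    rw [hL', Function.update_self]
    rcases Nat.lt_or_ge i (n - 1) with h | h
    · have := hmono i (n - 1) h (by omega); omega
    · have : i = n - 1 := by omega
      rw [this]; omega
  have hfirst_gt : ∀ i x, i < R → x < n → x < (i + 1) * g → L x < L' ((i + 1) * g) := by
    intro i x hi hx hxi
    rcases Nat.lt_or_ge ((i + 1) * g) n with h | h
    · rw [hlt _ h]; exact hmono _ _ hxi h
    · have h1 : i + 1 = R := by
        by_contra h2
        have : (i + 1) * g ≤ (R - 1) * g := Nat.mul_le_mul_right _ (by omega)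
        omega
      rw [h1]; exact hsent x hx
  have hfirst_le : ∀ i x, x < n → i * g ≤ x → L' (i * g) ≤ L x := by
    intro i x hx hxi
    rw [hlt _ (by omega)]
    rcases Nat.lt_or_eq_of_le hxi with h | h
    · exact (hmono _ _ h hx).le
    · rw [h]
  have hRX : 2 * R ≤ 𝔐.X := (Nat.le_mul_of_pos_right _ hn).trans hX
  refine (Runs.write_seq ?_ <| Runs.assign_seq (by simp) <| Runs.assign_seq ?_ <|
    Runs.forLoop (B := n) (c := 2 * R * 1403 + 202) (fun z τ => τ.reg 9 ≤ 2 * R * z ∧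
      Listed n R g L (τ.reg 9) τ.arr z) ?_ ?_ ?_ ?_).mono ?_
  · simpa [hP.n, hL] using hLX
  · simpa [hP.R] using hRX
  · simp [hP.n, ← hnd]
  · simp
    exact ⟨by simp, by simp⟩
  · intro z hz τ hb hF hτ ⟨hI1, hI2⟩
    have hA1 : τ.arr 1 = L' := by
      rw [hF.arr 1 rfl]; simp [hP.R, hP.g, hP.n, hL, hL', hRd, hgd, hnd]
    have hPτ : P.Holds τ := by
      refine Params.Holds.of_frame ?_ hF
      exact ((hP.setArr).setReg).setReg
    have e20 : τ.reg 20 = 2 * R := by simpa [hP.R] using hF.reg 20 rfl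
    -- Invariant of the walk: a solution whose pair of blocks is not yet listed has its x-block at
    -- or after register 22 and its y-block strictly before register 23. While register 23 is
    -- positive, the distance walked equals the number of iterations.
    refine (Runs.assign_seq (by simp) <| Runs.assign_seq (by simpa using hb.1 5) <|
      Runs.forLoop (B := 2 * R) (c := 1400) (fun s υ => υ.reg 9 ≤ 2 * R * z + s ∧
        Listed n R g L (υ.reg 9) υ.arr z ∧ υ.reg 22 < R ∧ υ.reg 23 ≤ R ∧
        (υ.reg 23 = 0 ∨ υ.reg 22 + (R - υ.reg 23) = s) ∧
        ∀ x < n, ∀ y < n, L x + L y = L z → Recorded g (υ.reg 9) υ.arr z x y ∨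
          (υ.reg 22 ≤ x / g ∧ y / g < υ.reg 23)) (by simp [e20]) ?_ ?_ ?_).mono ?_
    · simp [hPτ.R]
      refine ⟨hI1, hI2, hR0, le_rfl, Or.inr (Nat.sub_self _), fun x hx y hy _ => Or.inr ?_⟩
      rw [Nat.div_lt_iff_lt_mul hg]
      exact hy.trans_le hR
    · intro s hs υ hb' hF' hυ ⟨hJ1, hJ2, hJ3, hJ4, hJ5, hJ6⟩
      have hPυ : P.Holds υ := (hPτ.setReg.setReg).of_frame hF'
      have e21 : υ.reg 21 = z := by simpa [hτ] using hF'.reg 21 rfl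
      have hB1 : υ.arr 1 = L' := by rw [hF'.arr 1 rfl]; simpa using hA1
      have hstep : 2 * R * z + 2 * R ≤ 2 * R * n := by
        rw [← Nat.mul_succ]; exact Nat.mul_le_mul_left _ hz
      refine (Runs.ite (t := 1199) (t' := 1) (fun hpos => ?_) (fun hpos => Runs.skip ?_)).mono
        (by norm_num)
      · simp at hpos
        set i := υ.reg 22 with hi
        set j := υ.reg 23 with hj
        set N := υ.reg 9 with hN
        have hs5 : i + (R - j) = s := by omega
        set a' : ℕ → ℕ → ℕ := (((υ.setArr 4 N z).setArr 5 N i).setArr 6 N (j - 1)).arr with ha'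
        have hmon : ∀ z' x y, Recorded g N υ.arr z' x y → Recorded g (N + 1) a' z' x y := by
          rintro z' x y ⟨m, hm, h1, h2, h3⟩
          refine ⟨m, by omega, ?_⟩
          have : m ≠ N := by omega
          simp [ha', this, h1, h2, h3]
        have hnew : ∀ x y, x / g = i → y / g = j - 1 → Recorded g (N + 1) a' z x y := by
          intro x y hx hy
          exact ⟨N, by omega, by simp [ha', hx, hy]⟩
        have hlist : Listed n R g L (N + 1) a' z := by
          refine ⟨fun m hm => ?_, fun z' hz' x hx y hy h => hmon _ _ _ (hJ2.recorded z' hz' x hx y hy h)⟩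
          by_cases hmN : m = N
          · simp [ha', hmN, hz, hJ3]; omega
          · have := hJ2.range m (by omega)
            simpa [ha', hmN] using this
        have hrec : ∀ x < n, ∀ y < n, L x + L y = L z → Recorded g (N + 1) a' z x y ∨
            (i ≤ x / g ∧ y / g < j ∧ ¬ (x / g = i ∧ y / g = j - 1)) := by
          intro x hx y hy h
          rcases hJ6 x hx y hy h with h1 | ⟨h1, h2⟩
          · exact Or.inl (hmon _ _ _ h1)
          · by_cases h3 : x / g = i ∧ y / g = j - 1
            · exact Or.inl (hnew x y h3.1 h3.2)
            · exact Or.inr ⟨h1, h2, h3⟩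
        refine (Runs.write_seq ?_ <| Runs.write_seq ?_ <| Runs.write_seq ?_ <|
          Runs.assign_seq ?_ <| Runs.ite (t := 100) (t' := 100) (fun hlt' => Runs.assign ?_ ?_)
            (fun hlt' => Runs.assign ?_ ?_)).mono (by norm_num)
        · simpa using hb'.1 21
        · simpa using hb'.1 22
        · simp; omega
        · simp; omega
        · simp; omega
        · simp [hB1, e21, hPυ.g] at hlt'
          simp [e21]
          refine ⟨by omega, hlist, hJ3, by omega, by omega, fun x hx y hy h => ?_⟩
          rcases hrec x hx y hy h with h1 | ⟨h1, h2, h3⟩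
          · exact Or.inl h1
          · refine Or.inr ⟨h1, ?_⟩
            -- The pair with x-block i has just been listed. If x lies in a later block and y in
            -- block j - 1, the first entries of blocks i + 1 and j - 1 already exceed the target
            -- together.
            by_contra h4
            have h5 : y / g = j - 1 := by omega
            have h6 : i + 1 ≤ x / g := by omega
            have k1 := hfirst_le (i + 1) x hx ((Nat.le_div_iff_mul_le hg).mp h6)
            have k2 := hfirst_le (j - 1) y hy ((Nat.le_div_iff_mul_le hg).mp h5.ge)
            rw [hlt z hz] at hlt'
            simp only [← hgd, ← hi, ← hj] at hlt'
            omega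
        · simp
          omega
        · simp [hB1, e21, hPυ.g] at hlt'
          simp [e21]
          rw [hlt z hz] at hlt'
          -- In the last block the sentinel forces the other branch, so i never reaches R.
          have hiR : i + 1 < R := by
            by_contra h
            have h1 : i + 1 = R := by omega
            have h2 := hsent z hz
            simp only [← hgd, ← hi, ← hj, h1] at hlt'
            omega
          refine ⟨by omega, hlist, hiR, by omega, by omega, fun x hx y hy h => ?_⟩
          rcases hrec x hx y hy h with h1 | ⟨h1, h2, h3⟩
          · exact Or.inl h1
          · refine Or.inr ⟨?_, h2⟩
            -- Here x is below the first entry of block i + 1 and y, in a block before j - 1, is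
            -- below the first entry of block j - 1, so their sum misses the target.
            by_contra h4
            have h5 : x / g = i := by omega
            have h6 : j - 1 ≠ y / g := by omega
            have h7 : y / g < j - 1 := by omega
            have k1 := hfirst_gt i x hJ3 hx ((Nat.div_lt_iff_lt_mul hg).mp (by omega))
            have k2 := hfirst_gt (y / g) y (by omega) hy ((Nat.div_lt_iff_lt_mul hg).mp (by omega))
            have k3 : L' ((y / g + 1) * g) ≤ L' ((j - 1) * g) := by
              have h8 : (j - 1) * g < n := by
                have : (j - 1) * g ≤ (R - 1) * g := Nat.mul_le_mul_right _ (by omega)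
                omega
              rw [hlt _ h8]
              exact hfirst_le _ _ h8 (Nat.mul_le_mul_right _ (by omega))
            simp only [← hgd, ← hi, ← hj] at hlt'
            omega
      · simp at hpos
        simp [hpos]
        refine ⟨by omega, hJ2, hJ3, fun x hx y hy h => ?_⟩
        rcases hJ6 x hx y hy h with h1 | ⟨h1, h2⟩
        · exact h1
        · exact absurd (hpos ▸ h2) (Nat.not_lt_zero _)
    · intro υ hb' hF' hυ ⟨hJ1, hJ2, hJ3, hJ4, hJ5, hJ6⟩
      -- Otherwise the distance walked would be 2R, but i < R and j ≤ R.
      have hj0 : υ.reg 23 = 0 := by omega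
      simp
      refine ⟨by rw [Nat.mul_succ]; exact hJ1, hJ2.range, fun z' hz' x hx y hy h => ?_⟩
      rcases Nat.lt_succ_iff_lt_or_eq.mp hz' with h1 | rfl
      · exact hJ2.recorded z' h1 x hx y hy h
      · rcases hJ6 x hx y hy h with h2 | ⟨_, h2⟩
        · exact h2
        · exact absurd (hj0 ▸ h2) (Nat.not_lt_zero _)
    · omega
  · intro τ hb hF hτ ⟨hI1, hI2⟩
    have hA1 : τ.arr 1 = L' := by
      rw [hF.arr 1 rfl]; simp [hP.R, hP.g, hP.n, hL, hL', hRd, hgd, hnd]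
    exact ⟨hA1, hI1, hI2⟩
  · have h1 : n * (2 * R * 1403 + 202 + 3) = n * R * 2806 + n * 205 := by ring
    have h2 : n * R * 4000 = n * R * 2806 + n * R * 1194 := by ring
    have h3 : n * 1 ≤ n * R := Nat.mul_le_mul_left _ hR0
    omega

end ThreeSum

/-! ### Arrays written by compiled code -/

namespace RAM

theorem _root_.Nat.beq_eq_false_of_ne {a b : ℕ} (h : a ≠ b) : Nat.beq a b = false := by
  cases hb : Nat.beq a b
  · rfl
  · exact absurd (Nat.eq_of_beq_eq_true hb) h

@[simp] theorem Program.wa_seq (p q : Program) (y : ℕ) :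
    (p ;; q).wa y = (p.wa y || q.wa y) := rfl

theorem Expr.code_wa (e : Expr) (d y : ℕ) : (e.code d).1.wa y = false := by
  induction e generalizing d with
  | reg r => rfl
  | lit v => rfl
  | bin o a b iha ihb => simp [Expr.code, iha, ihb, Program.wa]
  | ld x a iha => simp [Expr.code, iha, Program.wa]

@[simp] theorem assign_wa (r : ℕ) (e : Expr) (y : ℕ) : (assign r e).wa y = false := by
  simp [assign, Expr.code_wa, Program.wa]

@[simp] theorem write_wa (x : ℕ) (i e : Expr) (y : ℕ) : (write x i e).wa y = Nat.beq x y := by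
  simp [write, Expr.code_wa, Program.wa]

@[simp] theorem forLoop_wa (i b : ℕ) (p : Program) (y : ℕ) : (forLoop i b p).wa y = p.wa y := by
  simp [forLoop, Program.wa]

end RAM

namespace ThreeSum

open Finset RAM RAM.Expr

/-! ### Tables of roots of unity -/

/-- Tabulate the powers of the roots of unity in array `8` and the matrix of the transform in
array `9`. -/
def tableCode (e : ℕ) : Program :=
  .const 20 (e - 1) ;; assign 21 (2 * reg 3) ;;
  forLoop 22 3 (assign 23 (reg 22) ;;
    forLoop 24 20 (assign 25 1 ;; forLoop 26 3 (assign 25 (reg 25 * reg 23 % reg 4)) ;;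
      assign 23 (reg 25)) ;;
    assign 25 1 ;;
    forLoop 26 21 (write 8 (reg 22 * reg 21 + reg 26) (reg 25) ;;
      assign 25 (reg 25 * reg 23 % reg 4))) ;;
  assign 20 (reg 10 * reg 3 * reg 3) ;;
  forLoop 22 20 (write 9 (reg 22)
    (ld 8 (reg 22 / reg 3 % reg 3 * reg 21 + reg 22 % reg 3)))

/-- Array `8` holds the powers of the roots of unity. -/
def PowersAt (ℓ e : ℕ) (a : ℕ → ℕ) : Prop :=
  ∀ y < ℓ, ∀ x < 2 * ℓ, (a (y * (2 * ℓ) + x) : ZMod (ℓ ^ e)) = root ℓ e y ^ x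

/-- The array holds the matrices `E 0, …, E (k - 1)`. -/
def MatAt (ℓ e k : ℕ) (E : ℕ → ℕ → ℕ → ZMod (ℓ ^ e)) (a : ℕ → ℕ) : Prop :=
  ∀ t < k, ∀ y < ℓ, ∀ x < ℓ, (a ((t * ℓ + y) * ℓ + x) : ZMod (ℓ ^ e)) = E t y x

theorem MatAt.of_flat {ℓ e k : ℕ} {E : ℕ → ℕ → ℕ → ZMod (ℓ ^ e)} {a : ℕ → ℕ}
    (h : ∀ idx < k * ℓ * ℓ, (a idx : ZMod (ℓ ^ e)) =
      E (idx / (ℓ * ℓ)) (idx / ℓ % ℓ) (idx % ℓ)) : MatAt ℓ e k E a := by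
  intro t ht y hy x hx
  have hℓ : 0 < ℓ := by omega
  have h1 : ((t * ℓ + y) * ℓ + x) / ℓ = t * ℓ + y := by
    rw [mul_comm, Nat.mul_add_div hℓ, Nat.div_eq_of_lt hx, add_zero]
  have h2 : ((t * ℓ + y) * ℓ + x) % ℓ = x := by
    rw [mul_comm, Nat.mul_add_mod, Nat.mod_eq_of_lt hx]
  rw [h, ← Nat.div_div_eq_div_mul, h1, h2]
  · congr 1
    · rw [mul_comm, Nat.mul_add_div hℓ, Nat.div_eq_of_lt hy, add_zero]
    · rw [mul_comm, Nat.mul_add_mod, Nat.mod_eq_of_lt hy]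
  · have e1 : t * ℓ + y + 1 ≤ k * ℓ := by nlinarith
    nlinarith

/-- The root of y arises from y by taking an ℓ-th power modulo ℓ^e, e - 1 times over. Exponents
below 2ℓ are tabulated, rather than below ℓ, because `dualEntry` uses exponents up to 2 (ℓ - 1). -/
theorem tableCode_runs {𝔐 : Machine} {σ : State} {P : Params} (hP : P.Holds σ) (hℓ : P.ℓ.Prime)
    (he : 1 ≤ P.e) (heX : P.e ≤ 𝔐.X) (hMX : P.ℓ ^ P.e ≤ 𝔐.X)
    (hX : 2 * P.h * P.ℓ * P.ℓ ≤ 𝔐.X) (hX' : 2 * P.ℓ ≤ 𝔐.X) :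
    Runs 𝔐 (tableCode P.e) σ
      (P.ℓ * (P.e * (P.ℓ * 103 + 300) + P.ℓ * 606 + 1000) + 2 * P.h * P.ℓ * P.ℓ * 203 + 1000)
      (fun τ => PowersAt P.ℓ P.e (τ.arr 8) ∧
        MatAt P.ℓ P.e (2 * P.h) (fun _ y x => root P.ℓ P.e y ^ x) (τ.arr 9)) := by
  set ℓ := P.ℓ with hℓd
  set e := P.e with hed
  have hX2 := 𝔐.two_le
  have hM : 0 < ℓ ^ e := pow_pos hℓ.pos e
  refine (Runs.const_seq (by omega) <| Runs.assign_seq (by simpa [hP.ℓ] using hX') <|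
    Runs.seq (Runs.forLoop (B := ℓ) (c := e * (ℓ * 103 + 300) + ℓ * 606 + 900)
      (fun j τ => ∀ y < j, ∀ x < 2 * ℓ, (τ.arr 8 (y * (2 * ℓ) + x) : ZMod (ℓ ^ e)) = root ℓ e y ^ x)
      (by simp [hP.ℓ]; rfl) ?_ ?_ (fun τ _ _ _ h => h)) fun τ₁ hb₁ hF₁ hQ₁ => ?_).mono
      (t := 1 + (100 + (ℓ * (e * (ℓ * 103 + 300) + ℓ * 606 + 900 + 3) + 2 +
        (100 + (2 * P.h * ℓ * ℓ * 203 + 2))))) ?_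
  · intro y hy; omega
  · intro y hy τ hb hF hτ hI
    have hPτ : P.Holds τ := (hP.setReg.setReg).of_frame hF
    have e20 : τ.reg 20 = e - 1 := by simpa using hF.reg 20 rfl
    have e21 : τ.reg 21 = 2 * ℓ := by simpa [hP.ℓ] using hF.reg 21 rfl
    refine (Runs.assign_seq (by simpa using hb.1 22) <|
      Runs.seq (Runs.forLoop (B := e - 1) (c := ℓ * 103 + 202)
        (fun s υ => (υ.reg 23 : ZMod (ℓ ^ e)) = (y : ZMod (ℓ ^ e)) ^ ℓ ^ s) (by simp [e20])
        (by simp [hτ]) ?_ (fun τ _ _ _ h => h)) fun υ₁ hb₁ hF₁ hQ₁ => ?_).mono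
        (t := 100 + ((e - 1) * (ℓ * 103 + 202 + 3) + 2 + (100 + (2 * ℓ * 303 + 2)))) ?_
    · intro s hs υ hb' hF' hυ hJ
      have hPυ : P.Holds υ := (hPτ.setReg).of_frame hF'
      refine (Runs.assign_seq (by simp; omega) <|
        Runs.seq (Runs.forLoop (B := ℓ) (c := 100)
          (fun i ρ => (ρ.reg 25 : ZMod (ℓ ^ e)) = (υ.reg 23 : ZMod (ℓ ^ e)) ^ i)
          (by simp [hPυ.ℓ, ← hℓd]) (by simp) ?_ (fun τ _ _ _ h => h)) fun ρ₁ hb₁ hF₁ hQ₁ =>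
          Runs.assign ?_ ?_).mono (t := 100 + (ℓ * (100 + 3) + 2 + 100)) (by omega)
      · intro i hi ρ hb'' hF'' hρ hK
        have hPρ : P.Holds ρ := (hPυ.setReg).of_frame hF''
        have e23 : ρ.reg 23 = υ.reg 23 := by simpa using hF''.reg 23 rfl
        refine Runs.assign ?_ ?_
        · simp only [eval_mod, eval_mul, eval_reg, hPρ.M]
          exact (Nat.mod_lt _ hM).le.trans hMX
        · simp [hPρ.M, e23, hK, pow_succ, ← hℓd, ← hed]
      · simpa using hb₁.1 25
      · simp [hQ₁, hJ, ← pow_mul, pow_succ]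
    · have hPυ : P.Holds υ₁ := (hPτ.setReg).of_frame hF₁
      have e21' : υ₁.reg 21 = 2 * ℓ := by
        have := hF₁.reg 21 rfl
        simpa [e21] using this
      have e22' : υ₁.reg 22 = y := by
        have := hF₁.reg 22 rfl
        simpa [hτ] using this
      have hu : (υ₁.reg 23 : ZMod (ℓ ^ e)) = root ℓ e y := hQ₁
      refine Runs.assign_seq (by simp; omega) <| Runs.forLoop (B := 2 * ℓ) (c := 300)
        (fun i ρ => (ρ.reg 25 : ZMod (ℓ ^ e)) = root ℓ e y ^ i ∧
          (∀ y' < y, ∀ x < 2 * ℓ, (ρ.arr 8 (y' * (2 * ℓ) + x) : ZMod (ℓ ^ e)) = root ℓ e y' ^ x) ∧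
          ∀ x < i, (ρ.arr 8 (y * (2 * ℓ) + x) : ZMod (ℓ ^ e)) = root ℓ e y ^ x)
        (by simp [e21']) ?_ ?_ ?_
      · simp
        have := hF₁.arr 8 rfl
        simp at this
        rw [this]
        exact hI
      · intro i hi ρ hb'' hF'' hρ ⟨hK1, hK2, hK3⟩
        have hPρ : P.Holds ρ := (hPυ.setReg).of_frame hF''
        have e23 : ρ.reg 23 = υ₁.reg 23 := by simpa using hF''.reg 23 rfl
        have e21'' : ρ.reg 21 = 2 * ℓ := by simpa [e21'] using hF''.reg 21 rfl
        have e22'' : ρ.reg 22 = y := by simpa [e22'] using hF''.reg 22 rfl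
        refine (Runs.write_seq (by simpa using hb''.1 25) <| Runs.assign ?_ ?_).mono (by norm_num)
        · simp only [eval_mod, eval_mul, eval_reg, State.setArr_reg, hPρ.M]
          exact (Nat.mod_lt _ hM).le.trans hMX
        · simp [hPρ.M, e23, hK1, hu, pow_succ, ← hℓd, ← hed, e21'', e22'', hρ]
          refine ⟨fun y' hy' x hx => ?_, fun x hx => ?_⟩
          · rw [Function.update_of_ne]
            · exact hK2 y' hy' x hx
            · have : (y' + 1) * (2 * ℓ) ≤ y * (2 * ℓ) := Nat.mul_le_mul_right _ hy'
              rw [Nat.succ_mul] at this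
              omega
          · rcases Nat.lt_or_eq_of_le hx with h | rfl
            · rw [Function.update_of_ne (by omega)]
              exact hK3 x h
            · rw [Function.update_self, hK1]
      · intro ρ hb'' hF'' hρ ⟨hK1, hK2, hK3⟩
        simp only [State.setReg_arr]
        intro y' hy' x hx
        rcases Nat.lt_succ_iff_lt_or_eq.mp hy' with h | rfl
        · exact hK2 y' h x hx
        · exact hK3 x hx
    · have h1 : (e - 1) * (ℓ * 103 + 202 + 3) ≤ e * (ℓ * 103 + 300) :=
        Nat.mul_le_mul (by omega) (by omega)
      omega
  · have hPτ : P.Holds τ₁ := (hP.setReg.setReg).of_frame hF₁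
    have e21 : τ₁.reg 21 = 2 * ℓ := by
      have := hF₁.reg 21 rfl
      simpa [hP.ℓ] using this
    have hℓ0 := hℓ.pos
    refine Runs.assign_seq (by simpa [hPτ.k, hPτ.ℓ] using hX) <|
      Runs.forLoop (B := 2 * P.h * ℓ * ℓ) (c := 200)
      (fun j ρ => ∀ i < j, (ρ.arr 9 i : ZMod (ℓ ^ e)) = root ℓ e (i / ℓ % ℓ) ^ (i % ℓ))
      (by simp [hPτ.k, hPτ.ℓ]; rfl) ?_ ?_ ?_
    · intro i hi; omega
    · intro j hj ρ hb hF hρ hI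
      have hPρ : P.Holds ρ := (hPτ.setReg).of_frame hF
      have e21' : ρ.reg 21 = 2 * ℓ := by simpa [e21] using hF.reg 21 rfl
      have e8 : ρ.arr 8 = τ₁.arr 8 := hF.arr 8 rfl
      refine Runs.write (by simpa using hb.2 8 _) ?_
      simp [hPρ.ℓ, e21', hρ, e8, ← hℓd]
      intro i hi
      rcases Nat.lt_or_eq_of_le hi with h | rfl
      · rw [Function.update_of_ne h.ne]
        exact hI i h
      · rw [Function.update_self]
        exact hQ₁ _ (Nat.mod_lt _ hℓ0) _ (by have := Nat.mod_lt i hℓ0; omega)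
    · intro ρ hb hF hρ hI
      refine ⟨?_, MatAt.of_flat hI⟩
      have e8 : ρ.arr 8 = τ₁.arr 8 := hF.arr 8 rfl
      rw [e8]
      exact hQ₁
  · have h1 : ℓ * (e * (ℓ * 103 + 300) + ℓ * 606 + 1000) =
      ℓ * (e * (ℓ * 103 + 300) + ℓ * 606 + 900 + 3) + ℓ * 97 := by ring
    omega

/-- The matrix of the transform of the keys of the tasks, for the moduli in array `7`. -/
def dualCode : Program :=
  assign 20 (reg 10 * reg 3 * reg 3) ;;
  forLoop 22 20 (
    assign 23 (reg 22 / reg 3 % reg 3 * (2 * reg 3)) ;;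
    assign 24 (ld 8 (reg 23 + (reg 3 - 1 - reg 22 % reg 3))) ;;
    assign 25 (ld 8 (reg 23 + (2 * (reg 3 - 1) - reg 22 % reg 3 - ld 7 (reg 22 / (reg 3 * reg 3))))) ;;
    write 10 (reg 22) (reg 12 * (reg 24 + reg 25) % reg 4))

theorem dualCode_runs {𝔐 : Machine} {σ : State} {P : Params} (hP : P.Holds σ) (hℓ : P.ℓ.Prime)
    (hMX : P.ℓ ^ P.e ≤ 𝔐.X) (hX : 2 * P.h * P.ℓ * P.ℓ ≤ 𝔐.X) (hX' : 2 * P.ℓ * P.ℓ ≤ 𝔐.X)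
    (h8 : PowersAt P.ℓ P.e (σ.arr 8)) {d : ℕ → ℕ} (hd : σ.arr 7 = d) :
    Runs 𝔐 dualCode σ (2 * P.h * P.ℓ * P.ℓ * 503 + 102)
      (fun τ => MatAt P.ℓ P.e (2 * P.h) (fun t y x => dualEntry P.ℓ P.e (d t) y x
        ((P.ℓ ^ P.e - (P.ℓ ^ P.e - 1) / (P.ℓ - 1) : ℕ) : ZMod (P.ℓ ^ P.e))) (τ.arr 10)) := by
  set ℓ := P.ℓ with hℓd
  set e := P.e with hed
  have hℓ0 := hℓ.pos
  have hM : 0 < ℓ ^ e := pow_pos hℓ.pos e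
  refine (Runs.assign_seq (by simpa [hP.k, hP.ℓ] using hX) <|
      Runs.forLoop (B := 2 * P.h * ℓ * ℓ) (c := 500)
      (fun j ρ => ∀ i < j, (ρ.arr 10 i : ZMod (ℓ ^ e)) = dualEntry ℓ e (d (i / (ℓ * ℓ)))
        (i / ℓ % ℓ) (i % ℓ) ((ℓ ^ e - (ℓ ^ e - 1) / (ℓ - 1) : ℕ) : ZMod (ℓ ^ e)))
      (by simp [hP.k, hP.ℓ]; rfl) ?_ ?_ ?_).mono (by omega)
  · intro i hi; omega
  · intro j hj ρ hb hF hρ hI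
    have hPρ : P.Holds ρ := (hP.setReg).of_frame hF
    have e8 : ρ.arr 8 = σ.arr 8 := hF.arr 8 rfl
    have e7 : ρ.arr 7 = d := (hF.arr 7 rfl).trans hd
    have hy : j / ℓ % ℓ < ℓ := Nat.mod_lt _ hℓ0
    have hx : j % ℓ < ℓ := Nat.mod_lt _ hℓ0
    refine (Runs.assign_seq ?_ <| Runs.assign_seq (by simpa using hb.2 8 _) <|
      Runs.assign_seq (by simpa using hb.2 8 _) <| Runs.write ?_ ?_).mono (by norm_num)
    · simp [hρ, hPρ.ℓ, ← hℓd]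
      refine le_trans ?_ hX'
      rw [mul_comm]
      exact Nat.mul_le_mul_left _ hy.le
    · simp [hPρ.M]
      exact (Nat.mod_lt _ hM).le.trans hMX
    · simp [hρ, hPρ.ℓ, hPρ.M, hPρ.inv, e7, e8, ← hℓd, ← hed]
      intro i hi
      rcases Nat.lt_or_eq_of_le hi with h | rfl
      · rw [Function.update_of_ne h.ne]
        exact hI i h
      · rw [Function.update_self, ZMod.natCast_mod]
        push_cast
        rw [h8 _ hy _ (by omega), h8 _ hy _ (by omega), dualEntry]
  · intro ρ hb hF hρ hI
    exact MatAt.of_flat hI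

/-! ### Hashing and transforms on the machine -/

/-- Register `23` becomes the hash value of register `20`, with the sign in register `21`, the shift
in register `22` and the moduli in array `7`. -/
def hashCode : Program :=
  assign 23 0 ;; assign 24 1 ;; forLoop 25 10 (assign 26 (ld 7 (reg 25)) ;;
    assign 23 (reg 23 + (reg 20 * (reg 21 * (reg 26 - 2) + 1) + reg 22 / reg 24 % reg 3) % reg 26 *
      reg 24) ;;
    assign 24 (reg 24 * reg 3))

theorem hashCode_runs {𝔐 : Machine} {σ : State} {P : Params} (hP : P.Holds σ) {d : ℕ → ℕ}
    (hd : ∀ t < 2 * P.h, σ.arr 7 t = d t) (hd' : ∀ t < 2 * P.h, 1 ≤ d t ∧ d t ≤ P.ℓ)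
    (hℓ : 0 < P.ℓ) (hX : P.ℓ ^ (2 * P.h) ≤ 𝔐.X) {x b sh : ℕ} (hx : σ.reg 20 = x)
    (hb : σ.reg 21 = b) (hsh : σ.reg 22 = sh) :
    Runs 𝔐 hashCode σ (2 * P.h * 303 + 202)
      (fun τ => τ.reg 23 = hash P.ℓ (2 * P.h) d b sh x) := by
  have hX2 := 𝔐.two_le
  have hpow : ∀ i ≤ 2 * P.h, P.ℓ ^ i ≤ 𝔐.X := fun i hi =>
    (Nat.pow_le_pow_right hℓ hi).trans hX
  refine (Runs.assign_seq (by simp) <| Runs.assign_seq (by simp; omega) <|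
    Runs.forLoop (B := 2 * P.h) (c := 300) (fun j τ => τ.reg 24 = P.ℓ ^ j ∧
      τ.reg 23 = ofDigits P.ℓ j fun t => (x * (b * (d t - 2) + 1) + digit P.ℓ t sh) % d t)
      (by simp [hP.k]) (by simp [ofDigits]) ?_ (fun τ _ _ _ h => h.2)).mono (by omega)
  intro j hj τ hbd hF hτ ⟨hI1, hI2⟩
  have hPτ : P.Holds τ := (hP.setReg.setReg).of_frame hF
  have e7 : τ.arr 7 j = d j := (congrFun (hF.arr 7 rfl) j).trans (hd j hj)
  have e20 : τ.reg 20 = x := by simpa [hx] using hF.reg 20 rfl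
  have e21 : τ.reg 21 = b := by simpa [hb] using hF.reg 21 rfl
  have e22 : τ.reg 22 = sh := by simpa [hsh] using hF.reg 22 rfl
  have hs : ofDigits P.ℓ (j + 1) (fun t => (x * (b * (d t - 2) + 1) + digit P.ℓ t sh) % d t) =
      ofDigits P.ℓ j (fun t => (x * (b * (d t - 2) + 1) + digit P.ℓ t sh) % d t) +
      (x * (b * (d j - 2) + 1) + digit P.ℓ j sh) % d j * P.ℓ ^ j := by
    rw [ofDigits, sum_range_succ]; rfl
  refine (Runs.assign_seq (by simpa using hbd.2 7 _) <| Runs.assign_seq ?_ <|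
    Runs.assign ?_ ?_).mono (by norm_num)
  · simp only [eval_add, eval_mod, eval_mul, eval_sub, eval_div, eval_reg, eval_ofNat, eval_ld,
      State.setReg_reg, hτ, e7, e20, e21, e22, hI1, hI2, hPτ.ℓ]
    -- The partial value has j + 1 digits below ℓ, so it stays within the bound.
    have := ofDigits_lt (ℓ := P.ℓ) (k := j + 1)
      (f := fun t => (x * (b * (d t - 2) + 1) + digit P.ℓ t sh) % d t)
      fun t ht => (Nat.mod_lt _ (hd' t (by omega)).1).trans_le (hd' t (by omega)).2
    rw [hs] at this
    exact this.le.trans (hpow _ hj)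
  · simpa [hI1, hPτ.ℓ, ← pow_succ] using hpow _ hj
  · simp only [digit] at hs
    simp [hI1, hPτ.ℓ, pow_succ, hs, hI2, hτ, e7, e20, e21, e22, digit]

/-- A change of digit `t` does not touch the quotient by ℓ^(t+1), so the transform never leaves the
table, even when B is no power of ℓ. -/
theorem setDigit_lt {ℓ t k B idx x : ℕ} (hℓ : 0 < ℓ) (ht : t < k) (hx : x < ℓ)
    (hidx : idx < B * ℓ ^ k) : setDigit ℓ t idx x < B * ℓ ^ k := by
  have h1 : setDigit ℓ t idx x / ℓ ^ (t + 1) = idx / ℓ ^ (t + 1) := by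
    rw [pow_succ, ← Nat.div_div_eq_div_mul, setDigit_div hℓ, mul_comm, Nat.mul_add_div hℓ,
      Nat.div_eq_of_lt hx, add_zero, pow_succ]
  have hk : B * ℓ ^ k = B * ℓ ^ (k - (t + 1)) * ℓ ^ (t + 1) := by
    rw [mul_assoc, ← pow_add, Nat.sub_add_cancel ht]
  rw [hk] at hidx ⊢
  rw [← Nat.div_lt_iff_lt_mul (pow_pos hℓ _)] at hidx ⊢
  rwa [h1]

/-- Transform array `x` of the length in register `30` along all digits by the matrices in array
`mat`. -/
def transformCode (x mat : ℕ) : Program :=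
  assign 31 1 ;; forLoop 32 10 (
    forLoop 33 30 (
      assign 34 (reg 33 / reg 31 % reg 3) ;; assign 35 (reg 33 - reg 34 * reg 31) ;;
      assign 36 0 ;;
      forLoop 37 3 (assign 36 ((reg 36 + ld mat ((reg 32 * reg 3 + reg 34) * reg 3 + reg 37) *
        ld x (reg 35 + reg 37 * reg 31)) % reg 4)) ;;
      write 13 (reg 33) (reg 36)) ;;
    forLoop 33 30 (write x (reg 33) (ld 13 (reg 33))) ;;
    assign 31 (reg 31 * reg 3))

/-- The loop invariant is `partialTransform` after `t` digits. Each pass is collected in array 13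
and then copied back, because every new entry depends on ℓ old ones. -/
theorem transformCode_runs {𝔐 : Machine} {σ : State} {P : Params} {x mat B N : ℕ}
    {E : ℕ → ℕ → ℕ → ZMod (P.ℓ ^ P.e)} {key : ℕ → ℕ} (hxm : x ≠ mat) (hx : x ≠ 13)
    (hm : mat ≠ 13) (hP : P.Holds σ) (hℓ : 0 < P.ℓ) (hMX : P.ℓ ^ P.e ≤ 𝔐.X)
    (h30 : σ.reg 30 = B * P.ℓ ^ (2 * P.h)) (hX : P.ℓ ^ (2 * P.h) ≤ 𝔐.X)
    (hmat : MatAt P.ℓ P.e (2 * P.h) E (σ.arr mat))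
    (hin : ∀ idx < B * P.ℓ ^ (2 * P.h),
      (σ.arr x idx : ZMod (P.ℓ ^ P.e)) = partialTransform P.ℓ E N key 0 idx) :
    Runs 𝔐 (transformCode x mat) σ
      (2 * P.h * (B * P.ℓ ^ (2 * P.h) * (P.ℓ * 103 + 800) + 200) + 102)
      (fun τ => ∀ idx < B * P.ℓ ^ (2 * P.h),
        (τ.arr x idx : ZMod (P.ℓ ^ P.e)) = partialTransform P.ℓ E N key (2 * P.h) idx) := by
  set tot := B * P.ℓ ^ (2 * P.h) with htot
  have hX2 := 𝔐.two_le
  have hM : 0 < P.ℓ ^ P.e := pow_pos hℓ P.e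
  have b1 : Nat.beq x mat = false := Nat.beq_eq_false_of_ne hxm
  have b2 : Nat.beq 13 mat = false := Nat.beq_eq_false_of_ne hm.symm
  have b3 : Nat.beq 13 x = false := Nat.beq_eq_false_of_ne hx.symm
  have hpow : ∀ i ≤ 2 * P.h, P.ℓ ^ i ≤ 𝔐.X := fun i hi =>
    (Nat.pow_le_pow_right hℓ hi).trans hX
  refine (Runs.assign_seq (by simp; omega) <|
    Runs.forLoop (B := 2 * P.h) (c := tot * (P.ℓ * 103 + 800) + 150) (fun t τ => τ.reg 31 = P.ℓ ^ t ∧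
      ∀ idx < tot, (τ.arr x idx : ZMod (P.ℓ ^ P.e)) = partialTransform P.ℓ E N key t idx)
      (by simp [hP.k]) (by simpa using hin) ?_ (fun τ _ _ _ h => h.2)).mono ?_
  · intro t ht τ hb hF hτ ⟨hI1, hI2⟩
    have hPτ : P.Holds τ := (hP.setReg).of_frame hF
    have e30 : τ.reg 30 = tot := by simpa [h30] using hF.reg 30 rfl
    have eM : τ.arr mat = σ.arr mat := by simpa using hF.arr mat (by simp [b1, b2])
    have htotX : tot ≤ 𝔐.X := e30 ▸ hb.1 30
    refine (Runs.seq (R := fun υ => ∀ idx < tot,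
        (υ.arr 13 idx : ZMod (P.ℓ ^ P.e)) = partialTransform P.ℓ E N key (t + 1) idx)
      (Runs.forLoop (B := tot) (c := P.ℓ * 103 + 502) (fun i υ => ∀ idx < i,
        (υ.arr 13 idx : ZMod (P.ℓ ^ P.e)) = partialTransform P.ℓ E N key (t + 1) idx) e30 ?_ ?_
        (fun τ _ _ _ h => h)) fun υ hb' hF' hυ => Runs.seq (Runs.forLoop (B := tot) (c := 200)
          (fun i ρ => ∀ idx < i,
        (ρ.arr x idx : ZMod (P.ℓ ^ P.e)) = partialTransform P.ℓ E N key (t + 1) idx) ?_ ?_ ?_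
        (fun τ _ _ _ h => h)) fun ρ hb'' hF'' hρ => Runs.assign ?_ ?_).mono ?_
    · intro i hi; omega
    · intro i hi υ hb' hF' hυ hJ
      have hPυ : P.Holds υ := hPτ.of_frame hF'
      have e31 : υ.reg 31 = P.ℓ ^ t := (hF'.reg 31 rfl).trans hI1
      have e32 : υ.reg 32 = t := (hF'.reg 32 rfl).trans hτ
      have eX : υ.arr x = τ.arr x := hF'.arr x (by simp [b3])
      have eM' : υ.arr mat = σ.arr mat := (hF'.arr mat (by simp [b2])).trans eM
      have hℓX : P.ℓ ≤ 𝔐.X := by have := hb'.1 3; rwa [hPυ.ℓ] at this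
      refine (Runs.assign_seq ?_ <| Runs.assign_seq ?_ <| Runs.assign_seq (by simp) <|
        Runs.seq (Runs.forLoop (B := P.ℓ) (c := 100) (fun s ρ => (ρ.reg 36 : ZMod (P.ℓ ^ P.e)) =
          ∑ y ∈ range s, E t (digit P.ℓ t i) y *
            partialTransform P.ℓ E N key t (setDigit P.ℓ t i y)) ?_ ?_ ?_
          (fun τ _ _ _ h => h)) fun ρ hb'' hF'' hρ => Runs.write ?_ ?_).mono
          (t := 100 + (100 + (100 + (P.ℓ * (100 + 3) + 2 + 200)))) (by omega)
      · simp [hPυ.ℓ]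
        exact (Nat.mod_lt _ hℓ).le.trans hℓX
      · simp [hυ]; omega
      · simp [hPυ.ℓ]
      · simp
      · intro s hs ρ hb'' hF'' hρ hK
        have hPρ : P.Holds ρ := (hPυ.setReg.setReg.setReg).of_frame hF''
        have f31 : ρ.reg 31 = P.ℓ ^ t := by simpa [e31] using hF''.reg 31 rfl
        have f32 : ρ.reg 32 = t := by simpa [e32] using hF''.reg 32 rfl
        have f34 : ρ.reg 34 = digit P.ℓ t i := by
          simpa [hυ, e31, hPυ.ℓ, digit] using hF''.reg 34 rfl
        have f35 : ρ.reg 35 = i - digit P.ℓ t i * P.ℓ ^ t := by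
          simpa [hυ, e31, hPυ.ℓ, digit] using hF''.reg 35 rfl
        have fX : ρ.arr x = τ.arr x := by simpa [eX] using hF''.arr x (by simp)
        have fM : ρ.arr mat = σ.arr mat := by simpa [eM'] using hF''.arr mat (by simp)
        refine Runs.assign ?_ ?_
        · simp only [eval_mod, eval_reg, hPρ.M]
          exact (Nat.mod_lt _ hM).le.trans hMX
        · simp [hPρ.M, hPρ.ℓ, hK, f31, f32, f34, f35, fX, fM, hρ, sum_range_succ]
          rw [hmat t ht _ (digit_lt hℓ t i) s hs]
          have := hI2 (setDigit P.ℓ t i s) (setDigit_lt hℓ ht hs hi)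
          rw [setDigit] at this
          rw [this, setDigit]
      · simpa using hb''.1 36
      · have f33 : ρ.reg 33 = i := by
          have := hF''.reg 33 rfl
          simpa [hυ] using this
        have f13 : ρ.arr 13 = υ.arr 13 := by
          have := hF''.arr 13 (by simp)
          simpa using this
        simp [f33, f13]
        intro idx hidx
        rcases Nat.lt_or_eq_of_le hidx with h | rfl
        · rw [Function.update_of_ne h.ne]
          exact hJ idx h
        · rw [Function.update_self, hρ, partialTransform_succ hℓ]
    · exact (hF'.reg 30 rfl).trans e30
    · intro i hi; omega
    · intro i hi ρ hb'' hF'' hρ hK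
      refine Runs.write (by simpa using hb''.2 13 _) ?_
      have f13 : ρ.arr 13 = υ.arr 13 := hF''.arr 13 (by simp [Nat.beq_eq_false_of_ne hx])
      simp [hρ, f13]
      intro idx hidx
      rcases Nat.lt_or_eq_of_le hidx with h | rfl
      · rw [Function.update_of_ne h.ne]
        exact hK idx h
      · rw [Function.update_self]
        exact hυ idx hi
    · have e1 : ρ.reg 31 = P.ℓ ^ t := ((hF''.reg 31 rfl).trans (hF'.reg 31 rfl)).trans hI1
      have e3 : ρ.reg 3 = P.ℓ := ((hF''.reg 3 rfl).trans (hF'.reg 3 rfl)).trans hPτ.ℓ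
      simpa [e1, e3, ← pow_succ] using hpow _ ht
    · have e1 : ρ.reg 31 = P.ℓ ^ t := ((hF''.reg 31 rfl).trans (hF'.reg 31 rfl)).trans hI1
      have e3 : ρ.reg 3 = P.ℓ := ((hF''.reg 3 rfl).trans (hF'.reg 3 rfl)).trans hPτ.ℓ
      simp [e1, e3, pow_succ]
      exact hρ
    · have h1 : tot * (P.ℓ * 103 + 800) = tot * (P.ℓ * 103 + 502 + 3) + tot * 203 + tot * 92 := by ring
      omega
  · have : 2 * P.h * (tot * (P.ℓ * 103 + 800) + 150 + 3) ≤
        2 * P.h * (tot * (P.ℓ * 103 + 800) + 200) := Nat.mul_le_mul_left _ (by omega)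
    omega

end ThreeSum

namespace ThreeSum

open Finset RAM RAM.Expr

/-! ### Counting the solutions modulo the hash functions -/

/-- Hash all entries of the list into array `14`. -/
def hashAllCode : Program :=
  assign 21 0 ;; assign 22 0 ;;
  forLoop 27 1 (assign 20 (ld 1 (reg 27)) ;; hashCode ;; write 14 (reg 27) (reg 23))

theorem hashAllCode_runs {𝔐 : Machine} {σ : State} {P : Params} (hP : P.Holds σ) {d : ℕ → ℕ}
    (hd : σ.arr 7 = d) (hd' : ∀ t < 2 * P.h, 1 ≤ d t ∧ d t ≤ P.ℓ)
    (hℓ : 0 < P.ℓ) (hX : P.ℓ ^ (2 * P.h) ≤ 𝔐.X) :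
    Runs 𝔐 hashAllCode σ (P.n * (2 * P.h * 303 + 505) + 202)
      (fun τ => ∀ z < P.n, τ.arr 14 z = hash P.ℓ (2 * P.h) d 0 0 (σ.arr 1 z)) := by
  refine (Runs.assign_seq (by simp) <| Runs.assign_seq (by simp) <|
    Runs.forLoop (B := P.n) (c := 100 + (2 * P.h * 303 + 202 + 200))
    (fun j τ => ∀ z < j, τ.arr 14 z = hash P.ℓ (2 * P.h) d 0 0 (σ.arr 1 z)) (by simp [hP.n])
    (by simp) ?_ (fun τ _ _ _ h => h)).mono ?_
  · intro j hj τ hb hF hτ hI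
    have hPτ : P.Holds τ := (hP.setReg.setReg).of_frame hF
    have e1 : τ.arr 1 = σ.arr 1 := hF.arr 1 rfl
    have e7 : τ.arr 7 = d := (hF.arr 7 rfl).trans hd
    have e21 : τ.reg 21 = 0 := by simpa using hF.reg 21 rfl
    have e22 : τ.reg 22 = 0 := by simpa using hF.reg 22 rfl
    refine Runs.assign_seq (by simpa using hb.2 1 _) <|
      Runs.seq (hashCode_runs (d := d) (x := σ.arr 1 j) (b := 0) (sh := 0) hPτ.setReg
        (by simp [e7]) hd' hℓ hX (by simp [e1, hτ]) (by simp [e21]) (by simp [e22]))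
        fun υ hb' hF' hQ => Runs.write ?_ ?_
    · simpa using hb'.1 23
    · have f27 : υ.reg 27 = j := by simpa [hτ] using hF'.reg 27 rfl
      have f14 : υ.arr 14 = τ.arr 14 := hF'.arr 14 rfl
      simp [f27, f14, hQ]
      intro z hz
      rcases Nat.lt_or_eq_of_le hz with h | rfl
      · rw [Function.update_of_ne h.ne]
        exact hI z h
      · rw [Function.update_self]
  · have : P.n * (100 + (2 * P.h * 303 + 202 + 200) + 3) = P.n * (2 * P.h * 303 + 505) := by ring
    omega

/-- Count in array `x`, of the length in register `30`, how often each key occurs among the keys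
`ke` for the values of register `33` below register `N`. -/
def histogramCode (x N : ℕ) (ke : Expr) : Program :=
  forLoop 33 30 (write x (reg 33) 0) ;; forLoop 33 N (write x ke (ld x ke + 1))

theorem _root_.RAM.Frame.seq {p q : Program} {σ τ υ : State} (h : Frame p σ τ)
    (h' : Frame q τ υ) : Frame (p ;; q) σ υ := by
  refine ⟨fun r hr => ?_, fun x hx => ?_⟩
  · simp only [Program.wr, Bool.or_eq_false_iff] at hr
    rw [h'.reg r hr.2, h.reg r hr.1]
  · simp only [Program.wa, Bool.or_eq_false_iff] at hx
    rw [h'.arr x hx.2, h.arr x hx.1]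

/-- The key expression may read memory. `hkey` asks for its value only in states that differ from
`σ` where the histogram itself writes. -/
theorem histogramCode_runs {𝔐 : Machine} {σ : State} {x N tot B : ℕ} {ke : Expr} {key : ℕ → ℕ}
    (h30 : σ.reg 30 = tot) (hN : σ.reg N = B) (hlt : ∀ m < B, key m < tot)
    (hkey : ∀ τ : State, Frame (histogramCode x N ke) σ τ → τ.reg 33 < B →
      ke.eval τ = key (τ.reg 33))
    (hke : ke.wf = true := by rfl) (hke' : (ld x ke + 1).wf = true := by rfl)
    (hN40 : Nat.ble (N + 1) 40 = true := by rfl) (hN33 : Nat.beq 33 N = false := by rfl)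
    (hwN : (write x ke (ld x ke + 1)).wr N = false := by rfl)
    (hw33 : (write x ke (ld x ke + 1)).wr 33 = false := by rfl)
    (hwN' : (forLoop 33 30 (write x (reg 33) 0)).wr N = false := by rfl) :
    Runs 𝔐 (histogramCode x N ke) σ (tot * 203 + B * 203 + 4)
      (fun τ => ∀ idx < tot, τ.arr x idx = ∑ m ∈ range B, if key m = idx then 1 else 0) := by
  refine Runs.of_bdd fun hσ => ?_
  have hBX : B ≤ 𝔐.X := hN ▸ hσ.1 N
  refine (Runs.seq (Runs.forLoop (B := tot) (c := 200)
    (fun j τ => ∀ idx < j, τ.arr x idx = 0) (by simpa using h30)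
    (by simp) ?_ (fun τ _ _ _ h => h)) fun υ hb hF hυ => Runs.forLoop (B := B) (c := 200)
    (fun j τ => ∀ idx < tot, τ.arr x idx = ∑ m ∈ range j, if key m = idx then 1 else 0)
    ((hF.reg N hwN').trans hN) (by simpa using hυ) ?_ (fun τ _ _ _ h => h) rfl hN40 hN33 hw33
    hwN).mono (by omega)
  · intro j hj τ hb hF hτ hI
    refine Runs.write (by simp) ?_
    simp [hτ]
    intro z hz
    rcases Nat.lt_or_eq_of_le hz with h | rfl
    · rw [Function.update_of_ne h.ne]
      exact hI z h
    · rw [Function.update_self]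
  · intro j hj τ hb' hF' hτ hI
    have e := hkey τ (hF.seq hF') (by omega)
    rw [hτ] at e
    -- A counter is at most the number j of keys already seen, so it can be increased without
    -- overflow.
    have hval : τ.arr x (key j) + 1 ≤ 𝔐.X := by
      rw [hI _ (hlt j hj), ← card_filter]
      have := (card_filter_le (range j) fun m => key m = key j)
      rw [card_range] at this
      omega
    refine Runs.write (by simpa [e] using hval) ?_ hke hke'
    simp [e, -sum_boole]
    intro idx hidx
    rw [sum_range_succ, Function.update_apply]
    split_ifs with h1 h2 h2
    · rw [h1, hI _ (hlt j hj)]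
    · exact absurd h1.symm h2
    · exact absurd h2.symm h1
    · rw [hI _ hidx, add_zero]

/-- Sum up the products of the transforms. -/
def productCode : Program :=
  assign 14 0 ;; forLoop 31 5 (forLoop 32 5 (forLoop 33 7 (
    assign 14 ((reg 14 + ld 11 (reg 31 * reg 7 + reg 33) * ld 11 (reg 32 * reg 7 + reg 33) *
      ld 12 ((reg 31 * reg 5 + reg 32) * reg 7 + reg 33)) % reg 4))))

theorem productCode_runs {𝔐 : Machine} {σ : State} {P : Params} (hP : P.Holds σ)
    (hM : 0 < P.ℓ ^ P.e) (hMX : P.ℓ ^ P.e ≤ 𝔐.X) :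
    Runs 𝔐 productCode σ (P.R * (P.R * (P.ℓ ^ (2 * P.h) * 103 + 10) + 10) + 102) (fun τ =>
      τ.reg 14 < P.ℓ ^ P.e ∧ (τ.reg 14 : ZMod (P.ℓ ^ P.e)) =
        ∑ i ∈ range P.R, ∑ j ∈ range P.R, ∑ v ∈ range (P.ℓ ^ (2 * P.h)),
          (σ.arr 11 (i * P.ℓ ^ (2 * P.h) + v) * σ.arr 11 (j * P.ℓ ^ (2 * P.h) + v) *
            σ.arr 12 ((i * P.R + j) * P.ℓ ^ (2 * P.h) + v) : ZMod (P.ℓ ^ P.e))) := by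
  set F : ℕ → ℕ → ℕ → ZMod (P.ℓ ^ P.e) := fun i j v =>
    (σ.arr 11 (i * P.ℓ ^ (2 * P.h) + v) * σ.arr 11 (j * P.ℓ ^ (2 * P.h) + v) *
      σ.arr 12 ((i * P.R + j) * P.ℓ ^ (2 * P.h) + v) : ZMod (P.ℓ ^ P.e)) with hFdef
  refine (Runs.assign_seq (by simp) <| Runs.forLoop (B := P.R)
    (c := P.R * (P.ℓ ^ (2 * P.h) * 103 + 2 + 3) + 2)
    (fun i τ => τ.reg 14 < P.ℓ ^ P.e ∧ (τ.reg 14 : ZMod (P.ℓ ^ P.e)) =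
      ∑ i ∈ range i, ∑ j ∈ range P.R, ∑ v ∈ range (P.ℓ ^ (2 * P.h)), F i j v) (by simp [hP.R])
    (by simp [hM]) ?_ (fun τ _ _ _ h => h)).mono ?_
  · intro i hi τ hb hF hτ ⟨hI1, hI2⟩
    have hPτ : P.Holds τ := (hP.setReg).of_frame hF
    refine Runs.forLoop (B := P.R) (c := P.ℓ ^ (2 * P.h) * 103 + 2)
      (fun j υ => υ.reg 14 < P.ℓ ^ P.e ∧ (υ.reg 14 : ZMod (P.ℓ ^ P.e)) =
        (τ.reg 14 : ZMod (P.ℓ ^ P.e)) +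
          ∑ j ∈ range j, ∑ v ∈ range (P.ℓ ^ (2 * P.h)), F i j v) (by simp [hPτ.R])
      (by simp [hI1]) ?_ ?_
    · intro j hj υ hb' hF' hυ ⟨hJ1, hJ2⟩
      have hPυ : P.Holds υ := hPτ.of_frame hF'
      refine Runs.forLoop (B := P.ℓ ^ (2 * P.h)) (c := 100)
        (fun v ρ => ρ.reg 14 < P.ℓ ^ P.e ∧ (ρ.reg 14 : ZMod (P.ℓ ^ P.e)) =
          (υ.reg 14 : ZMod (P.ℓ ^ P.e)) + ∑ v ∈ range v, F i j v) (by simp [hPυ.V])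
        (by simp [hJ1]) ?_ ?_
      · intro v hv ρ hb'' hF'' hρ ⟨hK1, hK2⟩
        have hPρ : P.Holds ρ := hPυ.of_frame hF''
        have e31 : ρ.reg 31 = i := by
          have h1 := hF'.reg 31 rfl; have h2 := hF''.reg 31 rfl
          simp [hτ] at h1 h2
          rw [h2, h1]
        have e32 : ρ.reg 32 = j := by simpa [hυ] using hF''.reg 32 rfl
        have a11 : ρ.arr 11 = σ.arr 11 := ((hF''.arr 11 rfl).trans (hF'.arr 11 rfl)).trans
          (hF.arr 11 rfl)
        have a12 : ρ.arr 12 = σ.arr 12 := ((hF''.arr 12 rfl).trans (hF'.arr 12 rfl)).trans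
          (hF.arr 12 rfl)
        refine Runs.assign ?_ ?_
        · simp only [eval_mod, eval_reg, hPρ.M]
          exact (Nat.mod_lt _ hM).le.trans hMX
        · simp [hPρ.M, hPρ.V, hPρ.R, e31, e32, a11, a12, hρ, Nat.mod_lt _ hM, hK2,
            sum_range_succ, hFdef, add_assoc]
      · intro ρ hb'' hF'' hρ ⟨hK1, hK2⟩
        simp [hK1, hK2, hJ2, sum_range_succ, add_assoc]
    · intro υ hb' hF' hυ ⟨hJ1, hJ2⟩
      simp [hJ1, hJ2, hI2, sum_range_succ]
  · have : P.R * (P.R * (P.ℓ ^ (2 * P.h) * 103 + 2 + 3) + 2 + 3) ≤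
        P.R * (P.R * (P.ℓ ^ (2 * P.h) * 103 + 10) + 10) := by
      have : P.R * (P.ℓ ^ (2 * P.h) * 103 + 2 + 3) ≤ P.R * (P.ℓ ^ (2 * P.h) * 103 + 10) :=
        Nat.mul_le_mul_left _ (by omega)
      exact Nat.mul_le_mul_left _ (by omega)
    omega

/-- The tasks that are stored in the memory. -/
def Params.tasks (P : Params) (σ : State) : Tasks :=
  ⟨P.n, P.g, P.R, σ.arr 1, σ.reg 9, σ.arr 4, σ.arr 5, σ.arr 6⟩

theorem Params.tasks_eq_of_frame (P : Params) {p : Program} {σ τ : State} (hF : Frame p σ τ)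
    (h9 : p.wr 9 = false := by rfl) (h1 : p.wa 1 = false := by rfl)
    (h4 : p.wa 4 = false := by rfl) (h5 : p.wa 5 = false := by rfl)
    (h6 : p.wa 6 = false := by rfl) : P.tasks τ = P.tasks σ := by
  simp only [Params.tasks, hF.arr 1 h1, hF.arr 4 h4, hF.arr 5 h5, hF.arr 6 h6, hF.reg 9 h9]

/-- Register `14` becomes the number of solutions of the tasks modulo the numbers in array `7`. -/
def countCode : Program :=
  hashAllCode ;; assign 30 (reg 5 * reg 7) ;;
  histogramCode 11 1 (reg 33 / reg 6 * reg 7 + ld 14 (reg 33)) ;; transformCode 11 9 ;;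
  assign 30 (reg 5 * reg 5 * reg 7) ;;
  histogramCode 12 9
    ((ld 5 (reg 33) * reg 5 + ld 6 (reg 33)) * reg 7 + ld 14 (ld 4 (reg 33))) ;;
  dualCode ;; transformCode 12 10 ;; productCode

/-- A bound for the running time of `countCode`. -/
def Params.countTime (P : Params) (N : ℕ) : ℕ :=
  P.n * (2 * P.h * 303 + 708) + N * 203 + 2 * P.h * P.ℓ * P.ℓ * 503 +
    P.R * P.R * P.ℓ ^ (2 * P.h) * (4 * P.h * (P.ℓ * 103 + 800) + 519) + P.R * P.R * 20 +
    1000 * P.h + 2000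

/-- This is `Tasks.collisions_eq_sum` on the machine. The histograms are the transforms with no
digit processed. The tables for pairs of blocks have R² ℓ^(2h) entries and dominate the cost. -/
theorem countCode_runs {𝔐 : Machine} {σ : State} {P : Params} (hP : P.Holds σ) {d : ℕ → ℕ}
    (hd : σ.arr 7 = d) (hd' : ∀ t < 2 * P.h, 1 ≤ d t ∧ 2 * d t ≤ P.ℓ - 1) (hℓ : P.ℓ.Prime)
    (he : 1 ≤ P.e) (hW : (P.tasks σ).Valid) (hMX : P.ℓ ^ P.e ≤ 𝔐.X)
    (hX : P.R * P.R * P.ℓ ^ (2 * P.h) ≤ 𝔐.X) (hX1 : 2 * P.h * P.ℓ * P.ℓ ≤ 𝔐.X)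
    (hX2 : 2 * P.ℓ * P.ℓ ≤ 𝔐.X) (h8 : PowersAt P.ℓ P.e (σ.arr 8))
    (h9 : MatAt P.ℓ P.e (2 * P.h) (fun _ y x => root P.ℓ P.e y ^ x) (σ.arr 9)) (hR : 1 ≤ P.R)
    (hcoll : (P.tasks σ).collisions (2 * P.h) d < P.ℓ ^ P.e) :
    Runs 𝔐 countCode σ (P.countTime (σ.reg 9))
      (fun τ => τ.reg 14 = (P.tasks σ).collisions (2 * P.h) d) := by
  have hℓ0 := hℓ.pos
  have hd'' : ∀ t < 2 * P.h, 1 ≤ d t ∧ d t ≤ P.ℓ := fun t ht => by have := hd' t ht; omega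
  set V := P.ℓ ^ (2 * P.h) with hV
  have hVX : V ≤ 𝔐.X := (Nat.le_mul_of_pos_left _ (Nat.mul_pos hR hR)).trans hX
  have hRVX : P.R * V ≤ 𝔐.X := by
    refine le_trans ?_ hX
    rw [mul_assoc]
    exact Nat.le_mul_of_pos_left _ hR
  have hM : 0 < P.ℓ ^ P.e := pow_pos hℓ0 _
  set W := P.tasks σ with hWdef
  have hA : ∀ x < P.n, W.keyA P.ℓ (2 * P.h) d x < P.R * V := fun x hx => by
    have h1 : x / P.g < P.R := by
      have hg : 0 < P.g := hW.g_pos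
      rw [Nat.div_lt_iff_lt_mul hg]
      exact hx.trans_le hW.le_mul
    have h2 := hash_lt hd'' 0 0 (W.L x)
    calc W.keyA P.ℓ (2 * P.h) d x < x / P.g * V + V := Nat.add_lt_add_left h2 _
      _ = (x / P.g + 1) * V := by ring
      _ ≤ _ := Nat.mul_le_mul_right _ h1
  have hC : ∀ m < σ.reg 9, W.keyC P.ℓ (2 * P.h) d m < P.R * P.R * V := fun m hm => by
    have h1 : W.wi m < P.R := hW.wi_lt m hm
    have h3 : W.wj m < P.R := hW.wj_lt m hm
    have h2 := hash_lt hd'' 0 0 (W.L (W.wz m))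
    calc W.keyC P.ℓ (2 * P.h) d m < (W.wi m * P.R + W.wj m) * V + V := Nat.add_lt_add_left h2 _
      _ = (W.wi m * P.R + W.wj m + 1) * V := by ring
      _ ≤ _ := Nat.mul_le_mul_right _ (by nlinarith)
  refine (Runs.seq (hashAllCode_runs hP hd hd'' hℓ0 hVX) fun τ₁ b₁ F₁ Q₁ =>
    Runs.assign_seq ?_ <|
    Runs.seq (histogramCode_runs (tot := P.R * V) (B := P.n)
      (key := W.keyA P.ℓ (2 * P.h) d) ?_ ?_ hA ?_) fun τ₂ b₂ F₂ Q₂ =>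
    Runs.seq (transformCode_runs (P := P) (B := P.R) (N := P.n)
      (key := W.keyA P.ℓ (2 * P.h) d) (E := fun _ y x => root P.ℓ P.e y ^ x)
      (by norm_num) (by norm_num) (by norm_num) ?_ hℓ0 hMX ?_ hVX ?_ ?_) fun τ₃ b₃ F₃ Q₃ =>
    Runs.assign_seq ?_ <|
    Runs.seq (histogramCode_runs (tot := P.R * P.R * V) (B := σ.reg 9)
      (key := W.keyC P.ℓ (2 * P.h) d) ?_ ?_ hC ?_) fun τ₄ b₄ F₄ Q₄ =>
    Runs.seq (dualCode_runs (P := P) (d := d) ?_ hℓ hMX hX1 hX2 ?_ ?_) fun τ₅ b₅ F₅ Q₅ =>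
    Runs.seq (transformCode_runs (P := P) (B := P.R * P.R) (N := σ.reg 9)
      (key := W.keyC P.ℓ (2 * P.h) d) (E := fun t y x => dualEntry P.ℓ P.e (d t) y x
        ((P.ℓ ^ P.e - (P.ℓ ^ P.e - 1) / (P.ℓ - 1) : ℕ) : ZMod (P.ℓ ^ P.e)))
      (by norm_num) (by norm_num) (by norm_num) ?_ hℓ0 hMX ?_ hVX ?_ ?_) fun τ₆ b₆ F₆ Q₆ =>
    (productCode_runs (P := P) ?_ hM hMX).imp fun υ bυ Fυ Qυ => ?_).mono ?_
  · simpa [(hP.of_frame F₁).R, (hP.of_frame F₁).V] using hRVX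
  · simp [(hP.of_frame F₁).R, (hP.of_frame F₁).V, hV]
  · simp [(hP.of_frame F₁).n]
  · intro τ hF hτ
    have hPτ : P.Holds τ := ((hP.of_frame F₁).setReg).of_frame hF
    have e14 : τ.arr 14 = τ₁.arr 14 := hF.arr 14 rfl
    simp [hPτ.g, hPτ.V, e14, Q₁ _ hτ, Tasks.keyA, hWdef, Params.tasks]
  · exact ((hP.of_frame F₁).setReg).of_frame F₂
  · have := F₂.reg 30 rfl
    simpa [(hP.of_frame F₁).R, (hP.of_frame F₁).V] using this
  · rw [F₂.arr 9 rfl, State.setReg_arr, F₁.arr 9 rfl]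
    exact h9
  · intro idx hidx
    rw [partialTransform_zero, Q₂ idx hidx]
  · have hP₃ : P.Holds τ₃ := (((hP.of_frame F₁).setReg).of_frame F₂).of_frame F₃
    simpa [hP₃.R, hP₃.V] using hX
  · have hP₃ : P.Holds τ₃ := (((hP.of_frame F₁).setReg).of_frame F₂).of_frame F₃
    simp [hP₃.R, hP₃.V, hV]
  · have h1 := F₁.reg 9 rfl; have h2 := F₂.reg 9 rfl; have h3 := F₃.reg 9 rfl
    simp at h1 h2 h3
    simp [h1, h2, h3]
  · intro τ hF hτ
    have hP₃ : P.Holds τ₃ := (((hP.of_frame F₁).setReg).of_frame F₂).of_frame F₃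
    have hPτ : P.Holds τ := (hP₃.setReg).of_frame hF
    have e : ∀ y, y = 14 ∨ y = 4 ∨ y = 5 ∨ y = 6 → τ.arr y = τ₁.arr y := by
      rintro y (rfl | rfl | rfl | rfl) <;>
        exact (hF.arr _ rfl).trans ((F₃.arr _ rfl).trans (F₂.arr _ rfl))
    have e4 : τ₁.arr 4 = σ.arr 4 := F₁.arr 4 rfl
    have e5 : τ₁.arr 5 = σ.arr 5 := F₁.arr 5 rfl
    have e6 : τ₁.arr 6 = σ.arr 6 := F₁.arr 6 rfl
    have hz : σ.arr 4 (τ.reg 33) < P.n := hW.wz_lt _ hτ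
    simp [hPτ.R, hPτ.V, e, e4, e5, e6, Q₁ _ hz, Tasks.keyC, hWdef, Params.tasks]
  · exact ((((hP.of_frame F₁).setReg).of_frame F₂).of_frame F₃).setReg.of_frame F₄
  · rw [F₄.arr 8 rfl, State.setReg_arr, F₃.arr 8 rfl, F₂.arr 8 rfl, State.setReg_arr,
      F₁.arr 8 rfl]
    exact h8
  · rw [F₄.arr 7 rfl, State.setReg_arr, F₃.arr 7 rfl, F₂.arr 7 rfl, State.setReg_arr,
      F₁.arr 7 rfl]
    exact hd
  · exact (((((hP.of_frame F₁).setReg).of_frame F₂).of_frame F₃).setReg.of_frame F₄).of_frame F₅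
  · have hP₃ : P.Holds τ₃ := (((hP.of_frame F₁).setReg).of_frame F₂).of_frame F₃
    have h4 := F₄.reg 30 rfl; have h5 := F₅.reg 30 rfl
    simp [hP₃.R, hP₃.V] at h4 h5
    rw [h5, h4]
  · exact Q₅
  · intro idx hidx
    rw [partialTransform_zero, F₅.arr 12 rfl, Q₄ idx hidx]
  · exact ((((((hP.of_frame F₁).setReg).of_frame F₂).of_frame F₃).setReg.of_frame
      F₄).of_frame F₅).of_frame F₆
  · obtain ⟨Q1, Q2⟩ := Qυ
    have e11 : τ₆.arr 11 = τ₃.arr 11 := (F₆.arr 11 rfl).trans ((F₅.arr 11 rfl).trans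
      (F₄.arr 11 rfl))
    have key := W.collisions_eq_sum hW (e := P.e) hℓ he hd' (inv_mul_eq_one hℓ.two_le)
    have hbd : ∀ i j v, i < P.R → j < P.R → v < V →
        i * V + v < P.R * V ∧ j * V + v < P.R * V ∧ (i * P.R + j) * V + v < P.R * P.R * V := by
      intro i j v hi hj hv
      have h1 : (i + 1) * V ≤ P.R * V := Nat.mul_le_mul_right _ hi
      have h2 : (j + 1) * V ≤ P.R * V := Nat.mul_le_mul_right _ hj
      have h3 : (i * P.R + j + 1) * V ≤ P.R * P.R * V := Nat.mul_le_mul_right _ (by nlinarith)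
      rw [Nat.succ_mul] at h1 h2 h3
      exact ⟨by omega, by omega, by omega⟩
    have : (υ.reg 14 : ZMod (P.ℓ ^ P.e)) = (W.collisions (2 * P.h) d : ZMod (P.ℓ ^ P.e)) := by
      rw [Q2, ← key]
      refine sum_congr rfl fun i hi => sum_congr rfl fun j hj => sum_congr rfl fun v hv => ?_
      obtain ⟨g1, g2, g3⟩ := hbd i j v (mem_range.mp hi) (mem_range.mp hj) (mem_range.mp hv)
      rw [e11, Q₃ _ g1, Q₃ _ g2, Q₆ _ g3]
      rfl
    -- Both numbers are smaller than ℓ^e, so equal residues are equal numbers.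
    rw [ZMod.natCast_eq_natCast_iff', Nat.mod_eq_of_lt Q1, Nat.mod_eq_of_lt hcoll] at this
    exact this
  · have h1 : P.R * V * (P.ℓ * 103 + 800) ≤ P.R * P.R * V * (P.ℓ * 103 + 800) := by
      gcongr
      exact Nat.le_mul_of_pos_left _ hR
    have h2 : P.R * V ≤ P.R * P.R * V := by
      gcongr
      exact Nat.le_mul_of_pos_left _ hR
    have h3 : P.R ≤ P.R * P.R := Nat.le_mul_of_pos_left _ hR
    rw [Params.countTime, ← hV]
    have h4 : 2 * P.h * (P.R * V * (P.ℓ * 103 + 800) + 200) ≤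
      2 * P.h * (P.R * P.R * V * (P.ℓ * 103 + 800) + 200) := by gcongr
    nlinarith

end ThreeSum

namespace ThreeSum

open Finset RAM RAM.Expr

/-! ### Choosing the hash functions -/

/-- Choose the moduli in array `7` one after the other, each one so as to minimize the number of
solutions, which is stored in register `14`. -/
def greedyCode : Program :=
  forLoop 28 10 (write 7 (reg 28) 1) ;;
  forLoop 28 10 (assign 16 0 ;; assign 17 1 ;;
    forLoop 29 2 (write 7 (reg 28) (reg 29 + 1) ;; countCode ;;
      ite (reg 29) 1 (assign 16 (reg 14) ;; assign 17 (reg 29 + 1))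
        (ite (reg 14) (reg 16) (assign 16 (reg 14) ;; assign 17 (reg 29 + 1)) .skip)) ;;
    write 7 (reg 28) (reg 17)) ;;
  countCode

-- The greedy choice derandomizes the averaging over primes. All numbers from 1 to D are tried as
-- moduli: the minimum over all of them is at most the minimum over the primes, so no primality test
-- is needed. Each trial is one call of `countCode`.
set_option maxRecDepth 4000 in
theorem greedyCode_runs {𝔐 : Machine} {σ : State} {P : Params} (hP : P.Holds σ)
    (hD : 2 ≤ P.D) (hDℓ : 2 * P.D < P.ℓ) (hℓ : P.ℓ.Prime)
    (he : 1 ≤ P.e) (hW : (P.tasks σ).Valid) (hMX : P.ℓ ^ P.e ≤ 𝔐.X)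
    (hX : P.R * P.R * P.ℓ ^ (2 * P.h) ≤ 𝔐.X) (hX1 : 2 * P.h * P.ℓ * P.ℓ ≤ 𝔐.X)
    (hX2 : 2 * P.ℓ * P.ℓ ≤ 𝔐.X) (h8 : PowersAt P.ℓ P.e (σ.arr 8))
    (h9 : MatAt P.ℓ P.e (2 * P.h) (fun _ y x => root P.ℓ P.e y ^ x) (σ.arr 9)) (hR : 1 ≤ P.R)
    (hcoll : σ.reg 9 * (P.g * P.g) < P.ℓ ^ P.e) :
    Runs 𝔐 greedyCode σ (2 * P.h * (P.D * (P.countTime (σ.reg 9) + 1000) + 1000) +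
        P.countTime (σ.reg 9) + 10)
      (fun τ => (∀ t < 2 * P.h, 1 ≤ τ.arr 7 t ∧ τ.arr 7 t ≤ P.D) ∧
        τ.reg 14 = (P.tasks σ).collisions (2 * P.h) (τ.arr 7) ∧
        ∀ B, (P.tasks σ).NoSolution → (∀ x < P.n, 2 * σ.arr 1 x < 2 ^ B) →
          Nat.primeCounting P.D ^ (2 * P.h) * τ.reg 14 ≤
            B ^ (2 * P.h) * (σ.reg 9 * (P.g * P.g))) := by
  have hX0 := 𝔐.two_le
  set W := P.tasks σ with hWdef
  set CT := P.countTime (σ.reg 9) with hCT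
  -- The trivial bound N g² holds for all moduli, so each count in the search is determined by its
  -- residue.
  have hcl : ∀ d, W.collisions (2 * P.h) d < P.ℓ ^ P.e := fun d =>
    (W.collisions_le hW _ d).trans_lt hcoll
  have hℓX : P.ℓ ≤ 𝔐.X := by
    refine le_trans ?_ hX2
    nlinarith [hℓ.pos]
  -- counting for any admissible choice of moduli
  have hcount : ∀ τ : State, P.Holds τ → P.tasks τ = W → τ.reg 9 = σ.reg 9 →
      τ.arr 8 = σ.arr 8 → τ.arr 9 = σ.arr 9 →
      (∀ t < 2 * P.h, 1 ≤ τ.arr 7 t ∧ τ.arr 7 t ≤ P.D) →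
      Runs 𝔐 countCode τ CT (fun υ => υ.reg 14 = W.collisions (2 * P.h) (τ.arr 7)) := by
    intro τ h1 h2 h3 h4 h5 h6
    rw [hCT, ← h3, ← h2]
    refine countCode_runs h1 rfl (fun t ht => ⟨(h6 t ht).1, ?_⟩) hℓ he (h2 ▸ hW) hMX hX hX1 hX2
      (h4 ▸ h8) (h5 ▸ h9) hR (by rw [h2]; exact hcl _)
    have := (h6 t ht).2
    omega
  -- All moduli start as 1, which imposes no condition. After j choices the invariant is count ≤ (B
  -- / π(D))^j N g², stated without division.
  refine (Runs.seq (Runs.forLoop (B := 2 * P.h) (c := 200)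
    (fun j τ => ∀ t < j, τ.arr 7 t = 1) (by simp [hP.k])
    (by simp) ?_ (fun τ _ _ _ h => h)) fun υ hb hF hυ =>
    Runs.seq (Runs.forLoop (B := 2 * P.h) (c := P.D * (CT + 803) + 402)
    (fun j τ => (∀ t < 2 * P.h, 1 ≤ τ.arr 7 t ∧ τ.arr 7 t ≤ P.D) ∧
      (∀ t < 2 * P.h, j ≤ t → τ.arr 7 t = 1) ∧
      ∀ B, W.NoSolution → (∀ x < P.n, 2 * σ.arr 1 x < 2 ^ B) →
        Nat.primeCounting P.D ^ j * W.collisions (2 * P.h) (τ.arr 7) ≤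
          B ^ j * (σ.reg 9 * (P.g * P.g))) (by simp [(hP.of_frame hF).k])
    ?_ ?_ (fun τ _ _ _ h => h)) fun ρ hb' hF' hρ => ?_).mono (t := 2 * P.h * 203 + 2 +
      (2 * P.h * (P.D * (CT + 803) + 402 + 3) + 2 + CT)) ?_
  · intro j hj τ hb hF hτ hI
    refine Runs.write (by simp; omega) ?_
    simp [hτ]
    intro z hz
    rcases Nat.lt_or_eq_of_le hz with h | rfl
    · rw [Function.update_of_ne h.ne]
      exact hI z h
    · rw [Function.update_self]
  · refine ⟨fun t ht => ?_, fun t ht _ => hυ t ht, fun B _ _ => ?_⟩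
    · simp only [State.setReg_arr]
      rw [hυ t ht]; omega
    · simp only [pow_zero, one_mul]
      exact W.collisions_le hW _ _
  · intro j hj τ hbτ hFτ hτ ⟨hI1, hI2, hI3⟩
    have hPτ : P.Holds τ := (hP.of_frame hF).of_frame hFτ
    have hWτ : P.tasks τ = W := (P.tasks_eq_of_frame hFτ).trans (P.tasks_eq_of_frame hF)
    have e9 : τ.reg 9 = σ.reg 9 := (hFτ.reg 9 rfl).trans (hF.reg 9 rfl)
    have a8 : τ.arr 8 = σ.arr 8 := (hFτ.arr 8 rfl).trans (hF.arr 8 rfl)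
    have a9 : τ.arr 9 = σ.arr 9 := (hFτ.arr 9 rfl).trans (hF.arr 9 rfl)
    refine (Runs.assign_seq (by simp) <| Runs.assign_seq (by simp; omega) <|
      Runs.seq (Runs.forLoop (B := P.D) (c := CT + 800)
      (fun i υ => (∀ t ≠ j, υ.arr 7 t = τ.arr 7 t) ∧ (0 < i → 1 ≤ υ.reg 17 ∧ υ.reg 17 ≤ i ∧
        υ.reg 16 = W.collisions (2 * P.h) (Function.update (τ.arr 7) j (υ.reg 17))) ∧
        ∀ p, 1 ≤ p → p ≤ i →
          υ.reg 16 ≤ W.collisions (2 * P.h) (Function.update (τ.arr 7) j p))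
      (by simp [hPτ.D]) ?_ ?_ (fun τ _ _ _ h => h)) fun υ hbυ hFυ hυ => Runs.write ?_ ?_).mono
      (t := 100 + (100 + (P.D * (CT + 800 + 3) + 2 + 200))) (le_of_eq (by ring))
    · simp
    · intro i hi ρ hbρ hFρ hρ ⟨hJ1, hJ2, hJ3⟩
      have hPρ : P.Holds ρ := (hPτ.setReg.setReg).of_frame hFρ
      have hWρ : P.tasks ρ = W := (P.tasks_eq_of_frame hFρ).trans hWτ
      have f9 : ρ.reg 9 = σ.reg 9 := (hFρ.reg 9 rfl).trans (by simpa using e9)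
      have f28 : ρ.reg 28 = j := (hFρ.reg 28 rfl).trans (by simpa using hτ)
      have g8 : ρ.arr 8 = σ.arr 8 := (hFρ.arr 8 rfl).trans a8
      have g9 : ρ.arr 9 = σ.arr 9 := (hFρ.arr 9 rfl).trans a9
      have hupd : Function.update (ρ.arr 7) j (i + 1) = Function.update (τ.arr 7) j (i + 1) := by
        funext t
        by_cases h : t = j
        · subst h; simp
        · simp [h, hJ1 t h]
      refine (Runs.write_seq ?_ <| Runs.seq (hcount _ hPρ.setArr (by simpa [Params.tasks] using hWρ)
        (by simpa using f9) (by simpa using g8) (by simpa using g9) ?_) fun κ hbκ hFκ hκ =>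
        Runs.ite (t := 200) (t' := max 200 1 + 200) ?_ ?_).mono ?_
      · simp [hρ]; omega
      · intro t ht
        simp only [State.setArr_arr, if_true, eval_reg, eval_add, eval_ofNat, f28, hρ, hupd]
        by_cases h : t = j
        · subst h; simp; omega
        · simpa [h] using hI1 t ht
      any_goals
        simp only [State.setArr_arr, if_true, eval_reg, eval_add, eval_ofNat, f28, hρ, hupd] at hκ
        have k29 : κ.reg 29 = i := (hFκ.reg 29 rfl).trans (by simpa using hρ)
        have k7 : κ.arr 7 = Function.update (τ.arr 7) j (i + 1) := (hFκ.arr 7 rfl).trans (by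
          simp [f28, hρ, hupd])
        have k16 : κ.reg 16 = ρ.reg 16 := (hFκ.reg 16 rfl).trans (by simp)
        have k17 : κ.reg 17 = ρ.reg 17 := (hFκ.reg 17 rfl).trans (by simp)
      · intro hlt
        simp [k29] at hlt
        subst hlt
        refine (Runs.assign_seq (by simpa using hbκ.1 14) <| Runs.assign (by simp [k29]; omega) ?_)
        simp [k29, k7, hκ]
        refine ⟨fun t ht => by simp [ht], fun p h1 h2 => ?_⟩
        have : p = 1 := by omega
        subst this; rfl
      · intro h0
        simp [k29] at h0
        refine Runs.ite (fun hlt => ?_) fun hlt => ?_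
        · simp [hκ, k16] at hlt
          refine (Runs.assign_seq (by simpa using hbκ.1 14) <|
            Runs.assign (by simp [k29]; omega) ?_)
          simp [k29, k7, hκ]
          refine ⟨fun t ht => by simp [ht], fun p h1 h2 => ?_⟩
          rcases Nat.lt_or_eq_of_le h2 with h | rfl
          · exact hlt.le.trans (hJ3 p h1 (by omega))
          · rfl
        · simp [hκ, k16] at hlt
          refine Runs.skip ?_
          simp [k7, k16, k17]
          refine ⟨fun t ht => by simp [ht], ⟨(hJ2 (by omega)).1, ?_, (hJ2 (by omega)).2.2⟩,
            fun p h1 h2 => ?_⟩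
          · have := (hJ2 (by omega)).2.1; omega
          · rcases Nat.lt_or_eq_of_le h2 with h | rfl
            · exact hJ3 p h1 (by omega)
            · exact hlt
      · simp; omega
    · simpa using hbυ.1 17
    · obtain ⟨hK1, hK2, hK3⟩ := hυ
      obtain ⟨hK4, hK5, hK6⟩ := hK2 (by omega)
      have f28 : υ.reg 28 = j := (hFυ.reg 28 rfl).trans (by simpa using hτ)
      have hupd : Function.update (υ.arr 7) j (υ.reg 17) =
          Function.update (τ.arr 7) j (υ.reg 17) := by
        funext t
        by_cases h : t = j
        · subst h; simp
        · simp [h, hK1 t h]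
      simp [f28, hupd]
      refine ⟨fun t ht => ?_, fun t ht hjt => ?_, fun B hno hB => ?_⟩
      · by_cases h : t = j
        · subst h; simp; omega
        · simpa [h] using hI1 t ht
      · rw [Function.update_of_ne (by omega)]
        exact hI2 t ht (by omega)
      -- The chosen modulus is at least as good as the prime found by averaging.
      · obtain ⟨p, h1, h2, h3⟩ := W.exists_update_le hno hj (hI2 j hj le_rfl) hD hW.wz_lt hB
        have h4 := hI3 B hno hB
        have h5 := hK3 p h1 h2
        rw [hK6] at h5
        calc _ = Nat.primeCounting P.D ^ j * (Nat.primeCounting P.D * _) := by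
              rw [pow_succ, mul_assoc]
          _ ≤ Nat.primeCounting P.D ^ j * (B * W.collisions (2 * P.h) (τ.arr 7)) := by
              refine Nat.mul_le_mul_left _ ((Nat.mul_le_mul_left _ h5).trans h3)
          _ = B * (Nat.primeCounting P.D ^ j * W.collisions (2 * P.h) (τ.arr 7)) := by ring
          _ ≤ B * (B ^ j * (σ.reg 9 * (P.g * P.g))) := Nat.mul_le_mul_left _ h4
          _ = _ := by ring
  · obtain ⟨hI1, hI2, hI3⟩ := hρ
    refine (hcount ρ ((hP.of_frame hF).of_frame hF') ((P.tasks_eq_of_frame hF').trans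
      (P.tasks_eq_of_frame hF)) ((hF'.reg 9 rfl).trans (hF.reg 9 rfl))
      ((hF'.arr 8 rfl).trans (hF.arr 8 rfl)) ((hF'.arr 9 rfl).trans (hF.arr 9 rfl)) hI1).imp
      fun κ hbκ hFκ hκ => ?_
    have k7 : κ.arr 7 = ρ.arr 7 := hFκ.arr 7 rfl
    rw [k7, hκ]
    exact ⟨hI1, rfl, hI3⟩
  · have h1 : P.D * (CT + 803) ≤ P.D * (CT + 1000) := Nat.mul_le_mul_left _ (by omega)
    have h2 : 2 * P.h * (P.D * (CT + 803) + 402 + 3) + 2 * P.h * 203 ≤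
        2 * P.h * (P.D * (CT + 1000) + 1000) := by
      rw [← Nat.mul_add]
      exact Nat.mul_le_mul_left _ (by omega)
    omega

end ThreeSum

/-! ### Lists without repetitions -/

namespace List

variable {α β : Type*} [DecidableEq α]

/-- Append an element unless it is in the list already. -/
def insertNew (l : List α) (a : α) : List α := if a ∈ l then l else l ++ [a]

/-- The list of the first occurrences of the elements. -/
def distinct (l : List α) : List α := l.foldl insertNew []

@[simp] theorem distinct_nil : distinct ([] : List α) = [] := rfl

/-- The recursion at the end of the list mirrors the machine, which appends an element when it
occurs for the first time. -/
theorem distinct_concat (l : List α) (a : α) : (l ++ [a]).distinct = l.distinct.insertNew a := by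
  simp [distinct]

@[simp] theorem mem_distinct {l : List α} {a : α} : a ∈ l.distinct ↔ a ∈ l := by
  induction l using List.reverseRecOn generalizing a with
  | nil => simp
  | append_singleton l b ih =>
    rw [distinct_concat, insertNew]
    split_ifs with h
    · rw [ih] at h
      simp only [ih, mem_append, mem_singleton]
      exact ⟨Or.inl, fun h' => h'.elim id fun h'' => h'' ▸ h⟩
    · simp [ih]

theorem nodup_distinct (l : List α) : l.distinct.Nodup := by
  induction l using List.reverseRecOn with
  | nil => simp
  | append_singleton l b ih =>
    rw [distinct_concat, insertNew]
    split_ifs with h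
    · exact ih
    · exact ih.append (by simp) (by simpa using h)

theorem length_distinct_le (l : List α) : l.distinct.length ≤ l.length := by
  induction l using List.reverseRecOn with
  | nil => simp
  | append_singleton l b ih =>
    rw [distinct_concat, insertNew]
    split_ifs <;> simp <;> omega

theorem sum_map_distinct_le (l : List α) (f : α → ℕ) :
    (l.distinct.map f).sum ≤ (l.map f).sum := by
  induction l using List.reverseRecOn with
  | nil => simp
  | append_singleton l b ih =>
    rw [distinct_concat, insertNew]
    split_ifs <;> simp <;> omega

end List

namespace ThreeSum.Tasks

open Finset

/-! ### The instance of Set Intersection -/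

/-- The element that represents the entry `x` in the set `i`. -/
def code (W : Tasks) (ℓ h : ℕ) (d : ℕ → ℕ) (i x : ℕ) : ℕ :=
  hash ℓ (2 * h) d (i / ℓ ^ h / W.R) (i % ℓ ^ h * (i / ℓ ^ h / W.R * (ℓ ^ h - 1) + 1)) (W.L x) + 1

/-- The first `t` indices of entries in the block that belongs to the set `i`. -/
def block (W : Tasks) (ℓ h i t : ℕ) : List ℕ :=
  ((List.range t).map fun s => i / ℓ ^ h % W.R * W.g + s).filter (· < W.n)

/-- The elements of the set `i` that represent the first `t` entries of the block. -/
def members (W : Tasks) (ℓ h : ℕ) (d : ℕ → ℕ) (i t : ℕ) : List ℕ :=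
  ((W.block ℓ h i t).map (W.code ℓ h d i)).distinct

/-- The indices among the first `t` entries of the block that are represented by `u`. -/
def bucket (W : Tasks) (ℓ h : ℕ) (d : ℕ → ℕ) (i t u : ℕ) : List ℕ :=
  (W.block ℓ h i t).filter fun x => W.code ℓ h d i x = u

/-- The query for a task. -/
def pair (W : Tasks) (ℓ h : ℕ) (d : ℕ → ℕ) (m : ℕ) : ℕ × ℕ :=
  (W.wi m * ℓ ^ h + hash ℓ (2 * h) d 1 0 (W.L (W.wz m)) % ℓ ^ h,
    (W.R + W.wj m) * ℓ ^ h + hash ℓ (2 * h) d 0 0 (W.L (W.wz m)) / ℓ ^ h)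

/-- The queries for the first `j` tasks. -/
def pairs (W : Tasks) (ℓ h : ℕ) (d : ℕ → ℕ) (j : ℕ) : List (ℕ × ℕ) :=
  ((List.range j).map (W.pair ℓ h d)).distinct

theorem mem_block {W : Tasks} (hg : 0 < W.g) {ℓ h i x : ℕ} :
    x ∈ W.block ℓ h i W.g ↔ x < W.n ∧ x / W.g = i / ℓ ^ h % W.R := by
  simp only [block, List.mem_filter, List.mem_map, List.mem_range, decide_eq_true_eq]
  constructor
  · rintro ⟨⟨s, hs, rfl⟩, h2⟩
    refine ⟨h2, ?_⟩
    rw [mul_comm, Nat.mul_add_div hg, Nat.div_eq_of_lt hs, add_zero]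
  · rintro ⟨h1, h2⟩
    refine ⟨⟨x % W.g, Nat.mod_lt _ hg, ?_⟩, h1⟩
    rw [← h2, mul_comm]
    exact Nat.div_add_mod x W.g

theorem length_block_le (W : Tasks) (ℓ h i t : ℕ) : (W.block ℓ h i t).length ≤ t := by
  refine (List.length_filter_le _ _).trans (by simp)

theorem length_members_le (W : Tasks) (ℓ h : ℕ) (d : ℕ → ℕ) (i t : ℕ) :
    (W.members ℓ h d i t).length ≤ t :=
  (List.length_distinct_le _).trans (by simpa using W.length_block_le ℓ h i t)

theorem mem_members {W : Tasks} {ℓ h : ℕ} {d : ℕ → ℕ} {i t u : ℕ} :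
    u ∈ W.members ℓ h d i t ↔ ∃ x ∈ W.block ℓ h i t, W.code ℓ h d i x = u := by
  simp [members]

theorem nodup_members (W : Tasks) (ℓ h : ℕ) (d : ℕ → ℕ) (i t : ℕ) :
    (W.members ℓ h d i t).Nodup := List.nodup_distinct _

theorem code_mem_Icc (W : Tasks) {ℓ h : ℕ} {d : ℕ → ℕ} (hd : ∀ t < 2 * h, 1 ≤ d t ∧ d t ≤ ℓ)
    (i x : ℕ) : 1 ≤ W.code ℓ h d i x ∧ W.code ℓ h d i x ≤ ℓ ^ (2 * h) :=
  ⟨Nat.le_add_left _ _, hash_lt hd _ _ _⟩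

theorem _root_.ThreeSum.hash_div_lt {ℓ h : ℕ} {d : ℕ → ℕ} (hd : ∀ t < 2 * h, 1 ≤ d t ∧ d t ≤ ℓ)
    (b sh x : ℕ) : hash ℓ (2 * h) d b sh x / ℓ ^ h < ℓ ^ h := by
  refine Nat.div_lt_of_lt_mul ?_
  rw [← pow_add, ← two_mul]
  exact hash_lt hd _ _ _

section Pair

variable {W : Tasks} {ℓ h : ℕ} {d : ℕ → ℕ} {m : ℕ}

theorem pair_fst_div (hℓ : 0 < ℓ) : (W.pair ℓ h d m).1 / ℓ ^ h = W.wi m := by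
  have hH : 0 < ℓ ^ h := pow_pos hℓ h
  rw [pair, mul_comm, Nat.mul_add_div hH, Nat.div_eq_of_lt (Nat.mod_lt _ hH), add_zero]

theorem pair_fst_mod : (W.pair ℓ h d m).1 % ℓ ^ h =
    hash ℓ (2 * h) d 1 0 (W.L (W.wz m)) % ℓ ^ h := by
  rw [pair, mul_comm, Nat.mul_add_mod, Nat.mod_mod]

theorem pair_snd_div (hℓ : 0 < ℓ) (hd : ∀ t < 2 * h, 1 ≤ d t ∧ d t ≤ ℓ) :
    (W.pair ℓ h d m).2 / ℓ ^ h = W.R + W.wj m := by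
  have hH : 0 < ℓ ^ h := pow_pos hℓ h
  rw [pair]
  dsimp only
  rw [mul_comm, Nat.mul_add_div hH, Nat.div_eq_of_lt (hash_div_lt hd _ _ _), add_zero]

theorem pair_snd_mod (hd : ∀ t < 2 * h, 1 ≤ d t ∧ d t ≤ ℓ) : (W.pair ℓ h d m).2 % ℓ ^ h =
    hash ℓ (2 * h) d 0 0 (W.L (W.wz m)) / ℓ ^ h := by
  rw [pair]
  dsimp only
  rw [mul_comm, Nat.mul_add_mod, Nat.mod_eq_of_lt (hash_div_lt hd _ _ _)]

theorem pair_lt (hℓ : 0 < ℓ) (hd : ∀ t < 2 * h, 1 ≤ d t ∧ d t ≤ ℓ) (hi : W.wi m < W.R)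
    (hj : W.wj m < W.R) : (W.pair ℓ h d m).1 < 2 * W.R * ℓ ^ h ∧
      (W.pair ℓ h d m).2 < 2 * W.R * ℓ ^ h := by
  have hH : 0 < ℓ ^ h := pow_pos hℓ h
  rw [← Nat.div_lt_iff_lt_mul hH, ← Nat.div_lt_iff_lt_mul hH, pair_fst_div hℓ, pair_snd_div hℓ hd]
  omega

/-- For d ≥ 2 the factor is d - 1, which represents -1. For d = 1 truncation makes it 1, and all
congruences are trivial. The first half serves the low digits, where -c shifts x, and the second the
high digits, where c shifts -y. -/
theorem mod_eq_neg_iff {d a b c : ℕ} (hd : 1 ≤ d) :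
    ((a + c * (d - 2 + 1)) % d = b * (d - 2 + 1) % d ↔ (a + b) % d = c % d) ∧
      (a % d = (b * (d - 2 + 1) + c) % d ↔ (a + b) % d = c % d) := by
  rcases Nat.lt_or_ge 1 d with h | h
  · have e : ((d - 2 + 1 : ℕ) : ZMod d) = -1 := by
      have : d - 2 + 1 = d - 1 := by omega
      rw [this, Nat.cast_sub hd, ZMod.natCast_self]; simp
    change (_ ≡ _ [MOD d] ↔ _ ≡ _ [MOD d]) ∧ (_ ≡ _ [MOD d] ↔ _ ≡ _ [MOD d])
    simp only [← ZMod.natCast_eq_natCast_iff, Nat.cast_add, Nat.cast_mul, Nat.cast_one] at e ⊢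
    rw [e]
    refine ⟨⟨fun h => ?_, fun h => ?_⟩, fun h => ?_, fun h => ?_⟩ <;> linear_combination h
  · have : d = 1 := by omega
    subst this
    simp [Nat.mod_one]

/-- The entries `x` and `y` are represented by the same element if and only if they solve the task
modulo `d 0, …, d (2 h - 1)`. -/
theorem code_pair_eq_iff (hℓ : 0 < ℓ) (hd : ∀ t < 2 * h, 1 ≤ d t ∧ d t ≤ ℓ) (hi : W.wi m < W.R)
    (hj : W.wj m < W.R) {x y : ℕ} :
    W.code ℓ h d (W.pair ℓ h d m).1 x = W.code ℓ h d (W.pair ℓ h d m).2 y ↔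
      ∀ t < 2 * h, (W.L x + W.L y) % d t = W.L (W.wz m) % d t := by
  have hH : 0 < ℓ ^ h := pow_pos hℓ h
  have hR : 0 < W.R := by omega
  have e1 : W.wi m / W.R = 0 := Nat.div_eq_of_lt hi
  have e2 : (W.R + W.wj m) / W.R = 1 := by
    rw [Nat.add_div_left _ hR, Nat.div_eq_of_lt hj]
  rw [code, code, pair_fst_div hℓ, pair_fst_mod, pair_snd_div hℓ hd, pair_snd_mod hd, e1, e2,
    Nat.add_right_cancel_iff]
  have e3 : 1 * (ℓ ^ h - 1) + 1 = ℓ ^ h := by omega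
  rw [e3, zero_mul, zero_add, mul_one]
  set c := W.L (W.wz m) with hc
  -- Digit by digit exactly one side is shifted: below h the set of x by the residue of -c, from h
  -- on the set of -y by the residue of c. The remaining shift digits are zero.
  have key : ∀ t < 2 * h, digit ℓ t (hash ℓ (2 * h) d 0 (hash ℓ (2 * h) d 1 0 c % ℓ ^ h) (W.L x)) =
      digit ℓ t (hash ℓ (2 * h) d 1 (hash ℓ (2 * h) d 0 0 c / ℓ ^ h * ℓ ^ h) (W.L y)) ↔
      (W.L x + W.L y) % d t = c % d t := by
    intro t ht
    rw [digit_hash hd _ _ _ ht, digit_hash hd _ _ _ ht]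
    have hdt := (hd t ht).1
    rcases Nat.lt_or_ge t h with hth | hth
    · rw [digit_mod_pow hth, digit_mul_pow_of_lt hth, digit_hash hd _ _ _ ht, digit_zero_right]
      simpa using (mod_eq_neg_iff (a := W.L x) (b := W.L y) (c := c) hdt).1
    · have h0 : digit ℓ t (hash ℓ (2 * h) d 1 0 c % ℓ ^ h) = 0 :=
        digit_eq_zero_of_lt ((Nat.mod_lt _ hH).trans_le (Nat.pow_le_pow_right hℓ hth))
      rw [h0, digit_div_mul_pow hℓ hth, digit_hash_zero hd _ ht]
      simpa using (mod_eq_neg_iff (a := W.L x) (b := W.L y) (c := c) hdt).2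
  constructor
  · intro heq t ht
    rw [← key t ht, heq]
  · intro hall
    exact eq_of_digit_eq hℓ (hash_lt hd _ _ _) (hash_lt hd _ _ _) fun t ht =>
      (key t ht).mpr (hall t ht)

theorem nodup_block (W : Tasks) (ℓ h i t : ℕ) : (W.block ℓ h i t).Nodup :=
  (List.nodup_range.map fun a b hab => by simpa using hab).filter _

-- An entry x lies in one bucket only, and if its image is a common element, some y has the same
-- image, so (x, y) is a hit by `code_pair_eq_iff`. The work of examining all buckets of an answer
-- is therefore bounded by the hits of the task.
open Classical in
theorem sum_bucket_le (hW : W.Valid) (hℓ : 0 < ℓ) (hd : ∀ t < 2 * h, 1 ≤ d t ∧ d t ≤ ℓ)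
    (hm : m < W.N) :
    ∑ u ∈ (W.members ℓ h d (W.pair ℓ h d m).1 W.g).toFinset ∩
        (W.members ℓ h d (W.pair ℓ h d m).2 W.g).toFinset,
      (W.bucket ℓ h d (W.pair ℓ h d m).1 W.g u).length ≤
    ∑ x ∈ range W.n, ∑ y ∈ range W.n, if W.Hit (2 * h) d m x y then 1 else 0 := by
  have hi := hW.wi_lt m hm
  have hj := hW.wj_lt m hm
  have hR : 0 < W.R := by omega
  set p := W.pair ℓ h d m with hp
  set A := (W.members ℓ h d p.1 W.g).toFinset ∩ (W.members ℓ h d p.2 W.g).toFinset with hA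
  set B := (W.block ℓ h p.1 W.g).toFinset with hB
  have h1 : ∀ u ∈ A, (W.bucket ℓ h d p.1 W.g u).length = #{x ∈ B | W.code ℓ h d p.1 x = u} := by
    intro u _
    rw [bucket, ← List.toFinset_card_of_nodup ((W.nodup_block ℓ h p.1 W.g).filter _),
      List.toFinset_filter]
    simp [hB]
  rw [sum_congr rfl h1]
  -- The buckets are the disjoint fibres of `code` over the common elements.
  have h2 : ∑ u ∈ A, #{x ∈ B | W.code ℓ h d p.1 x = u} =
      #{x ∈ B | W.code ℓ h d p.1 x ∈ A} := by
    refine Eq.symm ((card_eq_sum_card_fiberwise (s := {x ∈ B | W.code ℓ h d p.1 x ∈ A})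
      (f := W.code ℓ h d p.1) (t := A) fun x hx => (mem_filter.mp hx).2).trans ?_)
    refine sum_congr rfl fun u hu => ?_
    congr 1
    ext x
    simp only [mem_filter]
    constructor
    · rintro ⟨⟨h3, _⟩, h4⟩; exact ⟨h3, h4⟩
    · rintro ⟨h3, rfl⟩; exact ⟨⟨h3, hu⟩, rfl⟩
  rw [h2]
  have hBn : {x ∈ B | W.code ℓ h d p.1 x ∈ A} ⊆ range W.n := by
    intro x hx
    simp only [hB, mem_filter, List.mem_toFinset, mem_block hW.g_pos] at hx
    exact mem_range.mpr hx.1.1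
  rw [card_eq_sum_ones]
  refine le_trans (sum_le_sum fun x hx => ?_) (sum_le_sum_of_subset hBn)
  simp only [hB, hA, mem_filter, mem_inter, List.mem_toFinset, mem_members,
    mem_block hW.g_pos] at hx
  obtain ⟨⟨h3, h4⟩, _, y, ⟨h5, h6⟩, h7⟩ := hx
  rw [hp, pair_fst_div hℓ, Nat.mod_eq_of_lt hi] at h4
  rw [hp, pair_snd_div hℓ hd, Nat.add_mod_left, Nat.mod_eq_of_lt hj] at h6
  have hhit : W.Hit (2 * h) d m x y := ⟨h4, h6, (code_pair_eq_iff hℓ hd hi hj).mp h7.symm⟩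
  calc 1 = if W.Hit (2 * h) d m x y then 1 else 0 := by rw [if_pos hhit]
    _ ≤ _ := single_le_sum (f := fun y => if W.Hit (2 * h) d m x y then 1 else 0)
      (fun _ _ => Nat.zero_le _) (mem_range.mpr h5)

/-- Completeness: a true solution is a hit for any moduli, so its x is found in the bucket of a
reported element. -/
theorem exists_of_hit (hW : W.Valid) (hℓ : 0 < ℓ) (hd : ∀ t < 2 * h, 1 ≤ d t ∧ d t ≤ ℓ)
    (hm : m < W.N) {x y : ℕ} (hx : x < W.n) (hy : y < W.n) (hh : W.Hit (2 * h) d m x y) :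
    ∃ u, u ∈ W.members ℓ h d (W.pair ℓ h d m).1 W.g ∧
      u ∈ W.members ℓ h d (W.pair ℓ h d m).2 W.g ∧
      x ∈ W.bucket ℓ h d (W.pair ℓ h d m).1 W.g u := by
  have hi := hW.wi_lt m hm
  have hj := hW.wj_lt m hm
  obtain ⟨h1, h2, h3⟩ := hh
  have hxb : x ∈ W.block ℓ h (W.pair ℓ h d m).1 W.g := by
    rw [mem_block hW.g_pos, pair_fst_div hℓ, Nat.mod_eq_of_lt hi]
    exact ⟨hx, h1⟩
  have hyb : y ∈ W.block ℓ h (W.pair ℓ h d m).2 W.g := by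
    rw [mem_block hW.g_pos, pair_snd_div hℓ hd, Nat.add_mod_left, Nat.mod_eq_of_lt hj]
    exact ⟨hy, h2⟩
  refine ⟨_, mem_members.mpr ⟨x, hxb, rfl⟩, mem_members.mpr ⟨y, hyb, ?_⟩, ?_⟩
  · exact ((code_pair_eq_iff hℓ hd hi hj).mpr h3).symm
  · simpa [bucket] using hxb

theorem one_le_length_bucket {i t u : ℕ} (hu : u ∈ W.members ℓ h d i t) :
    1 ≤ (W.bucket ℓ h d i t u).length := by
  obtain ⟨x, hx, rfl⟩ := mem_members.mp hu
  exact List.length_pos_of_mem (a := x) (by simpa [bucket] using hx)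

end Pair

/-- The instance of Set Intersection that belongs to the tasks. -/
def toSetIntersection (W : Tasks) (ℓ h : ℕ) (d : ℕ → ℕ) (hW : W.Valid) (hℓ : 0 < ℓ)
    (hd : ∀ t < 2 * h, 1 ≤ d t ∧ d t ≤ ℓ) : SetIntersection where
  U := ℓ ^ (2 * h)
  N := 2 * W.R * ℓ ^ h
  s := W.g
  S i := W.members ℓ h d i W.g
  queries := (W.pairs ℓ h d W.N).pmap (P := fun e => e.1 < 2 * W.R * ℓ ^ h ∧ e.2 < 2 * W.R * ℓ ^ h)
    (fun e he => (⟨e.1, he.1⟩, ⟨e.2, he.2⟩)) (by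
    intro e he
    simp only [pairs, List.mem_distinct, List.mem_map, List.mem_range] at he
    obtain ⟨m, hm, rfl⟩ := he
    exact pair_lt hℓ hd (hW.wi_lt m hm) (hW.wj_lt m hm))
  nodup_S i := W.nodup_members ℓ h d i W.g
  mem_S i x hx := by
    obtain ⟨y, _, rfl⟩ := mem_members.mp hx
    exact W.code_mem_Icc hd i y
  length_S i := W.length_members_le ℓ h d i W.g
  nodup_queries := by
    refine List.Nodup.pmap (fun a ha b hb hab => ?_) (List.nodup_distinct _)
    simp only [Prod.mk.injEq, Fin.mk.injEq] at hab
    exact Prod.ext hab.1 hab.2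

/-- Every common element has a nonempty bucket and is thus counted in `sum_bucket_le`. Different
tasks may lead to the same query, and removing repetitions only lowers the sum. -/
theorem outputSize_le (W : Tasks) (ℓ h : ℕ) (d : ℕ → ℕ) (hW : W.Valid) (hℓ : 0 < ℓ)
    (hd : ∀ t < 2 * h, 1 ≤ d t ∧ d t ≤ ℓ) :
    (W.toSetIntersection ℓ h d hW hℓ hd).outputSize ≤ W.collisions (2 * h) d := by
  have h1 : (W.toSetIntersection ℓ h d hW hℓ hd).outputSize = ((W.pairs ℓ h d W.N).map fun e =>
      #((W.members ℓ h d e.1 W.g).toFinset ∩ (W.members ℓ h d e.2 W.g).toFinset)).sum := by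
    refine congrArg List.sum ((List.map_pmap ..).trans ?_)
    exact List.pmap_eq_map (f := fun e : ℕ × ℕ =>
      #((W.members ℓ h d e.1 W.g).toFinset ∩ (W.members ℓ h d e.2 W.g).toFinset)) ..
  rw [h1, pairs]
  refine (List.sum_map_distinct_le _ _).trans ?_
  rw [List.map_map, ← Multiset.sum_coe, ← Multiset.map_coe, collisions]
  change ∑ m ∈ range W.N, _ ≤ _
  refine sum_le_sum fun m hm => ?_
  rw [mem_range] at hm
  refine le_trans ?_ (sum_bucket_le hW hℓ hd hm)
  rw [Function.comp, card_eq_sum_ones]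
  refine sum_le_sum fun u hu => one_le_length_bucket ?_
  simp only [mem_inter, List.mem_toFinset] at hu
  exact hu.1

theorem length_pairs_le (W : Tasks) (ℓ h : ℕ) (d : ℕ → ℕ) (j : ℕ) :
    (W.pairs ℓ h d j).length ≤ j :=
  (List.length_distinct_le _).trans (by simp)

end ThreeSum.Tasks

/-! ### Incremental description of the sets and buckets -/

namespace ThreeSum

open Finset RAM RAM.Expr

theorem update_getD_length (l : List ℕ) (v : ℕ) :
    Function.update (fun k => l.getD k 0) l.length v = fun k => (l ++ [v]).getD k 0 := by
  funext k
  rw [Function.update_apply]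
  split_ifs with h
  · subst h; simp
  · rcases Nat.lt_or_ge k l.length with h1 | h1
    · simp [List.getElem?_append_left h1, h1]
    · rw [List.getD_eq_default _ _ h1, List.getD_eq_default]
      simp; omega

namespace Tasks

variable {W : Tasks} {ℓ h : ℕ} {d : ℕ → ℕ} {i t : ℕ}

theorem block_succ_of_lt (hx : i / ℓ ^ h % W.R * W.g + t < W.n) :
    W.block ℓ h i (t + 1) = W.block ℓ h i t ++ [i / ℓ ^ h % W.R * W.g + t] := by
  simp [block, List.range_succ, hx]

theorem block_succ_of_ge (hx : ¬ i / ℓ ^ h % W.R * W.g + t < W.n) :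
    W.block ℓ h i (t + 1) = W.block ℓ h i t := by
  simp only [block, List.range_succ, List.map_append, List.filter_append, List.map_cons,
    List.map_nil, List.filter_cons, hx, decide_false, List.filter_nil]
  simp

theorem members_succ (hx : i / ℓ ^ h % W.R * W.g + t < W.n) :
    W.members ℓ h d i (t + 1) =
      (W.members ℓ h d i t).insertNew (W.code ℓ h d i (i / ℓ ^ h % W.R * W.g + t)) := by
  rw [members, block_succ_of_lt hx, List.map_append, List.map_singleton, List.distinct_concat,
    members]

theorem bucket_succ (hx : i / ℓ ^ h % W.R * W.g + t < W.n) (u : ℕ) :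
    W.bucket ℓ h d i (t + 1) u = W.bucket ℓ h d i t u ++
      if W.code ℓ h d i (i / ℓ ^ h % W.R * W.g + t) = u then [i / ℓ ^ h % W.R * W.g + t] else [] := by
  rw [bucket, block_succ_of_lt hx, List.filter_append, bucket, List.filter_cons, List.filter_nil]
  simp

theorem length_bucket_le (W : Tasks) (ℓ h : ℕ) (d : ℕ → ℕ) (i t u : ℕ) :
    (W.bucket ℓ h d i t u).length ≤ t :=
  (List.length_filter_le _ _).trans (W.length_block_le ℓ h i t)

theorem mem_members_iff_bucket {u : ℕ} :
    u ∈ W.members ℓ h d i t ↔ 0 < (W.bucket ℓ h d i t u).length := by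
  rw [List.length_pos_iff_exists_mem, mem_members]
  simp [bucket]

/-- How many entries have been put into the set `j`, when the set `i` has received `t`. -/
def progress (g i t j : ℕ) : ℕ := if j < i then g else if j = i then t else 0

/-- The elements of the sets before the set `i`. -/
def flatMembers (W : Tasks) (ℓ h : ℕ) (d : ℕ → ℕ) (i : ℕ) : List ℕ :=
  ((List.range i).map fun j => W.members ℓ h d j W.g).flatten

/-- The buckets are stored in arrays `15` and `16`. -/
structure BucketsAt (W : Tasks) (ℓ h : ℕ) (d : ℕ → ℕ) (T : ℕ → ℕ) (σ : State) : Prop where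
  cnt : ∀ j u, u ≤ ℓ ^ (2 * h) →
    σ.arr 15 (j * (ℓ ^ (2 * h) + 1) + u) = (W.bucket ℓ h d j (T j) u).length
  slots : ∀ j u k, u ≤ ℓ ^ (2 * h) → (hk : k < (W.bucket ℓ h d j (T j) u).length) →
    σ.arr 16 ((j * (ℓ ^ (2 * h) + 1) + u) * W.g + k) = (W.bucket ℓ h d j (T j) u)[k]

/-- The elements are stored in array `23`, with their number in register `16`. -/
structure ElementsAt (l : List ℕ) (σ : State) : Prop where
  pos : σ.reg 16 = l.length
  elems : σ.arr 23 = fun k => l.getD k 0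

end Tasks

/-! ### Building the sets -/

/-- Put the entry with the index in register `30` into the set in register `28`. -/
def insertCode : Program :=
  assign 20 (ld 1 (reg 30)) ;; hashCode ;;
  assign 31 (reg 28 * (reg 7 + 1) + (reg 23 + 1)) ;;
  ite (ld 15 (reg 31)) 1 (write 23 (reg 16) (reg 23 + 1) ;; assign 16 (reg 16 + 1)) .skip ;;
  write 16 (reg 31 * reg 6 + ld 15 (reg 31)) (reg 30) ;;
  write 15 (reg 31) (ld 15 (reg 31) + 1)

/-- Two-dimensional tables have rows of length V + 1, because elements run from 1 to V. This is the
injectivity of their addresses. -/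
theorem eq_of_mul_add_eq {V j u j' u' : ℕ} (hu : u ≤ V) (hu' : u' ≤ V)
    (h : j * (V + 1) + u = j' * (V + 1) + u') : j = j' ∧ u = u' := by
  have h1 : (j * (V + 1) + u) / (V + 1) = j := by
    rw [mul_comm, Nat.mul_add_div (by omega), Nat.div_eq_of_lt (by omega), add_zero]
  have h2 : (j' * (V + 1) + u') / (V + 1) = j' := by
    rw [mul_comm, Nat.mul_add_div (by omega), Nat.div_eq_of_lt (by omega), add_zero]
  rw [h, h2] at h1
  subst h1
  exact ⟨rfl, by omega⟩

/-- An element is new to its set exactly when its bucket is empty, so the bucket counters double as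
a constant-time membership test. -/
theorem insertCode_runs {𝔐 : Machine} {σ : State} {P : Params} (hP : P.Holds σ) {W : Tasks}
    (hn : W.n = P.n) (hg : W.g = P.g) (hR : W.R = P.R) (hL : σ.arr 1 = W.L) {d : ℕ → ℕ}
    (hd : σ.arr 7 = d) (hd' : ∀ t < 2 * P.h, 1 ≤ d t ∧ d t ≤ P.ℓ) (hℓ : 0 < P.ℓ) {i t : ℕ}
    {F : List ℕ} (hx : i / P.ℓ ^ P.h % P.R * P.g + t < P.n)
    (h28 : σ.reg 28 = i) (h30 : σ.reg 30 = i / P.ℓ ^ P.h % P.R * P.g + t)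
    (h21 : σ.reg 21 = i / P.ℓ ^ P.h / P.R)
    (h22 : σ.reg 22 = i % P.ℓ ^ P.h * (i / P.ℓ ^ P.h / P.R * (P.ℓ ^ P.h - 1) + 1))
    (htg : t < P.g)
    (hV : P.ℓ ^ (2 * P.h) ≤ 𝔐.X) (hX : (i + 1) * (P.ℓ ^ (2 * P.h) + 1) ≤ 𝔐.X)
    (hFX : F.length + P.g ≤ 𝔐.X)
    (hE : Tasks.ElementsAt (F ++ W.members P.ℓ P.h d i t) σ)
    (hB : W.BucketsAt P.ℓ P.h d (Tasks.progress W.g i t) σ) :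
    Runs 𝔐 insertCode σ (2 * P.h * 303 + 1302) (fun τ =>
      Tasks.ElementsAt (F ++ W.members P.ℓ P.h d i (t + 1)) τ ∧
      W.BucketsAt P.ℓ P.h d (Tasks.progress W.g i (t + 1)) τ) := by
  set V := P.ℓ ^ (2 * P.h) with hVdef
  set x := i / P.ℓ ^ P.h % P.R * P.g + t with hxdef
  set u := W.code P.ℓ P.h d i x with hu
  have hx' : i / P.ℓ ^ P.h % W.R * W.g + t < W.n := by rw [hn, hg, hR]; exact hx
  have hxe : i / P.ℓ ^ P.h % W.R * W.g + t = x := by rw [hg, hR]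
  have huV : 1 ≤ u ∧ u ≤ V := W.code_mem_Icc hd' i x
  have hprog : ∀ j, Tasks.progress W.g i (t + 1) j =
      if j = i then t + 1 else Tasks.progress W.g i t j := by
    intro j
    simp only [Tasks.progress]
    split_ifs <;> omega
  have hpi : Tasks.progress W.g i t i = t := by simp [Tasks.progress]
  have hcnt : σ.arr 15 (i * (V + 1) + u) = (W.bucket P.ℓ P.h d i t u).length := by
    have := hB.cnt i u huV.2
    rwa [hpi] at this
  have hlen : (W.bucket P.ℓ P.h d i t u).length ≤ t := W.length_bucket_le ..
  have hkey : i * (V + 1) + u ≤ 𝔐.X := by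
    rw [Nat.succ_mul] at hX; omega
  refine Runs.of_bdd fun hσb => ?_
  have hml := W.length_members_le P.ℓ P.h d i t
  refine (Runs.assign_seq (by simpa using hσb.2 1 _) <|
    Runs.seq (hashCode_runs (d := d) (x := W.L x) (b := i / P.ℓ ^ P.h / P.R)
      (sh := i % P.ℓ ^ P.h * (i / P.ℓ ^ P.h / P.R * (P.ℓ ^ P.h - 1) + 1)) hP.setReg
        (by simp [hd]) hd' hℓ hV (by simp [hL, h30]) (by simp [h21]) (by simp [h22]))
      fun τ b F₁ Q => ?_).mono (t := 100 + (2 * P.h * 303 + 202 + (100 + (500 + (200 + 200)))))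
      (by omega)
  have e23 : τ.reg 23 + 1 = u := by rw [Q, hu, Tasks.code, hR]
  have e28 : τ.reg 28 = i := (F₁.reg 28 rfl).trans (by simpa using h28)
  have e30 : τ.reg 30 = x := (F₁.reg 30 rfl).trans (by simpa using h30)
  have e7 : τ.reg 7 = V := (F₁.reg 7 rfl).trans (by simpa using hP.V)
  have e6 : τ.reg 6 = P.g := (F₁.reg 6 rfl).trans (by simpa using hP.g)
  have e16 : τ.reg 16 = (F ++ W.members P.ℓ P.h d i t).length :=
    (F₁.reg 16 rfl).trans (by simpa using hE.pos)
  have a15 : τ.arr 15 = σ.arr 15 := (F₁.arr 15 rfl).trans (by simp)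
  have a16 : τ.arr 16 = σ.arr 16 := (F₁.arr 16 rfl).trans (by simp)
  have a23 : τ.arr 23 = σ.arr 23 := (F₁.arr 23 rfl).trans (by simp)
  have e31 : τ.reg 28 * (τ.reg 7 + 1) + (τ.reg 23 + 1) = i * (V + 1) + u := by
    rw [e28, e7, e23]
  refine Runs.assign_seq (by simpa [e31] using hkey) <| Runs.seq
    (R := fun ρ => Tasks.ElementsAt (F ++ W.members P.ℓ P.h d i (t + 1)) ρ)
    ((Runs.ite (t := 300) (t' := 1) (fun hlt => ?_) fun hlt => ?_).mono (by norm_num))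
    fun ρ b' F₂ Q' => ?_
  · simp [e31, a15, hcnt] at hlt
    have hnot : u ∉ W.members P.ℓ P.h d i t := by
      rw [Tasks.mem_members_iff_bucket, hlt]; simp
    have hlist : F ++ W.members P.ℓ P.h d i (t + 1) = F ++ W.members P.ℓ P.h d i t ++ [u] := by
      rw [Tasks.members_succ hx', hxe, ← hu, List.insertNew, if_neg hnot, List.append_assoc]
    refine (Runs.write_seq (by simpa [e23] using huV.2.trans hV) <| Runs.assign ?_ ?_)
    · simp [e16]; omega
    · rw [hlist]
      refine ⟨by simp [e16, add_assoc], ?_⟩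
      simp [a23, hE.elems, e23, e16]
      have := update_getD_length (F ++ W.members P.ℓ P.h d i t) u
      simpa using this
  · simp [e31, a15, hcnt] at hlt
    have hmem : u ∈ W.members P.ℓ P.h d i t := by
      rw [Tasks.mem_members_iff_bucket]; exact List.length_pos_iff.mpr hlt
    have hlist : W.members P.ℓ P.h d i (t + 1) = W.members P.ℓ P.h d i t := by
      rw [Tasks.members_succ hx', hxe, ← hu, List.insertNew, if_pos hmem]
    rw [hlist]
    exact Runs.skip ⟨by simp [e16], by simp [a23, hE.elems]⟩
  · have f31 : ρ.reg 31 = i * (V + 1) + u := (F₂.reg 31 rfl).trans (by simpa using e31)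
    have f30 : ρ.reg 30 = x := (F₂.reg 30 rfl).trans (by simpa using e30)
    have f6 : ρ.reg 6 = P.g := (F₂.reg 6 rfl).trans (by simpa using e6)
    have b15 : ρ.arr 15 = σ.arr 15 := (F₂.arr 15 rfl).trans (by simp [a15])
    have b16 : ρ.arr 16 = σ.arr 16 := (F₂.arr 16 rfl).trans (by simp [a16])
    refine Runs.write_seq (by simpa using b'.1 30) <| Runs.write ?_ ⟨?_, ?_⟩
    · simp [f31, b15, hcnt]; omega
    · exact ⟨by simp [Q'.pos], by simp [Q'.elems]⟩
    · have hbs : ∀ j v, W.bucket P.ℓ P.h d j (Tasks.progress W.g i (t + 1) j) v =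
          W.bucket P.ℓ P.h d j (Tasks.progress W.g i t j) v ++
            if j = i ∧ v = u then [x] else [] := by
        intro j v
        rw [hprog]
        by_cases hj : j = i
        · subst hj
          rw [if_pos rfl, hpi, Tasks.bucket_succ hx', hxe, ← hu]
          congr 1
          by_cases hv : u = v
          · simp [hv]
          · simp [hv, Ne.symm hv]
        · simp [hj]
      constructor
      · intro j v hv
        simp only [← hVdef, State.setArr_arr, eval_add, eval_reg, eval_ld, eval_mul, f31, f30, f6, b15, b16,
          hbs, State.setArr_reg]
        by_cases hjv : j = i ∧ v = u
        · obtain ⟨rfl, rfl⟩ := hjv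
          simp [hpi, hcnt]
        · have hne : j * (V + 1) + v ≠ i * (V + 1) + u := fun h =>
            hjv (eq_of_mul_add_eq hv huV.2 h)
          simpa [hne, hjv] using hB.cnt j v hv
      · intro j v k hv hk
        simp only [← hVdef, State.setArr_arr, eval_add, eval_reg, eval_ld, eval_mul, f31, f30, f6, ← hg, b15, b16,
          State.setArr_reg, hcnt]
        -- No bucket holds more than g entries, so the slots reserved for different keys, g for
        -- each, do not overlap.
        have hkg : k ≤ t ∨ j ≠ i ∧ k < W.g := by
          have h1 := W.length_bucket_le P.ℓ P.h d j (Tasks.progress W.g i (t + 1) j) v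
          rw [hprog] at h1 hk
          by_cases hj : j = i
          · rw [if_pos hj] at h1 hk; left; omega
          · rw [if_neg hj] at h1 hk
            right
            refine ⟨hj, hk.trans_le (h1.trans ?_)⟩
            simp only [Tasks.progress]; split_ifs <;> omega
        have hkg' : k < W.g := by omega
        have hsplit : ∀ {a b k k' : ℕ}, k < W.g → k' < W.g → a * W.g + k = b * W.g + k' →
            a = b ∧ k = k' := by
          intro a b k k' h1 h2 h3
          have := eq_of_mul_add_eq (V := W.g - 1) (j := a) (u := k) (j' := b) (u' := k')
            (by omega) (by omega) (by rwa [Nat.sub_add_cancel (by omega)])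
          exact this
        rw [List.getElem_of_eq (hbs j v)]
        simp only [show ¬ (16 = 15) by norm_num, if_false, if_true, Function.update_apply]
        by_cases he : (j * (V + 1) + v) * W.g + k =
            (i * (V + 1) + u) * W.g + (W.bucket P.ℓ P.h d i t u).length
        · rw [if_pos he]
          obtain ⟨h1, h2⟩ := hsplit hkg' (by omega) he
          obtain ⟨rfl, rfl⟩ := eq_of_mul_add_eq hv huV.2 h1
          subst h2
          simp [hpi]
        · rw [if_neg he]
          have hk' : k < (W.bucket P.ℓ P.h d j (Tasks.progress W.g i t j) v).length := by
            rw [hbs, List.length_append] at hk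
            by_contra hk'
            split_ifs at hk with hjv
            · obtain ⟨rfl, rfl⟩ := hjv
              rw [hpi] at hk hk'
              simp at hk
              have : k = (W.bucket P.ℓ P.h d j t u).length := by omega
              exact he (by rw [this])
            · simp at hk; omega
          rw [List.getElem_append_left hk', ← hB.slots j v k hv hk', ← hVdef]

/-- Build all sets, in arrays `21`, `22`, `23`, and the buckets. -/
def setsCode : Program :=
  assign 18 (2 * reg 5 * reg 8) ;; assign 16 0 ;;
  forLoop 28 18 (
    write 21 (reg 28) (reg 16) ;;
    assign 21 (reg 28 / reg 8 / reg 5) ;;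
    assign 22 (reg 28 % reg 8 * (reg 21 * (reg 8 - 1) + 1)) ;;
    assign 29 (reg 28 / reg 8 % reg 5 * reg 6) ;;
    forLoop 27 6 (assign 30 (reg 29 + reg 27) ;; ite (reg 30) (reg 1) insertCode .skip) ;;
    write 22 (reg 28) (reg 16 - ld 21 (reg 28)))

theorem Tasks.length_flatMembers_le (W : Tasks) (ℓ h : ℕ) (d : ℕ → ℕ) (i : ℕ) :
    (W.flatMembers ℓ h d i).length ≤ i * W.g := by
  induction i with
  | zero => simp [flatMembers]
  | succ i ih =>
    have := W.length_members_le ℓ h d i W.g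
    rw [flatMembers, List.range_succ, List.map_append, List.flatten_append, List.length_append]
    rw [flatMembers] at ih
    simp only [List.map_cons, List.map_nil, List.flatten_cons, List.flatten_nil, List.append_nil]
    rw [Nat.succ_mul]
    omega

theorem Tasks.flatMembers_succ (W : Tasks) (ℓ h : ℕ) (d : ℕ → ℕ) (i : ℕ) :
    W.flatMembers ℓ h d (i + 1) = W.flatMembers ℓ h d i ++ W.members ℓ h d i W.g := by
  simp [flatMembers, List.range_succ]

theorem update_getD_range (f : ℕ → ℕ) (i : ℕ) :
    Function.update (fun k => ((List.range i).map f).getD k 0) i (f i) =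
      fun k => ((List.range (i + 1)).map f).getD k 0 := by
  have := update_getD_length ((List.range i).map f) (f i)
  rw [List.length_map, List.length_range] at this
  rw [this, List.range_succ, List.map_append, List.map_singleton]

/-- The sets before the set `i` are stored. -/
structure Tasks.SetsAt (W : Tasks) (ℓ h : ℕ) (d : ℕ → ℕ) (i : ℕ) (σ : State) : Prop where
  elements : ElementsAt (W.flatMembers ℓ h d i) σ
  buckets : W.BucketsAt ℓ h d (progress W.g i 0) σ
  starts : σ.arr 21 = fun k => ((List.range i).map fun j => (W.flatMembers ℓ h d j).length).getD k 0
  sizes : σ.arr 22 = fun k => ((List.range i).map fun j => (W.members ℓ h d j W.g).length).getD k 0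

theorem setsCode_runs {𝔐 : Machine} {σ : State} {P : Params} (hP : P.Holds σ) {W : Tasks}
    (hn : W.n = P.n) (hg : W.g = P.g) (hR : W.R = P.R) (hL : σ.arr 1 = W.L) {d : ℕ → ℕ}
    (hd : σ.arr 7 = d) (hd' : ∀ t < 2 * P.h, 1 ≤ d t ∧ d t ≤ P.ℓ) (hℓ : 0 < P.ℓ)
    (hV : P.ℓ ^ (2 * P.h) ≤ 𝔐.X) (hX : 2 * P.R * P.ℓ ^ P.h * (P.ℓ ^ (2 * P.h) + 1) ≤ 𝔐.X)
    (hX1 : 2 * P.R * P.ℓ ^ P.h * P.g ≤ 𝔐.X) (h15 : σ.arr 15 = fun _ => 0)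
    (h21 : σ.arr 21 = fun _ => 0) (h22 : σ.arr 22 = fun _ => 0) (h23 : σ.arr 23 = fun _ => 0) :
    Runs 𝔐 setsCode σ
      (2 * P.R * P.ℓ ^ P.h * (P.g * (2 * P.h * 303 + 1610) + 710) + 300) (fun τ =>
      W.SetsAt P.ℓ P.h d (2 * P.R * P.ℓ ^ P.h) τ ∧ τ.reg 18 = 2 * P.R * P.ℓ ^ P.h) := by
  set V := P.ℓ ^ (2 * P.h) with hVdef
  set H := P.ℓ ^ P.h with hHdef
  have hH : 0 < H := pow_pos hℓ _
  have hHV : H * H = V := by rw [hHdef, hVdef, ← pow_add, two_mul]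
  have hNX : 2 * P.R * H ≤ 𝔐.X := (Nat.le_mul_of_pos_right _ (by omega)).trans hX
  refine (Runs.assign_seq (by simpa [hP.R, hP.H] using hNX) <| Runs.assign_seq (by simp) <|
    Runs.forLoop (B := 2 * P.R * H) (c := P.g * (2 * P.h * 303 + 1605) + 702)
    (fun i τ => W.SetsAt P.ℓ P.h d i τ) (by simp [hP.R, hP.H, hHdef]) ?_ ?_ ?_).mono ?_
  · refine ⟨⟨by simp [Tasks.flatMembers], by simpa [Tasks.flatMembers] using h23⟩, ⟨?_, ?_⟩,
      by simpa using h21, by simpa using h22⟩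
    · intro j u hu
      simp [h15, Tasks.progress, Tasks.bucket, Tasks.block]
    · intro j u k hu hk
      simp [Tasks.progress, Tasks.bucket, Tasks.block] at hk
  · intro i hi τ hb hF hτ hS
    have hPτ : P.Holds τ := (hP.setReg.setReg).of_frame hF
    have a1 : τ.arr 1 = W.L := (hF.arr 1 rfl).trans hL
    have a7 : τ.arr 7 = d := (hF.arr 7 rfl).trans hd
    have hi1 : i + 1 ≤ 2 * P.R * H := hi
    have hR0 : 0 < P.R := by
      rcases Nat.eq_zero_or_pos P.R with h | h
      · simp [h] at hi
      · exact h
    -- The index of a set encodes its side (0 or 1), its block and its shift, in this order.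
    have hi2 : i / H / P.R ≤ 1 := by
      have h1 : i / H < 2 * P.R := by rwa [Nat.div_lt_iff_lt_mul hH]
      have : i / H / P.R < 2 := by rwa [Nat.div_lt_iff_lt_mul hR0]
      omega
    have hi3 : i / H % P.R < P.R := Nat.mod_lt _ hR0
    have hfl := W.length_flatMembers_le P.ℓ P.h d i
    rw [hg] at hfl
    have hRg : 2 * P.R * P.g ≤ 𝔐.X := by
      refine le_trans (Nat.le_mul_of_pos_right _ hH) ?_
      rwa [mul_right_comm]
    have hstart : i / H % P.R * P.g + P.g ≤ 2 * P.R * P.g := by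
      have : (i / H % P.R + 1) * P.g ≤ 2 * P.R * P.g := Nat.mul_le_mul_right _ (by omega)
      rwa [Nat.succ_mul] at this
    have hfX : (i + 1) * P.g ≤ 𝔐.X := (Nat.mul_le_mul_right _ hi1).trans hX1
    have hfX' : (W.flatMembers P.ℓ P.h d i).length + P.g ≤ 𝔐.X := by
      rw [Nat.succ_mul] at hfX; omega
    have hkX : (i + 1) * (V + 1) ≤ 𝔐.X := (Nat.mul_le_mul_right _ hi1).trans hX
    have hshX : i % H * (i / H / P.R * (H - 1) + 1) ≤ 𝔐.X := by
      refine le_trans ?_ hV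
      rw [← hHV]
      refine Nat.mul_le_mul (Nat.mod_lt _ hH).le ?_
      have : i / H / P.R * (H - 1) ≤ 1 * (H - 1) := Nat.mul_le_mul_right _ hi2
      omega
    have hH' : τ.reg 8 = H := hPτ.H
    have hpos : τ.reg 16 = (W.flatMembers P.ℓ P.h d i).length := hS.elements.pos
    refine (Runs.write_seq (by simpa using hb.1 16) <| Runs.assign_seq ?_ <|
      Runs.assign_seq ?_ <| Runs.assign_seq ?_ <|
      Runs.seq (Runs.forLoop (B := P.g) (c := 2 * P.h * 303 + 1602) (fun t υ =>
        Tasks.ElementsAt (W.flatMembers P.ℓ P.h d i ++ W.members P.ℓ P.h d i t) υ ∧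
        W.BucketsAt P.ℓ P.h d (Tasks.progress W.g i t) υ) ?_ ?_ ?_ (fun τ _ _ _ h => h))
        fun υ hb' hF' hυ => Runs.write ?_ ?_).mono (t := 200 + (100 + (100 + (100 +
          (P.g * (2 * P.h * 303 + 1602 + 3) + 2 + 200))))) (by linarith)
    · simp [hτ, hH', hPτ.R]; have := 𝔐.two_le; omega
    · simpa [hτ, hH', hPτ.R] using hshX
    · simp [hτ, hH', hPτ.R, hPτ.g]; omega
    · simp [hPτ.g]
    · refine ⟨⟨?_, ?_⟩, ⟨?_, ?_⟩⟩
      · simp [hpos, Tasks.members, Tasks.block]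
      · simpa [Tasks.members, Tasks.block] using hS.elements.elems
      · intro j u hu
        simpa using hS.buckets.cnt j u hu
      · intro j u k hu hk
        simpa using hS.buckets.slots j u k hu hk
    · intro t ht ρ hb'' hF'' hρ ⟨hJ1, hJ2⟩
      have hPρ : P.Holds ρ := (hPτ.setArr.setReg.setReg.setReg).of_frame hF''
      have e28 : ρ.reg 28 = i := (hF''.reg 28 rfl).trans (by simp [hτ])
      have e21 : ρ.reg 21 = i / H / P.R := (hF''.reg 21 rfl).trans (by simp [hτ, hH', hPτ.R])
      have e22 : ρ.reg 22 = i % H * (i / H / P.R * (H - 1) + 1) :=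
        (hF''.reg 22 rfl).trans (by simp [hτ, hH', hPτ.R])
      have e29 : ρ.reg 29 = i / H % P.R * P.g :=
        (hF''.reg 29 rfl).trans (by simp [hτ, hH', hPτ.R, hPτ.g])
      have f1 : ρ.arr 1 = W.L := (hF''.arr 1 rfl).trans (by simp [a1])
      have f7 : ρ.arr 7 = d := (hF''.arr 7 rfl).trans (by simp [a7])
      refine (Runs.assign_seq ?_ <| Runs.ite (t := 2 * P.h * 303 + 1302) (t' := 1)
        (fun hlt => ?_) fun hlt => ?_).mono (by
          rw [max_eq_left (by omega)]; omega)
      · simp [e29, hρ]; omega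
      · simp [e29, hρ, hPρ.n] at hlt
        exact insertCode_runs hPρ.setReg hn hg hR (by simpa using f1) (by simpa using f7) hd' hℓ
          hlt (by simpa using e28) (by simp [e29, hρ, hHdef]) (by simpa using e21)
          (by simpa using e22) ht hV hkX hfX' ⟨by simpa using hJ1.pos, by simpa using hJ1.elems⟩
          ⟨fun j u hu => by simpa using hJ2.cnt j u hu,
            fun j u k hu hk => by simpa using hJ2.slots j u k hu hk⟩ |>.imp fun κ _ _ hκ =>
          ⟨⟨by simpa using hκ.1.pos, by simpa using hκ.1.elems⟩,
          ⟨fun j u hu => by simpa using hκ.2.cnt j u hu,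
            fun j u k hu hk => by simpa using hκ.2.slots j u k hu hk⟩⟩
      · simp [e29, hρ, hPρ.n] at hlt
        -- The last block may be incomplete, and positions from n on contribute nothing.
        have hblock : W.block P.ℓ P.h i (t + 1) = W.block P.ℓ P.h i t :=
          Tasks.block_succ_of_ge (by rw [hg, hR, hn]; exact not_lt.mpr hlt)
        have hmem : W.members P.ℓ P.h d i (t + 1) = W.members P.ℓ P.h d i t := by
          rw [Tasks.members, hblock, Tasks.members]
        have hbuc : ∀ j u, W.bucket P.ℓ P.h d j (Tasks.progress W.g i (t + 1) j) u =
            W.bucket P.ℓ P.h d j (Tasks.progress W.g i t j) u := by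
          intro j u
          by_cases hj : j = i
          · subst hj
            simp [Tasks.progress, Tasks.bucket, hblock]
          · simp [Tasks.progress, hj]
        refine Runs.skip ⟨⟨?_, ?_⟩, ⟨?_, ?_⟩⟩
        · rw [hmem]; simpa using hJ1.pos
        · rw [hmem]; simpa using hJ1.elems
        · intro j u hu
          rw [hbuc]; simpa using hJ2.cnt j u hu
        · intro j u k hu hk
          rw [List.getElem_of_eq (hbuc j u)]
          rw [hbuc] at hk
          simpa using hJ2.slots j u k hu hk
    · have := hb'.1 16; simp; omega
    · obtain ⟨hJ1, hJ2⟩ := hυ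
      have e28 : υ.reg 28 = i := (hF'.reg 28 rfl).trans (by simp [hτ])
      have b21 : υ.arr 21 = Function.update (τ.arr 21) i (τ.reg 16) :=
        (hF'.arr 21 rfl).trans (by simp [hτ])
      have b22 : υ.arr 22 = τ.arr 22 := (hF'.arr 22 rfl).trans (by simp)
      -- A completed set i is the same as a set i + 1 that has not begun.
      have hprog : Tasks.progress W.g (i + 1) 0 = Tasks.progress W.g i W.g := by
        funext j
        simp only [Tasks.progress]
        split_ifs <;> omega
      rw [hg] at hprog
      refine ⟨⟨?_, ?_⟩, ?_, ?_, ?_⟩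
      · simpa [Tasks.flatMembers_succ, hg] using hJ1.pos
      · simpa [Tasks.flatMembers_succ, hg] using hJ1.elems
      · rw [hg, hprog, ← hg]
        rw [← hg] at hJ2
        exact ⟨fun j u hu => by simpa using hJ2.cnt j u hu,
          fun j u k hu hk => by simpa using hJ2.slots j u k hu hk⟩
      · have := update_getD_range (fun j => (W.flatMembers P.ℓ P.h d j).length) i
        simp only [State.setReg_arr, State.setArr_arr, show ¬ (21 = 22) by norm_num, if_false]
        rw [b21, hS.starts, hpos, this]
      · have := update_getD_range (fun j => (W.members P.ℓ P.h d j W.g).length) i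
        simp only [State.setReg_arr, State.setArr_arr, if_true, eval_reg, eval_sub, eval_ld, e28,
          b21, b22, Function.update_self, hJ1.pos, hpos, hS.sizes]
        rw [← this]
        congr 1
        simp [hg]
  · intro τ hb hF hτ hS
    exact ⟨hS, (hF.reg 18 rfl).trans (by simp [hP.R, hP.H, hHdef])⟩
  · have h1 : 2 * P.R * H * (P.g * (2 * P.h * 303 + 1605) + 702 + 3) ≤
        2 * P.R * H * (P.g * (2 * P.h * 303 + 1610) + 710) := by
      refine Nat.mul_le_mul_left _ ?_
      have : P.g * (2 * P.h * 303 + 1605) ≤ P.g * (2 * P.h * 303 + 1610) :=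
        Nat.mul_le_mul_left _ (by omega)
      linarith
    linarith

end ThreeSum

namespace ThreeSum

open Finset RAM RAM.Expr

/-! ### Building the queries -/

theorem Tasks.pairs_succ (W : Tasks) (ℓ h : ℕ) (d : ℕ → ℕ) (j : ℕ) :
    W.pairs ℓ h d (j + 1) = (W.pairs ℓ h d j).insertNew (W.pair ℓ h d j) := by
  rw [pairs, List.range_succ, List.map_append, List.map_singleton, List.distinct_concat, pairs]

/-- The queries for the first `j` tasks are stored. -/
structure Tasks.QueriesAt (W : Tasks) (ℓ h : ℕ) (d : ℕ → ℕ) (N j : ℕ) (σ : State) : Prop where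
  num : σ.reg 19 = (W.pairs ℓ h d j).length
  fst : σ.arr 24 = fun k => ((W.pairs ℓ h d j).map Prod.fst).getD k 0
  snd : σ.arr 25 = fun k => ((W.pairs ℓ h d j).map Prod.snd).getD k 0
  unseen : ∀ a b, b < N → σ.arr 17 (a * N + b) = 0 → (a, b) ∉ W.pairs ℓ h d j
  seen : ∀ a b v, b < N → σ.arr 17 (a * N + b) = v + 1 → (W.pairs ℓ h d j)[v]? = some (a, b)
  index : ∀ m < j, (W.pairs ℓ h d j)[σ.arr 14 m]? = some (W.pair ℓ h d m)
  side : ∀ m < j, σ.arr 12 m = (W.pair ℓ h d m).1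

theorem Tasks.QueriesAt.congr {W : Tasks} {ℓ h : ℕ} {d : ℕ → ℕ} {N j : ℕ} {σ τ : State}
    (hQ : W.QueriesAt ℓ h d N j σ) (h19 : τ.reg 19 = σ.reg 19) (h24 : τ.arr 24 = σ.arr 24)
    (h25 : τ.arr 25 = σ.arr 25) (h17 : τ.arr 17 = σ.arr 17) (h14 : τ.arr 14 = σ.arr 14)
    (h12 : τ.arr 12 = σ.arr 12) : W.QueriesAt ℓ h d N j τ :=
  ⟨h19.trans hQ.num, h24.trans hQ.fst, h25.trans hQ.snd, by rw [h17]; exact hQ.unseen,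
    by rw [h17]; exact hQ.seen, by rw [h14]; exact hQ.index, by rw [h12]; exact hQ.side⟩

/-- Store the pair in the registers `29` and `30` as a query, unless it has occurred before. -/
def queryCode : Program :=
  assign 31 (reg 29 * reg 18 + reg 30) ;;
  ite (ld 17 (reg 31)) 1 (write 24 (reg 19) (reg 29) ;; write 25 (reg 19) (reg 30) ;;
    assign 19 (reg 19 + 1) ;; write 17 (reg 31) (reg 19)) .skip ;;
  write 14 (reg 28) (ld 17 (reg 31) - 1) ;; write 12 (reg 28) (reg 29)

/-- Array 17 holds, at the address of a pair, one more than its position among the queries. The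
initial value 0 thus means that the pair is new, and repetitions are recognized in constant time
without initializing the table. -/
theorem queryCode_runs {𝔐 : Machine} {σ : State} {W : Tasks} {ℓ h N j : ℕ} {d : ℕ → ℕ}
    (h18 : σ.reg 18 = N) (h28 : σ.reg 28 = j) (h29 : σ.reg 29 = (W.pair ℓ h d j).1)
    (h30 : σ.reg 30 = (W.pair ℓ h d j).2) (hp1 : (W.pair ℓ h d j).1 < N)
    (hp2 : (W.pair ℓ h d j).2 < N) (hX : N * N ≤ 𝔐.X) (hj : j + 1 ≤ 𝔐.X)
    (hQ : W.QueriesAt ℓ h d N j σ) :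
    Runs 𝔐 queryCode σ 1400 (W.QueriesAt ℓ h d N (j + 1)) := by
  set p := W.pair ℓ h d j with hp
  set l := W.pairs ℓ h d j with hl
  have hkey : p.1 * N + p.2 < N * N := by
    have : (p.1 + 1) * N ≤ N * N := Nat.mul_le_mul_right _ hp1
    rw [Nat.succ_mul] at this; omega
  have hinj : ∀ {a b : ℕ}, b < N → a * N + b = p.1 * N + p.2 → (a, b) = p := by
    intro a b hb he
    have := eq_of_mul_add_eq (V := N - 1) (j := a) (u := b) (j' := p.1) (u' := p.2)
      (by omega) (by omega) (by rwa [Nat.sub_add_cancel (by omega)])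
    exact Prod.ext this.1 this.2
  have hlen : l.length ≤ j := W.length_pairs_le ℓ h d j
  refine Runs.of_bdd fun hσb => ?_
  have hmono : ∀ (v : ℕ) (e : ℕ × ℕ), l[v]? = some e → (l.insertNew p)[v]? = some e := by
    intro v e he
    rw [List.insertNew]
    split_ifs
    · exact he
    · rw [List.getElem?_append_left (List.getElem?_eq_some_iff.mp he).1, he]
  refine (Runs.assign_seq (by simp [h29, h18, h30]; omega) <|
    Runs.seq (R := fun τ => τ.reg 19 = (l.insertNew p).length ∧
      τ.arr 24 = (fun k => ((l.insertNew p).map Prod.fst).getD k 0) ∧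
      τ.arr 25 = (fun k => ((l.insertNew p).map Prod.snd).getD k 0) ∧
      (∀ a b, b < N → τ.arr 17 (a * N + b) = 0 → (a, b) ∉ l.insertNew p) ∧
      (∀ a b v, b < N → τ.arr 17 (a * N + b) = v + 1 → (l.insertNew p)[v]? = some (a, b)) ∧
      ∃ v, τ.arr 17 (p.1 * N + p.2) = v + 1)
    ((Runs.ite (t := 700) (t' := 1) (fun hlt => ?_) fun hlt => ?_).mono (t' := 900)
      (by norm_num)) fun τ b F Q => Runs.write_seq ?_ <| Runs.write ?_ ?_).mono (by norm_num)
  · simp [h29, h18, h30] at hlt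
    have hnot : p ∉ l := hQ.unseen p.1 p.2 hp2 hlt
    have hins : l.insertNew p = l ++ [p] := by rw [List.insertNew, if_neg hnot]
    refine (Runs.write_seq (by simp [h29]; nlinarith) <|
      Runs.write_seq (by simp [h30]; nlinarith) <| Runs.assign_seq (by simp [hQ.num, ← hl]; omega) <|
      Runs.write (by simp [hQ.num, ← hl]; omega) ?_).mono (by norm_num)
    rw [hins]
    simp only [State.setReg_reg, State.setArr_reg, State.setReg_arr, State.setArr_arr, eval_reg,
      eval_add, eval_mul, eval_ofNat, h29, h30, h18, hQ.num, ← hl, if_true, List.map_append,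
      List.map_singleton, show ¬ (19 = 31) by norm_num, show ¬ (31 = 19) by norm_num,
      show ¬ (24 = 17) by norm_num, show ¬ (25 = 17) by norm_num, show ¬ (17 = 25) by norm_num,
      show ¬ (24 = 25) by norm_num, show ¬ (25 = 24) by norm_num, show ¬ (17 = 24) by norm_num,
      show ¬ (29 = 31) by norm_num, show ¬ (30 = 31) by norm_num, if_false, hQ.fst, hQ.snd]
    refine ⟨by simp, ?_, ?_, ?_, ?_, l.length, by simp⟩
    · have := update_getD_length (l.map Prod.fst) p.1
      simpa using this
    · have := update_getD_length (l.map Prod.snd) p.2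
      simpa using this
    · intro a b hb h0
      by_cases he : a * N + b = p.1 * N + p.2
      · rw [he, Function.update_self] at h0; omega
      · rw [Function.update_of_ne he] at h0
        rw [List.mem_append, List.mem_singleton]
        rintro (h1 | h1)
        · exact hQ.unseen a b hb h0 h1
        · exact he (by rw [← h1])
    · intro a b v hb h0
      by_cases he : a * N + b = p.1 * N + p.2
      · rw [he, Function.update_self] at h0
        have hv : v = l.length := by omega
        rw [hinj hb he, hv]
        simp
      · rw [Function.update_of_ne he] at h0
        have := hmono v _ (hQ.seen a b v hb h0)
        rwa [hins] at this
  · simp [h29, h18, h30] at hlt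
    obtain ⟨v, hv⟩ := Nat.exists_eq_succ_of_ne_zero hlt
    have hmem : p ∈ l := List.mem_of_getElem? (hQ.seen p.1 p.2 v hp2 hv)
    have hins : l.insertNew p = l := by rw [List.insertNew, if_pos hmem]
    rw [hins]
    refine Runs.skip ⟨by simp [hQ.num, ← hl], by simp [hQ.fst, ← hl], by simp [hQ.snd, ← hl],
      fun a b hb h0 => hQ.unseen a b hb (by simpa using h0),
      fun a b v hb h0 => hQ.seen a b v hb (by simpa using h0), v, by simpa using hv⟩
  · have := b.2 17 (τ.reg 31)
    simp; omega
  · simpa using b.1 29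
  · obtain ⟨q1, q2, q3, q4, q5, v, hv⟩ := Q
    have e28 : τ.reg 28 = j := (F.reg 28 rfl).trans (by simpa using h28)
    have e29 : τ.reg 29 = p.1 := (F.reg 29 rfl).trans (by simpa using h29)
    have e31 : τ.reg 31 = p.1 * N + p.2 := (F.reg 31 rfl).trans (by simp [h29, h30, h18])
    have a14 : τ.arr 14 = σ.arr 14 := (F.arr 14 rfl).trans (by simp)
    have a12 : τ.arr 12 = σ.arr 12 := (F.arr 12 rfl).trans (by simp)
    have hs : W.pairs ℓ h d (j + 1) = l.insertNew p := W.pairs_succ ℓ h d j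
    refine ⟨by simpa [hs] using q1, by simpa [hs] using q2, by simpa [hs] using q3,
      fun a b hb h0 => ?_, fun a b v hb h0 => ?_, fun m hm => ?_, fun m hm => ?_⟩
    · rw [hs]; exact q4 a b hb (by simpa using h0)
    · rw [hs]; exact q5 a b v hb (by simpa using h0)
    · rw [hs]
      simp only [State.setArr_arr, State.setArr_reg, eval_reg, eval_sub, eval_ld, eval_ofNat, e28,
        e31, hv, a14, show ¬ (14 = 12) by norm_num, if_false, if_true]
      rcases Nat.lt_or_eq_of_le (Nat.le_of_lt_succ hm) with h | rfl
      · rw [Function.update_of_ne h.ne]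
        exact hmono _ _ (hQ.index m h)
      · rw [Function.update_self]
        exact q5 p.1 p.2 v hp2 hv
    · simp only [State.setArr_arr, State.setArr_reg, eval_reg, e28, e29, a12, if_true]
      rcases Nat.lt_or_eq_of_le (Nat.le_of_lt_succ hm) with h | rfl
      · simpa [h.ne] using hQ.side m h
      · simp [hp]

/-- Build all queries, in arrays `24` and `25`. -/
def queriesCode : Program :=
  assign 19 0 ;; forLoop 28 9 (
    assign 20 (ld 1 (ld 4 (reg 28))) ;; assign 22 0 ;; assign 21 1 ;; hashCode ;;
    assign 29 (ld 5 (reg 28) * reg 8 + reg 23 % reg 8) ;; assign 21 0 ;; hashCode ;;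
    assign 30 ((reg 5 + ld 6 (reg 28)) * reg 8 + reg 23 / reg 8) ;; queryCode)

theorem queriesCode_runs {𝔐 : Machine} {σ : State} {P : Params} (hP : P.Holds σ) {W : Tasks}
    (hWσ : W = P.tasks σ) (hW : W.Valid) {d : ℕ → ℕ}
    (hd : σ.arr 7 = d) (hd' : ∀ t < 2 * P.h, 1 ≤ d t ∧ d t ≤ P.ℓ) (hℓ : 0 < P.ℓ)
    (hV : P.ℓ ^ (2 * P.h) ≤ 𝔐.X)
    (hX : 2 * P.R * P.ℓ ^ P.h * (2 * P.R * P.ℓ ^ P.h) ≤ 𝔐.X)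
    (h18 : σ.reg 18 = 2 * P.R * P.ℓ ^ P.h) (h17 : σ.arr 17 = fun _ => 0)
    (h24 : σ.arr 24 = fun _ => 0) (h25 : σ.arr 25 = fun _ => 0) :
    Runs 𝔐 queriesCode σ (W.N * (4 * P.h * 303 + 2500) + 200)
      (W.QueriesAt P.ℓ P.h d (2 * P.R * P.ℓ ^ P.h) W.N) := by
  set N := 2 * P.R * P.ℓ ^ P.h with hN
  have hX2 := 𝔐.two_le
  have hH : 0 < P.ℓ ^ P.h := pow_pos hℓ _
  have hNX : N ≤ 𝔐.X := by nlinarith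
  have hWn : σ.reg 9 = W.N := by rw [hWσ]; rfl
  have hWR : W.R = P.R := by rw [hWσ]; rfl
  refine Runs.of_bdd fun hσb => ?_
  have hWX : W.N ≤ 𝔐.X := hWn ▸ hσb.1 9
  refine (Runs.assign_seq (by simp) <| Runs.forLoop (B := W.N)
    (c := 300 + (2 * P.h * 303 + 202) + 200 + (2 * P.h * 303 + 202) + 100 + 1400)
    (fun j τ => W.QueriesAt P.ℓ P.h d N j τ) (by simpa using hWn) ?_ ?_
    (fun τ _ _ _ h => h)).mono ?_
  · refine ⟨by simp [Tasks.pairs], by simpa [Tasks.pairs] using h24,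
      by simpa [Tasks.pairs] using h25, fun a b _ _ => by simp [Tasks.pairs], fun a b v _ h0 => ?_,
      fun m hm => by omega, fun m hm => by omega⟩
    simp [h17] at h0
  · intro j hj τ hb hF hτ hQ
    have hPτ : P.Holds τ := hP.setReg.of_frame hF
    have a1 : τ.arr 1 = W.L := (hF.arr 1 rfl).trans (by rw [hWσ]; rfl)
    have a4 : τ.arr 4 = W.wz := (hF.arr 4 rfl).trans (by rw [hWσ]; rfl)
    have a5 : τ.arr 5 = W.wi := (hF.arr 5 rfl).trans (by rw [hWσ]; rfl)
    have a6 : τ.arr 6 = W.wj := (hF.arr 6 rfl).trans (by rw [hWσ]; rfl)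
    have a7 : τ.arr 7 = d := (hF.arr 7 rfl).trans hd
    have g18 : τ.reg 18 = N := (hF.reg 18 rfl).trans (by simpa using h18)
    obtain ⟨hp1, hp2⟩ := Tasks.pair_lt (m := j) hℓ hd' (hW.wi_lt j hj) (hW.wj_lt j hj)
    rw [hWR] at hp1 hp2
    refine Runs.mono (t := 100 + (100 + (100 + (2 * P.h * 303 + 202 + (100 + (100 +
      (2 * P.h * 303 + 202 + (100 + 1400)))))))) ?_ (by linarith)
    refine Runs.assign_seq (by simpa using hb.2 1 _) <| Runs.assign_seq (by simp) <|
      Runs.assign_seq (by simp; omega) <| Runs.seq (hashCode_runs (P := P) (d := d)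
        (x := W.L (W.wz j)) (b := 1) (sh := 0) hPτ.setReg.setReg.setReg (by simp [a7]) hd' hℓ hV
        (by simp [a1, a4, hτ]) (by simp) (by simp)) fun υ b₁ F₁ Q₁ => ?_
    have e28 : υ.reg 28 = j := (F₁.reg 28 rfl).trans (by simp [hτ])
    have e8 : υ.reg 8 = P.ℓ ^ P.h := (F₁.reg 8 rfl).trans (by simp [hPτ.H])
    have e5 : υ.arr 5 = W.wi := (F₁.arr 5 rfl).trans (by simp [a5])
    have e29 : υ.arr 5 (υ.reg 28) * υ.reg 8 + υ.reg 23 % υ.reg 8 = (W.pair P.ℓ P.h d j).1 := by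
      rw [e28, e8, e5, Q₁, Tasks.pair]
    have e20 : υ.reg 20 = _ := F₁.reg 20 rfl
    have e22 : υ.reg 22 = _ := F₁.reg 22 rfl
    refine Runs.assign_seq (by
        simp only [eval_add, eval_mul, eval_ld, eval_reg, eval_mod, e29]; omega) <|
      Runs.assign_seq (by simp) <| Runs.seq (hashCode_runs (P := P) (d := d)
        (x := W.L (W.wz j)) (b := 0) (sh := 0)
        (hPτ.setReg.setReg.setReg.of_frame F₁).setReg.setReg
        (fun t _ => by simp [F₁.arr 7 rfl, a7]) hd' hℓ hV
        (by simp [e20, a1, a4, hτ]) (by simp) (by simp [e22])) fun ρ b₂ F₂ Q₂ => ?_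
    have f28 : ρ.reg 28 = j := (F₂.reg 28 rfl).trans (by simp [e28])
    have f8 : ρ.reg 8 = P.ℓ ^ P.h := (F₂.reg 8 rfl).trans (by simp [e8])
    have f5 : ρ.reg 5 = W.R := (F₂.reg 5 rfl).trans (by simp [F₁.reg 5 rfl, hPτ.R, hWR])
    have f6 : ρ.arr 6 = W.wj := (F₂.arr 6 rfl).trans (by simp [F₁.arr 6 rfl, a6])
    have f29 : ρ.reg 29 = _ := F₂.reg 29 rfl
    have e30 : (ρ.reg 5 + ρ.arr 6 (ρ.reg 28)) * ρ.reg 8 + ρ.reg 23 / ρ.reg 8 =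
        (W.pair P.ℓ P.h d j).2 := by
      rw [f28, f8, f5, f6, Q₂, Tasks.pair]
    refine Runs.assign_seq (by
        simp only [eval_add, eval_mul, eval_ld, eval_reg, eval_div, e30]; omega) <|
      (queryCode_runs (j := j) (by simp [F₂.reg 18 rfl, F₁.reg 18 rfl, g18, hN]) (by simp [f28])
        (by simp [f29]; exact e29) (by simp [e30]) hp1 hp2 hX (by omega) ?_).imp
        fun κ _ _ hκ => hκ.congr (by simp) rfl rfl rfl rfl rfl
    have g14 : ρ.arr 14 = τ.arr 14 := (F₂.arr 14 rfl).trans (F₁.arr 14 rfl)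
    have g12 : ρ.arr 12 = τ.arr 12 := (F₂.arr 12 rfl).trans (F₁.arr 12 rfl)
    have g17 : ρ.arr 17 = τ.arr 17 := (F₂.arr 17 rfl).trans (F₁.arr 17 rfl)
    have g24 : ρ.arr 24 = τ.arr 24 := (F₂.arr 24 rfl).trans (F₁.arr 24 rfl)
    have g25 : ρ.arr 25 = τ.arr 25 := (F₂.arr 25 rfl).trans (F₁.arr 25 rfl)
    have g19 : ρ.reg 19 = τ.reg 19 := (F₂.reg 19 rfl).trans (by simp [F₁.reg 19 rfl])
    exact hQ.congr (by simp [g19]) g24 g25 g17 g14 g12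
  · have : W.N * (300 + (2 * P.h * 303 + 202) + 200 + (2 * P.h * 303 + 202) + 100 + 1400 + 3) ≤
        W.N * (4 * P.h * 303 + 2500) := Nat.mul_le_mul_left _ (by linarith)
    linarith

end ThreeSum

/-! ### Arrays that a program never names -/

namespace RAM

/-- All arrays of the program have names below this bound. -/
def Program.arrBound : Program → ℕ
  | .skip => 0
  | .const _ _ => 0
  | .op _ _ _ _ => 0
  | .load _ x _ => x + 1
  | .store x _ _ => x + 1
  | .seq p q => max p.arrBound q.arrBound
  | .cond _ _ p q => max p.arrBound q.arrBound
  | .loop _ _ p => p.arrBound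

theorem Program.wa_of_arrBound_le {p : Program} {x : ℕ} (hx : p.arrBound ≤ x) :
    p.wa x = false := by
  induction p with
  | skip | const | op | load => rfl
  | store y a b =>
    simp only [arrBound] at hx
    have : y ≠ x := by omega
    exact Nat.beq_eq_false_of_ne this
  | seq p q ihp ihq | cond a b p q ihp ihq =>
    simp only [arrBound, max_le_iff] at hx
    simp [wa, ihp hx.1, ihq hx.2]
  | loop a b p ih => exact ih hx

end RAM

namespace ThreeSum

open Finset RAM RAM.Expr

/-! ### Writing down the instance of Set Intersection -/

/-- Write down the instance of Set Intersection in the arrays from `20`. -/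
def buildCode : Program :=
  setsCode ;; queriesCode ;; write 20 0 (reg 15) ;; write 20 1 (reg 7) ;; write 20 2 (reg 18) ;;
  write 20 (2 + 1) (reg 6) ;; write 20 (2 + 2) (reg 19)

namespace Tasks

section Start

variable (W : Tasks) (ℓ h : ℕ) (d : ℕ → ℕ) (hW : W.Valid) (hℓ : 0 < ℓ)
  (hd : ∀ t < 2 * h, 1 ≤ d t ∧ d t ≤ ℓ)

theorem setLists_toSetIntersection : (W.toSetIntersection ℓ h d hW hℓ hd).setLists =
    (List.range (2 * W.R * ℓ ^ h)).map fun i => W.members ℓ h d i W.g := by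
  refine List.ext_getElem (by simp [SetIntersection.setLists]; rfl) fun i h1 h2 => ?_
  simp [SetIntersection.setLists]
  rfl

theorem queries_map_fst : ((W.toSetIntersection ℓ h d hW hℓ hd).queries.map fun e => (e.1 : ℕ)) =
    (W.pairs ℓ h d W.N).map Prod.fst := by
  refine (List.map_pmap ..).trans ?_
  exact List.pmap_eq_map ..

theorem queries_map_snd : ((W.toSetIntersection ℓ h d hW hℓ hd).queries.map fun e => (e.2 : ℕ)) =
    (W.pairs ℓ h d W.N).map Prod.snd := by
  refine (List.map_pmap ..).trans ?_
  exact List.pmap_eq_map ..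

theorem q_toSetIntersection : (W.toSetIntersection ℓ h d hW hℓ hd).q =
    (W.pairs ℓ h d W.N).length := List.length_pmap ..

theorem start_toSetIntersection (n : ℕ) : (W.toSetIntersection ℓ h d hW hℓ hd).start n =
    State.ofArrays [[n, ℓ ^ (2 * h), 2 * W.R * ℓ ^ h, W.g, (W.pairs ℓ h d W.N).length],
      (List.range (2 * W.R * ℓ ^ h)).map fun i => (W.flatMembers ℓ h d i).length,
      (List.range (2 * W.R * ℓ ^ h)).map fun i => (W.members ℓ h d i W.g).length,
      W.flatMembers ℓ h d (2 * W.R * ℓ ^ h),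
      (W.pairs ℓ h d W.N).map Prod.fst, (W.pairs ℓ h d W.N).map Prod.snd] := by
  rw [SetIntersection.start, queries_map_fst, queries_map_snd, q_toSetIntersection,
    setLists_toSetIntersection, List.map_map]
  have : ((List.range (2 * W.R * ℓ ^ h)).map fun i => (((List.range (2 * W.R * ℓ ^ h)).map
      fun i => W.members ℓ h d i W.g).take i).flatten.length) =
      (List.range (2 * W.R * ℓ ^ h)).map fun i => (W.flatMembers ℓ h d i).length := by
    refine List.map_congr_left fun i hi => ?_
    have hi' : i < 2 * W.R * ℓ ^ h := List.mem_range.mp hi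
    rw [← List.map_take, List.take_range, min_eq_left hi'.le]
    rfl
  exact congrArg (fun l => State.ofArrays [_, l, _, _, _, _]) this

end Start

/-- The tables that relate the answers to the tasks are stored. -/
structure TablesAt (W : Tasks) (ℓ h : ℕ) (d : ℕ → ℕ) (σ : State) : Prop where
  buckets : ∀ j u, j < 2 * W.R * ℓ ^ h → u ≤ ℓ ^ (2 * h) →
    σ.arr 15 (j * (ℓ ^ (2 * h) + 1) + u) = (W.bucket ℓ h d j W.g u).length
  slots : ∀ j u k, j < 2 * W.R * ℓ ^ h → u ≤ ℓ ^ (2 * h) →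
    (hk : k < (W.bucket ℓ h d j W.g u).length) →
    σ.arr 16 ((j * (ℓ ^ (2 * h) + 1) + u) * W.g + k) = (W.bucket ℓ h d j W.g u)[k]
  num : σ.reg 19 = (W.pairs ℓ h d W.N).length
  index : ∀ m < W.N, (W.pairs ℓ h d W.N)[σ.arr 14 m]? = some (W.pair ℓ h d m)
  side : ∀ m < W.N, σ.arr 12 m = (W.pair ℓ h d m).1

end Tasks

/-- The unknown program for Set Intersection may read anything, so the arrays from 20 on have to
equal its start configuration everywhere. The parameter it is told is D^m and not n. -/
theorem buildCode_runs {𝔐 : Machine} {σ : State} {P : Params} (hP : P.Holds σ) {W : Tasks}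
    (hWσ : W = P.tasks σ) (hW : W.Valid) {d : ℕ → ℕ} (hd : σ.arr 7 = d) (hℓ : 0 < P.ℓ)
    (hd' : ∀ t < 2 * P.h, 1 ≤ d t ∧ d t ≤ P.ℓ)
    (hX : 2 * P.R * P.ℓ ^ P.h * (P.ℓ ^ (2 * P.h) + 1) ≤ 𝔐.X)
    (hX1 : 2 * P.R * P.ℓ ^ P.h * P.g ≤ 𝔐.X)
    (hX2 : 2 * P.R * P.ℓ ^ P.h * (2 * P.R * P.ℓ ^ P.h) ≤ 𝔐.X) (hR : 1 ≤ P.R)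
    (hz : ∀ x, 15 ≤ x → σ.arr x = fun _ => 0) :
    Runs 𝔐 buildCode σ
      (2 * P.R * P.ℓ ^ P.h * (P.g * (2 * P.h * 303 + 1610) + 710) +
        W.N * (4 * P.h * 303 + 2500) + 1500)
      (fun τ => W.TablesAt P.ℓ P.h d τ ∧ ∀ x, τ.arr (20 + x) =
        ((W.toSetIntersection P.ℓ P.h d hW hℓ hd').start (P.D ^ P.m)).arr x) := by
  set N := 2 * P.R * P.ℓ ^ P.h with hN
  have hV : P.ℓ ^ (2 * P.h) ≤ 𝔐.X := by
    have : 1 ≤ P.R * P.ℓ ^ P.h := Nat.mul_pos hR (pow_pos hℓ _)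
    nlinarith
  have hWN : W.N = σ.reg 9 := by rw [hWσ]; rfl
  refine Runs.mono (t := N * (P.g * (2 * P.h * 303 + 1610) + 710) + 300 +
    (W.N * (4 * P.h * 303 + 2500) + 200 + (200 + (200 + (200 + (200 + 200)))))) ?_ (by omega)
  refine Runs.seq (setsCode_runs hP (W := W) (by rw [hWσ]; rfl) (by rw [hWσ]; rfl)
    (by rw [hWσ]; rfl) (by rw [hWσ]; rfl) hd hd' hℓ hV hX hX1 (hz 15 le_rfl) (hz 21 (by norm_num))
    (hz 22 (by norm_num)) (hz 23 (by norm_num))) fun τ b F h => ?_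
  obtain ⟨⟨hel, hbu, hst, hsi⟩, h18⟩ := h
  have zz : ∀ x, setsCode.wa x = false → 15 ≤ x → τ.arr x = fun _ => 0 := fun x hx hx' =>
    (F.arr x hx).trans (hz x hx')
  refine Runs.seq (queriesCode_runs (hP.of_frame F) (W := W)
    (hWσ.trans (P.tasks_eq_of_frame F).symm) hW ((F.arr 7 rfl).trans hd) hd' hℓ hV hX2 h18
    (zz 17 rfl (by norm_num)) (zz 24 rfl (by norm_num)) (zz 25 rfl (by norm_num)))
    fun υ b' F' hQ => ?_
  have hPυ : P.Holds υ := (hP.of_frame F).of_frame F'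
  have u18 : υ.reg 18 = N := (F'.reg 18 rfl).trans h18
  have zu : ∀ x, queriesCode.wa x = false → setsCode.wa x = false → 15 ≤ x →
      υ.arr x = fun _ => 0 := fun x h1 h2 h3 => (F'.arr x h1).trans (zz x h2 h3)
  have z20 := zu 20 rfl rfl (by norm_num)
  refine Runs.write_seq (by simpa using b'.1 15) <| Runs.write_seq (by simpa using b'.1 7) <|
    Runs.write_seq (by simpa using b'.1 18) <| Runs.write_seq (by simpa using b'.1 6) <|
    Runs.write (by simpa using b'.1 19) ?_
  have hWR : W.R = P.R := by rw [hWσ]; rfl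
  have hWg : W.g = P.g := by rw [hWσ]; rfl
  refine ⟨⟨fun j u hj hu => ?_, fun j u k hj hu hk => ?_, ?_, ?_, ?_⟩, fun x => ?_⟩
  · have h1 : υ.arr 15 = τ.arr 15 := F'.arr 15 rfl
    rw [hWR] at hj
    have h2 := hbu.cnt j u hu
    rw [Tasks.progress, if_pos hj] at h2
    simpa [h1] using h2
  · have h1 : υ.arr 16 = τ.arr 16 := F'.arr 16 rfl
    rw [hWR] at hj
    have hp : Tasks.progress W.g (2 * P.R * P.ℓ ^ P.h) 0 j = W.g := if_pos hj
    have h2 := hbu.slots j u k hu (by rw [hp]; exact hk)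
    simp only [hp] at h2
    simpa [h1] using h2
  · simpa using hQ.num
  · intro m hm; simpa using hQ.index m hm
  · intro m hm; simpa using hQ.side m hm
  · rw [Tasks.start_toSetIntersection, hWR]
    rw [hN] at u18
    rcases x with _ | _ | _ | _ | _ | _ | x
    · simp [State.ofArrays, z20, hPυ.m, hPυ.V, u18, hPυ.g, hQ.num, hWg]
      funext i
      rcases i with _ | _ | _ | _ | _ | i <;> simp
    · have : υ.arr 21 = τ.arr 21 := F'.arr 21 rfl
      simp [State.ofArrays, this, hst]
    · have : υ.arr 22 = τ.arr 22 := F'.arr 22 rfl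
      simp [State.ofArrays, this, hsi]
    · have : υ.arr 23 = τ.arr 23 := F'.arr 23 rfl
      simp [State.ofArrays, this, hel.elems]
    · simp [State.ofArrays, hQ.fst]
    · simp [State.ofArrays, hQ.snd]
    -- Arrays from 26 on are untouched and hence still zero, as the start configuration demands.
    · have := zu (20 + (x + 6)) (Program.wa_of_arrBound_le (le_trans (b := 26) (by decide) (by omega)))
        (Program.wa_of_arrBound_le (le_trans (b := 26) (by decide) (by omega))) (by omega)
      have h1 : 20 + (x + 6) ≠ 20 := by omega
      simp only [State.setArr_arr, h1, if_false, State.ofArrays]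
      rw [this]
      simp

end ThreeSum

namespace RAM

/-! ### Programs as subroutines -/

namespace Program

/-- All registers of the program have names below this bound. -/
def regBound : Program → ℕ
  | .skip => 0
  | .const r _ => r + 1
  | .op _ r a b => max (r + 1) (max (a + 1) (b + 1))
  | .load r _ a => max (r + 1) (a + 1)
  | .store _ a b => max (a + 1) (b + 1)
  | .seq p q => max p.regBound q.regBound
  | .cond a b p q => max (max (a + 1) (b + 1)) (max p.regBound q.regBound)
  | .loop a b p => max (max (a + 1) (b + 1)) p.regBound

/-- Rename the registers and the arrays. -/
def rename : Program → Program
  | .skip => .skip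
  | .const r v => .const (100 + r) v
  | .op o r a b => .op o (100 + r) (100 + a) (100 + b)
  | .load r x a => .load (100 + r) (20 + x) (100 + a)
  | .store x a b => .store (20 + x) (100 + a) (100 + b)
  | .seq p q => .seq p.rename q.rename
  | .cond a b p q => .cond (100 + a) (100 + b) p.rename q.rename
  | .loop a b p => .loop (100 + a) (100 + b) p.rename

/-- Clear the first registers of the renamed program. -/
def clear : ℕ → Program
  | 0 => .skip
  | B + 1 => .seq (clear B) (.const (100 + B) 0)

/-- Run the program on separate registers and arrays. -/
def embed (p : Program) : Program := .seq (clear p.regBound) p.rename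

end Program

/-- The state `σ` looks like `ρ` to a renamed program with at most `B` registers. -/
structure Simulates (B : ℕ) (ρ σ : State) : Prop where
  reg : ∀ r < B, σ.reg (100 + r) = ρ.reg r
  arr : ∀ x, σ.arr (20 + x) = ρ.arr x

/-- The registers and arrays that a renamed program cannot access are the same. -/
structure Agree (σ τ : State) : Prop where
  reg : ∀ r < 100, τ.reg r = σ.reg r
  arr : ∀ x < 20, τ.arr x = σ.arr x

theorem Agree.refl (σ : State) : Agree σ σ := ⟨fun _ _ => rfl, fun _ _ => rfl⟩

theorem Agree.trans {σ τ υ : State} (h : Agree σ τ) (h' : Agree τ υ) : Agree σ υ :=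
  ⟨fun r hr => (h'.reg r hr).trans (h.reg r hr), fun x hx => (h'.arr x hx).trans (h.arr x hx)⟩

theorem Agree.setReg (σ : State) (r v : ℕ) : Agree σ (σ.setReg (100 + r) v) :=
  ⟨fun s hs => by simp [show s ≠ 100 + r by omega], fun _ _ => rfl⟩

theorem Agree.setArr (σ : State) (x i v : ℕ) : Agree σ (σ.setArr (20 + x) i v) :=
  ⟨fun _ _ => rfl, fun y hy => by simp [show y ≠ 20 + x by omega]⟩

theorem Simulates.setReg {B : ℕ} {ρ σ : State} (h : Simulates B ρ σ) (r v : ℕ) :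
    Simulates B (ρ.setReg r v) (σ.setReg (100 + r) v) :=
  ⟨fun s hs => by simp [h.reg s hs], h.arr⟩

theorem Simulates.setArr {B : ℕ} {ρ σ : State} (h : Simulates B ρ σ) (x i v : ℕ) :
    Simulates B (ρ.setArr x i v) (σ.setArr (20 + x) i v) :=
  ⟨h.reg, fun y => by simp [h.arr]⟩

/-- The renamed program lives in registers from 100 and arrays from 20, so it makes the same steps
as the original and leaves all other data intact. -/
theorem Exec.rename {w B : ℕ} {p : Program} {ρ ρ' σ : State} {t : ℕ} (h : Exec w p ρ t ρ')
    (hB : p.regBound ≤ B) (hs : Simulates B ρ σ) :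
    ∃ σ', Exec w p.rename σ t σ' ∧ Simulates B ρ' σ' ∧ Agree σ σ' := by
  induction h generalizing σ with
  | skip => exact ⟨σ, .skip σ, hs, .refl σ⟩
  | const ρ r v h => exact ⟨_, .const σ _ v h, hs.setReg r v, .setReg σ r v⟩
  | op ρ o r a b h =>
    simp only [Program.regBound, max_le_iff] at hB
    have ha : σ.reg (100 + a) = ρ.reg a := hs.reg a hB.2.1
    have hb : σ.reg (100 + b) = ρ.reg b := hs.reg b hB.2.2
    refine ⟨_, .op σ o _ _ _ (by rwa [ha, hb]), ?_, .setReg σ r _⟩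
    rw [ha, hb]; exact hs.setReg r _
  | load ρ r x a h =>
    simp only [Program.regBound, max_le_iff] at hB
    have ha : σ.reg (100 + a) = ρ.reg a := hs.reg a hB.2
    refine ⟨_, .load σ _ _ _ (by rwa [ha, hs.arr]), ?_, .setReg σ r _⟩
    rw [ha, hs.arr]; exact hs.setReg r _
  | store ρ x a b =>
    simp only [Program.regBound, max_le_iff] at hB
    have ha : σ.reg (100 + a) = ρ.reg a := hs.reg a hB.1
    have hb : σ.reg (100 + b) = ρ.reg b := hs.reg b hB.2
    refine ⟨_, .store σ _ _ _, ?_, .setArr σ x _ _⟩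
    rw [ha, hb]; exact hs.setArr x _ _
  | seq _ _ ih1 ih2 =>
    simp only [Program.regBound, max_le_iff] at hB
    obtain ⟨τ, h1, h2, h3⟩ := ih1 hB.1 hs
    obtain ⟨υ, g1, g2, g3⟩ := ih2 hB.2 h2
    exact ⟨υ, h1.seq g1, g2, h3.trans g3⟩
  | @cond_true a b p q ρ ρ' t h _ ih =>
    simp only [Program.regBound, max_le_iff] at hB
    obtain ⟨τ, h1, h2, h3⟩ := ih hB.2.1 hs
    exact ⟨τ, .cond_true (by rwa [hs.reg a hB.1.1, hs.reg b hB.1.2]) h1, h2, h3⟩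
  | @cond_false a b p q ρ ρ' t h _ ih =>
    simp only [Program.regBound, max_le_iff] at hB
    obtain ⟨τ, h1, h2, h3⟩ := ih hB.2.2 hs
    exact ⟨τ, .cond_false (by rwa [hs.reg a hB.1.1, hs.reg b hB.1.2]) h1, h2, h3⟩
  | @loop_done a b p ρ h =>
    simp only [Program.regBound, max_le_iff] at hB
    exact ⟨σ, .loop_done (by rwa [hs.reg a hB.1.1, hs.reg b hB.1.2]), hs, .refl σ⟩
  | @loop_step a b p ρ ρ' ρ'' t t' h _ _ ih1 ih2 =>
    have hB' := hB
    simp only [Program.regBound, max_le_iff] at hB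
    obtain ⟨τ, h1, h2, h3⟩ := ih1 hB.2 hs
    obtain ⟨υ, g1, g2, g3⟩ := ih2 hB' h2
    exact ⟨υ, .loop_step (by rwa [hs.reg a hB.1.1, hs.reg b hB.1.2]) h1 g1, g2, h3.trans g3⟩

theorem Exec.mono {w w' : ℕ} (hw : 2 ^ w ≤ 2 ^ w') {p : Program} {σ τ : State} {t : ℕ}
    (h : Exec w p σ t τ) : Exec w' p σ t τ := by
  induction h with
  | skip => exact .skip _
  | const _ _ _ h => exact .const _ _ _ (h.trans_le hw)
  | op _ _ _ _ _ h => exact .op _ _ _ _ _ (h.trans_le hw)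
  | load _ _ _ _ h => exact .load _ _ _ _ (h.trans_le hw)
  | store => exact .store _ _ _ _
  | seq _ _ ih1 ih2 => exact .seq ih1 ih2
  | cond_true h _ ih => exact .cond_true h ih
  | cond_false h _ ih => exact .cond_false h ih
  | loop_done h => exact .loop_done h
  | loop_step h _ _ ih1 ih2 => exact .loop_step h ih1 ih2

theorem Exec.bdd {w X : ℕ} (hX : 2 ^ w ≤ X) {p : Program} {σ τ : State} {t : ℕ}
    (h : Exec w p σ t τ) (hσ : σ.Bdd X) : τ.Bdd X := by
  induction h with
  | skip | loop_done => exact hσ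
  | const _ _ _ h => exact hσ.setReg (h.le.trans hX)
  | op _ _ _ _ _ h => exact hσ.setReg (h.le.trans hX)
  | load _ _ _ _ h => exact hσ.setReg (h.le.trans hX)
  | store _ _ _ b => exact hσ.setArr (hσ.1 b)
  | seq _ _ ih1 ih2 => exact ih2 (ih1 hσ)
  | cond_true _ _ ih => exact ih hσ
  | cond_false _ _ ih => exact ih hσ
  | loop_step _ _ _ ih1 ih2 => exact ih2 (ih1 hσ)

theorem exec_clear (w B : ℕ) (σ : State) : ∃ τ, Exec w (Program.clear B) σ (B + 1) τ ∧
    (∀ r < B, τ.reg (100 + r) = 0) ∧ τ.arr = σ.arr ∧ Agree σ τ := by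
  induction B with
  | zero => exact ⟨σ, .skip σ, by simp, rfl, .refl σ⟩
  | succ B ih =>
    obtain ⟨τ, h1, h2, h3, h4⟩ := ih
    refine ⟨_, h1.seq (.const τ (100 + B) 0 (by positivity)), fun r hr => ?_, h3,
      h4.trans (.setReg τ B 0)⟩
    rw [State.setReg_reg]
    split_ifs with h
    · rfl
    · exact h2 r (by omega)

/-- A triple allows arbitrary contents of the registers from 40 on, while the subroutine expects
zeros, hence the clearing. Its values are below 2^w ≤ X, so the bound on states survives the call,
and since its registers are erased, no register seems to change. -/
theorem embed_runs {𝔐 : Machine} {p : Program} {w t : ℕ} {ρ ρ' σ : State}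
    (hp : Exec w p ρ t ρ') (hw : 2 ^ w ≤ 𝔐.X) (hreg : ρ.reg = fun _ => 0)
    (harr : ∀ x, σ.arr (20 + x) = ρ.arr x) :
    Runs 𝔐 p.embed σ (t + p.regBound + 1) (fun τ => τ.reg = σ.reg ∧
      (∀ x < 20, τ.arr x = σ.arr x) ∧ ∀ x, τ.arr (20 + x) = ρ'.arr x) := by
  rintro hb σ₀ rfl
  have hρ : ρ.Bdd 𝔐.X := ⟨fun r => by simp [hreg], fun x i => by rw [← harr]; exact hb.2 _ i⟩
  have hρ' := hp.bdd hw hρ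
  have hw' : 2 ^ w ≤ 2 ^ 𝔐.w :=
    hw.trans ((Nat.le_self_pow (by norm_num) 𝔐.X).trans 𝔐.pow_lt.le)
  obtain ⟨τ, h1, h2, h3, h4⟩ := exec_clear 𝔐.w p.regBound σ₀
  obtain ⟨υ, g1, g2, g3⟩ := (hp.mono hw').rename le_rfl (σ := τ)
    ⟨fun r hr => by rw [h2 r hr, hreg], fun x => by rw [h3, ← harr]; rfl⟩
  have hag := h4.trans g3
  have hregs : υ.erase.reg = σ₀.erase.reg := by
    funext r
    simp only [State.erase]
    split_ifs with hr
    · exact hag.reg r (by omega)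
    · rfl
  refine ⟨_, υ, h1.seq g1, by omega, ⟨fun r => ?_, fun x i => ?_⟩, hregs, hag.arr, g2.arr⟩
  · rw [hregs]; exact hb.1 r
  · rcases Nat.lt_or_ge x 20 with h | h
    · exact (congrFun (hag.arr x h) i).le.trans (hb.2 x i)
    · obtain ⟨y, rfl⟩ := Nat.exists_eq_add_of_le h
      exact (congrFun (g2.arr y) i).le.trans (hρ'.2 y i)

end RAM

/-! ### Positions in concatenated lists -/

namespace List

variable {α : Type*}

theorem sum_range_length_getD (l : List α) (a : α) (f : α → ℕ) :
    ∑ v ∈ Finset.range l.length, f (l.getD v a) = (l.map f).sum := by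
  induction l with
  | nil => rfl
  | cons b l ih =>
    rw [length_cons, Finset.sum_range_succ', map_cons, sum_cons, ← ih, add_comm]
    rfl

theorem getElem?_flatten_add {L : List (List α)} {i v : ℕ} (hi : i < L.length)
    (hv : v < L[i].length) : L.flatten[(L.take i).flatten.length + v]? = some L[i][v] := by
  have h : L.flatten = (L.take i).flatten ++ (L[i] ++ (L.drop (i + 1)).flatten) := by
    conv_lhs => rw [← take_append_drop i L, drop_eq_getElem_cons hi]
    rw [flatten_append, flatten_cons]
  rw [h, getElem?_append_right (by omega), Nat.add_sub_cancel_left,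
    getElem?_append_left hv, getElem?_eq_getElem hv]

end List

namespace ThreeSum

open Finset RAM RAM.Expr

/-! ### Evaluating the answers -/

/-- The register `0` tells whether `p` holds. -/
structure Flag (p : Prop) (σ : State) : Prop where
  yes : p → σ.reg 0 = 1
  no : ¬ p → σ.reg 0 = 0

theorem Flag.congr {p q : Prop} {σ τ : State} (h : Flag p σ) (hpq : p ↔ q)
    (h0 : τ.reg 0 = σ.reg 0) : Flag q τ :=
  ⟨fun hq => h0.trans (h.yes (hpq.mpr hq)), fun hq => h0.trans (h.no fun hp => hq (hpq.mp hp))⟩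

/-- Starting positions of the answers, in array `18`. -/
def offsetCode : Program :=
  assign 20 0 ;; forLoop 28 19 (write 18 (reg 28) (reg 20) ;; assign 20 (reg 20 + ld 26 (reg 28)))

theorem offsetCode_runs {𝔐 : Machine} {σ : State} {Ls : List (List ℕ)}
    (hnum : σ.reg 19 = Ls.length) (hsz : ∀ k (hk : k < Ls.length), σ.arr 26 k = Ls[k].length)
    (hX : Ls.flatten.length ≤ 𝔐.X) :
    Runs 𝔐 offsetCode σ (Ls.length * 303 + 102)
      (fun τ => ∀ k < Ls.length, τ.arr 18 k = (Ls.take k).flatten.length) := by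
  have hmono : ∀ k, (Ls.take k).flatten.length ≤ 𝔐.X := fun k => by
    refine le_trans ?_ hX
    conv_rhs => rw [← List.take_append_drop k Ls, List.flatten_append, List.length_append]
    omega
  refine (Runs.assign_seq (by simp) <| Runs.forLoop (B := Ls.length) (c := 300)
    (fun j τ => τ.reg 20 = (Ls.take j).flatten.length ∧
      ∀ k < j, τ.arr 18 k = (Ls.take k).flatten.length) (by simpa using hnum) (by simp) ?_
    (fun τ _ _ _ h => h.2)).mono (by omega)
  rintro j hj τ hb hF hτ ⟨h20, h18⟩
  have a26 : τ.arr 26 j = Ls[j].length := (congrFun (hF.arr 26 rfl) j).trans (hsz j hj)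
  have hstep : (Ls.take (j + 1)).flatten.length = (Ls.take j).flatten.length + Ls[j].length := by
    rw [List.take_add_one, List.getElem?_eq_getElem hj, List.flatten_append, List.length_append]
    simp
  refine (Runs.write_seq (by simpa using hb.1 20) <| Runs.assign ?_ ⟨?_, ?_⟩).mono (by norm_num)
  · have := hmono (j + 1)
    simp only [State.setArr_reg, State.setArr_arr, eval_add, eval_reg, eval_ld, h20, hτ,
      show ¬ (26 = 18) by norm_num, if_false, a26]
    omega
  · rw [hstep]; simp [h20, hτ, a26]
  · intro k hk
    rcases Nat.lt_or_eq_of_le (Nat.le_of_lt_succ hk) with h | rfl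
    · simpa [hτ, h.ne] using h18 k h
    · simpa [hτ] using h20

/-- Does the entry `x` together with some element of the table `mem` sum up to `c`? -/
def Completes (L mem : ℕ → ℕ) (c x : ℕ) : Prop := L x < c ∧ 0 < mem (c - L x)

/-- Check the entries of the bucket with the key in register `34`. -/
def bucketCode : Program :=
  assign 35 (ld 15 (reg 34)) ;; forLoop 26 35 (
    assign 36 (ld 1 (ld 16 (reg 34 * reg 6 + reg 26))) ;;
    ite (reg 36) (reg 32) (ite 0 (ld 3 (reg 32 - reg 36)) (assign 0 1) .skip) .skip)

/-- The comparison with the target comes first, because c - L x is a truncated subtraction and would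
be meaningless otherwise. -/
theorem bucketCode_runs {𝔐 : Machine} {σ : State} {p : Prop} {L mem : ℕ → ℕ} {c key g : ℕ}
    {l : List ℕ} (h1 : σ.arr 1 = L) (h3 : σ.arr 3 = mem) (hc : σ.reg 32 = c) (hg : σ.reg 6 = g)
    (hkey : σ.reg 34 = key) (h15 : σ.arr 15 key = l.length)
    (h16 : ∀ k (hk : k < l.length), σ.arr 16 (key * g + k) = l[k]) (hp : Flag p σ) :
    Runs 𝔐 bucketCode σ (l.length * 603 + 102) (Flag (p ∨ ∃ x ∈ l, Completes L mem c x)) := by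
  refine Runs.of_bdd fun hσb => ?_
  refine (Runs.assign_seq (by simpa using hσb.2 15 _) <| Runs.forLoop (B := l.length) (c := 600)
    (fun j => Flag (p ∨ ∃ x ∈ l.take j, Completes L mem c x)) (by simp [hkey, h15])
    (hp.congr (by simp) (by simp)) ?_
    (fun τ _ _ _ h => h.congr (by simp) rfl)).mono (by omega)
  intro j hj τ hb hF hτ hI
  have a1 : τ.arr 1 = L := (hF.arr 1 rfl).trans (by simpa using h1)
  have a3 : τ.arr 3 = mem := (hF.arr 3 rfl).trans (by simpa using h3)
  have r32 : τ.reg 32 = c := (hF.reg 32 rfl).trans (by simpa using hc)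
  have r34 : τ.reg 34 = key := (hF.reg 34 rfl).trans (by simpa using hkey)
  have r6 : τ.reg 6 = g := (hF.reg 6 rfl).trans (by simpa using hg)
  have a16 : τ.arr 16 (key * g + j) = l[j] :=
    (congrFun (hF.arr 16 rfl) _).trans (by simpa using h16 j hj)
  have hx : ∀ q : Prop, (q ↔ Completes L mem c l[j]) →
      ((p ∨ ∃ x ∈ l.take (j + 1), Completes L mem c x) ↔
        (p ∨ ∃ x ∈ l.take j, Completes L mem c x) ∨ q) := by
    intro q hq
    rw [hq, List.take_add_one, List.getElem?_eq_getElem hj, or_assoc]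
    simp only [List.mem_append, Option.mem_toList, or_and_right,
      exists_or, Option.some.injEq, exists_eq_left']
  refine (Runs.assign_seq (by simpa using hb.2 1 _) <| Runs.ite (t := 300) (t' := 1)
    (fun hlt => (Runs.ite (t := 100) (t' := 1) (fun hlt' => Runs.assign ?_ ?_)
      fun hlt' => Runs.skip ?_).mono (by norm_num)) fun hlt => Runs.skip ?_).mono (by norm_num)
  · have := 𝔐.two_le
    simp; omega
  · simp [a1, a3, r32, r34, r6, hτ, a16] at hlt hlt'
    exact ⟨fun _ => by simp, fun h => absurd ((hx _ Iff.rfl).mpr (Or.inr ⟨hlt, hlt'⟩)) h⟩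
  · simp [a1, a3, r32, r34, r6, hτ, a16] at hlt hlt'
    exact hI.congr ((or_iff_left_of_imp fun h => h.elim).symm.trans
      (hx _ ⟨False.elim, fun h => by have := h.2; omega⟩).symm) (by simp)
  · simp [a1, r32, r34, r6, hτ, a16] at hlt
    exact hI.congr ((or_iff_left_of_imp fun h => h.elim).symm.trans
      (hx _ ⟨False.elim, fun h => by have := h.1; omega⟩).symm) (by simp)

/-- The reported elements `Ls` are stored, with their offsets. -/
structure OutputAt (Ls : List (List ℕ)) (σ : State) : Prop where
  sizes : ∀ k (hk : k < Ls.length), σ.arr 26 k = Ls[k].length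
  elems : ∀ k (hk : k < Ls.flatten.length), σ.arr 27 k = Ls.flatten[k]
  offsets : ∀ k < Ls.length, σ.arr 18 k = (Ls.take k).flatten.length

/-- Check the answer with the index in array `14` at the position in register `28`. -/
def answerCode : Program :=
  assign 29 (ld 14 (reg 28)) ;; assign 30 (ld 12 (reg 28) * (reg 7 + 1)) ;;
  assign 31 (ld 26 (reg 29)) ;; assign 32 (ld 1 (ld 4 (reg 28))) ;; assign 33 (ld 18 (reg 29)) ;;
  forLoop 27 31 (assign 34 (reg 30 + ld 27 (reg 33 + reg 27)) ;; bucketCode)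

/-- The cost depends on the bucket sizes. A uniform bound per reported element would be too weak, so
the loop rule with individual costs is used. -/
theorem answerCode_runs {𝔐 : Machine} {σ : State} {p : Prop} {L mem : ℕ → ℕ} {V g m i N : ℕ}
    {Ls : List (List ℕ)} {B : ℕ → List ℕ} (hO : OutputAt Ls σ) (h1 : σ.arr 1 = L)
    (h3 : σ.arr 3 = mem) (hg : σ.reg 6 = g) (hV : σ.reg 7 = V) (hm : σ.reg 28 = m)
    (hi : σ.arr 14 m < Ls.length) (h12 : σ.arr 12 m = i) (hiN : i < N)
    (hX : N * (V + 1) ≤ 𝔐.X)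
    (hle : ∀ u ∈ Ls[σ.arr 14 m], u ≤ V)
    (h15 : ∀ u ≤ V, σ.arr 15 (i * (V + 1) + u) = (B u).length)
    (h16 : ∀ u ≤ V, ∀ k (hk : k < (B u).length), σ.arr 16 ((i * (V + 1) + u) * g + k) = (B u)[k])
    (hp : Flag p σ) :
    Runs 𝔐 answerCode σ ((Ls[σ.arr 14 m].map fun u => (B u).length * 603 + 205).sum + 502)
      (Flag (p ∨ ∃ u ∈ Ls[σ.arr 14 m], ∃ x ∈ B u, Completes L mem (L (σ.arr 4 m)) x)) := by
  set id := σ.arr 14 m with hid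
  set l := Ls[id] with hl
  set c := L (σ.arr 4 m) with hc
  have hiV : i * (V + 1) + V + 1 ≤ 𝔐.X := by
    have : (i + 1) * (V + 1) ≤ N * (V + 1) := Nat.mul_le_mul_right _ hiN
    rw [Nat.succ_mul] at this; omega
  refine Runs.of_bdd fun hσb => ?_
  refine (Runs.assign_seq (by simpa using hσb.2 14 _) <|
    Runs.assign_seq (by simp [hm, h12, hV]; omega) <|
    Runs.assign_seq (by simpa using hσb.2 26 _) <| Runs.assign_seq (by simpa using hσb.2 1 _) <|
    Runs.assign_seq (by simpa using hσb.2 18 _) <| Runs.forLoop_sum (B := l.length)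
      (fun v => Flag (p ∨ ∃ u ∈ l.take v, ∃ x ∈ B u, Completes L mem c x))
      (fun v => (B (l.getD v 0)).length * 603 + 202)
      (by simp [hm, ← hid, hO.sizes id hi, hl]) (hp.congr (by simp) (by simp)) ?_
    (fun τ _ _ _ h => h.congr (by simp) rfl)).mono ?_
  · intro v hv τ hb hF hτ hI
    have hvu : l.getD v 0 = l[v] := by simp [hv]
    have hu : l[v] ≤ V := hle _ (List.getElem_mem hv)
    have a1 : τ.arr 1 = L := (hF.arr 1 rfl).trans (by simpa using h1)
    have a3 : τ.arr 3 = mem := (hF.arr 3 rfl).trans (by simpa using h3)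
    have r32 : τ.reg 32 = c := (hF.reg 32 rfl).trans (by simp [hm, h1, hc])
    have r30 : τ.reg 30 = i * (V + 1) := (hF.reg 30 rfl).trans (by simp [hm, hV, h12])
    have r6 : τ.reg 6 = g := (hF.reg 6 rfl).trans (by simpa using hg)
    have r33 : τ.reg 33 = (Ls.take id).flatten.length :=
      (hF.reg 33 rfl).trans (by
        simp only [State.setReg_reg, State.setReg_arr, eval_ld, eval_reg]
        simpa [hm, ← hid] using hO.offsets id hi)
    have a27 : τ.arr 27 ((Ls.take id).flatten.length + v) = l[v] := by
      have h := List.getElem?_flatten_add hi hv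
      obtain ⟨h5, h6⟩ := List.getElem?_eq_some_iff.mp h
      exact (congrFun (hF.arr 27 rfl) _).trans ((hO.elems _ h5).trans h6)
    have hx : ((p ∨ ∃ u ∈ l.take v, ∃ x ∈ B u, Completes L mem c x) ∨
          ∃ x ∈ B l[v], Completes L mem c x) ↔
        (p ∨ ∃ u ∈ l.take (v + 1), ∃ x ∈ B u, Completes L mem c x) := by
      rw [List.take_add_one, List.getElem?_eq_getElem hv, or_assoc]
      simp only [List.mem_append, Option.mem_toList, or_and_right, exists_or, Option.some.injEq,
        exists_eq_left']
    rw [hvu]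
    generalize (Ls.take id).flatten.length = off at r33 a27
    refine Runs.mono (t := 100 + ((B l[v]).length * 603 + 102)) ?_ (by omega)
    refine Runs.assign_seq (by simp [r30, r33, hτ, a27]; omega) <|
      Runs.imp (bucketCode_runs (key := i * (V + 1) + l[v]) (l := B l[v]) (g := g) a1 a3 (by simpa using r32)
        (by simpa using r6) (by simp [r30, r33, hτ, a27])
        ((congrFun (hF.arr 15 rfl) _).trans (h15 _ hu))
        (fun k hk => (congrFun (hF.arr 16 rfl) _).trans (h16 _ hu k hk))
        (hI.congr Iff.rfl (by simp)))
        fun κ _ _ hκ => hκ.congr hx (by simp)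
  · have h := List.sum_range_length_getD l 0 (fun u => (B u).length * 603 + 205)
    have h' : ∑ v ∈ range l.length, ((B (l.getD v 0)).length * 603 + 202 + 3) =
        ∑ v ∈ range l.length, ((B (l.getD v 0)).length * 603 + 205) :=
      sum_congr rfl fun _ _ => by omega
    rw [← h, h']
    omega

theorem Tasks.TablesAt.of_eq {W : Tasks} {ℓ h : ℕ} {d : ℕ → ℕ} {σ τ : State}
    (hT : W.TablesAt ℓ h d σ) (h15 : τ.arr 15 = σ.arr 15) (h16 : τ.arr 16 = σ.arr 16)
    (h14 : τ.arr 14 = σ.arr 14) (h12 : τ.arr 12 = σ.arr 12) (h19 : τ.reg 19 = σ.reg 19) :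
    W.TablesAt ℓ h d τ :=
  ⟨by rw [h15]; exact hT.buckets, by rw [h16]; exact hT.slots, h19.trans hT.num,
    by rw [h14]; exact hT.index, by rw [h12]; exact hT.side⟩

/-- Some reported element leads to a solution of some task. -/
def Tasks.Solved (W : Tasks) (ℓ h : ℕ) (d mem : ℕ → ℕ) (m : ℕ) : Prop :=
  ∃ u, (u ∈ W.members ℓ h d (W.pair ℓ h d m).1 W.g ∧ u ∈ W.members ℓ h d (W.pair ℓ h d m).2 W.g) ∧
    ∃ x ∈ W.bucket ℓ h d (W.pair ℓ h d m).1 W.g u, Completes W.L mem (W.L (W.wz m)) x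

/-- Check the answers for all tasks. -/
def verifyCode : Program := offsetCode ;; assign 0 0 ;; forLoop 28 9 answerCode

theorem verifyCode_runs {𝔐 : Machine} {σ : State} {P : Params} (hP : P.Holds σ) {W : Tasks}
    (hWσ : W = P.tasks σ) (hW : W.Valid) {d mem : ℕ → ℕ} (hℓ : 0 < P.ℓ)
    (hd : ∀ t < 2 * P.h, 1 ≤ d t ∧ d t ≤ P.ℓ) (h3 : σ.arr 3 = mem)
    (hT : W.TablesAt P.ℓ P.h d σ) {Ls : List (List ℕ)}
    (hLs : List.Forall₂ (fun e l => l.Nodup ∧ l.toFinset =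
      (W.members P.ℓ P.h d e.1 W.g).toFinset ∩ (W.members P.ℓ P.h d e.2 W.g).toFinset)
      (W.pairs P.ℓ P.h d W.N) Ls)
    (h26 : ∀ k (hk : k < Ls.length), σ.arr 26 k = Ls[k].length)
    (h27 : ∀ k (hk : k < Ls.flatten.length), σ.arr 27 k = Ls.flatten[k])
    (hX : Ls.flatten.length ≤ 𝔐.X) (hX1 : 2 * P.R * P.ℓ ^ P.h * (P.ℓ ^ (2 * P.h) + 1) ≤ 𝔐.X) :
    Runs 𝔐 verifyCode σ (W.N * 811 + 808 * W.collisions (2 * P.h) d + 300)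
      (Flag (∃ m < W.N, W.Solved P.ℓ P.h d mem m)) := by
  classical
  have hlen : Ls.length = (W.pairs P.ℓ P.h d W.N).length := hLs.length_eq.symm
  have hlenN : Ls.length ≤ W.N := hlen.le.trans (W.length_pairs_le ..)
  have hWN : W.N = σ.reg 9 := by rw [hWσ]; rfl
  have hWR : W.R = P.R := by rw [hWσ]; rfl
  have hWg : W.g = P.g := by rw [hWσ]; rfl
  have hget : ∀ m < W.N, ∃ hi : σ.arr 14 m < Ls.length, Ls[σ.arr 14 m].Nodup ∧
      Ls[σ.arr 14 m].toFinset = (W.members P.ℓ P.h d (W.pair P.ℓ P.h d m).1 W.g).toFinset ∩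
        (W.members P.ℓ P.h d (W.pair P.ℓ P.h d m).2 W.g).toFinset := by
    intro m hm
    obtain ⟨h1, h2⟩ := List.getElem?_eq_some_iff.mp (hT.index m hm)
    have h3 : σ.arr 14 m < Ls.length := by omega
    have h4 := (List.forall₂_iff_get.mp hLs).2 _ h1 h3
    rw [List.get_eq_getElem, List.get_eq_getElem, h2] at h4
    exact ⟨h3, h4⟩
  have hmem : ∀ m (hm : m < W.N) u, u ∈ Ls[σ.arr 14 m]'(hget m hm).1 ↔
      u ∈ W.members P.ℓ P.h d (W.pair P.ℓ P.h d m).1 W.g ∧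
        u ∈ W.members P.ℓ P.h d (W.pair P.ℓ P.h d m).2 W.g := by
    intro m hm u
    rw [← List.mem_toFinset, (hget m hm).2.2, mem_inter, List.mem_toFinset, List.mem_toFinset]
  set b : ℕ → ℕ → ℕ := fun m u => (W.bucket P.ℓ P.h d (W.pair P.ℓ P.h d m).1 W.g u).length with hb
  set S : ℕ → ℕ := fun m => ∑ x ∈ range W.n, ∑ y ∈ range W.n,
    if W.Hit (2 * P.h) d m x y then 1 else 0 with hS
  -- A reported element costs 205 steps plus 603 per entry of its bucket. The bucket is nonempty, so
  -- this is at most 808 times its length.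
  have hsum : ∀ m (hm : m < W.N), ((Ls[σ.arr 14 m]'(hget m hm).1).map fun u =>
      b m u * 603 + 205).sum ≤ 808 * S m := by
    intro m hm
    rw [← List.sum_toFinset _ (hget m hm).2.1, (hget m hm).2.2]
    refine le_trans ?_ (Nat.mul_le_mul_left _ (Tasks.sum_bucket_le hW hℓ hd hm))
    rw [mul_sum]
    refine sum_le_sum fun u hu => ?_
    rw [mem_inter, List.mem_toFinset] at hu
    have := Tasks.one_le_length_bucket hu.1
    simp only [hb]; omega
  refine Runs.mono (t := Ls.length * 303 + 102 + (100 +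
    (∑ m ∈ range W.N, (808 * S m + 502 + 3) + 2))) ?_ ?_
  · refine Runs.seq (offsetCode_runs (hT.num.trans hlen.symm) h26 hX) fun τ _ F h18 => ?_
    refine Runs.assign_seq (by simp) <| Runs.forLoop_sum (B := W.N)
      (fun j => Flag (∃ m < j, W.Solved P.ℓ P.h d mem m)) (fun m => 808 * S m + 502)
      (by simp [F.reg 9 rfl, hWN]) ⟨by simp, by simp⟩ ?_ (fun υ _ _ _ h => h)
    intro m hm υ hbd hF hυ hI
    have q : ∀ x, offsetCode.wa x = false → answerCode.wa x = false → υ.arr x = σ.arr x :=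
      fun x h1 h2 => (hF.arr x (by simpa [Program.wa, forLoop] using h2)).trans (F.arr x h1)
    have qr : ∀ r, offsetCode.wr r = false → (forLoop 28 9 answerCode).wr r = false → r ≠ 0 →
        υ.reg r = σ.reg r := fun r h1 h2 h3 =>
      (hF.reg r h2).trans (by simpa [h3] using F.reg r h1)
    have hPυ : P.Holds υ := (hP.of_frame F).setReg.of_frame hF
    have a14 := q 14 rfl rfl
    have hTυ : W.TablesAt P.ℓ P.h d υ := hT.of_eq (q 15 rfl rfl) (q 16 rfl rfl) a14
      (q 12 rfl rfl) (qr 19 rfl rfl (by norm_num))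
    have hO : OutputAt Ls υ := ⟨by rw [q 26 rfl rfl]; exact h26, by rw [q 27 rfl rfl]; exact h27,
      by rw [hF.arr 18 rfl]; exact h18⟩
    obtain ⟨hp1, hp2⟩ := Tasks.pair_lt (m := m) hℓ hd (hW.wi_lt m hm) (hW.wj_lt m hm)
    have a4 : υ.arr 4 = W.wz := (q 4 rfl rfl).trans (by rw [hWσ]; rfl)
    have hget' : υ.arr 14 m < Ls.length := by rw [a14]; exact (hget m hm).1
    have hLsm : Ls[υ.arr 14 m] = Ls[σ.arr 14 m]'(hget m hm).1 := by simp only [a14]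
    have hVle : ∀ u ∈ Ls[υ.arr 14 m], u ≤ P.ℓ ^ (2 * P.h) := by
      intro u hu
      rw [hLsm, hmem m hm] at hu
      obtain ⟨x, _, rfl⟩ := Tasks.mem_members.mp hu.1
      exact (W.code_mem_Icc hd _ x).2
    have hs := hsum m hm
    rw [← hLsm] at hs
    refine Runs.mono (t := (Ls[υ.arr 14 m].map fun u => b m u * 603 + 205).sum + 502) ?_
      (by omega)
    refine Runs.imp (answerCode_runs (p := ∃ m' < m, W.Solved P.ℓ P.h d mem m') (L := W.L)
      (mem := mem) (V := P.ℓ ^ (2 * P.h)) (g := W.g) (i := (W.pair P.ℓ P.h d m).1)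
      (B := W.bucket P.ℓ P.h d (W.pair P.ℓ P.h d m).1 W.g) hO
      ((q 1 rfl rfl).trans (by rw [hWσ]; rfl)) ((q 3 rfl rfl).trans h3) (hWg ▸ hPυ.g) hPυ.V hυ
      hget' (hTυ.side m hm) hp1 (by rw [hWR]; exact hX1) hVle (fun u hu => hTυ.buckets _ u hp1 hu)
      (fun u hu k hk => hTυ.slots _ u k hp1 hu hk) hI) fun κ _ _ hκ => hκ.congr ?_ (by simp)
    rw [a4, hLsm]
    simp only [hmem m hm]
    constructor
    · rintro (⟨m', h1, h2⟩ | h)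
      · exact ⟨m', by omega, h2⟩
      · exact ⟨m, by omega, h⟩
    · rintro ⟨m', h1, h2⟩
      rcases Nat.lt_or_eq_of_le (Nat.le_of_lt_succ h1) with h | rfl
      · exact Or.inl ⟨m', h, h2⟩
      · exact Or.inr h2
  · have h1 : ∑ m ∈ range W.N, (808 * S m + 502 + 3) =
        808 * W.collisions (2 * P.h) d + W.N * 505 := by
      have h2 : W.collisions (2 * P.h) d = ∑ m ∈ range W.N, S m := by
        rw [Tasks.collisions]
      rw [h2, mul_sum, sum_congr rfl fun _ _ => add_assoc _ _ _, sum_add_distrib]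
      simp
    rw [h1]; omega

end ThreeSum

namespace ThreeSum

open Finset RAM RAM.Expr

/-! ### The search for a solution -/

/-- Soundness holds because candidates are tested over the integers, so false positives cost time
but no correctness. Completeness holds because an integer solution satisfies all congruences and its
task has been listed. -/
theorem Tasks.exists_solved_iff {W : Tasks} (hW : W.Valid) {ℓ h : ℕ} {d mem : ℕ → ℕ} (hℓ : 0 < ℓ)
    (hd : ∀ t < 2 * h, 1 ≤ d t ∧ d t ≤ ℓ) (hmem : ∀ v, 0 < mem v ↔ ∃ y < W.n, W.L y = v)
    (hpos : ∀ y < W.n, 1 ≤ W.L y)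
    (hrec : ∀ z < W.n, ∀ x < W.n, ∀ y < W.n, W.L x + W.L y = W.L z →
      ∃ m < W.N, W.wz m = z ∧ W.wi m = x / W.g ∧ W.wj m = y / W.g) :
    (∃ m < W.N, W.Solved ℓ h d mem m) ↔
      ∃ x < W.n, ∃ y < W.n, ∃ z < W.n, W.L x + W.L y = W.L z := by
  constructor
  · rintro ⟨m, hm, u, _, x, hx, h1, h2⟩
    obtain ⟨y, hy, hxy⟩ := (hmem _).mp h2
    have hxn : x < W.n := by
      rw [bucket, List.mem_filter, mem_block hW.g_pos] at hx
      exact hx.1.1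
    exact ⟨x, hxn, y, hy, _, hW.wz_lt m hm, by omega⟩
  · rintro ⟨x, hx, y, hy, z, hz, hxyz⟩
    obtain ⟨m, hm, h1, h2, h3⟩ := hrec z hz x hx y hy hxyz
    have hhit : W.Hit (2 * h) d m x y := ⟨h2.symm, h3.symm, fun t _ => by rw [h1, hxyz]⟩
    obtain ⟨u, hu1, hu2, hu3⟩ := exists_of_hit hW hℓ hd hm hx hy hhit
    have := hpos y hy
    exact ⟨m, hm, u, ⟨hu1, hu2⟩, x, hu3, by rw [h1]; omega,
      (hmem _).mpr ⟨y, hy, by rw [h1]; omega⟩⟩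

theorem length_flatten_of_forall₂ {ι : Type*} {f : ι → Finset ℕ} {l : List ι}
    {L : List (List ℕ)} (h : List.Forall₂ (fun e l => l.Nodup ∧ l.toFinset = f e) l L) :
    L.flatten.length = (l.map fun e => #(f e)).sum := by
  induction h with
  | nil => rfl
  | cons h _ ih =>
    rw [List.flatten_cons, List.length_append, ih, List.map_cons, List.sum_cons, ← h.2,
      List.toFinset_card_of_nodup h.1]

theorem Tasks.exists_of_reports {W : Tasks} {ℓ h : ℕ} {d : ℕ → ℕ} {hW : W.Valid} {hℓ : 0 < ℓ}
    {hd : ∀ t < 2 * h, 1 ≤ d t ∧ d t ≤ ℓ} {σ : State}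
    (hσ : (W.toSetIntersection ℓ h d hW hℓ hd).Reports σ) : ∃ Ls : List (List ℕ),
      List.Forall₂ (fun e l => l.Nodup ∧ l.toFinset =
        (W.members ℓ h d e.1 W.g).toFinset ∩ (W.members ℓ h d e.2 W.g).toFinset)
        (W.pairs ℓ h d W.N) Ls ∧
      (∀ k (hk : k < Ls.length), σ.arr 6 k = Ls[k].length) ∧
      (∀ k (hk : k < Ls.flatten.length), σ.arr 7 k = Ls.flatten[k]) ∧
      Ls.flatten.length ≤ W.collisions (2 * h) d := by
  obtain ⟨Ls, h1, h2, h3⟩ := hσ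
  refine ⟨Ls, ?_, h2, h3, ?_⟩
  · have hq : W.pairs ℓ h d W.N = (W.toSetIntersection ℓ h d hW hℓ hd).queries.map
        fun e => ((e.1 : ℕ), (e.2 : ℕ)) := by
      refine Eq.symm ((List.map_pmap ..).trans ?_)
      exact (List.pmap_eq_map ..).trans (List.map_id _)
    rw [hq, List.forall₂_map_left_iff]
    exact h1
  · rw [length_flatten_of_forall₂ h1]
    exact W.outputSize_le ℓ h d hW hℓ hd

theorem Params.Holds.congr {P : Params} {σ τ : State} (hP : P.Holds σ) (h : τ.reg = σ.reg) :
    P.Holds τ := by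
  obtain ⟨h1, h2, h3, h4, h5, h6, h7, h8, h9, h10, h11, h12⟩ := hP
  constructor <;> rw [h] <;> assumption

/-- Solve the tasks by means of a program for Set Intersection. -/
def searchCode (e : ℕ) (p : Program) : Program :=
  tableCode e ;; greedyCode ;;
    ite (reg 11) (reg 14) (assign 0 1) (buildCode ;; p.embed ;; verifyCode)

/-- A bound for the running time of `searchCode`, without the program for Set Intersection. -/
def Params.searchTime (P : Params) (N : ℕ) : ℕ :=
  P.ℓ * (P.e * (P.ℓ * 103 + 300) + P.ℓ * 606 + 1000) + 2 * P.h * P.ℓ * P.ℓ * 203 + 1000 +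
    (2 * P.h * (P.D * (P.countTime N + 1000) + 1000) + P.countTime N + 10) +
    (2 * P.R * P.ℓ ^ P.h * (P.g * (2 * P.h * 303 + 1610) + 710) +
      N * (4 * P.h * 303 + 2500) + 1500) + (N * 811 + 808 * P.D ^ P.f + 300) + 200

/-- Set Intersection is called only when the number of surviving pairs is at most D^f, so `hp` needs
to cover only instances with such a small output. -/
theorem searchCode_runs {𝔐 : Machine} {σ : State} {P : Params} (hP : P.Holds σ) {W : Tasks}
    (hWσ : W = P.tasks σ) (hW : W.Valid) (hD : 2 ≤ P.D) (hDℓ : 2 * P.D < P.ℓ) (hℓ : P.ℓ.Prime)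
    (he : 1 ≤ P.e) (heX : P.e ≤ 𝔐.X) (hMX : P.ℓ ^ P.e ≤ 𝔐.X)
    (hX : P.R * P.R * P.ℓ ^ (2 * P.h) ≤ 𝔐.X) (hX1 : 2 * P.h * P.ℓ * P.ℓ ≤ 𝔐.X)
    (hX2 : 2 * P.ℓ * P.ℓ ≤ 𝔐.X) (hX3 : 2 * P.R * P.ℓ ^ P.h * (P.ℓ ^ (2 * P.h) + 1) ≤ 𝔐.X)
    (hX4 : 2 * P.R * P.ℓ ^ P.h * P.g ≤ 𝔐.X)
    (hX5 : 2 * P.R * P.ℓ ^ P.h * (2 * P.R * P.ℓ ^ P.h) ≤ 𝔐.X) (hR : 1 ≤ P.R)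
    (hcoll : W.N * (P.g * P.g) < P.ℓ ^ P.e) (hz : ∀ x, 15 ≤ x → σ.arr x = fun _ => 0)
    (hmem : ∀ v, 0 < σ.arr 3 v ↔ ∃ y < W.n, W.L y = v) (hpos : ∀ y < W.n, 1 ≤ W.L y)
    (hrec : ∀ z < W.n, ∀ x < W.n, ∀ y < W.n, W.L x + W.L y = W.L z →
      ∃ m < W.N, W.wz m = z ∧ W.wi m = x / W.g ∧ W.wj m = y / W.g)
    {B : ℕ} (hB : ∀ x < W.n, 2 * W.L x < 2 ^ B)
    (hno : ∀ F, Nat.primeCounting P.D ^ (2 * P.h) * F ≤ B ^ (2 * P.h) * (W.N * (P.g * P.g)) →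
      F ≤ P.D ^ P.f)
    {p : Program} {w t : ℕ} (hw : 2 ^ w ≤ 𝔐.X)
    (hp : ∀ I : SetIntersection, I.U = P.ℓ ^ (2 * P.h) → I.N = 2 * P.R * P.ℓ ^ P.h → I.s = P.g →
      I.q ≤ W.N → I.outputSize ≤ P.D ^ P.f →
      ∃ t' τ, Exec w p (I.start (P.D ^ P.m)) t' τ ∧ t' ≤ t ∧ I.Reports τ) :
    Runs 𝔐 (searchCode P.e p) σ (P.searchTime W.N + (t + p.regBound + 1))
      (Flag (∃ x < W.n, ∃ y < W.n, ∃ z < W.n, W.L x + W.L y = W.L z)) := by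
  have hX0 := 𝔐.two_le
  have hWN : W.N = σ.reg 9 := by rw [hWσ]; rfl
  have hWn : W.n = P.n := by rw [hWσ]; rfl
  have hWR : W.R = P.R := by rw [hWσ]; rfl
  have hWg : W.g = P.g := by rw [hWσ]; rfl
  have hWL : W.L = σ.arr 1 := by rw [hWσ]; rfl
  have hℓX : 2 * P.ℓ ≤ 𝔐.X := le_trans (Nat.le_mul_of_pos_right _ hℓ.pos) hX2
  set T1 := P.ℓ * (P.e * (P.ℓ * 103 + 300) + P.ℓ * 606 + 1000) + 2 * P.h * P.ℓ * P.ℓ * 203 + 1000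
    with hT1
  set T2 := 2 * P.h * (P.D * (P.countTime W.N + 1000) + 1000) + P.countTime W.N + 10 with hT2
  set T3 := 2 * P.R * P.ℓ ^ P.h * (P.g * (2 * P.h * 303 + 1610) + 710) +
    W.N * (4 * P.h * 303 + 2500) + 1500 with hT3
  refine Runs.mono (t := T1 + (T2 + (max 100 (T3 + ((t + p.regBound + 1) +
    (W.N * 811 + 808 * P.D ^ P.f + 300))) + 200))) ?_ ?_
  · refine Runs.seq (tableCode_runs hP hℓ he heX hMX hX1 hℓX) fun τ₁ _ F₁ Q₁ => ?_
    have hW₁ : P.tasks τ₁ = W := (P.tasks_eq_of_frame F₁).trans hWσ.symm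
    have e9 : τ₁.reg 9 = W.N := (F₁.reg 9 rfl).trans hWN.symm
    rw [hT2, ← e9]
    refine Runs.seq (greedyCode_runs (hP.of_frame F₁) hD hDℓ hℓ he (hW₁ ▸ hW) hMX hX hX1 hX2 Q₁.1
      Q₁.2 hR (e9 ▸ hcoll)) fun τ₂ _ F₂ Q₂ => ?_
    rw [hW₁] at Q₂
    have hP₂ : P.Holds τ₂ := (hP.of_frame F₁).of_frame F₂
    have hW₂ : P.tasks τ₂ = W := (P.tasks_eq_of_frame F₂).trans hW₁
    obtain ⟨q1, q2, q3⟩ := Q₂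
    set d := τ₂.arr 7 with hd
    have hdℓ : ∀ t < 2 * P.h, 1 ≤ d t ∧ d t ≤ P.ℓ := fun t ht => by have := q1 t ht; omega
    have a3 : τ₂.arr 3 = σ.arr 3 := (F₂.arr 3 rfl).trans (F₁.arr 3 rfl)
    refine Runs.ite (fun hlt => Runs.assign (by simp; omega) ?_) fun hlt => ?_
    -- Too many surviving pairs contradict the greedy bound, which holds whenever there is no
    -- solution. The answer yes is right although no solution has been exhibited.
    · simp only [eval_reg, hP₂.f] at hlt
      refine ⟨fun _ => by simp, fun h => absurd ?_ (Nat.not_le.mpr hlt)⟩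
      refine hno _ (e9 ▸ q3 B (fun m hm x hx y hy hxy => ?_) fun x hx => ?_)
      · exact h ⟨x, hx, y, hy, _, hW.wz_lt m hm, hxy⟩
      · have : τ₁.arr 1 = W.L := (F₁.arr 1 rfl).trans hWL.symm
        rw [this]; exact hB x (hWn ▸ hx)
    · simp only [eval_reg, hP₂.f, q2, not_lt] at hlt
      refine Runs.seq (buildCode_runs hP₂ hW₂.symm hW hd.symm hℓ.pos hdℓ hX3 hX4 hX5 hR fun x hx =>
        (F₂.arr x (Program.wa_of_arrBound_le (le_trans (by decide) hx))).trans
          ((F₁.arr x (Program.wa_of_arrBound_le (le_trans (Nat.le_of_ble_eq_true rfl) hx))).trans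
            (hz x hx))) fun τ₃ _ F₃ Q₃ => ?_
      have hW₃ : P.tasks τ₃ = W := (P.tasks_eq_of_frame F₃).trans hW₂
      set I := W.toSetIntersection P.ℓ P.h d hW hℓ.pos hdℓ with hI
      obtain ⟨t', ρ, hE, ht', hρ⟩ := hp I rfl (by rw [hI, ← hWR]; rfl) hWg
        ((Tasks.q_toSetIntersection ..).le.trans (W.length_pairs_le ..))
        ((W.outputSize_le ..).trans hlt)
      obtain ⟨Ls, hL1, hL2, hL3, hL4⟩ := Tasks.exists_of_reports hρ
      refine Runs.seq ((embed_runs hE hw rfl Q₃.2).mono (by omega)) fun τ₄ _ _ Q₄ => ?_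
      obtain ⟨r1, r2, r3⟩ := Q₄
      have hW₄ : P.tasks τ₄ = W := by
        rw [← hW₃]
        simp only [Params.tasks, r1, r2 1 (by norm_num), r2 4 (by norm_num), r2 5 (by norm_num),
          r2 6 (by norm_num)]
      have hle : W.collisions (2 * P.h) d ≤ 𝔐.X := by
        refine le_trans ?_ (hcoll.le.trans hMX)
        rw [← hWg]
        exact W.collisions_le hW _ d
      refine ((verifyCode_runs ((hP₂.of_frame F₃).congr r1) hW₄.symm hW hℓ.pos hdℓ rfl
        (Q₃.1.of_eq (r2 15 (by norm_num)) (r2 16 (by norm_num)) (r2 14 (by norm_num))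
          (r2 12 (by norm_num)) (by rw [r1])) hL1 (fun k hk => (congrFun (r3 6) k).trans (hL2 k hk))
        (fun k hk => (congrFun (r3 7) k).trans (hL3 k hk)) (hL4.trans hle) hX3).mono
          (by omega)).imp fun τ₅ _ _ Q₅ => Q₅.congr ?_ rfl
      refine Tasks.exists_solved_iff hW hℓ.pos hdℓ (fun v => ?_) hpos hrec
      rw [← hmem v, r2 3 (by norm_num), F₃.arr 3 rfl, a3]
  · rw [Params.searchTime]
    omega

end ThreeSum

namespace ThreeSum

open Finset RAM RAM.Expr

/-! ### The reduction -/

/-- The parameters are the ones that `paramCode K r h e m f` computes from `n`. -/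
structure Params.Fits (P : Params) (n K r h e m f : ℕ) : Prop where
  n_eq : P.n = n
  e_eq : P.e = e
  h_eq : P.h = h
  m_eq : P.m = m
  f_eq : P.f = f
  pow_le : P.D ^ K ≤ n
  lt_pow : n < (P.D + 1) ^ K
  prime : P.ℓ.Prime
  lt : 2 * P.D < P.ℓ
  le : P.ℓ ≤ 4 * P.D
  R_eq : P.R = (n - 1) / (n / P.D ^ r + 1) + 1
  g_eq : P.g = n / P.D ^ r + 1

theorem Params.searchTime_mono (P : Params) {N N' : ℕ} (h : N ≤ N') :
    P.searchTime N ≤ P.searchTime N' := by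
  unfold searchTime countTime
  gcongr

/-- Decide 3SUM for many numbers. -/
def reductionCode (K r h e m f c : ℕ) (p : Program) : Program :=
  paramCode K r h e m f ;; sortCode c ;; walkCode ;; searchCode e p

-- All conditions on the word length are deduced from a single power of 4n. The value e = 4K + 1
-- makes ℓ^e larger than every count that can occur.
set_option maxHeartbeats 800000 in
theorem reductionCode_runs {𝔐 : Machine} {σ : State} {A : List ℕ} {n K r h e m f c B : ℕ}
    (hAn : A.length = n) (hn : σ.reg 1 = n) (hn1 : 1 ≤ n) (hA : A.Nodup)
    (hAc : ∀ a ∈ A, 1 ≤ a ∧ a ≤ n ^ c) (hc : 1 ≤ c) (hK : 2 ≤ K) (he : e = 4 * K + 1)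
    (hL : ListAt (σ.arr 1) A) (hmem : ∀ v, 0 < σ.arr 3 v ↔ v ∈ A)
    (hz : ∀ x, 15 ≤ x → σ.arr x = fun _ => 0) (hB : 2 * n ^ c < 2 ^ B)
    (hE : K + r + 4 * h + e + m + f + c + 10 ≤ 𝔐.X)
    (hX : (4 * n) ^ (K + r + 4 * h + e + m + f + c + 10) ≤ 𝔐.X)
    (hD : ∀ P : Params, P.Fits n K r h e m f → 4 ≤ P.D)
    (hno : ∀ P : Params, P.Fits n K r h e m f → ∀ F,
      Nat.primeCounting P.D ^ (2 * h) * F ≤ B ^ (2 * h) * (2 * P.R * n * (P.g * P.g)) →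
      F ≤ P.D ^ f)
    {p : Program} {w t T : ℕ} (hw : ∀ P : Params, P.Fits n K r h e m f → 2 ^ w ≤ 𝔐.X)
    (hp : ∀ P : Params, P.Fits n K r h e m f → ∀ I : SetIntersection, I.U = P.ℓ ^ (2 * h) →
      I.N = 2 * P.R * P.ℓ ^ h → I.s = P.g → I.q ≤ 2 * P.R * n → I.outputSize ≤ P.D ^ f →
      ∃ t' τ, Exec w p (I.start (P.D ^ m)) t' τ ∧ t' ≤ t ∧ I.Reports τ)
    (hT : ∀ P : Params, P.Fits n K r h e m f →
      P.searchTime (2 * P.R * n) + n * P.R * 4000 ≤ T) :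
    Runs 𝔐 (reductionCode K r h e m f c p) σ
      (n * (103 * K + 5979) + 103 * (e + 3 * h + f + m + r) +
        (Nat.log 2 n + 1) * c * (n * 1500 + 209) + T + t + p.regBound + 5000)
      (Flag (IsYes A)) := by
  have hX2 := 𝔐.two_le
  have hpow : ∀ i ≤ K + r + 4 * h + e + m + f + c + 10, (4 * n) ^ i ≤ 𝔐.X := fun i hi =>
    (Nat.pow_le_pow_right (by omega) hi).trans hX
  refine Runs.mono (t := (n * (103 * K + 5574) + 103 * (e + 3 * h + f + m + r) + 3000) +
    ((n * 405 + (Nat.log 2 n + 1) * c * (n * 1500 + 209) + 507) +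
      (T + (t + p.regBound + 1) + 1000))) ?_ (by
        have : n * (103 * K + 5979) = n * (103 * K + 5574) + n * 405 := by ring
        omega)
  refine Runs.seq (paramCode_runs hn hK hn1 (by omega) (hpow _ (by omega)))
    fun τ₁ _ F₁ Q₁ => ?_
  obtain ⟨D, ℓ, hDK, hDK', hℓ, hDℓ, hℓD, hP⟩ := Q₁
  set P : Params := ⟨n, D, ℓ, e, h, (n - 1) / (n / D ^ r + 1) + 1, n / D ^ r + 1, m, f⟩ with hPdef
  have hfit : P.Fits n K r h e m f := ⟨rfl, rfl, rfl, rfl, rfl, hDK, hDK', hℓ, hDℓ, hℓD, rfl, rfl⟩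
  have hD4 : 4 ≤ D := hD P hfit
  have hDn : D ≤ n := (Nat.le_self_pow (by omega) D).trans hDK
  have hg1 : 1 ≤ P.g := Nat.le_add_left _ _
  have hgn : P.g ≤ n + 1 := Nat.succ_le_succ (Nat.div_le_self _ _)
  have hR1 : 1 ≤ P.R := Nat.le_add_left _ _
  have hRn : P.R ≤ n := by
    have : (n - 1) / (n / D ^ r + 1) ≤ n - 1 := Nat.div_le_self _ _
    change (n - 1) / (n / D ^ r + 1) + 1 ≤ n
    omega
  have hRg : (P.R - 1) * P.g < n := by
    have : (n - 1) / P.g * P.g ≤ n - 1 := Nat.div_mul_le_self _ _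
    change ((n - 1) / P.g + 1 - 1) * P.g < n
    rw [Nat.add_sub_cancel]
    omega
  have hnRg : n ≤ P.R * P.g := by
    have := Nat.lt_div_mul_add (a := n - 1) (b := P.g) (by omega)
    change n ≤ ((n - 1) / P.g + 1) * P.g
    rw [Nat.succ_mul]
    omega
  have hL₁ : ListAt (τ₁.arr 1) A := by rw [F₁.arr 1 rfl]; exact hL
  have hsort := sortCode_runs (𝔐 := 𝔐) (hP.n.trans hAn.symm) (by omega) hL₁
    (fun a ha => hAn ▸ (hAc a ha).2) hc (by omega)
    ((Nat.pow_le_pow_left (by omega) _).trans (hpow (c + 2) (by omega)))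
  rw [hAn] at hsort
  refine Runs.seq hsort fun τ₂ _ F₂ Q₂ => ?_
  obtain ⟨L, hLA, hLs, hL⟩ := Q₂
  have hP₂ := hP.of_frame F₂
  have hLn : L.length = n := hLA.length_eq.trans hAn
  have hLmem : ∀ v, v ∈ A ↔ ∃ i < n, τ₂.arr 1 i = v := by
    intro v
    rw [← hLA.mem_iff, List.mem_iff_getElem]
    constructor
    · rintro ⟨i, hi, rfl⟩; exact ⟨i, hLn ▸ hi, hL i hi⟩
    · rintro ⟨i, hi, rfl⟩; exact ⟨i, hLn ▸ hi, (hL i (hLn ▸ hi)).symm⟩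
  have hmono : ∀ i j, i < j → j < P.n → τ₂.arr 1 i < τ₂.arr 1 j := by
    intro i j hij (hj : j < n)
    rw [hL i (by omega), hL j (by omega)]
    refine lt_of_le_of_ne (List.pairwise_iff_getElem.mp hLs i j _ _ hij) fun h => ?_
    exact hij.ne ((hLA.nodup_iff.mpr hA).getElem_inj_iff.mp h)
  have hval : ∀ i < n, 1 ≤ τ₂.arr 1 i ∧ τ₂.arr 1 i ≤ n ^ c := fun i hi =>
    hAc _ ((hLmem _).mpr ⟨i, hi, rfl⟩)
  have hy : 4 ≤ 4 * n := by omega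
  have hnX : n ^ c + 1 ≤ 𝔐.X := by
    refine le_trans ?_ (hpow (c + 1) (by omega))
    have h1 : n ^ c ≤ (4 * n) ^ c := Nat.pow_le_pow_left (by omega) c
    have h2 : 1 ≤ (4 * n) ^ c := Nat.one_le_pow _ _ (by omega)
    rw [pow_succ]
    calc n ^ c + 1 ≤ (4 * n) ^ c + (4 * n) ^ c := Nat.add_le_add h1 h2
      _ = (4 * n) ^ c * 2 := by ring
      _ ≤ _ := Nat.mul_le_mul_left _ (by omega)
  have hRX : 2 * P.R * n ≤ 𝔐.X := by
    refine le_trans ?_ (hpow 2 (by omega))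
    rw [pow_two]
    exact Nat.mul_le_mul (by omega) (by omega)
  have hTP := hT P hfit
  refine Runs.mono (t := P.n * P.R * 4000 + 1000 +
    (P.searchTime (2 * P.R * n) + (t + p.regBound + 1))) ?_ (by
      change n * P.R * 4000 + 1000 + _ ≤ _
      linarith)
  refine Runs.seq (walkCode_runs hP₂ rfl hmono hn1 hg1 hRg hnRg hR1
    ((Nat.succ_le_succ (hval _ (by change n - 1 < n; omega)).2).trans hnX) hRX)
    fun τ₃ _ F₃ Q₃ => ?_
  obtain ⟨q1, q2, q3⟩ := Q₃
  have hP₃ := hP₂.of_frame F₃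
  set W := P.tasks τ₃ with hW
  -- The sentinel was written beyond the first n cells.
  have hWL : ∀ i < n, W.L i = τ₂.arr 1 i := fun i hi => by
    change τ₃.arr 1 i = _
    rw [q1, Function.update_of_ne (by omega)]
  have hWv : W.Valid := ⟨hg1, hnRg, fun m hm => (q3.range m hm).1, fun m hm => (q3.range m hm).2.1,
    fun m hm => (q3.range m hm).2.2⟩
  have hℓy : ℓ ≤ 4 * n := by omega
  have hℓi : ∀ i, ℓ ^ i ≤ (4 * n) ^ i := fun i => Nat.pow_le_pow_left hℓy i
  have h1y : ∀ i, 1 ≤ (4 * n) ^ i := fun i => Nat.one_le_pow _ _ (by omega)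
  have hWN : W.N ≤ 2 * P.R * n := q2
  -- N ≤ 2n² and g ≤ 2n give N g² ≤ 8 n⁴. Here n < ℓ^K, and the last factor ℓ > 2D ≥ 8 pays for the
  -- 8.
  have hcoll : W.N * (P.g * P.g) < ℓ ^ e := by
    have h1 : n < ℓ ^ K := hDK'.trans_le (Nat.pow_le_pow_left (by omega) K)
    have h2 : n ^ 4 < ℓ ^ (4 * K) := by
      rw [mul_comm, pow_mul]
      exact Nat.pow_lt_pow_left h1 (by norm_num)
    have h3 : W.N * (P.g * P.g) ≤ 2 * n * n * ((2 * n) * (2 * n)) :=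
      Nat.mul_le_mul (hWN.trans (Nat.mul_le_mul_right _ (by omega)))
        (Nat.mul_le_mul (by omega) (by omega))
    rw [he, pow_succ]
    calc W.N * (P.g * P.g) ≤ n ^ 4 * 8 := h3.trans (le_of_eq (by ring))
      _ < ℓ ^ (4 * K) * 8 := by omega
      _ ≤ ℓ ^ (4 * K) * ℓ := Nat.mul_le_mul_left _ (by omega)
  have hyes : IsYes A ↔ ∃ x < W.n, ∃ y < W.n, ∃ z < W.n, W.L x + W.L y = W.L z := by
    constructor
    · rintro ⟨a, ha, b, hb, c, hc, habc⟩
      obtain ⟨x, hx, rfl⟩ := (hLmem a).mp ha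
      obtain ⟨y, hy, rfl⟩ := (hLmem b).mp hb
      obtain ⟨z, hz, rfl⟩ := (hLmem c).mp hc
      exact ⟨x, hx, y, hy, z, hz, by rw [hWL x hx, hWL y hy, hWL z hz]; exact habc⟩
    · rintro ⟨x, hx, y, hy, z, hz, h⟩
      rw [hWL x hx, hWL y hy, hWL z hz] at h
      exact ⟨_, (hLmem _).mpr ⟨x, hx, rfl⟩, _, (hLmem _).mpr ⟨y, hy, rfl⟩, _,
        (hLmem _).mpr ⟨z, hz, rfl⟩, h⟩
  refine ((searchCode_runs hP₃ hW hWv (by change 2 ≤ D; omega) hDℓ hℓ (by change 1 ≤ e; omega)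
    (by change e ≤ _; omega) ((hℓi e).trans (hpow e (by omega))) ?_ ?_ ?_ ?_ ?_ ?_ hR1 hcoll
    (fun x hx => ?_) (fun v => ?_) (fun y hy => ?_) ?_ (B := B) (fun x hx => ?_)
    (fun F hF => hno P hfit F (hF.trans (Nat.mul_le_mul_left _ (Nat.mul_le_mul_right _ hWN))))
    (hw P hfit) fun I h1 h2 h3 h4 => hp P hfit I h1 h2 h3 (h4.trans hWN)).mono
    (Nat.add_le_add_right (P.searchTime_mono hWN) _)).imp fun τ _ _ Q => Q.congr hyes.symm rfl
  · refine le_trans ?_ (hpow (2 * h + 2) (by omega))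
    calc P.R * P.R * ℓ ^ (2 * h) ≤ (4 * n) * (4 * n) * (4 * n) ^ (2 * h) :=
          Nat.mul_le_mul (Nat.mul_le_mul (by omega) (by omega)) (hℓi _)
      _ = _ := by ring
  · refine le_trans ?_ (hpow (2 * h + 2) (by omega))
    calc 2 * h * ℓ * ℓ ≤ (4 * n) ^ (2 * h) * (4 * n) * (4 * n) :=
          Nat.mul_le_mul (Nat.mul_le_mul ((Nat.lt_pow_self (by omega)).le) hℓy) hℓy
      _ = _ := by ring
  · refine le_trans ?_ (hpow 3 (by omega))
    calc 2 * ℓ * ℓ ≤ 4 * n * (4 * n) * (4 * n) :=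
          Nat.mul_le_mul (Nat.mul_le_mul (by omega) hℓy) hℓy
      _ = _ := by ring
  · refine le_trans ?_ (hpow (3 * h + 2) (by omega))
    have h2 : ℓ ^ (2 * h) + 1 ≤ (4 * n) ^ (2 * h) * (4 * n) := by
      calc ℓ ^ (2 * h) + 1 ≤ (4 * n) ^ (2 * h) + (4 * n) ^ (2 * h) :=
            Nat.add_le_add (hℓi _) (h1y _)
        _ = (4 * n) ^ (2 * h) * 2 := by ring
        _ ≤ _ := Nat.mul_le_mul_left _ (by omega)
    calc 2 * P.R * ℓ ^ h * (ℓ ^ (2 * h) + 1) ≤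
        4 * n * (4 * n) ^ h * ((4 * n) ^ (2 * h) * (4 * n)) :=
          Nat.mul_le_mul (Nat.mul_le_mul (by omega) (hℓi h)) h2
      _ = _ := by ring
  · refine le_trans ?_ (hpow (h + 2) (by omega))
    calc 2 * P.R * ℓ ^ h * P.g ≤ 4 * n * (4 * n) ^ h * (4 * n) :=
          Nat.mul_le_mul (Nat.mul_le_mul (by omega) (hℓi h)) (by omega)
      _ = _ := by ring
  · refine le_trans ?_ (hpow (2 * h + 2) (by omega))
    calc 2 * P.R * ℓ ^ h * (2 * P.R * ℓ ^ h) ≤ 4 * n * (4 * n) ^ h * (4 * n * (4 * n) ^ h) :=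
          Nat.mul_le_mul (Nat.mul_le_mul (by omega) (hℓi h)) (Nat.mul_le_mul (by omega) (hℓi h))
      _ = _ := by ring
  · rw [F₃.arr x (Program.wa_of_arrBound_le (le_trans (by decide) hx)),
      F₂.arr x (Program.wa_of_arrBound_le (le_trans (Nat.le_of_ble_eq_true rfl) hx)),
      F₁.arr x (Program.wa_of_arrBound_le (le_trans (Nat.le_of_ble_eq_true rfl) hx)), hz x hx]
  · have h3 : τ₃.arr 3 = σ.arr 3 :=
      (F₃.arr 3 rfl).trans ((F₂.arr 3 rfl).trans (F₁.arr 3 rfl))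
    rw [h3, hmem, hLmem]
    constructor
    · rintro ⟨i, hi, h⟩; exact ⟨i, hi, (hWL i hi).trans h⟩
    · rintro ⟨i, hi, h⟩; exact ⟨i, hi, (hWL i hi).symm.trans h⟩
  · rw [hWL y hy]; exact (hval y hy).1
  · intro z hz x hx y hy hxyz
    rw [hWL x hx, hWL y hy, hWL z hz] at hxyz
    exact q3.recorded z hz x hx y hy hxyz
  · rw [hWL x hx]
    have := (hval x hx).2
    omega

end ThreeSum

namespace ThreeSum

open Finset RAM RAM.Expr

/-! ### The whole program -/

/-- Mark the numbers of the input in array `3`. -/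
def markCode : Program := forLoop 28 1 (write 3 (ld 1 (reg 28)) 1)

/-- The table is indexed by the numbers themselves, up to n^c. As memory starts with zeros, only n
cells have to be written. -/
theorem markCode_runs {𝔐 : Machine} {σ : State} {A : List ℕ} (hn : σ.reg 1 = A.length)
    (hL : ListAt (σ.arr 1) A) (h3 : σ.arr 3 = fun _ => 0) :
    Runs 𝔐 markCode σ (A.length * 203 + 2) (fun τ => ∀ v, 0 < τ.arr 3 v ↔ v ∈ A) := by
  refine Runs.forLoop (B := A.length) (c := 200) (fun j τ => ∀ v, 0 < τ.arr 3 v ↔ v ∈ A.take j) hn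
    (by simp [h3]) ?_ (fun τ _ _ _ h => by simpa using h)
  intro j hj τ hb hF hτ hI
  refine Runs.write (by have := 𝔐.two_le; simp; omega) fun v => ?_
  have a1 : τ.arr 1 j = A[j] := (congrFun (hF.arr 1 rfl) j).trans (hL j hj)
  rw [List.take_add_one, List.getElem?_eq_getElem hj]
  simp only [State.setReg_arr, State.setArr_arr, if_true, eval_ld, eval_reg, eval_ofNat, hτ, a1,
    Function.update_apply, List.mem_append, ← hI v, Option.mem_toList, Option.some.injEq]
  by_cases h : v = A[j]
  · simp [h]
  · simp [h, Ne.symm h]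

/-- Test all pairs of numbers. -/
def bruteCode : Program :=
  assign 0 0 ;; forLoop 28 1 (forLoop 27 1 (
    ite 0 (ld 3 (ld 1 (reg 28) + ld 1 (reg 27))) (assign 0 1) .skip))

theorem bruteCode_runs {𝔐 : Machine} {σ : State} {A : List ℕ} (hn : σ.reg 1 = A.length)
    (hL : ListAt (σ.arr 1) A) (h3 : ∀ v, 0 < σ.arr 3 v ↔ v ∈ A) :
    Runs 𝔐 bruteCode σ (A.length * (A.length * 303 + 5) + 102) (Flag (IsYes A)) := by
  have hX := 𝔐.two_le
  refine (Runs.assign_seq (by simp) <| Runs.forLoop (B := A.length) (c := A.length * 303 + 2)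
    (fun i => Flag (∃ a ∈ A.take i, ∃ b ∈ A, a + b ∈ A)) (by simpa using hn) ⟨by simp, by simp⟩ ?_
    (fun τ _ _ _ h => h.congr (by simp [IsYes]) rfl)).mono (by
      rw [add_assoc]; omega)
  intro i hi τ hb hF hτ hI
  refine Runs.forLoop (B := A.length) (c := 300)
    (fun j => Flag ((∃ a ∈ A.take i, ∃ b ∈ A, a + b ∈ A) ∨ ∃ b ∈ A.take j, A[i] + b ∈ A))
    (by simpa [hF.reg 1 rfl] using hn) (hI.congr (by simp) (by simp)) ?_
    (fun υ _ _ _ h => h.congr ?_ (by simp))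
  · intro j hj υ hb' hF' hυ hJ
    have e28 : υ.reg 28 = i := (hF'.reg 28 rfl).trans hτ
    have a1 : υ.arr 1 = σ.arr 1 := (hF'.arr 1 rfl).trans (hF.arr 1 rfl)
    have a3 : υ.arr 3 = σ.arr 3 := (hF'.arr 3 rfl).trans (hF.arr 3 rfl)
    have ai : σ.arr 1 i = A[i] := hL i hi
    have aj : σ.arr 1 j = A[j] := hL j hj
    have hx : ((∃ a ∈ A.take i, ∃ b ∈ A, a + b ∈ A) ∨ ∃ b ∈ A.take (j + 1), A[i] + b ∈ A) ↔
        ((∃ a ∈ A.take i, ∃ b ∈ A, a + b ∈ A) ∨ ∃ b ∈ A.take j, A[i] + b ∈ A) ∨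
          A[i] + A[j] ∈ A := by
      rw [List.take_add_one, List.getElem?_eq_getElem hj, or_assoc]
      simp only [List.mem_append, Option.mem_toList, or_and_right, exists_or, Option.some.injEq,
        exists_eq_left']
    refine (Runs.ite (t := 100) (t' := 1) (fun hlt => Runs.assign (by simp; omega) ?_)
      fun hlt => Runs.skip ?_).mono (by norm_num)
    · simp [e28, hυ, a1, a3, ai, aj, h3] at hlt
      exact ⟨fun _ => by simp, fun h => absurd (hx.mpr (Or.inr hlt)) h⟩
    · rw [eval_ofNat, not_lt, Nat.le_zero] at hlt
      simp only [eval_ld, eval_add, eval_reg, e28, hυ, a1, a3, ai, aj] at hlt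
      have : A[i] + A[j] ∉ A := by rw [← h3, hlt]; exact lt_irrefl 0
      exact hJ.congr ((or_iff_left this).symm.trans hx.symm) (by simp)
  · rw [List.take_length, List.take_add_one, List.getElem?_eq_getElem hi]
    simp only [List.mem_append, Option.mem_toList, or_and_right, exists_or, Option.some.injEq,
      exists_eq_left']

/-- Use the program `p` for at least `n₀` numbers only. -/
def wholeCode (n₀ : ℕ) (p : Program) : Program :=
  assign 1 (ld 0 0) ;; markCode ;; .const 20 n₀ ;; ite (reg 1) (reg 20) bruteCode p

/-- The reduction relies on estimates for large n. Below the constant n₀ the test of all pairs takes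
constant time. -/
theorem wholeCode_runs {𝔐 : Machine} {A : List ℕ} {n₀ t : ℕ} {p : Program} (hn₀ : n₀ ≤ 𝔐.X)
    (hA : A.length ≤ 𝔐.X) (hb : A.length < n₀ → n₀ * (n₀ * 303 + 5) + 102 ≤ t)
    (hp : n₀ ≤ A.length → ∀ σ : State, σ.reg 1 = A.length → ListAt (σ.arr 1) A →
      (∀ v, 0 < σ.arr 3 v ↔ v ∈ A) → (∀ x, 15 ≤ x → σ.arr x = fun _ => 0) →
      Runs 𝔐 p σ t (Flag (IsYes A))) :
    Runs 𝔐 (wholeCode n₀ p) (start A) (A.length * 203 + t + 400) (Flag (IsYes A)) := by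
  have hlist : ListAt (fun i => A.getD i 0) A := fun i hi => by simp [hi]
  refine Runs.mono (t := 100 + (A.length * 203 + 2 + (1 + (max t t + 200)))) ?_
    (by rw [max_self]; omega)
  refine Runs.assign_seq (by simpa [start, State.ofArrays] using hA) <| Runs.seq
    (markCode_runs (A := A) (by simp [start, State.ofArrays]) hlist rfl) fun τ _ F h3 =>
    Runs.const_seq hn₀ <| Runs.ite (fun hlt => ?_) fun hlt => ?_
  all_goals
    have h1 : (τ.setReg 20 n₀).reg 1 = A.length := by
      simp [F.reg 1 rfl, start, State.ofArrays]
    have hL : ListAt ((τ.setReg 20 n₀).arr 1) A := by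
      change ListAt (τ.arr 1) A
      rw [F.arr 1 rfl]; exact hlist
    rw [eval_reg, eval_reg, h1] at hlt
    simp only [State.setReg_reg, if_true] at hlt
  · refine (bruteCode_runs h1 hL h3).mono (le_trans ?_ (hb hlt))
    exact Nat.add_le_add_right (Nat.mul_le_mul hlt.le
      (Nat.add_le_add_right (Nat.mul_le_mul_right _ hlt.le) _)) _
  · refine hp (not_lt.mp hlt) _ h1 hL h3 fun x hx => ?_
    have h15 : markCode.arrBound ≤ 15 := by decide
    change τ.arr x = _
    rw [F.arr x (Program.wa_of_arrBound_le (h15.trans hx))]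
    funext i
    obtain ⟨y, rfl⟩ := Nat.exists_eq_add_of_le hx
    rw [Nat.add_comm]
    rfl

/-- A machine with words of `O(log n)` bits. -/
def machine (J n : ℕ) (hJ : 1 ≤ J) : Machine where
  X := (2 ^ (Nat.log 2 n + 1)) ^ J
  w := wordLength (32 * J + 1) n
  two_le := by
    rw [← pow_mul]
    exact Nat.le_self_pow (Nat.mul_pos (Nat.succ_pos _) hJ).ne' 2
  pow_lt := by
    rw [wordLength, ← pow_mul, ← pow_mul]
    refine Nat.pow_lt_pow_right (by norm_num) ?_
    ring_nf
    omega

/-- The start configuration is bounded by n^c and has no work registers in use, so a triple applies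
to it directly. -/
theorem exists_exec {J n c t : ℕ} (hJ : 1 ≤ J) (hc : 1 ≤ c) (hcJ : c ≤ J) {A : List ℕ}
    (hAn : A.length = n) (hA : ∀ a ∈ A, 1 ≤ a ∧ a ≤ n ^ c) {p : Program}
    (h : Runs (machine J n hJ) p (start A) t (Flag (IsYes A))) :
    ∃ t' σ, Exec (wordLength (32 * J + 1) n) p (start A) t' σ ∧ t' ≤ t ∧
      (IsYes A → σ.reg 0 = 1) ∧ (¬ IsYes A → σ.reg 0 = 0) := by
  have hn : n ≤ 2 ^ (Nat.log 2 n + 1) := (Nat.lt_pow_succ_log_self (by norm_num) n).le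
  have hcX : n ^ c ≤ (machine J n hJ).X :=
    (Nat.pow_le_pow_left hn c).trans (Nat.pow_le_pow_right (by positivity) hcJ)
  have hnX : n ≤ (machine J n hJ).X := (Nat.le_self_pow (by omega) n).trans hcX
  have hbdd : (start A).Bdd (machine J n hJ).X := by
    refine ⟨fun r => Nat.zero_le _, fun x i => ?_⟩
    rcases x with _ | _ | x
    · rcases i with _ | i
      · exact hAn.le.trans hnX
      · exact Nat.zero_le _
    · change A.getD i 0 ≤ _
      rcases Nat.lt_or_ge i A.length with hi | hi
      · rw [List.getD_eq_getElem _ _ hi]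
        exact (hA _ (List.getElem_mem hi)).2.trans hcX
      · rw [List.getD_eq_default _ _ hi]
        exact Nat.zero_le _
    · exact Nat.zero_le _
  have herase : (start A).erase = start A := by
    ext r
    · simp [State.erase, start, State.ofArrays]
    · rfl
  obtain ⟨t', τ, h1, h2, _, h4⟩ := h hbdd _ herase
  exact ⟨t', τ, h1, h2, h4.yes, h4.no⟩

end ThreeSum

namespace ThreeSum

open Finset Filter Topology

/-! ### The size of the parameters -/

theorem eventually_mul_log_pow_le (k b : ℕ) (c : ℝ) :
    ∀ᶠ D : ℕ in atTop, c * Real.log D ^ k ≤ D ∧ b ≤ Real.log D := by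
  have h1 := (Real.isLittleO_pow_log_id_atTop (n := k)).bound
    (c := 1 / (|c| + 1)) (by positivity)
  have h2 := Real.tendsto_log_atTop.eventually_ge_atTop (b : ℝ)
  have h3 := tendsto_natCast_atTop_atTop (R := ℝ) |>.eventually
    (h1.and (h2.and (eventually_ge_atTop 1)))
  filter_upwards [h3] with D hD
  obtain ⟨h4, h5, h6⟩ := hD
  refine ⟨?_, h5⟩
  have hl : 0 ≤ Real.log D := Real.log_nonneg h6
  rw [Real.norm_of_nonneg (by positivity), id, Real.norm_of_nonneg (by positivity), div_mul_eq_mul_div,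
    one_mul, le_div_iff₀ (by positivity)] at h4
  calc c * Real.log D ^ k ≤ Real.log D ^ k * (|c| + 1) := by
        rw [mul_comm]
        gcongr
        linarith [le_abs_self c]
    _ ≤ D := h4

/-- Up to powers of the logarithm, the number of primes up to `D` is at least `D`. -/
theorem eventually_mul_pow_le_primeCounting (k a G : ℕ) : ∀ᶠ D : ℕ in atTop,
    G * ((a * (Nat.log 2 (D + 1) + 1) + 1) * D) ^ k ≤ Nat.primeCounting D ^ k * D := by
  filter_upwards [eventually_mul_log_pow_le 1 1 20,
    eventually_mul_log_pow_le (2 * k) 1 (G * (2 * (5 * a + 1)) ^ k)] with D h1 h2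
  obtain ⟨h1, hl⟩ := h1
  obtain ⟨h2, -⟩ := h2
  rw [pow_one] at h1
  rw [Nat.cast_one] at hl
  set l := Real.log D with hldef
  have hD : (20 : ℝ) ≤ D := by linarith
  have hD0 : (0 : ℝ) < D := by linarith
  have hD1 : Real.log (D + 1) ≤ 2 * l := by
    rw [hldef, ← Real.log_rpow hD0]
    refine Real.log_le_log (by positivity) ?_
    rw [Real.rpow_two]
    nlinarith
  -- Chebyshev's lower bound for π(D), where log 2 > 0.69 leaves room for the factor 2.
  have hpi : (D : ℝ) ≤ 2 * (Nat.primeCounting D * l) := by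
    have h3 := Chebyshev.pi_ge D
    rw [div_le_iff₀ (by linarith)] at h3
    have h4 : (0.69 : ℝ) < Real.log 2 := by linarith [Real.log_two_gt_d9]
    nlinarith
  have hlog : ((Nat.log 2 (D + 1) : ℕ) : ℝ) ≤ 4 * l := by
    have h3 : (2 : ℝ) ^ Nat.log 2 (D + 1) ≤ D + 1 := by
      exact_mod_cast Nat.pow_log_le_self 2 (Nat.succ_ne_zero D)
    have h4 := Real.log_le_log (by positivity) h3
    rw [Real.log_pow] at h4
    have h5 : (0.69 : ℝ) < Real.log 2 := by linarith [Real.log_two_gt_d9]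
    have h6 : (0 : ℝ) ≤ (Nat.log 2 (D + 1) : ℕ) := Nat.cast_nonneg _
    nlinarith
  have hB : (a * ((Nat.log 2 (D + 1) : ℕ) + 1) + 1 : ℝ) ≤ (5 * a + 1) * l := by
    have h3 : (0 : ℝ) ≤ a := Nat.cast_nonneg _
    nlinarith
  have hreal : (G : ℝ) * ((a * ((Nat.log 2 (D + 1) : ℕ) + 1) + 1) * D) ^ k ≤
      (Nat.primeCounting D : ℝ) ^ k * D := by
    calc (G : ℝ) * ((a * ((Nat.log 2 (D + 1) : ℕ) + 1) + 1) * D) ^ k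
        ≤ G * (((5 * a + 1) * l) * (2 * (Nat.primeCounting D * l))) ^ k := by gcongr
      _ = (Nat.primeCounting D : ℝ) ^ k * (G * (2 * (5 * a + 1)) ^ k * l ^ (2 * k)) := by
          simp only [mul_pow, pow_mul]
          ring
      _ ≤ _ := by gcongr
  exact_mod_cast hreal

/-- The parameters that fit to some `n`. -/
def fitting (K r h e m f : ℕ) : Set Params :=
  {P | 1 ≤ P.n ∧ 1 ≤ P.D ∧ P.Fits P.n K r h e m f}

/-- Needed to compare with powers of D those costs that depend on n alone, independently of the
parameters a run computes. -/
theorem exists_fits {n K : ℕ} (r h e m f : ℕ) (hn : 1 ≤ n) (hK : 1 ≤ K) :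
    ∃ P : Params, P.Fits n K r h e m f := by
  have hex : ∃ D, n < (D + 1) ^ K := ⟨n, by
    calc n < n + 1 := Nat.lt_succ_self n
      _ ≤ (n + 1) ^ K := Nat.le_self_pow (by omega) _⟩
  have hmin := Nat.find_spec hex
  set D := Nat.find hex with hDdef
  have hD1 : 1 ≤ D := by
    by_contra h0
    have : D = 0 := by omega
    rw [this] at hmin
    simp at hmin
    omega
  have hle : D ^ K ≤ n := by
    have := Nat.find_min hex (m := D - 1) (by omega)
    rw [Nat.sub_add_cancel hD1] at this
    omega
  obtain ⟨ℓ, h1, h2, h3⟩ := Nat.exists_prime_lt_and_le_two_mul (2 * D) (by omega)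
  exact ⟨⟨n, D, ℓ, e, h, (n - 1) / (n / D ^ r + 1) + 1, n / D ^ r + 1, m, f⟩,
    rfl, rfl, rfl, rfl, rfl, hle, hmin, h1, h2, by change ℓ ≤ 4 * D; omega, rfl, rfl⟩

theorem Params.Fits.one_le {P : Params} {n K r h e m f : ℕ} (hP : P.Fits n K r h e m f)
    (hn : 1 ≤ n) : 1 ≤ P.D := by
  have h1 := hP.lt_pow
  by_contra h0
  have : P.D = 0 := by omega
  rw [this] at h1
  simp at h1
  omega

theorem Params.Fits.mem_fitting {P : Params} {n K r h e m f : ℕ} (hP : P.Fits n K r h e m f)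
    (hn : 1 ≤ n) : P ∈ fitting K r h e m f :=
  ⟨hP.n_eq ▸ hn, hP.one_le hn, hP.n_eq ▸ hP⟩

/-- The function is bounded by a constant multiple of `D ^ s`. -/
def BigO (S : Set Params) (s : ℕ) (F : Params → ℕ) : Prop := ∃ c, ∀ P ∈ S, F P ≤ c * P.D ^ s

namespace BigO

variable {K r h e m f : ℕ} {s s' : ℕ} {F G : Params → ℕ}

theorem mono (hF : BigO (fitting K r h e m f) s F) (hs : s ≤ s') : BigO (fitting K r h e m f) s' F := by
  obtain ⟨c, hc⟩ := hF
  exact ⟨c, fun P hP => (hc P hP).trans (Nat.mul_le_mul_left _ (Nat.pow_le_pow_right hP.2.1 hs))⟩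

theorem add (hF : BigO (fitting K r h e m f) s F) (hG : BigO (fitting K r h e m f) s G) : BigO (fitting K r h e m f) s fun P => F P + G P := by
  obtain ⟨c, hc⟩ := hF
  obtain ⟨c', hc'⟩ := hG
  exact ⟨c + c', fun P hP => by rw [add_mul]; exact Nat.add_le_add (hc P hP) (hc' P hP)⟩

theorem mul (hF : BigO (fitting K r h e m f) s F) (hG : BigO (fitting K r h e m f) s' G) : BigO (fitting K r h e m f) (s + s') fun P => F P * G P := by
  obtain ⟨c, hc⟩ := hF
  obtain ⟨c', hc'⟩ := hG
  refine ⟨c * c', fun P hP => (Nat.mul_le_mul (hc P hP) (hc' P hP)).trans (le_of_eq ?_)⟩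
  rw [pow_add]
  ring

theorem const (c : ℕ) : BigO (fitting K r h e m f) s fun _ => c :=
  ⟨c, fun _ hP => Nat.le_mul_of_pos_right _ (pow_pos hP.2.1 _)⟩

theorem of_le (hG : BigO (fitting K r h e m f) s G) (hF : ∀ P ∈ fitting K r h e m f, F P ≤ G P) : BigO (fitting K r h e m f) s F := by
  obtain ⟨c, hc⟩ := hG
  exact ⟨c, fun P hP => (hF P hP).trans (hc P hP)⟩

theorem pow_D (i : ℕ) : BigO (fitting K r h e m f) i fun P => P.D ^ i := ⟨1, fun _ _ => by rw [one_mul]⟩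

theorem pow_ℓ (i : ℕ) : BigO (fitting K r h e m f) i fun P => P.ℓ ^ i :=
  ⟨4 ^ i, fun P hP => by rw [← mul_pow]; exact Nat.pow_le_pow_left hP.2.2.le i⟩

theorem ofD : BigO (fitting K r h e m f) 1 fun P => P.D := ⟨1, fun P _ => by simp⟩

theorem ofℓ : BigO (fitting K r h e m f) 1 fun P => P.ℓ := ⟨4, fun P hP => by rw [pow_one]; exact hP.2.2.le⟩

theorem ofN : BigO (fitting K r h e m f) K fun P => P.n := ⟨2 ^ K, fun P hP => by
  rw [← mul_pow]
  exact hP.2.2.lt_pow.le.trans (Nat.pow_le_pow_left (by have := hP.2.1; omega) K)⟩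

theorem ofE : BigO (fitting K r h e m f) 0 fun P => P.e := (const e).of_le fun _ hP => hP.2.2.e_eq.le

theorem ofH : BigO (fitting K r h e m f) 0 fun P => P.h :=
  (const h).of_le fun _ hP => hP.2.2.h_eq.le

/-- A block length above n / D^r allows at most D^r blocks. -/
theorem ofR : BigO (fitting K r h e m f) r fun P => P.R := ⟨1, fun P hP => by
  change P.R ≤ _
  rw [one_mul, hP.2.2.R_eq]
  refine Nat.succ_le_of_lt ((Nat.div_lt_iff_lt_mul (Nat.succ_pos _)).mpr ?_)
  have h1 := Nat.lt_div_mul_add (a := P.n) (b := P.D ^ r) (pow_pos hP.2.1 _)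
  rw [mul_comm, Nat.succ_mul]
  omega⟩

theorem ofG (hr : r ≤ K) : BigO (fitting K r h e m f) (K - r) fun P => P.g := by
  suffices hg : BigO (fitting K r h e m f) (K - r) fun P => P.n / P.D ^ r from
    (hg.add (const 1)).of_le fun P hP => hP.2.2.g_eq.le
  refine ⟨2 ^ K, fun P hP => ?_⟩
  have h1 : P.n ≤ 2 ^ K * P.D ^ K := by
    rw [← mul_pow]
    exact hP.2.2.lt_pow.le.trans (Nat.pow_le_pow_left (by have := hP.2.1; omega) K)
  refine Nat.div_le_of_le_mul (h1.trans (le_of_eq ?_))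
  rw [mul_left_comm, ← pow_add, Nat.add_sub_cancel' hr]

/-- A whole power of D is a crude bound for a logarithm, but sorting is far from critical. -/
theorem ofLog : BigO (fitting K r h e m f) 1 fun P => Nat.log 2 P.n + 1 := ⟨K, fun P hP => by
  rw [pow_one]
  refine Nat.succ_le_of_lt (Nat.log_lt_of_lt_pow (by have := hP.1; omega) ?_)
  refine hP.2.2.lt_pow.trans_le ?_
  rw [mul_comm, pow_mul]
  exact Nat.pow_le_pow_left (Nat.succ_le_of_lt P.D.lt_two_pow_self) K⟩

theorem pow_D_f : BigO (fitting K r h e m f) f fun P => P.D ^ P.f :=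
  (pow_D f).of_le fun P hP => by rw [hP.2.2.f_eq]

theorem pow_ℓ_h : BigO (fitting K r h e m f) h fun P => P.ℓ ^ P.h :=
  (pow_ℓ h).of_le fun P hP => by rw [hP.2.2.h_eq]

theorem pow_ℓ_two_mul_h : BigO (fitting K r h e m f) (2 * h) fun P => P.ℓ ^ (2 * P.h) :=
  (pow_ℓ (2 * h)).of_le fun P hP => by rw [hP.2.2.h_eq]

/-- The number of tasks. -/
theorem tasks : BigO (fitting K r h e m f) (r + K) fun P => 2 * P.R * P.n :=
  (((const (s := 0) 2).mul ofR).mul ofN).mono (by omega)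

/-- The transforms cost D^(2r+2h+1). One more power of D has to remain free, since the greedy search
counts for D candidates per modulus. -/
theorem countTime (hr : r + 2 ≤ K) (hc : 2 * r + 2 * h + 3 ≤ 2 * K) :
    BigO (fitting K r h e m f) (2 * K - 2) fun P => P.countTime (2 * P.R * P.n) := by
  have c : ∀ c, BigO (fitting K r h e m f) 0 fun _ => c := fun c => const c
  unfold Params.countTime
  refine .add (.add (.add (.add (.add (.add ?_ ?_) ?_) ?_) ?_) ?_) (const _)
  · exact (ofN.mul (s' := 0) ((((c 2).mul ofH).mul (c 303)).add (c 708))).mono (by omega)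
  · exact (tasks.mul (c 203)).mono (by omega)
  · exact (((((c 2).mul ofH).mul ofℓ).mul ofℓ).mul (c 503)).mono (by omega)
  · refine (((ofR.mul ofR).mul pow_ℓ_two_mul_h).mul (s' := 1) (.add ?_ (const _))).mono (by omega)
    exact (((c 4).mul ofH).mul (((ofℓ.mul (c 103)).mono (s' := 1) (by omega)).add (const _))).mono (by omega)
  · exact ((ofR.mul ofR).mul (c 20)).mono (by omega)
  · exact ((c 1000).mul ofH).mono (by omega)

theorem searchTime (hr : r + 2 ≤ K) (hc : 2 * r + 2 * h + 3 ≤ 2 * K) (hf : f + 1 ≤ 2 * K)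
    (hh : h + 1 ≤ K) : BigO (fitting K r h e m f) (2 * K - 1) fun P => P.searchTime (2 * P.R * P.n) := by
  have c : ∀ c, BigO (fitting K r h e m f) 0 fun _ => c := fun c => const c
  have hk : ∀ b, BigO (fitting K r h e m f) 0 fun P => 2 * P.h * 303 + b := fun b =>
    (((c 2).mul ofH).mul (c 303)).add (c b)
  have ct := countTime (f := f) (m := m) (e := e) hr hc
  unfold Params.searchTime
  refine .add (.add (.add (.add (.add (.add ?_ ?_) (const _)) (.add (.add ?_ ?_) (const _)))
    (.add (.add ?_ ?_) (const _))) (.add (.add ?_ ?_) (const _))) (const _)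
  · refine (ofℓ.mul (s' := 1) (.add (.add ?_ ?_) (const _))).mono (by omega)
    · exact ofE.mul (((ofℓ.mul (c 103)).mono le_rfl).add (const _)) |>.mono (by omega)
    · exact ofℓ.mul (c 606)
  · exact (((((c 2).mul ofH).mul ofℓ).mul ofℓ).mul (c 203)).mono (by omega)
  · refine (((c 2).mul ofH).mul (s' := 2 * K - 1) (.add ?_ (const _))).mono (by omega)
    exact (ofD.mul (ct.add (const _))).mono (by omega)
  · exact ct.mono (by omega)
  · exact ((((c 2).mul ofR).mul pow_ℓ_h).mul (s' := K - r)
      (.add ((ofG (by omega)).mul (hk 1610)) (const _))).mono (by omega)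
  · exact (tasks.mul (s' := 0) ((((c 4).mul ofH).mul (c 303)).add (c 2500))).mono (by omega)
  · exact (tasks.mul (c 811)).mono (by omega)
  · exact ((c 808).mul pow_D_f).mono (by omega)

end BigO

end ThreeSum

namespace ThreeSum

open Finset Filter Topology RAM

/-! ### The choice of the exponents -/

/-- The conditions on the exponents of the reduction. -/
structure Exponents (α β ε : ℝ) (K r h m f : ℕ) : Prop where
  sets : 2 * r + 2 * h < m * (1 + α + β)
  elements : 2 * h < m * (1 + β - α)
  size : K - r < m * (1 - α)
  queries : K + r < m * (1 + α)
  output : f < m * (2 - β)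
  filter : 3 * K + 1 ≤ f + r + 2 * h
  output_le : f + 1 ≤ 2 * K
  convolution : 2 * r + 2 * h + 3 ≤ 2 * K
  build : h + 1 ≤ K
  blocks : r + 2 ≤ K
  time : m * (2 - ε) < 2 * K

/-- Divide all conditions by K and let K grow: r, 2h, m and f become the reals α, θ, 1 + δ and φ
times K, and the additive constants disappear. It suffices to satisfy the limiting inequalities
strictly. -/
theorem exists_exponents {α β ε : ℝ} (hα₀ : 0 ≤ α) (hα₁ : α < 1) (hβ₀ : 0 ≤ β) (hβ₁ : β ≤ 1 - α)
    (hε : 0 < ε) (hε₁ : ε ≤ 1) : ∃ K r h m f : ℕ, Exponents α β ε K r h m f := by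
  obtain ⟨δ, hδ⟩ : ∃ δ, δ = ε / 4 := ⟨_, rfl⟩
  have hδ0 : 0 < δ := by rw [hδ]; positivity
  have hμ : (1 + δ) * (2 - ε) < 2 := by rw [hδ]; nlinarith
  -- The lower bounds make φ > 3 - α - θ compatible with φ < 2 and with the output bound. The upper
  -- bounds come from the time for the transforms, the universe and the number of sets. The
  -- condition β ≤ 1 - α is what puts the second lower bound below 2 - 2α, and the margin δ makes
  -- this strict when β = 1 - α.
  obtain ⟨θ, h1, h2⟩ : ∃ θ, max (1 - α) (1 + β - α - δ * (2 - β)) < θ ∧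
      θ < min (2 - 2 * α) (min ((1 + δ) * (1 + β - α)) (1 + β - α + δ * (1 + α + β))) := by
    have a1 : 0 < δ * (2 - β) := mul_pos hδ0 (by linarith)
    have a2 : 0 < δ * (1 + β - α) := mul_pos hδ0 (by linarith)
    have a3 : 0 < δ * (1 + α + β) := mul_pos hδ0 (by linarith)
    refine exists_between (max_lt (lt_min ?_ (lt_min ?_ ?_)) (lt_min ?_ (lt_min ?_ ?_))) <;>
      linarith
  obtain ⟨h11, h12⟩ := max_lt_iff.mp h1
  obtain ⟨h21, h22⟩ := lt_min_iff.mp h2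
  obtain ⟨h22, h23⟩ := lt_min_iff.mp h22
  obtain ⟨φ, h3, h4⟩ : ∃ φ, 3 - α - θ < φ ∧ φ < min 2 ((1 + δ) * (2 - β)) :=
    exists_between (lt_min (by linarith) (by linarith))
  obtain ⟨h41, h42⟩ := lt_min_iff.mp h4
  have hfl : ∀ a : ℝ, 0 ≤ a → Tendsto (fun K : ℕ => (⌊a * K⌋₊ : ℝ) / K) atTop (𝓝 a) :=
    fun a ha => (tendsto_nat_floor_mul_div_atTop ha).comp tendsto_natCast_atTop_atTop
  have hr := hfl α hα₀
  have hh := hfl (θ / 2) (by linarith)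
  have hm := hfl (1 + δ) (by linarith)
  have hf := hfl φ (by linarith)
  have h0 : Tendsto (fun K : ℕ => (1 : ℝ) / K) atTop (𝓝 0) := tendsto_one_div_atTop_nhds_zero_nat
  have hc : ∀ a : ℝ, Tendsto (fun _ : ℕ => a) atTop (𝓝 a) := fun a => tendsto_const_nhds
  have e1 := ((hr.const_mul 2).add (hh.const_mul 2)).eventually_lt (hm.mul_const (1 + α + β))
    (by linarith)
  have e2 := (hh.const_mul 2).eventually_lt (hm.mul_const (1 + β - α)) (by linarith)
  have e3 := ((hc 1).sub hr).eventually_lt (hm.mul_const (1 - α)) (by nlinarith)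
  have e4 := ((hc 1).add hr).eventually_lt (hm.mul_const (1 + α)) (by nlinarith)
  have e5 := hf.eventually_lt (hm.mul_const (2 - β)) (by linarith)
  have e6 := ((hc 3).add h0).eventually_lt ((hf.add hr).add (hh.const_mul 2)) (by linarith)
  have e7 := (hf.add h0).eventually_lt (hc 2) (by linarith)
  have e8 := (((hr.const_mul 2).add (hh.const_mul 2)).add (h0.const_mul 3)).eventually_lt (hc 2)
    (by linarith)
  have e9 := (hh.add h0).eventually_lt (hc 1) (by linarith)
  have e10 := (hr.add (h0.const_mul 2)).eventually_lt (hc 1) (by linarith)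
  have e11 := (hm.mul_const (2 - ε)).eventually_lt (hc 2) hμ
  obtain ⟨K, ⟨⟨⟨⟨⟨⟨⟨⟨⟨⟨⟨e1, e2⟩, e3⟩, e4⟩, e5⟩, e6⟩, e7⟩, e8⟩, e9⟩, e10⟩, e11⟩, hK⟩⟩ :=
    (((((((((((e1.and e2).and e3).and e4).and e5).and e6).and e7).and e8).and e9).and e10).and
      e11).and (eventually_ge_atTop 1)).exists
  have hK0 : (0 : ℝ) < K := by exact_mod_cast hK
  refine ⟨K, ⌊α * K⌋₊, ⌊θ / 2 * K⌋₊, ⌊(1 + δ) * K⌋₊, ⌊φ * K⌋₊, ?_⟩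
  generalize ⌊α * K⌋₊ = r at *
  generalize ⌊θ / 2 * K⌋₊ = h at *
  generalize ⌊(1 + δ) * K⌋₊ = m at *
  generalize ⌊φ * K⌋₊ = f at *
  field_simp at e1 e2 e3 e4 e5 e6 e7 e8 e9 e10 e11
  refine ⟨by linarith, by linarith, by linarith, by linarith, by linarith, ?_, ?_, ?_, ?_, ?_,
    by linarith⟩
  · have : ((3 * K + 1 : ℕ) : ℝ) < ((f + r + 2 * h : ℕ) : ℝ) := by push_cast; linarith
    exact (Nat.cast_lt.mp this).le
  · have : ((f + 1 : ℕ) : ℝ) < ((2 * K : ℕ) : ℝ) := by push_cast; linarith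
    exact (Nat.cast_lt.mp this).le
  · have : ((2 * r + 2 * h + 3 : ℕ) : ℝ) < ((2 * K : ℕ) : ℝ) := by push_cast; linarith
    exact (Nat.cast_lt.mp this).le
  · have : ((h + 1 : ℕ) : ℝ) < (K : ℝ) := by push_cast; linarith
    exact (Nat.cast_lt.mp this).le
  · have : ((r + 2 : ℕ) : ℝ) < (K : ℝ) := by push_cast; linarith
    exact (Nat.cast_lt.mp this).le

/-- A strict gap between exponents absorbs any constant c, however small C is. -/
theorem eventually_mul_pow_le_rpow (c s : ℕ) {x C : ℝ} (hC : 0 < C) (hx : s < x) :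
    ∀ᶠ D : ℕ in atTop, (c : ℝ) * (D : ℝ) ^ s ≤ C * (D : ℝ) ^ x := by
  have h1 := ((tendsto_rpow_atTop (sub_pos.mpr hx)).comp
    (tendsto_natCast_atTop_atTop (R := ℝ))).eventually_ge_atTop (c / C)
  filter_upwards [h1, eventually_ge_atTop 1] with D hD hD1
  have hD0 : (0 : ℝ) < D := by exact_mod_cast hD1
  rw [Function.comp, div_le_iff₀ hC] at hD
  calc (c : ℝ) * (D : ℝ) ^ s ≤ (D : ℝ) ^ (x - s) * C * (D : ℝ) ^ s := by gcongr
    _ = C * ((D : ℝ) ^ (x - s) * (D : ℝ) ^ (s : ℝ)) := by rw [Real.rpow_natCast]; ring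
    _ = _ := by rw [← Real.rpow_add hD0, sub_add_cancel]

theorem rpow_le_rpow_of_pow_le {D n K : ℕ} {x η : ℝ} (hD : 1 ≤ D) (hK : 1 ≤ K) (h : D ^ K ≤ n)
    (hx : x / K ≤ η) (hη : 0 ≤ η) : (D : ℝ) ^ x ≤ (n : ℝ) ^ η := by
  have hD1 : (1 : ℝ) ≤ D := by exact_mod_cast hD
  have hK0 : (0 : ℝ) < K := by exact_mod_cast hK
  have hn : (D : ℝ) ^ K ≤ n := by exact_mod_cast h
  calc (D : ℝ) ^ x ≤ (D : ℝ) ^ (K * η) :=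
        Real.rpow_le_rpow_of_exponent_le hD1 (by rw [div_le_iff₀ hK0] at hx; linarith)
    _ = ((D : ℝ) ^ K) ^ η := by rw [Real.rpow_mul (by positivity), Real.rpow_natCast]
    _ ≤ (n : ℝ) ^ η := Real.rpow_le_rpow (by positivity) hn hη

end ThreeSum

namespace ThreeSum

open Finset Filter Topology RAM RAM.Expr

/-! ### The running time of the reduction -/

/-- The statement that the chosen moduli are good if there is no solution. -/
theorem eventually_le_pow {K r h m f a : ℕ} (e : ℕ) (hf : 3 * K + 1 ≤ f + r + 2 * h)
    (hr : r ≤ K) : ∀ᶠ D₀ : ℕ in atTop, ∀ P ∈ fitting K r h e m f, D₀ ≤ P.D → ∀ F,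
      Nat.primeCounting P.D ^ (2 * h) * F ≤
        (a * (Nat.log 2 P.n + 1) + 1) ^ (2 * h) * (2 * P.R * P.n * (P.g * P.g)) →
      F ≤ P.D ^ f := by
  have hG : BigO (fitting K r h e m f) (r + K + (K - r + (K - r)))
      fun P => 2 * P.R * P.n * (P.g * P.g) := BigO.tasks.mul ((BigO.ofG hr).mul (BigO.ofG hr))
  obtain ⟨G, hG⟩ := hG
  obtain ⟨D₁, hD₁⟩ := eventually_atTop.mp (eventually_mul_pow_le_primeCounting (2 * h) (a * K) G)
  filter_upwards [eventually_ge_atTop (max D₁ 2)] with D₀ hD₀ P hP hD F hF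
  obtain ⟨h1, h2⟩ := max_le_iff.mp (hD₀.trans hD)
  have hprime := hD₁ P.D h1
  have hpi : 0 < Nat.primeCounting P.D :=
    (show 0 < Nat.primeCounting 2 by decide).trans_le (Nat.monotone_primeCounting h2)
  -- Since n < (D + 1)^K, the bit length is O(log D), as needed to compare it with π(D).
  have hlog : Nat.log 2 P.n + 1 ≤ K * (Nat.log 2 (P.D + 1) + 1) := by
    refine Nat.succ_le_of_lt (Nat.log_lt_of_lt_pow (by have := hP.1; omega) ?_)
    refine hP.2.2.lt_pow.trans_le ?_
    rw [mul_comm, pow_mul]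
    exact Nat.pow_le_pow_left (Nat.lt_pow_succ_log_self (by norm_num) _).le K
  have hB : a * (Nat.log 2 P.n + 1) + 1 ≤ a * K * (Nat.log 2 (P.D + 1) + 1) + 1 := by
    rw [mul_assoc]
    exact Nat.succ_le_succ (Nat.mul_le_mul_left _ hlog)
  by_contra hlt
  rw [not_le] at hlt
  -- The spare factor D pays for (B D / π(D))^(2h), which is only polylogarithmic. It is the `+ 1`
  -- in the hypothesis `hf`.
  have h3 : Nat.primeCounting P.D ^ (2 * h) * P.D * P.D ^ f <
      Nat.primeCounting P.D ^ (2 * h) * P.D * F :=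
    Nat.mul_lt_mul_of_pos_left hlt (Nat.mul_pos (pow_pos hpi _) (by omega))
  refine absurd h3 (not_lt.mpr ?_)
  calc Nat.primeCounting P.D ^ (2 * h) * P.D * F
      = Nat.primeCounting P.D ^ (2 * h) * F * P.D := by ring
    _ ≤ (a * K * (Nat.log 2 (P.D + 1) + 1) + 1) ^ (2 * h) *
          (G * P.D ^ (r + K + (K - r + (K - r)))) * P.D := by
        refine Nat.mul_le_mul_right _ (hF.trans ?_)
        exact Nat.mul_le_mul (Nat.pow_le_pow_left hB _) (hG P hP)
    _ = (a * K * (Nat.log 2 (P.D + 1) + 1) + 1) ^ (2 * h) * G *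
          P.D ^ (r + K + (K - r + (K - r)) + 1) := by ring
    _ ≤ (a * K * (Nat.log 2 (P.D + 1) + 1) + 1) ^ (2 * h) * G * P.D ^ (2 * h + f) :=
        Nat.mul_le_mul_left _ (Nat.pow_le_pow_right (by omega) (by omega))
    _ = G * ((a * K * (Nat.log 2 (P.D + 1) + 1) + 1) * P.D) ^ (2 * h) * P.D ^ f := by
        rw [mul_pow, pow_add]; ring
    _ ≤ _ := Nat.mul_le_mul_right _ hprime

/-- Each parameter of the instance is O(D^s) with s strictly below m times the exponent allowed for
it. -/
theorem eventually_admissible {α β C ε : ℝ} {K r h m f : ℕ} (hE : Exponents α β ε K r h m f)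
    (e : ℕ) (hC : 0 < C) : ∀ᶠ D₀ : ℕ in atTop, ∀ P ∈ fitting K r h e m f, D₀ ≤ P.D →
      ∀ I : SetIntersection, I.U = P.ℓ ^ (2 * h) → I.N = 2 * P.R * P.ℓ ^ h → I.s = P.g →
        I.q ≤ 2 * P.R * P.n → I.outputSize ≤ P.D ^ f → I.Admissible α β C (P.D ^ m) := by
  have hr := hE.blocks
  obtain ⟨cU, hU⟩ := BigO.pow_ℓ (K := K) (r := r) (h := h) (e := e) (m := m) (f := f) (2 * h)
  obtain ⟨cN, hN⟩ := ((BigO.const (s := 0) 2).mul BigO.ofR).mul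
    (BigO.pow_ℓ (K := K) (r := r) (h := h) (e := e) (m := m) (f := f) h)
  obtain ⟨cs, hs⟩ := BigO.ofG (K := K) (r := r) (h := h) (e := e) (m := m) (f := f) (by omega)
  obtain ⟨cq, hq⟩ := BigO.tasks (K := K) (r := r) (h := h) (e := e) (m := m) (f := f)
  have hKr : ((K - r : ℕ) : ℝ) = K - r := Nat.cast_sub (by omega)
  have key := (((eventually_mul_pow_le_rpow cU (2 * h) hC (x := m * (1 + β - α))
      (by push_cast; exact hE.elements)).and
    (eventually_mul_pow_le_rpow cN (0 + r + h) hC (x := m * (1 / 2 + α / 2 + β / 2))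
      (by push_cast; linarith [hE.sets]))).and
    (eventually_mul_pow_le_rpow cs (K - r) hC (x := m * (1 - α))
      (by rw [hKr]; exact hE.size))).and
    ((eventually_mul_pow_le_rpow cq (r + K) hC (x := m * (1 + α))
      (by push_cast; linarith [hE.queries])).and
    (eventually_mul_pow_le_rpow 1 f hC (x := m * (2 - β)) hE.output))
  obtain ⟨D₁, hD₁⟩ := eventually_atTop.mp key
  filter_upwards [eventually_ge_atTop D₁] with D₀ hD₀ P hP hD I h1 h2 h3 h4 h5
  obtain ⟨⟨⟨k1, k2⟩, k3⟩, k4, k5⟩ := hD₁ P.D (hD₀.trans hD)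
  have hpow : ∀ x : ℝ, ((P.D ^ m : ℕ) : ℝ) ^ x = (P.D : ℝ) ^ (m * x) := fun x => by
    rw [Real.rpow_mul (Nat.cast_nonneg _), Real.rpow_natCast, Nat.cast_pow]
  refine ⟨?_, ?_, ?_, ?_, ?_⟩
  all_goals rw [hpow]
  · refine le_trans ?_ k1
    rw [h1]; exact_mod_cast hU P hP
  · refine le_trans ?_ k2
    rw [h2]; exact_mod_cast hN P hP
  · refine le_trans ?_ k3
    rw [h3]; exact_mod_cast hs P hP
  · refine le_trans ?_ k4
    exact_mod_cast h4.trans (hq P hP)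
  · refine le_trans ?_ k5
    rw [Nat.cast_one, one_mul]; exact_mod_cast h5

theorem wordLength_pow_le (κ m n : ℕ) :
    wordLength κ (n ^ m) ≤ κ * (m + 1) * (Nat.log 2 n + 1) := by
  have h1 : Nat.log 2 (n ^ m) ≤ m * (Nat.log 2 n + 1) := by
    calc Nat.log 2 (n ^ m) ≤ Nat.log 2 (2 ^ ((Nat.log 2 n + 1) * m)) := by
          refine Nat.log_mono_right ?_
          rw [pow_mul]
          exact Nat.pow_le_pow_left (Nat.lt_pow_succ_log_self (by norm_num) _).le m
      _ = _ := by rw [Nat.log_pow (by norm_num), mul_comm]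
  rw [wordLength, mul_assoc]
  refine Nat.mul_le_mul_left _ ?_
  rw [Nat.succ_mul]
  omega

theorem le_machine_X {J n c : ℕ} (hJ : 1 ≤ J) (hc : c ≤ J) : c ≤ (machine J n hJ).X := by
  calc c ≤ 2 ^ c := Nat.lt_two_pow_self.le
    _ ≤ (2 ^ (Nat.log 2 n + 1)) ^ c := Nat.pow_le_pow_left (Nat.le_self_pow (by omega) 2) c
    _ ≤ _ := Nat.pow_le_pow_right (by positivity) hc

theorem pow_le_machine_X {J n E : ℕ} (hJ : 1 ≤ J) (hE : 3 * E ≤ J) :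
    (4 * n) ^ E ≤ (machine J n hJ).X := by
  have h1 : n ≤ 2 ^ (Nat.log 2 n + 1) := (Nat.lt_pow_succ_log_self (by norm_num) _).le
  have h2 : 2 ≤ 2 ^ (Nat.log 2 n + 1) := Nat.le_self_pow (by omega) 2
  calc (4 * n) ^ E ≤ ((2 ^ (Nat.log 2 n + 1)) ^ 3) ^ E := by
        refine Nat.pow_le_pow_left ?_ E
        calc 4 * n = 2 * 2 * n := by ring
          _ ≤ 2 ^ (Nat.log 2 n + 1) * 2 ^ (Nat.log 2 n + 1) * 2 ^ (Nat.log 2 n + 1) :=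
            Nat.mul_le_mul (Nat.mul_le_mul h2 h2) h1
          _ = _ := by ring
    _ = (2 ^ (Nat.log 2 n + 1)) ^ (3 * E) := by rw [← pow_mul _ 3 E]
    _ ≤ _ := Nat.pow_le_pow_right (by positivity) hE

/-- The two conditions on η cover the two parts of the time: D^(2K-1) for everything done by the
reduction itself and (D^m)^(2-ε) for the call of Set Intersection. The exponent c' affects only the
constants and the word length. -/
theorem hasAlgorithm_of_exponents {α β C ε : ℝ} {K r h m f : ℕ} (hE : Exponents α β ε K r h m f)
    (hC : 0 < C) (hSI : SetIntersection.HasAlgorithm α β C ε) {η : ℝ}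
    (hη : (2 * K - 1 : ℝ) / K ≤ η) (hη' : (m * (2 - ε)) / K ≤ η) (c' : ℕ) :
    HasAlgorithm c' (2 - η) := by
  obtain ⟨p, κ, T, hp⟩ := hSI
  have hr := hE.blocks
  have hK1 : (1 : ℝ) ≤ K := by exact_mod_cast (show 1 ≤ K by omega)
  have hη1 : 1 ≤ η := by
    refine le_trans ?_ hη
    rw [le_div_iff₀ (by linarith)]
    linarith
  set e := 4 * K + 1 with he
  set c := c' + 1 with hc
  set E := K + r + 4 * h + e + m + f + c + 10 with hEdef
  obtain ⟨cT, hcT⟩ := (BigO.searchTime (m := m) (e := e) hr hE.convolution hE.output_le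
    hE.build).add (((BigO.ofN.mul BigO.ofR).mul (BigO.const (s := 0) 4000)).mono
      (s' := 2 * K - 1) (by omega))
  obtain ⟨cS, hcS⟩ : BigO (fitting K r h e m f) (2 * K - 1) fun P =>
      P.n * (103 * K + 5979) + 103 * (e + 3 * h + f + m + r) +
        (Nat.log 2 P.n + 1) * c * (P.n * 1500 + 209) + p.regBound + 5000 :=
    ((((BigO.ofN.mul (BigO.const (s := 0) _)).mono (by omega)).add (BigO.const _)).add
      (((BigO.ofLog.mul (BigO.const (s := 0) _)).mul (s' := K) (((BigO.ofN.mul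
        (BigO.const (s := 0) _)).mono (by omega)).add (BigO.const _))).mono (by omega))).add
          (BigO.const _) |>.add (BigO.const _)
  obtain ⟨D₀, hD₀⟩ := ((eventually_le_pow (m := m) (a := c) e hE.filter (by omega)).and
    ((eventually_admissible hE e hC).and (eventually_ge_atTop 4))).exists
  obtain ⟨hno, hadm, hD4⟩ := hD₀
  -- For n ≥ D₀^K every fitting D is at least D₀, where all asymptotic estimates are valid.
  set n₀ := D₀ ^ K with hn₀
  set J := 3 * E + κ * (m + 1) + n₀ with hJdef
  have hJ : 1 ≤ J := by omega
  set M : ℝ := (n₀ * (n₀ * 303 + 5) + 102 : ℕ) + cS + cT + |T| with hM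
  have hM0 : 0 ≤ M := by positivity
  -- Here 603 = 203 + 400 covers the linear and the constant term, as n and 1 are at most n^η.
  refine ⟨wholeCode n₀ (reductionCode K r h e m f c p), 32 * J + 1, M + 603, fun A hA1 hA hA' => ?_⟩
  set n := A.length with hn
  have hn1 : (1 : ℝ) ≤ n := by exact_mod_cast hA1
  have hnη : (1 : ℝ) ≤ (n : ℝ) ^ η := Real.one_le_rpow hn1 (by linarith)
  have hnη' : (n : ℝ) ≤ (n : ℝ) ^ η := by
    simpa using Real.rpow_le_rpow_of_exponent_le hn1 hη1
  have hA'' : ∀ a ∈ A, 1 ≤ a ∧ a ≤ n ^ c := fun a ha =>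
    ⟨(hA' a ha).1, (hA' a ha).2.trans (Nat.pow_le_pow_right hA1 (by omega))⟩
  have hpowD : ∀ P : Params, P.Fits n K r h e m f →
      (P.D : ℝ) ^ (2 * K - 1) ≤ (n : ℝ) ^ η := fun P hP => by
    rw [← Real.rpow_natCast]
    refine rpow_le_rpow_of_pow_le (hP.one_le hA1) (by omega) hP.pow_le ?_ (by linarith)
    rw [Nat.cast_sub (by omega)]
    push_cast
    exact hη
  have hruns : Runs (machine J n hJ) (wholeCode n₀ (reductionCode K r h e m f c p)) (start A)
      (n * 203 + ⌊M * (n : ℝ) ^ η⌋₊ + 400) (Flag (IsYes A)) := by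
    refine wholeCode_runs (le_machine_X hJ (by omega)) ?_ (fun _ => ?_) fun hlt σ h1 hL h3 hz => ?_
    · have := pow_le_machine_X (n := n) (E := 1) hJ (by omega)
      rw [pow_one] at this
      omega
    · refine Nat.le_floor ?_
      refine le_trans ?_ (le_mul_of_one_le_right hM0 hnη)
      rw [hM]
      have : (0 : ℝ) ≤ cS + cT + |T| := by positivity
      linarith
    · obtain ⟨P₀, hP₀⟩ := exists_fits (n := n) r h e m f hA1 (show 1 ≤ K by omega)
      have hDle : ∀ P : Params, P.Fits n K r h e m f → D₀ ≤ P.D := fun P hP => by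
        have := (lt_of_pow_lt_pow_left₀ K (Nat.zero_le _) (hlt.trans_lt hP.lt_pow))
        omega
      refine (reductionCode_runs (B := c * (Nat.log 2 n + 1) + 1) (w := wordLength κ (n ^ m))
        (t := ⌊|T| * (n : ℝ) ^ η⌋₊) (T := ⌊cT * (n : ℝ) ^ η⌋₊) hn.symm h1 hA1 hA hA'' (by omega)
        (by omega) he hL h3 hz ?_ (le_machine_X hJ (by omega)) (pow_le_machine_X hJ (by omega))
        (fun P hP => hD4.trans (hDle P hP)) (fun P hP F hF => ?_) (fun P hP => ?_)
        (fun P hP I i1 i2 i3 i4 i5 => ?_) (fun P hP => ?_)).mono ?_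
      · have h9 : n ^ c < (2 ^ (Nat.log 2 n + 1)) ^ c :=
          Nat.pow_lt_pow_left (Nat.lt_pow_succ_log_self (by norm_num) _) (by omega)
        rw [← pow_mul, mul_comm _ c] at h9
        rw [pow_succ 2 (c * _)]
        omega
      · refine hno P (hP.mem_fitting hA1) (hDle P hP) F ?_
        rw [hP.n_eq]
        exact hF
      · refine (Nat.pow_le_pow_right (by norm_num) (wordLength_pow_le κ m n)).trans ?_
        rw [mul_comm, pow_mul]
        exact Nat.pow_le_pow_right (by positivity) (by omega)
      · have hD1 := hP.one_le hA1
        have hDm : 1 ≤ P.D ^ m := Nat.one_le_pow _ _ hD1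
        obtain ⟨t, τ, j1, j2, j3⟩ := hp (P.D ^ m) hDm I (hadm P (hP.mem_fitting hA1) (hDle P hP) I i1
          i2 i3 (by rw [hP.n_eq]; exact i4) i5)
        -- The given algorithm uses words for the parameter D^m ≤ n^m. They are enlarged to a length
        -- that depends on n only.
        refine ⟨t, τ, j1.mono (Nat.pow_le_pow_right (by norm_num) ?_), Nat.le_floor (j2.trans ?_), j3⟩
        · refine Nat.mul_le_mul_left _ (Nat.succ_le_succ (Nat.log_mono_right ?_))
          exact Nat.pow_le_pow_left ((Nat.le_self_pow (by omega) _).trans hP.pow_le) m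
        · refine mul_le_mul (le_abs_self T) ?_ (by positivity) (abs_nonneg T)
          rw [Nat.cast_pow, ← Real.rpow_natCast, ← Real.rpow_mul (Nat.cast_nonneg _)]
          exact rpow_le_rpow_of_pow_le hD1 (by omega) hP.pow_le hη' (by linarith)
      · refine Nat.le_floor ?_
        have h4 := hcT P (hP.mem_fitting hA1)
        simp only [hP.n_eq] at h4
        calc ((P.searchTime (2 * P.R * n) + n * P.R * 4000 : ℕ) : ℝ)
            ≤ (cT * P.D ^ (2 * K - 1) : ℕ) := by exact_mod_cast h4
          _ = cT * (P.D : ℝ) ^ (2 * K - 1) := by push_cast; ring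
          _ ≤ _ := by gcongr; exact hpowD P hP
      · refine Nat.le_floor ?_
        have h4 := hcS P₀ (hP₀.mem_fitting hA1)
        simp only [hP₀.n_eq] at h4
        have h5 : ((n * (103 * K + 5979) + 103 * (e + 3 * h + f + m + r) +
            (Nat.log 2 n + 1) * c * (n * 1500 + 209) + p.regBound + 5000 : ℕ) : ℝ) ≤
              cS * (n : ℝ) ^ η := by
          calc _ ≤ ((cS * P₀.D ^ (2 * K - 1) : ℕ) : ℝ) := by exact_mod_cast h4
            _ = cS * (P₀.D : ℝ) ^ (2 * K - 1) := by push_cast; ring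
            _ ≤ _ := by gcongr; exact hpowD P₀ hP₀
        have h6 := Nat.floor_le (show 0 ≤ cT * (n : ℝ) ^ η by positivity)
        have h7 := Nat.floor_le (show 0 ≤ |T| * (n : ℝ) ^ η by positivity)
        have h8 : (0 : ℝ) ≤ (n₀ * (n₀ * 303 + 5) + 102 : ℕ) * (n : ℝ) ^ η := by positivity
        rw [hM, add_mul, add_mul, add_mul]
        push_cast at h5 h8 ⊢
        linarith
  obtain ⟨t, τ, k1, k2, k3⟩ := exists_exec hJ (by omega) (show c ≤ J by omega) rfl hA'' hruns
  refine ⟨t, τ, k1, ?_, k3⟩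
  have h4 := Nat.floor_le (show 0 ≤ M * (n : ℝ) ^ η by positivity)
  have h5 : (t : ℝ) ≤ (n * 203 + ⌊M * (n : ℝ) ^ η⌋₊ + 400 : ℕ) := by exact_mod_cast k2
  rw [sub_sub_cancel]
  push_cast at h5
  nlinarith

end ThreeSum

theorem theorem1p6 (α β : ℝ) (hα₀ : 0 ≤ α) (hα₁ : α < 1) (hβ₀ : 0 ≤ β) (hβ₁ : β ≤ 1 - α)
    (h3SUM : ThreeSum.DeterministicHypothesis) :
    ∀ C : ℝ, 0 < C → ∀ ε : ℝ, 0 < ε → ¬ SetIntersection.HasAlgorithm α β C ε := by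
  intro C hC ε hε hSI
  -- A smaller saving is a weaker claim, because n ≥ 1. The constant is replaced by its absolute
  -- value so that the bounds can be multiplied.
  have hSI' : SetIntersection.HasAlgorithm α β C (min ε 1) := by
    obtain ⟨p, κ, T, hp⟩ := hSI
    refine ⟨p, κ, |T|, fun n hn I hI => ?_⟩
    obtain ⟨t, σ, h1, h2, h3⟩ := hp n hn I hI
    refine ⟨t, σ, h1, h2.trans ?_, h3⟩
    have hn1 : (1 : ℝ) ≤ n := by exact_mod_cast hn
    refine mul_le_mul (le_abs_self T) ?_ (by positivity) (abs_nonneg T)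
    exact Real.rpow_le_rpow_of_exponent_le hn1 (sub_le_sub_left (min_le_left ε 1) 2)
  obtain ⟨K, r, h, m, f, hE⟩ := ThreeSum.exists_exponents hα₀ hα₁ hβ₀ hβ₁ (lt_min hε one_pos)
    (min_le_right ε 1)
  have hK : (0 : ℝ) < K := by
    have := hE.blocks
    exact_mod_cast (show 0 < K by omega)
  -- This η is fixed before the hypothesis supplies c, so the algorithm for that c gives the
  -- contradiction.
  obtain ⟨η, hη⟩ : ∃ η, η = max ((2 * K - 1 : ℝ) / K) (m * (2 - min ε 1) / K) := ⟨_, rfl⟩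
  have hη2 : η < 2 := by
    rw [hη]
    refine max_lt ?_ ?_
    · rw [div_lt_iff₀ hK]; linarith
    · rw [div_lt_iff₀ hK]; exact hE.time
  obtain ⟨c, hc⟩ := h3SUM (2 - η) (by linarith)
  exact hc (ThreeSum.hasAlgorithm_of_exponents hE hC hSI' (hη ▸ le_max_left _ _)
    (hη ▸ le_max_right _ _) c)
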